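/- Let $(L,q)$ be a non-degenerate even $\mathbb Z$-lattice with bilinear form $(x,y)=q(x+y)-q(x)-q(y)$, signature $\mathrm{sig}=b^+-b^-$, dual lattice $L'$, discriminant group $A=L'/L$ with induced form $q:A\to\mathbb Q/\mathbb Z$, and let $\mathrm{level}(L)$ be the least positive integer $M$ with $Mq(\lambda)\in\mathbb Z$ for all $\lambda\in L'$. Write $e(x)=e^{2\pi i x}$. Let $\rho$ be the Weil representation of $\mathrm{Mp}_2(\mathbb Z)$ on $\mathbb C[A]$ (basis $\mathfrak e_\lambda$), given on the generators $T=\left(\begin{pmatrix}1&1\\0&1\end{pmatrix},1\right)$ and $S=\left(\begin{pmatrix}0&-1\\1&0\end{pmatrix},\sqrt\tau\right)$ by $\rho(T)\mathfrak e_\lambda=e(q(\lambda))\mathfrak e_\lambda$ and $\rho(S)\mathfrak e_\lambda=\frac{e(-\mathrm{sig}/8)}{\sqrt{|A|}}\sum_{\mu\in A}e(-(\lambda,\mu))\mathfrak e_\mu$. Let $k\in\frac12\mathbb Z$ and let $f$ be a cusp form of weight $k$ for $\rho$, i.e. a holomorphic function $f:\mathbb H\to\mathbb C[A]$ with $f(M\tau)=\varphi(\tau)^{2k}\rho(M,\varphi)f(\tau)$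 for all $(M,\varphi)\in\mathrm{Mp}_2(\mathbb Z)$, vanishing at $i\infty$. Let $f(\tau)=\sum_{\lambda\in A}\sum_{n\in q(\lambda)+\mathbb Z}a(\lambda,n)e(n\tau)\mathfrak e_\lambda$ be its Fourier expansion. Let $N\in\mathbb N$ and let $p$ be a prime with $p\nmid \mathrm{level}(L)\cdot N$. Put $\alpha=\left(\begin{pmatrix}p^2&0\\0&1\end{pmatrix},1\right)$ and $\rho(\alpha)^{-1}\mathfrak e_\lambda=\mathfrak e_{p\lambda}$; for $\delta=\gamma\alpha\gamma'$ with $\gamma,\gamma'\in\mathrm{Mp}_2(\mathbb Z)$ put $\rho(\delta)=\rho(\gamma)\rho(\alpha)\rho(\gamma')$, and for $\delta=(M,\varphi)$ put $(f|_k\delta)(\tau)=\det(M)^{k/2}\varphi(\tau)^{-2k}\rho(\delta)^{-1}f(M\tau)$. The Hecke operator is $$f|T(p^2)=p^{k-2}\sum_{\delta\in \mathrm{Mp}_2(\mathbb Z)\backslash \mathrm{Mp}_2(\mathbb Z)\,\alpha\,\mathrm{Mp}_2(\mathbb Z)}f|_k\delta .$$ Assume $f|T(p^2)=\lambda_p f$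 with $\lambda_p\in\mathbb C$. Let $\lambda\in A$ and $0<t\in q(\lambda)+\mathbb Z$ be such that $p^2\nmid\mathrm{level}(L)\,t$. For $M\in\mathbb N$ let $$L^{M}_{(\lambda,t)}(f,s)=\sum_{n\ge1,\ \gcd(n,M)=1}\frac{a(n\lambda,n^2t)}{n^s}.$$ Let $G_A(d)=\sum_{\lambda\in A}e(d\,q(\lambda))$; let $\delta_{p\nmid t}$ be $1$ if $p\nmid t$ and $0$ if $p\mid t$ (in $\mathbb Z_{(p)}$); let $\varepsilon_p=1$ or $i$ according as $p\equiv1$ or $3\bmod 4$; and for odd $p$ let $\chi_A(p)=\varepsilon_p^{\,\mathrm{sig}+\left(\frac{-1}{|A|}\right)}\left(\frac{p}{|A|}\right)\left(\frac p2\right)^{\mathrm{sig}}$ with Kronecker symbols. (If $\mathrm{rk}(L)$ is odd, the level is divisible by $4$, so $p$ is odd.) Define $$Q_p(s)=\begin{cases}\dfrac{1+\delta_{p\nmid t}\frac{G_A(1)}{G_A(p)}\,p^{k-1-s}}{1-\left(\frac{\lambda_p}{p^{k-1}}-(1-p^{-1})\frac{G_A(1)}{G_A(p)}\right)p^{k-1-s}+p^{2(k-1-s)}},&2\mid\mathrm{rk}(L),\\[3ex]\dfrac{1-\chi_A(p)\left(\frac{-t}{p}\right)p^{-1/2}\,p^{k-1-s}}{1-\frac{\lambda_p}{p^{k-1}}\,p^{k-1-s}+p^{2(k-1-s)}},&2\nmid\mathrm{rk}(L),\end{cases}$$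 a rational function of $p^{-s}$. Let $\sigma=\frac12$ if $\mathrm{rk}(L)$ is even; if $\mathrm{rk}(L)$ is odd, let $\sigma=\frac5{16}$ when $\mathrm{level}(L)$ divides a power of $N$, and $\sigma=\frac14$ otherwise. Let $s\in\mathbb C$ satisfy $\mathrm{Re}(s)>k+1-2\sigma$, or be any point at which the series $L^N_{(\lambda,t)}(f,s)$ converges absolutely. Then: 1. The series $L^{N}_{(\lambda,t)}(f,s)$ converges absolutely if and only if $L^{Np}_{(\lambda,t)}(f,s)$ does, and in this case $$L^{N}_{(\lambda,t)}(f,s)=L^{Np}_{(\lambda,t)}(f,s)\cdot Q_p(s)$$ (the right-hand side is read as $0$ if the series $L^{N}_{(\lambda,t)}(f,\cdot)$ vanishes identically and the denominator of $Q_p$ is zero at $s$). 2. If $L^{N}_{(\lambda,t)}(f,\cdot)$ is not identically zero, then the denominator of $Q_p(s)$ is nonzero and $Q_p(s)\neq0$. -/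

import Mathlib

open scoped UpperHalfPlane MatrixGroups Manifold

noncomputable section

namespace VVMF

/-! ### Even lattices and their discriminant forms -/

/-- A non-degenerate even `ℤ`-lattice `(L, q)`, realised as a full lattice `L` in the rational
quadratic space `V = L ⊗ ℚ`. Evenness means that `q` is integral on `L`; the bilinear form is
`(x, y) = q (x + y) - q x - q y`. -/
structure EvenLattice (V : Type*) [AddCommGroup V] [Module ℚ V] where
  q : QuadraticForm ℚ V
  nondegenerate : (QuadraticMap.polarBilin q).Nondegenerate
  L : Submodule ℤ V
  isLattice : Submodule.IsLattice ℚ L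
  even : ∀ x ∈ L, ∃ z : ℤ, q x = z

namespace EvenLattice

variable {V : Type*} [AddCommGroup V] [Module ℚ V] (Λ : EvenLattice V)

/-- The dual lattice `L'`. -/
def dual : Submodule ℤ V :=
  LinearMap.BilinForm.dualSubmodule (QuadraticMap.polarBilin Λ.q) Λ.L

/-- The discriminant group `A = L' / L`. -/
abbrev Disc : Type _ := Λ.dual ⧸ Submodule.submoduleOf Λ.L Λ.dual

theorem finite_disc [FiniteDimensional ℚ V] : Finite Λ.Disc := by
  classical
  have := Λ.isLattice
  have hfree : Module.Free ℤ Λ.L := inferInstance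
  let b := Module.Free.chooseBasis ℤ Λ.L
  let b' : Module.Basis _ ℚ V := b.extendOfIsLattice ℚ
  have hL : Λ.L = Submodule.span ℤ (Set.range b') := by
    have h1 : Set.range b' = Λ.L.subtype '' Set.range b := by
      ext x
      simp [b', Set.mem_range]
    rw [h1, ← Submodule.map_span, b.span_eq, Submodule.map_top, Submodule.range_subtype]
  have hfg : Λ.dual.FG := by
    unfold dual
    rw [hL, LinearMap.BilinForm.dualSubmodule_span_of_basis _ Λ.nondegenerate]
    exact Submodule.fg_span (Set.finite_range _)
  have : Module.Finite ℤ Λ.dual := Module.Finite.iff_fg.mpr hfg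
  apply Module.finite_of_fg_torsion
  intro x
  obtain ⟨x, rfl⟩ := Submodule.Quotient.mk_surjective _ x
  have key : ∀ v : V, ∃ n : ℤ, n ≠ 0 ∧ n • v ∈ Λ.L := by
    intro v
    have hv : v ∈ Submodule.span ℚ (Λ.L : Set V) := by
      rw [Λ.isLattice.span_eq_top]; trivial
    induction hv using Submodule.span_induction with
    | mem x hx => exact ⟨1, one_ne_zero, by simpa using hx⟩
    | zero => exact ⟨1, one_ne_zero, by simp⟩
    | add x y _ _ hx hy =>
      obtain ⟨n, hn, hx⟩ := hx
      obtain ⟨m, hm, hy⟩ := hy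
      refine ⟨n * m, mul_ne_zero hn hm, ?_⟩
      rw [smul_add]
      refine add_mem ?_ ?_
      · rw [mul_comm, mul_smul]; exact Submodule.smul_mem _ _ hx
      · rw [mul_smul]; exact Submodule.smul_mem _ _ hy
    | smul a x _ hx =>
      obtain ⟨n, hn, hx⟩ := hx
      refine ⟨n * a.den, mul_ne_zero hn (by exact_mod_cast a.den_nz), ?_⟩
      have h : (n * (a.den : ℤ)) • a • x = a.num • n • x := by
        rw [← Int.cast_smul_eq_zsmul ℚ, ← Int.cast_smul_eq_zsmul ℚ a.num,
          ← Int.cast_smul_eq_zsmul ℚ n, smul_smul, smul_smul]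
        congr 1
        push_cast
        rw [mul_assoc, mul_comm (a.den : ℚ) a, Rat.mul_den_eq_num, mul_comm]
      rw [h]
      exact Submodule.smul_mem _ _ hx
  obtain ⟨n, hn, hx⟩ := key x
  refine ⟨⟨n, mem_nonZeroDivisors_of_ne_zero hn⟩, ?_⟩
  change n • (Submodule.Quotient.mk x : Λ.Disc) = 0
  rw [← Submodule.Quotient.mk_smul, Submodule.Quotient.mk_eq_zero]
  exact hx

instance [FiniteDimensional ℚ V] : Fintype Λ.Disc :=
  haveI := Λ.finite_disc
  Fintype.ofFinite _

/-- The `ℚ/ℤ`-valued (here: `ℝ/ℤ`-valued) quadratic form `λ ↦ q(λ) mod ℤ` on `L' / L`. -/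
def qbar : Λ.Disc → UnitAddCircle :=
  Quotient.lift (fun x : Λ.dual => (((Λ.q (x : V) : ℚ) : ℝ) : UnitAddCircle)) <| by
    intro x y hxy
    have hmem : (x : V) - y ∈ Λ.L := by
      exact (Submodule.quotientRel_def (Submodule.submoduleOf Λ.L Λ.dual)).mp hxy
    obtain ⟨a, ha⟩ := Λ.even _ hmem
    obtain ⟨c, hc⟩ := Submodule.mem_one.mp (y.2 _ hmem)
    have hpol : Λ.q (x : V) = Λ.q (y : V) + ((a + c : ℤ) : ℚ) := by
      have h : Λ.q ((y : V) + ((x : V) - y)) - Λ.q (y : V) - Λ.q ((x : V) - y) = (c : ℚ) := by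
        simpa [QuadraticMap.polar] using hc.symm
      rw [add_sub_cancel, ha] at h
      push_cast
      linarith
    rw [hpol]
    refine (QuotientAddGroup.eq_iff_sub_mem).mpr ?_
    refine AddSubgroup.mem_zmultiples_iff.mpr ⟨a + c, ?_⟩
    push_cast
    simp

/-- The `ℚ/ℤ`-valued bilinear form on `L' / L`. -/
def bbar (x y : Λ.Disc) : UnitAddCircle := Λ.qbar (x + y) - Λ.qbar x - Λ.qbar y

/-- The rank of `L`. -/
def rk (_Λ : EvenLattice V) : ℕ := Module.finrank ℚ V

/-- The signature `b⁺ - b⁻` of `L`. -/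
def sig : ℤ := (sigPos Λ.q : ℤ) - (sigNeg Λ.q : ℤ)

/-- The level of `L`: the least positive `N` with `N q(λ) ∈ ℤ` for all `λ ∈ L'`. -/
def level : ℕ := sInf {N : ℕ | 0 < N ∧ ∀ x : Λ.Disc, N • Λ.qbar x = 0}

end EvenLattice

/-- `e(x) = exp(2πi x)` for `x ∈ ℝ/ℤ`. -/
def e (x : UnitAddCircle) : ℂ := (AddCircle.toCircle x : ℂ)

/-! ### The metaplectic group -/

/-- The metaplectic cover of `GL₂⁺(ℝ)`: pairs `(M, φ)` with `φ : ℍ → ℂ` continuous (hence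
holomorphic) and `φ(τ)² = cτ + d`. -/
@[ext]
structure Mp where
  M : GL (Fin 2) ℝ
  φ : ℍ → ℂ
  det_pos : 0 < M.det.val
  cont : Continuous φ
  sq : ∀ τ : ℍ, φ τ ^ 2 = UpperHalfPlane.denom M τ

namespace Mp

theorem φ_ne_zero (x : Mp) (τ : ℍ) : x.φ τ ≠ 0 := by
  intro h
  have := x.sq τ
  rw [h] at this
  exact UpperHalfPlane.denom_ne_zero x.M τ (by simpa using this.symm)

theorem denom_mul {g h : GL (Fin 2) ℝ} (hh : 0 < h.det.val) (τ : ℍ) :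
    UpperHalfPlane.denom (g * h) τ =
      UpperHalfPlane.denom g ((h • τ : ℍ) : ℂ) * UpperHalfPlane.denom h τ := by
  rw [UpperHalfPlane.denom_cocycle g h τ.im_ne_zero, UpperHalfPlane.coe_smul_of_det_pos hh]

theorem det_inv_pos {g : GL (Fin 2) ℝ} (hg : 0 < g.det.val) : 0 < (g⁻¹).det.val := by
  rw [map_inv, Units.val_inv_eq_inv_val]
  exact inv_pos.mpr hg

/-- `(M₁, φ₁(τ)) (M₂, φ₂(τ)) = (M₁ M₂, φ₁(M₂ τ) φ₂(τ))`. -/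
instance : Mul Mp where
  mul x y :=
    { M := x.M * y.M
      φ := fun τ => x.φ (y.M • τ) * y.φ τ
      det_pos := by
        rw [map_mul, Units.val_mul]
        exact mul_pos x.det_pos y.det_pos
      cont := (x.cont.comp (continuous_const_smul y.M)).mul y.cont
      sq := fun τ => by rw [mul_pow, x.sq, y.sq, denom_mul y.det_pos] }

instance : One Mp where
  one :=
    { M := 1
      φ := fun _ => 1
      det_pos := by simp
      cont := continuous_const
      sq := fun τ => by simp [UpperHalfPlane.denom] }

instance : Inv Mp where
  inv x :=
    { M := x.M⁻¹
      φ := fun τ => (x.φ (x.M⁻¹ • τ))⁻¹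
      det_pos := det_inv_pos x.det_pos
      cont := (x.cont.comp (continuous_const_smul x.M⁻¹)).inv₀ (fun τ => x.φ_ne_zero _)
      sq := fun τ => by
        have h := denom_mul (g := x.M) (h := x.M⁻¹) (det_inv_pos x.det_pos) τ
        rw [mul_inv_cancel] at h
        have h1 : UpperHalfPlane.denom (1 : GL (Fin 2) ℝ) τ = 1 := by simp [UpperHalfPlane.denom]
        rw [h1] at h
        rw [inv_pow, x.sq]
        exact inv_eq_of_mul_eq_one_right h.symm }

@[simp] theorem mul_M (x y : Mp) : (x * y).M = x.M * y.M := rfl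
@[simp] theorem mul_φ (x y : Mp) (τ : ℍ) : (x * y).φ τ = x.φ (y.M • τ) * y.φ τ := rfl
@[simp] theorem one_M : (1 : Mp).M = 1 := rfl
@[simp] theorem one_φ (τ : ℍ) : (1 : Mp).φ τ = 1 := rfl
@[simp] theorem inv_M (x : Mp) : (x⁻¹).M = x.M⁻¹ := rfl
@[simp] theorem inv_φ (x : Mp) (τ : ℍ) : (x⁻¹).φ τ = (x.φ (x.M⁻¹ • τ))⁻¹ := rfl

instance : Group Mp :=
  Group.ofLeftAxioms
    (fun x y z => by
      ext1
      · simp [mul_assoc]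
      · funext τ; simp [mul_assoc, mul_smul])
    (fun x => by
      ext1
      · simp
      · funext τ; simp)
    (fun x => by
      ext1
      · simp
      · funext τ; simp [x.φ_ne_zero])

/-- The generator `T = ((1 1; 0 1), 1)` of `Mp₂(ℤ)`. -/
def T : Mp where
  M := Matrix.GeneralLinearGroup.mkOfDetNeZero !![1, 1; 0, 1] (by simp)
  φ := fun _ => 1
  det_pos := by simp [Matrix.GeneralLinearGroup.mkOfDetNeZero]
  cont := continuous_const
  sq := fun τ => by simp [UpperHalfPlane.denom, Matrix.GeneralLinearGroup.mkOfDetNeZero]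

/-- The generator `S = ((0 -1; 1 0), √τ)` of `Mp₂(ℤ)`, with the principal branch of the root. -/
def S : Mp where
  M := Matrix.GeneralLinearGroup.mkOfDetNeZero !![0, -1; 1, 0] (by simp)
  φ := fun τ => (τ : ℂ) ^ (1 / 2 : ℂ)
  det_pos := by simp [Matrix.GeneralLinearGroup.mkOfDetNeZero]
  cont := by
    refine Continuous.cpow UpperHalfPlane.continuous_coe continuous_const fun τ => ?_
    exact Or.inr (by simpa using τ.im_ne_zero)
  sq := fun τ => by
    rw [← Complex.cpow_nat_mul]
    simp [UpperHalfPlane.denom, Matrix.GeneralLinearGroup.mkOfDetNeZero]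

/-- The element `α = ((p² 0; 0 1), 1)`. -/
def α (p : ℕ) [Fact p.Prime] : Mp where
  M := Matrix.GeneralLinearGroup.mkOfDetNeZero !![(p : ℝ) ^ 2, 0; 0, 1]
    (by simp [(Fact.out : p.Prime).ne_zero])
  φ := fun _ => 1
  det_pos := by
    simp [Matrix.GeneralLinearGroup.mkOfDetNeZero, (Fact.out : p.Prime).pos]
  cont := continuous_const
  sq := fun τ => by simp [UpperHalfPlane.denom, Matrix.GeneralLinearGroup.mkOfDetNeZero]

end Mp

/-! ### The Weil representation, vector-valued cusp forms and Hecke operators -/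

variable {V : Type*} [AddCommGroup V] [Module ℚ V] [FiniteDimensional ℚ V] (Λ : EvenLattice V)

/-- The group algebra `ℂ[L'/L]`; a vector `v` stands for `∑ v(λ) 𝔢_λ`. -/
abbrev GrpAlg : Type _ := Λ.Disc → ℂ

/-- `ρ(T) 𝔢_λ = e(q(λ)) 𝔢_λ`. -/
def weilT : GrpAlg Λ →ₗ[ℂ] GrpAlg Λ where
  toFun v := fun x => e (Λ.qbar x) * v x
  map_add' v w := by funext x; simp [mul_add]
  map_smul' c v := by funext x; simp [mul_left_comm]

/-- `ρ(S) 𝔢_λ = e(-sig(L)/8) / √|L'/L| · ∑_μ e(-(λ, μ)) 𝔢_μ`. -/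
def weilS : GrpAlg Λ →ₗ[ℂ] GrpAlg Λ where
  toFun v := fun x =>
    Complex.exp (-2 * Real.pi * Complex.I * (Λ.sig : ℂ) / 8) /
      (Real.sqrt (Fintype.card Λ.Disc) : ℂ) * ∑ y : Λ.Disc, e (-Λ.bbar x y) * v y
  map_add' v w := by funext x; simp [mul_add, Finset.sum_add_distrib]
  map_smul' c v := by
    funext x
    simp only [Pi.smul_apply, smul_eq_mul, RingHom.id_apply, Finset.mul_sum]
    exact Finset.sum_congr rfl fun y _ => by ring

/-- Elements of the metaplectic cover of `GL₂⁺(ℝ)` together with an automorphism of `ℂ[L'/L]`. -/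
abbrev Ext : Type _ := Mp × (GrpAlg Λ ≃ₗ[ℂ] GrpAlg Λ)

/-- `Mp₂(ℤ)` with its Weil representation: the subgroup of pairs `(γ, ρ(γ))`, `γ ∈ Mp₂(ℤ)`. As
`Mp₂(ℤ)` is generated by `T` and `S`, this is the group generated by `(T, ρ(T))` and
`(S, ρ(S))`. -/
def weilGroup : Subgroup (Ext Λ) :=
  Subgroup.closure
    {x | (x.1 = Mp.T ∧ (x.2 : GrpAlg Λ →ₗ[ℂ] GrpAlg Λ) = weilT Λ) ∨
      (x.1 = Mp.S ∧ (x.2 : GrpAlg Λ →ₗ[ℂ] GrpAlg Λ) = weilS Λ)}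

/-- The slash operator of weight `k = κ / 2`:
`(f | (M, φ, U))(τ) = det(M)^{k/2} φ(τ)^{-2k} U⁻¹ f(M τ)`. -/
def slash (κ : ℤ) (f : ℍ → GrpAlg Λ) (x : Ext Λ) : ℍ → GrpAlg Λ := fun τ =>
  (((x.1.M.det.val : ℝ) ^ ((κ : ℝ) / 4) : ℝ) : ℂ) • (x.1.φ τ) ^ (-κ) • x.2.symm (f (x.1.M • τ))

/-- Vector-valued cusp forms of weight `k = κ / 2` for the Weil representation of `L`. -/
structure IsCuspForm (κ : ℤ) (f : ℍ → GrpAlg Λ) : Prop where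
  holo : ∀ x : Λ.Disc, MDiff (fun τ : ℍ => f τ x)
  slash_eq : ∀ γ ∈ weilGroup Λ, slash Λ κ f γ = f
  zero_at_infty : ∀ x : Λ.Disc, UpperHalfPlane.IsZeroAtImInfty (fun τ : ℍ => f τ x)

/-- The double coset of `α = ((p² 0; 0 1), 1)` with respect to `Mp₂(ℤ)`, where `α` acts on
`ℂ[L'/L]` through `ρ(α)⁻¹ 𝔢_λ = 𝔢_{pλ}`, i.e. `(ρ(α) v)(λ) = v(pλ)` (for `p` prime to
`|L'/L|`), and `γ α γ'` through `ρ(γ) ρ(α) ρ(γ')`. -/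
def heckeCoset (p : ℕ) [Fact p.Prime] : Set (Ext Λ) :=
  {x | ∃ a : Ext Λ, a.1 = Mp.α p ∧ (∀ v y, a.2 v y = v (p • y)) ∧
    x ∈ DoubleCoset.doubleCoset a (weilGroup Λ : Set (Ext Λ)) (weilGroup Λ : Set (Ext Λ))}

/-- The Hecke operator `T(p²)` in weight `k = κ / 2`:
`f | T(p²) = p^{k-2} ∑_{δ ∈ Mp₂(ℤ) \ Mp₂(ℤ) α Mp₂(ℤ)} f | δ`. For a modular form `f` the summand
does not depend on the representative `δ`. -/
def heckeOp (κ : ℤ) (p : ℕ) [Fact p.Prime] (f : ℍ → GrpAlg Λ) : ℍ → GrpAlg Λ :=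
  (((p : ℝ) ^ ((κ : ℝ) / 2 - 2) : ℝ) : ℂ) •
    ∑ᶠ c ∈ (Quotient.mk (QuotientGroup.rightRel (weilGroup Λ))) '' heckeCoset Λ p,
      slash Λ κ f (Quotient.out c)

/-- The Fourier coefficient `a(λ, n)` of `f = ∑_λ ∑_{n ∈ q(λ) + ℤ} a(λ, n) e(nτ) 𝔢_λ`
(meaningful for `n ∈ q(λ) + ℤ`), as an integral over the segment from `i` to `1 + i`. -/
def fourierCoeff (f : ℍ → GrpAlg Λ) (x : Λ.Disc) (n : ℚ) : ℂ :=
  ∫ u in (0 : ℝ)..1, f (u +ᵥ UpperHalfPlane.I) x *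
    Complex.exp (-2 * Real.pi * Complex.I * (n : ℂ) * ((u : ℂ) + Complex.I))

/-- The coefficients of `L^N_{(λ,t)}(f, s) = ∑_{n ≥ 1, gcd(n, N) = 1} a(nλ, n²t) n^{-s}`. -/
def Lcoeff (f : ℍ → GrpAlg Λ) (x : Λ.Disc) (t : ℚ) (N : ℕ) (n : ℕ) : ℂ :=
  if n.gcd N = 1 then fourierCoeff Λ f (n • x) ((n : ℚ) ^ 2 * t) else 0

/-! ### The Euler factor -/

/-- The Gauss sum `G_A(d) = ∑_λ e(d q(λ))`. -/
def gaussSum (d : ℕ) : ℂ := ∑ x : Λ.Disc, e (d • Λ.qbar x)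

/-- The Kronecker symbol `(a / n)` for `n ≥ 1`. -/
def kronecker (a : ℤ) (n : ℕ) : ℤ :=
  (ZMod.χ₈ (a : ZMod 8)) ^ (n.factorization 2) * jacobiSym a (n / 2 ^ (n.factorization 2))

/-- `ε_d = 1` for `d ≡ 1 mod 4` and `ε_d = i` for `d ≡ 3 mod 4`. -/
def epsilon (d : ℕ) : ℂ := if d % 4 = 1 then 1 else Complex.I

/-- `χ_A(p) = ε_p^{sig + (-1/|A|)} (p / (|A| 2^{sig}))` for odd `p`, the last symbol being
`(p / |A|) (p / 2)^{sig}`. -/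
def chi (p : ℕ) : ℂ :=
  epsilon p ^ (Λ.sig + kronecker (-1) (Fintype.card Λ.Disc)) *
    (kronecker p (Fintype.card Λ.Disc) : ℂ) * (kronecker p 2 : ℂ) ^ Λ.sig

/-- The Legendre symbol `(-t / p)` of a rational number `t` with denominator prime to `p`. -/
def legendreNeg (p : ℕ) [Fact p.Prime] (t : ℚ) : ℤ := legendreSym p (-(t.num * t.den))

/-- `δ_{p ∤ t}` for a rational number `t` with denominator prime to `p`. -/
def deltaNotDvd (p : ℕ) (t : ℚ) : ℂ := if (p : ℤ) ∣ t.num then 0 else 1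

/-- Numerator of the factor at `p`, as a function of `y = p^{k-1-s}`. -/
def eulerNum (p : ℕ) [Fact p.Prime] (t : ℚ) (y : ℂ) : ℂ :=
  if Even Λ.rk then
    1 + deltaNotDvd p t * (gaussSum Λ 1 / gaussSum Λ p) * y
  else
    1 - chi Λ p * (legendreNeg p t : ℂ) * (((p : ℝ) ^ (-(1 / 2) : ℝ) : ℝ) : ℂ) * y

/-- Denominator of the factor at `p`, as a function of `y = p^{k-1-s}`, where `k = κ / 2` and `ev`
is the eigenvalue of `T(p²)`. -/
def eulerDen (κ : ℤ) (p : ℕ) (ev : ℂ) (y : ℂ) : ℂ :=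
  if Even Λ.rk then
    1 - (ev / (((p : ℝ) ^ ((κ : ℝ) / 2 - 1) : ℝ) : ℂ) -
      (1 - (p : ℂ)⁻¹) * (gaussSum Λ 1 / gaussSum Λ p)) * y + y ^ 2
  else
    1 - ev / (((p : ℝ) ^ ((κ : ℝ) / 2 - 1) : ℝ) : ℂ) * y + y ^ 2

/-- `y = p^{k-1-s}` with `k = κ / 2`. -/
def eulerVar (κ : ℤ) (p : ℕ) (s : ℂ) : ℂ := (p : ℂ) ^ ((κ : ℂ) / 2 - 1 - s)

/-- The parameter `σ`: `1/2` for even rank; for odd rank `5/16` if `level(L) ∣ N^∞`, and `1/4`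
otherwise. -/
def sigmaBound (N : ℕ) : ℝ :=
  open Classical in
  if Even Λ.rk then 1 / 2 else if ∃ m : ℕ, Λ.level ∣ N ^ m then 5 / 16 else 1 / 4

/-- The region in which the `L`-series `L^N_{(λ,t)}(f, s)` is considered: the half-plane
`Re(s) > k + 1 - 2σ` (with `k = κ / 2`), together with every further point at which the series
converges absolutely. -/
def Region (κ : ℤ) (f : ℍ → GrpAlg Λ) (x : Λ.Disc) (t : ℚ) (N : ℕ) : Set ℂ :=
  {s | (κ : ℝ) / 2 + 1 - 2 * sigmaBound Λ N < s.re ∨ LSeriesSummable (Lcoeff Λ f x t N) s}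

end VVMF

end

noncomputable section
namespace VVMF

/-! ### Theta functions of rank one -/

open Complex Filter Topology

/-! Write k = κ/2, K = p^(k-1) and y = p^(k-1-s). The theorem comes from a three-term recursion for
the coefficients a(nλ, n²t) along the powers of p.

The double coset of α splits into p² + p cosets, indexed by the bottom rows (c : d) in ℙ¹(ℤ/p²).
They are represented by α, by the matrices (1, j; 0, p²) for j mod p², and by the matrices (p, h; 0,
p) for h prime to p. Comparing Fourier coefficients in f|T(p²) = λ_p f gives (`hecke_fourierCoeff`)
λ_p a(pμ, m) = p^(k-2) (p^k a(μ, m/p²) + p^(2-k) a(p²μ, p²m) + W(m) a(pμ, m)), where W(m) sums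
normalised Gauss sums of L/pL against the characters e(hm/p). At the start of a chain the term a(μ,
m/p²) is absent because p² does not divide level·t; further up p divides level·m, so W takes its
value at zero. Hence a(p^j mλ, p^(2j) m²t) = K^j c_j a(mλ, m²t) for p ∤ m (`fourierCoeff_pow`),
where c_j = `eulerSeq β ν j` has generating function (1 + νy)/(1 - βy + y²). Sorting n as p^j m
splits off the factor ∑ c_j y^j (`tsum_factor`).

For convergence, suppose a coefficient a(mλ, m²t) occurring in the series with p ∤ m is nonzero.
Then ∑ c_j y^j converges, either because it is a constant times a subseries of the L-series, or by
the Hecke bound a(nλ, n²t) = O(n^k), which suffices for Re s > k. Convergence forces |y| < 1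
(`norm_lt_one_of_summable`). Since |ν| ≤ 1, the numerator 1 + νy is nonzero, and so is the
denominator, whose product with the sum is the numerator. If no such coefficient exists, all series
vanish.

The Weil representation is given by generators only, so the operators attached to the
representatives have to be identified. This is done with the (non-holomorphic) theta functions of L
with characteristics (u, w). They transform under T and S by ρ and a scalar factor (Poisson
summation), and their values span ℂ[A], because for a suitable characteristic they tend to a single
𝔢_λ at i∞ (`linearMap_ext_Theta`). An operator is therefore known once its effect on theta values is
known. Replacing τ by p²τ amounts to restricting the theta sum from L' to pL', which is detected by
averaging over the characters of L/pL; this yields conjugation by α on Γ₀(p²) (`Theta_conj`) and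
shows that (p, h; 0, p) acts by a scalar, a Gauss sum of L/pL (`Theta_middle`, `exists_middle`).

The Gauss sums are evaluated in three steps. The limit at i∞ of a theta identity gives reciprocity
with G_A(p) (`gauss_reciprocity`). Unitarity of ρ gives the absolute value (`norm_latticeGauss`).
For odd p, diagonalisation modulo p together with quadratic reciprocity gives the dependence on h
and identifies χ_A(p); for p = 2 the absolute value forces even rank. -/

/-- `ee z = exp(2πi z)` for complex `z`. -/
def ee (z : ℂ) : ℂ := cexp (2 * Real.pi * I * z)

theorem ee_add (z w : ℂ) : ee (z + w) = ee z * ee w := by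
  simp only [ee, mul_add, Complex.exp_add]

@[simp] theorem ee_zero : ee 0 = 1 := by simp [ee]

theorem ee_ne_zero (z : ℂ) : ee z ≠ 0 := Complex.exp_ne_zero _

@[simp] theorem ee_int (n : ℤ) : ee n = 1 := by
  rw [ee, mul_comm]; exact Complex.exp_int_mul_two_pi_mul_I n

theorem ee_eq_one_of_int {z : ℂ} (h : ∃ n : ℤ, z = n) : ee z = 1 := by
  obtain ⟨n, rfl⟩ := h; exact ee_int n

theorem ee_congr {z w : ℂ} (h : ∃ n : ℤ, z = w + n) : ee z = ee w := by
  obtain ⟨n, rfl⟩ := h; rw [ee_add, ee_int, mul_one]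

theorem ee_neg (z : ℂ) : ee (-z) = (ee z)⁻¹ := by
  rw [ee, ee, mul_neg, Complex.exp_neg]

theorem norm_ee (z : ℂ) : ‖ee z‖ = Real.exp (-2 * Real.pi * z.im) := by
  rw [ee, Complex.norm_exp]
  congr 1
  simp [Complex.mul_re, Complex.mul_im]

theorem norm_ee_real (x : ℝ) : ‖ee x‖ = 1 := by simp [norm_ee]

theorem conj_ee (z : ℂ) : (starRingEnd ℂ) (ee z) = ee (-(starRingEnd ℂ) z) := by
  rw [ee, ee, ← Complex.exp_conj]
  congr 1
  simp only [map_mul, Complex.conj_I, Complex.conj_ofReal, map_ofNat]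
  ring

theorem ee_sum {ι : Type*} (s : Finset ι) (g : ι → ℂ) : ee (∑ i ∈ s, g i) = ∏ i ∈ s, ee (g i) := by
  simp only [ee, Finset.mul_sum, Complex.exp_sum]

/-- The terms of the theta series of the rank one lattice with quadratic form `m x²`. -/
def thTerm (m : ℕ) (a u w : ℝ) (τ : ℂ) (n : ℤ) : ℂ :=
  ee (m * ((n + a + u) ^ 2 * τ + 2 * (n + a + u / 2) * w))

/-- The theta function of the rank one lattice with quadratic form `m x²`. -/
def th (m : ℕ) (a u w : ℝ) (τ : ℂ) : ℂ := ∑' n : ℤ, thTerm m a u w τ n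

theorem norm_thTerm (m : ℕ) (a u w : ℝ) (τ : ℂ) (n : ℤ) :
    ‖thTerm m a u w τ n‖ = Real.exp (-2 * Real.pi * m * (n + a + u) ^ 2 * τ.im) := by
  have h : (m * ((n + a + u) ^ 2 * τ + 2 * (n + a + u / 2) * w) : ℂ) =
      ((m * (n + a + u) ^ 2 : ℝ) : ℂ) * τ + ((m * (2 * (n + a + u / 2) * w) : ℝ) : ℂ) := by
    push_cast; ring
  rw [thTerm, norm_ee, h]
  congr 1
  rw [Complex.add_im, Complex.im_ofReal_mul, Complex.ofReal_im]
  ring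

theorem summable_thTerm {m : ℕ} (hm : 0 < m) (a u w : ℝ) {τ : ℂ} (hτ : 0 < τ.im) :
    Summable (thTerm m a u w τ) := by
  have h1 := (summable_jacobiTheta₂_term_iff (2 * m * ((a + u) * τ + w)) (2 * m * τ)).mpr
    (by
      have : (2 * (m : ℂ) * τ).im = 2 * m * τ.im := by
        have : (2 * (m : ℂ) * τ) = ((2 * m : ℝ) : ℂ) * τ := by push_cast; ring
        rw [this, Complex.im_ofReal_mul]
      rw [this]; positivity)
  have h2 : thTerm m a u w τ = fun n => ee (m * ((a + u) ^ 2 * τ + 2 * (a + u / 2) * w)) *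
      jacobiTheta₂_term n (2 * m * ((a + u) * τ + w)) (2 * m * τ) := by
    funext n
    rw [thTerm, jacobiTheta₂_term, ee, ee, ← Complex.exp_add]
    congr 1
    ring
  rw [h2]
  exact h1.mul_left _

theorem tsum_int_eq_sum_fin (d : ℕ) [NeZero d] {g : ℤ → ℂ} (hg : Summable g) :
    ∑' n : ℤ, g n = ∑ k : Fin d, ∑' l : ℤ, g (l * d + (k : ℕ)) := by
  rw [← (Int.divModEquiv d).symm.tsum_eq g]
  have hg' : Summable fun x : ℤ × Fin d => g ((Int.divModEquiv d).symm x) :=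
    (Int.divModEquiv d).symm.summable_iff.mpr hg
  have hg2 : Summable fun x : Fin d × ℤ => g ((Int.divModEquiv d).symm x.swap) :=
    (Equiv.prodComm _ _).summable_iff.mpr hg'
  rw [← (Equiv.prodComm (Fin d) ℤ).tsum_eq]
  exact (Summable.tsum_prod hg2).trans (tsum_fintype _)

/-- Passing from τ to τ + 1 and from w to w - u changes the exponent by m(n + a)², the terms in u
cancelling. Since 2ma is an integer, this is ma² modulo 1. -/
theorem th_T (m : ℕ) (k : ℤ) (a u w : ℝ) (hk : 2 * m * a = k) (τ : ℂ) :
    th m a u (w - u) (τ + 1) = ee (m * a ^ 2) * th m a u w τ := by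
  rw [th, th, ← tsum_mul_left]
  refine tsum_congr fun n => ?_
  rw [thTerm, thTerm, ← ee_add]
  refine ee_congr ⟨k * n + m * n ^ 2, ?_⟩
  have hk' : (2 * m * a : ℂ) = k := by exact_mod_cast hk
  push_cast
  linear_combination (n : ℂ) * hk'

/-- Poisson summation for a Gaussian. The dual variable runs over (1/2m)ℤ, and sorting it by
residues modulo 2m turns the dual sum into a combination of the 2m theta functions at τ. -/
theorem th_S {m : ℕ} (hm : 0 < m) (k' : ℤ) (u w : ℝ) {τ : ℂ} (hτ : 0 < τ.im) :
    th m ((k' : ℝ) / (2 * m : ℕ)) (-w) u (-1 / τ) =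
      1 / (2 * m * (I / τ)) ^ (1 / 2 : ℂ) * ∑ k : Fin (2 * m),
        ee (-(k' * (k : ℕ) / (2 * m : ℕ))) * th m (((k : ℕ) : ℝ) / (2 * m : ℕ)) u w τ := by
  have hτ0 : τ ≠ 0 := by rintro rfl; simp at hτ
  have hm0 : (m : ℂ) ≠ 0 := by exact_mod_cast hm.ne'
  have : NeZero (2 * m) := ⟨by omega⟩
  set A : ℂ := 2 * m * (I / τ) with hA
  have hAre : 0 < A.re := by
    have h1 : A = ((2 * m / Complex.normSq τ : ℝ) : ℂ) * (I * (starRingEnd ℂ) τ) := by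
      rw [hA, div_eq_mul_inv, Complex.inv_def]; push_cast; ring
    have h2 : (I * (starRingEnd ℂ) τ).re = τ.im := by simp
    rw [h1, Complex.re_ofReal_mul, h2]
    have := Complex.normSq_pos.mpr hτ0
    positivity
  have hA0 : A ≠ 0 := by intro h; rw [h] at hAre; simp at hAre
  set α : ℂ := (k' : ℂ) / (2 * m) with hα
  set B : ℂ := 2 * I * m * ((α - w) * (-1 / τ) + u) with hB
  set c : ℂ := ee (m * ((α - w) ^ 2 * (-1 / τ) + 2 * (α - w / 2) * u)) with hc
  have e1 : ∀ n : ℤ, thTerm m ((k' : ℝ) / (2 * m : ℕ)) (-w) u (-1 / τ) n =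
      c * cexp (-Real.pi * A * n ^ 2 + 2 * Real.pi * B * n) := by
    intro n
    rw [thTerm, hc, ee, ee, ← Complex.exp_add, hA, hB]
    congr 1
    push_cast
    rw [← hα]
    field_simp
    ring_nf
  rw [th, tsum_congr e1, tsum_mul_left, Complex.tsum_exp_neg_quadratic hAre,
    mul_left_comm]
  congr 1
  -- The dual Gaussian, with the square expanded, is the theta term at -n/(2m). The substitution n ↦
  -- -n and the splitting n = 2m·l + k follow.
  have e2 : ∀ n : ℤ, c * cexp (-Real.pi / A * (n + I * B) ^ 2) =
      ee (-(k' * (-n : ℤ) / (2 * m))) *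
        ee (m * (((-n : ℤ) / (2 * m) + u) ^ 2 * τ + 2 * ((-n : ℤ) / (2 * m) + u / 2) * w)) := by
    intro n
    have hIA : (-Real.pi / A : ℂ) = Real.pi * I * τ / (2 * m) := by
      rw [hA]; field_simp; rw [Complex.I_sq]
    rw [hc, ee, ee, ee, ← Complex.exp_add, ← Complex.exp_add, hIA]
    congr 1
    have hIB : I * B = -(2 * m * ((α - w) * (-1 / τ) + u)) := by
      rw [hB]; linear_combination (2 * m * ((α - w) * (-1 / τ) + u)) * Complex.I_sq
    rw [hIB, hα]
    push_cast
    field_simp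
    ring
  rw [← tsum_mul_left, tsum_congr e2]
  refine ((Equiv.neg ℤ).tsum_eq (fun n : ℤ => ee (-(k' * n / (2 * m))) *
    ee (m * ((n / (2 * m) + u) ^ 2 * τ + 2 * (n / (2 * m) + u / 2) * w)))).trans ?_
  have e3 : ∀ (l : ℤ) (k : Fin (2 * m)), ee (-(k' * ((l * (2 * m : ℕ) + (k : ℕ) : ℤ) : ℂ) / (2 * m))) *
      ee (m * ((((l * (2 * m : ℕ) + (k : ℕ) : ℤ) : ℂ) / (2 * m) + u) ^ 2 * τ +
        2 * (((l * (2 * m : ℕ) + (k : ℕ) : ℤ) : ℂ) / (2 * m) + u / 2) * w)) =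
      ee (-(k' * (k : ℕ) / (2 * m : ℕ))) * thTerm m (((k : ℕ) : ℝ) / (2 * m : ℕ)) u w τ l := by
    intro l k
    congr 1
    · refine ee_congr ⟨-(k' * l), ?_⟩
      push_cast; field_simp; ring
    · rw [thTerm]; congr 1; push_cast; field_simp
  rw [tsum_int_eq_sum_fin (2 * m)]
  · refine Finset.sum_congr rfl fun k _ => ?_
    rw [tsum_congr fun l => e3 l k, tsum_mul_left]; rfl
  · refine (Int.divModEquiv (2 * m)).symm.summable_iff.mp
      ((Equiv.prodComm (Fin (2 * m)) ℤ).summable_iff.mp ?_)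
    refine Summable.congr (f := fun x : Fin (2 * m) × ℤ => ee (-(k' * (x.1 : ℕ) / (2 * m : ℕ))) *
      thTerm m (((x.1 : ℕ) : ℝ) / (2 * m : ℕ)) u w τ x.2) ?_ (fun x => (e3 x.2 x.1).symm)
    apply Summable.of_norm
    have h4 : ∀ x : Fin (2 * m) × ℤ, ‖ee (-(k' * (x.1 : ℕ) / (2 * m : ℕ))) * thTerm m (((x.1 : ℕ) : ℝ) / (2 * m : ℕ)) u w τ x.2‖ =
        ‖thTerm m (((x.1 : ℕ) : ℝ) / (2 * m : ℕ)) u w τ x.2‖ := by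
      intro x
      have : (-(k' * (x.1 : ℕ) / (2 * m : ℕ)) : ℂ) = ((-(k' * (x.1 : ℕ) / (2 * m : ℕ)) : ℝ) : ℂ) := by
        push_cast; ring
      rw [norm_mul, this, norm_ee_real, one_mul]
    refine Summable.congr ?_ (fun x => (h4 x).symm)
    have h5 : Summable fun x : Fin (2 * m) × ℤ =>
        ‖thTerm m (((x.1 : ℕ) : ℝ) / (2 * m : ℕ)) u w τ x.2‖ := by
      refine (summable_prod_of_nonneg (fun x => norm_nonneg _)).mpr ⟨fun k => ?_, Summable.of_finite⟩
      exact (summable_thTerm hm (((k : ℕ) : ℝ) / (2 * m : ℕ)) u w hτ).norm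
    exact h5

/-- A term decays exponentially unless n + a + u = 0, in which case it does not depend on τ. The
terms at height 1 dominate all later ones. -/
theorem tendsto_th_im_atTop {m : ℕ} (hm : 0 < m) (a u w σ : ℝ) :
    Tendsto (fun T : ℝ => th m a u w (σ + I * T)) atTop
      (𝓝 (∑' n : ℤ, if (n + a + u : ℝ) = 0 then ee (-(m * u * w)) else 0)) := by
  unfold th
  refine tendsto_tsum_of_dominated_convergence
    (bound := fun n => ‖thTerm m a u w (σ + I * (1 : ℝ)) n‖) ?_ ?_ ?_
  · exact (summable_thTerm hm _ _ _ (by simp)).norm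
  · intro n
    split_ifs with h
    · refine Tendsto.congr (fun T => ?_) tendsto_const_nhds
      rw [thTerm]
      have h' : (n + a + u : ℂ) = 0 := by exact_mod_cast h
      congr 1
      linear_combination (-(m : ℂ) * (n + a + u) * (σ + I * T) - 2 * m * w) * h'
    · rw [tendsto_zero_iff_norm_tendsto_zero]
      simp_rw [norm_thTerm]
      refine Real.tendsto_exp_atBot.comp ?_
      have : 0 < 2 * Real.pi * m * (n + a + u) ^ 2 := by positivity
      have h2 : (fun T : ℝ => -2 * Real.pi * m * (n + a + u) ^ 2 * (σ + I * T : ℂ).im) =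
          fun T : ℝ => (-(2 * Real.pi * m * (n + a + u) ^ 2)) * T := by
        funext T; simp
      rw [h2]
      exact tendsto_id.const_mul_atTop_of_neg (by linarith)
  · filter_upwards [eventually_ge_atTop 1] with T hT n
    rw [norm_thTerm, norm_thTerm]
    apply Real.exp_le_exp.mpr
    have : 0 ≤ 2 * Real.pi * m * (n + a + u) ^ 2 := by positivity
    simp
    nlinarith

end VVMF
end

noncomputable section
namespace VVMF

/-! ### Classes in the discriminant group -/

open Complex Filter Topology

theorem e_coe (x : ℝ) : e (x : UnitAddCircle) = ee x := by
  rw [e, AddCircle.toCircle_apply_mk, Circle.coe_exp, ee]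
  congr 1; push_cast; ring

theorem e_add (x y : UnitAddCircle) : e (x + y) = e x * e y := by
  rw [e, AddCircle.toCircle_add]; rfl

@[simp] theorem e_zero : e 0 = 1 := by simp [e]

theorem e_neg (x : UnitAddCircle) : e (-x) = (e x)⁻¹ := by
  refine eq_inv_of_mul_eq_one_left ?_
  rw [← e_add]; simp

theorem norm_e (x : UnitAddCircle) : ‖e x‖ = 1 := Circle.norm_coe _

theorem conj_e (x : UnitAddCircle) : (starRingEnd ℂ) (e x) = e (-x) := by
  rw [e_neg, Complex.inv_def, Complex.normSq_eq_norm_sq, norm_e]; simp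

namespace EvenLattice

variable {V : Type*} [AddCommGroup V] [Module ℚ V] (Λ : EvenLattice V)

/-- `v ∈ L'` represents the class `y ∈ L'/L`. -/
def Cls (v : V) (y : Λ.Disc) : Prop := ∃ h : v ∈ Λ.dual, Submodule.Quotient.mk ⟨v, h⟩ = y

variable {Λ}

theorem exists_cls (y : Λ.Disc) : ∃ v, Λ.Cls v y := by
  obtain ⟨x, rfl⟩ := Submodule.Quotient.mk_surjective _ y
  exact ⟨x, x.2, rfl⟩

theorem Cls.mem {v : V} {y : Λ.Disc} (h : Λ.Cls v y) : v ∈ Λ.dual := h.1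

theorem Cls.add {v w : V} {x y : Λ.Disc} (h : Λ.Cls v x) (h' : Λ.Cls w y) :
    Λ.Cls (v + w) (x + y) := by
  obtain ⟨a, rfl⟩ := h
  obtain ⟨b, rfl⟩ := h'
  exact ⟨add_mem a b, rfl⟩

theorem Cls.nsmul {v : V} {x : Λ.Disc} (h : Λ.Cls v x) (k : ℕ) : Λ.Cls (k • v) (k • x) := by
  obtain ⟨a, rfl⟩ := h
  exact ⟨Submodule.smul_of_tower_mem _ _ a, rfl⟩

theorem Cls.neg {v : V} {x : Λ.Disc} (h : Λ.Cls v x) : Λ.Cls (-v) (-x) := by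
  obtain ⟨a, rfl⟩ := h
  exact ⟨neg_mem a, rfl⟩

theorem Cls.sub {v w : V} {x y : Λ.Disc} (h : Λ.Cls v x) (h' : Λ.Cls w y) :
    Λ.Cls (v - w) (x - y) := by
  rw [sub_eq_add_neg, sub_eq_add_neg]; exact h.add h'.neg

theorem Cls.unique {v : V} {x y : Λ.Disc} (h : Λ.Cls v x) (h' : Λ.Cls v y) : x = y := by
  obtain ⟨_, rfl⟩ := h
  obtain ⟨_, rfl⟩ := h'
  rfl

theorem polar_mem_int {v w : V} (hv : v ∈ Λ.dual) (hw : w ∈ Λ.L) :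
    ∃ c : ℤ, QuadraticMap.polar Λ.q v w = c := by
  obtain ⟨c, hc⟩ := Submodule.mem_one.mp (hv _ hw)
  exact ⟨c, by simpa using hc.symm⟩

theorem mem_dual_iff {v : V} :
    v ∈ Λ.dual ↔ ∀ w ∈ Λ.L, ∃ c : ℤ, QuadraticMap.polar Λ.q v w = c := by
  refine ⟨fun h w hw => polar_mem_int h hw, fun h w hw => ?_⟩
  obtain ⟨c, hc⟩ := h w hw
  exact Submodule.mem_one.mpr ⟨c, by simpa using hc.symm⟩

theorem L_le_dual : Λ.L ≤ Λ.dual := by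
  intro v hv
  rw [mem_dual_iff]
  intro w hw
  obtain ⟨a, ha⟩ := Λ.even _ (add_mem hv hw)
  obtain ⟨b, hb⟩ := Λ.even _ hv
  obtain ⟨c, hc⟩ := Λ.even _ hw
  exact ⟨a - b - c, by rw [QuadraticMap.polar, ha, hb, hc]; push_cast; ring⟩

theorem cls_zero_iff {v : V} : Λ.Cls v 0 ↔ v ∈ Λ.L := by
  constructor
  · rintro ⟨h, h'⟩
    exact (Submodule.Quotient.mk_eq_zero (Submodule.submoduleOf Λ.L Λ.dual)).mp h'
  · intro h
    exact ⟨L_le_dual h, (Submodule.Quotient.mk_eq_zero _).mpr h⟩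

theorem cls_add_iff {v w : V} {x y : Λ.Disc} (h : Λ.Cls w y) :
    Λ.Cls (v + w) (x + y) ↔ Λ.Cls v x := by
  refine ⟨fun h' => ?_, fun h' => h'.add h⟩
  simpa using h'.sub h

theorem cls_add_mem_iff {v l : V} {x : Λ.Disc} (h : l ∈ Λ.L) :
    Λ.Cls (v + l) x ↔ Λ.Cls v x := by
  simpa using cls_add_iff (v := v) (x := x) (cls_zero_iff.mpr h)

theorem Cls.qbar {v : V} {x : Λ.Disc} (h : Λ.Cls v x) :
    Λ.qbar x = (((Λ.q v : ℚ) : ℝ) : UnitAddCircle) := by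
  obtain ⟨_, rfl⟩ := h; rfl

theorem Cls.e_qbar {v : V} {x : Λ.Disc} (h : Λ.Cls v x) : e (Λ.qbar x) = ee (Λ.q v : ℚ) := by
  rw [h.qbar, e_coe]; simp

theorem Cls.bbar {v w : V} {x y : Λ.Disc} (h : Λ.Cls v x) (h' : Λ.Cls w y) :
    Λ.bbar x y = (((QuadraticMap.polar Λ.q v w : ℚ) : ℝ) : UnitAddCircle) := by
  rw [EvenLattice.bbar, h.qbar, h'.qbar, (h.add h').qbar, QuadraticMap.polar]
  push_cast; rfl

theorem Cls.e_neg_bbar {v w : V} {x y : Λ.Disc} (h : Λ.Cls v x) (h' : Λ.Cls w y) :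
    e (-Λ.bbar x y) = ee (-(QuadraticMap.polar Λ.q v w : ℚ)) := by
  rw [e_neg, h.bbar h', e_coe, ee_neg]; simp

/-! ### Orthogonal bases -/

theorem exists_smul_mem (Λ : EvenLattice V) (v : V) : ∃ n : ℤ, n ≠ 0 ∧ n • v ∈ Λ.L := by
  have hv : v ∈ Submodule.span ℚ (Λ.L : Set V) := by
    rw [Λ.isLattice.span_eq_top]; trivial
  induction hv using Submodule.span_induction with
  | mem x hx => exact ⟨1, one_ne_zero, by simpa using hx⟩
  | zero => exact ⟨1, one_ne_zero, by simp⟩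
  | add x y _ _ hx hy =>
    obtain ⟨n, hn, hx⟩ := hx
    obtain ⟨m, hm, hy⟩ := hy
    refine ⟨n * m, mul_ne_zero hn hm, ?_⟩
    rw [smul_add]
    refine add_mem ?_ ?_
    · rw [mul_comm, mul_smul]; exact Submodule.smul_mem _ _ hx
    · rw [mul_smul]; exact Submodule.smul_mem _ _ hy
  | smul a x _ hx =>
    obtain ⟨n, hn, hx⟩ := hx
    refine ⟨n * a.den, mul_ne_zero hn (by exact_mod_cast a.den_nz), ?_⟩
    have h : (n * (a.den : ℤ)) • a • x = a.num • n • x := by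
      rw [← Int.cast_smul_eq_zsmul ℚ, ← Int.cast_smul_eq_zsmul ℚ a.num,
        ← Int.cast_smul_eq_zsmul ℚ n, smul_smul, smul_smul]
      congr 1
      push_cast
      rw [mul_assoc, mul_comm (a.den : ℚ) a, Rat.mul_den_eq_num, mul_comm]
    rw [h]
    exact Submodule.smul_mem _ _ hx

variable (Λ) in
/-- An orthogonal basis of the quadratic space consisting of lattice vectors. -/
structure Diag where
  b : Module.Basis (Fin (Module.finrank ℚ V)) ℚ V
  m : Fin (Module.finrank ℚ V) → ℤ
  m_ne : ∀ i, m i ≠ 0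
  b_mem : ∀ i, b i ∈ Λ.L
  q_eq : ∀ v, Λ.q v = ∑ i, m i * b.repr v i ^ 2

/-- An orthogonal ℚ-basis is scaled into L. Evenness makes its diagonal values integers and
non-degeneracy makes them nonzero. Theta functions of L thereby reduce to products of theta
functions of rank one. -/
theorem nonempty_diag [FiniteDimensional ℚ V] (Λ : EvenLattice V) : Nonempty Λ.Diag := by
  obtain ⟨v, hv⟩ := LinearMap.BilinForm.exists_orthogonal_basis
    (B := QuadraticMap.polarBilin Λ.q) ⟨fun x y => by simp [QuadraticMap.polar_comm]⟩
  choose c hc0 hc using fun i => Λ.exists_smul_mem (v i)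
  have hu : ∀ i, IsUnit ((c i : ℤ) : ℚ) := fun i => by
    rw [isUnit_iff_ne_zero]; exact_mod_cast hc0 i
  set b := v.isUnitSMul hu with hb
  have hbi : ∀ i, b i = c i • v i := fun i => by
    rw [hb, Module.Basis.isUnitSMul_apply, Int.cast_smul_eq_zsmul]
  have hbm : ∀ i, b i ∈ Λ.L := fun i => by rw [hbi]; exact hc i
  choose m hm using fun i => Λ.even _ (hbm i)
  have hort : ∀ i j, i ≠ j → QuadraticMap.polar Λ.q (b i) (b j) = 0 := by
    intro i j hij
    have h0 : QuadraticMap.polarBilin Λ.q (v i) (v j) = 0 := hv hij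
    rw [hbi, hbi]
    have : QuadraticMap.polarBilin Λ.q (c i • v i) (c j • v j) = 0 := by
      rw [map_zsmul, map_zsmul, LinearMap.smul_apply, h0]; simp
    simpa [or_left_comm] using this
  have hq : ∀ w, Λ.q w = ∑ i, (m i : ℚ) * b.repr w i ^ 2 := by
    intro w
    conv_lhs => rw [← b.sum_repr w]
    rw [QuadraticMap.map_sum]
    have : ∑ ij ∈ (Finset.univ : Finset (Fin (Module.finrank ℚ V))).sym2.filter (fun ij => ¬ij.IsDiag),
        QuadraticMap.polarSym2 Λ.q (ij.map fun i => b.repr w i • b i) = 0 := by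
      refine Finset.sum_eq_zero fun ij hij => ?_
      induction ij with
      | _ i j =>
        simp only [Finset.mem_filter, Sym2.mk_isDiag_iff] at hij
        simp [QuadraticMap.polar_smul_left, QuadraticMap.polar_smul_right, hort i j hij.2]
    rw [this, add_zero]
    refine Finset.sum_congr rfl fun i _ => ?_
    rw [QuadraticMap.map_smul, hm]; simp only [smul_eq_mul]; ring
  refine ⟨⟨b, m, fun i hi => ?_, hbm, hq⟩⟩
  have : b i = 0 := by
    refine Λ.nondegenerate.1 _ fun y => ?_
    have h : ∀ y, QuadraticMap.polar Λ.q (b i) y = 0 := by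
      intro y
      have h2 : QuadraticMap.polarBilin Λ.q (b i) = 0 := by
        refine b.ext fun j => ?_
        by_cases hij : i = j
        · subst hij
          simp [QuadraticMap.polar_self, hm, hi]
        · simpa using hort i j hij
      simpa using LinearMap.congr_fun h2 y
    simpa using h y
  exact b.ne_zero i this

namespace Diag

variable (D : Λ.Diag)

local notation "n" => Module.finrank ℚ V

/-- The index of `ℤ b_i` in its dual. -/
def d (i : Fin n) : ℕ := 2 * (D.m i).natAbs

theorem natAbs_pos (i : Fin n) : 0 < (D.m i).natAbs := Int.natAbs_pos.mpr (D.m_ne i)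

theorem d_pos (i : Fin n) : 0 < D.d i := by have := D.natAbs_pos i; unfold d; omega

theorem polar_eq (v w : V) :
    QuadraticMap.polar Λ.q v w = ∑ i, 2 * D.m i * (D.b.repr v i * D.b.repr w i) := by
  rw [QuadraticMap.polar, D.q_eq, D.q_eq, D.q_eq, ← Finset.sum_sub_distrib,
    ← Finset.sum_sub_distrib]
  refine Finset.sum_congr rfl fun i _ => ?_
  simp; ring

/-- The vector with coordinates `z_i / d_i`. -/
def pt (z : Fin n → ℤ) : V := D.b.equivFun.symm fun i => (z i : ℚ) / D.d i

theorem repr_pt (z : Fin n → ℤ) (i : Fin n) : D.b.repr (D.pt z) i = (z i : ℚ) / D.d i := by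
  rw [← D.b.equivFun_apply, pt, LinearEquiv.apply_symm_apply]

theorem pt_add (z z' : Fin n → ℤ) : D.pt (z + z') = D.pt z + D.pt z' := by
  rw [pt, pt, pt, ← map_add]
  congr 1; funext i; simp [add_div]

/-- L' lies in the dual of the sublattice ⊕ ℤb_i, because pairing with b_i multiplies the i-th
coordinate by 2m_i, and the result is an integer. -/
theorem exists_pt {v : V} (hv : v ∈ Λ.dual) : ∃ z, v = D.pt z := by
  choose c hc using fun i => polar_mem_int hv (D.b_mem i)
  refine ⟨fun i => c i * (D.m i).sign, ?_⟩
  refine D.b.ext_elem fun i => ?_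
  rw [repr_pt]
  have h := hc i
  rw [D.polar_eq, Finset.sum_eq_single i (by intro j _ hj; simp [hj]) (by simp)] at h
  simp only [Module.Basis.repr_self, Finsupp.single_eq_same, mul_one] at h
  have h1 : (D.d i : ℚ) = 2 * (D.m i * (D.m i).sign) := by
    rw [d]; push_cast
    have : ((D.m i).natAbs : ℤ) = D.m i * (D.m i).sign := by
      rw [Int.natCast_natAbs, mul_comm, Int.sign_mul_self_eq_abs]
    have h2 : (((D.m i).natAbs : ℤ) : ℚ) = D.m i * (D.m i).sign := by rw [this]; push_cast; rfl
    rw [← h2]; simp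
  have hs : ((D.m i).sign : ℚ) * (D.m i).sign = 1 := by
    rcases lt_or_gt_of_ne (D.m_ne i) with h | h
    · rw [Int.sign_eq_neg_one_of_neg h]; norm_num
    · rw [Int.sign_eq_one_of_pos h]; norm_num
  have hd : (D.d i : ℚ) ≠ 0 := by exact_mod_cast (D.d_pos i).ne'
  rw [eq_div_iff hd, h1]; push_cast; rw [← h]
  linear_combination (0 : ℚ) * hs

/-- Two coordinate vectors that agree modulo `N d_i` differ by a vector of `N (⊕ ℤ b_i)`. -/
theorem exists_pt_eq_add (N : ℕ) {z z' : Fin n → ℤ} (h : ∀ i, z i ≡ z' i [ZMOD (D.d i * N : ℕ)]) :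
    ∃ l ∈ Λ.L, D.pt z = D.pt z' + (N : ℤ) • l := by
  choose c hc using fun i => (h i).symm.dvd
  refine ⟨∑ i, c i • D.b i, Submodule.sum_mem _ fun i _ => Submodule.smul_mem _ _ (D.b_mem i), ?_⟩
  refine D.b.ext_elem fun i => ?_
  have hd : (D.d i : ℚ) ≠ 0 := by exact_mod_cast (D.d_pos i).ne'
  have h1 : (z i : ℚ) = z' i + D.d i * N * c i := by
    have := hc i
    have h2 : z i = z' i + (D.d i * N : ℕ) * c i := by omega
    rw [h2]; push_cast; ring
  have h3 : D.b.repr (∑ j, c j • D.b j) i = c i := by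
    have : (∑ j, c j • D.b j) = ∑ j, (c j : ℚ) • D.b j := by
      refine Finset.sum_congr rfl fun j _ => by rw [Int.cast_smul_eq_zsmul]
    rw [this, D.b.repr_sum_self]
  rw [map_add, map_zsmul, Finsupp.add_apply, Finsupp.smul_apply, h3, repr_pt, repr_pt, h1]
  field_simp
  simp; ring

end Diag

end EvenLattice

/-! ### Sums over residue systems -/

section ResidueSums

variable {N : ℕ}

/-- The integer vector with entries given by residues. -/
def toInt {D : Fin N → ℕ} (k : ∀ i, Fin (D i)) : Fin N → ℤ := fun i => ((k i : ℕ) : ℤ)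

theorem sum_residues_of_bijective {D : Fin N → ℕ} (hD : ∀ i, 0 < D i) {H : (Fin N → ℤ) → ℂ}
    (hH : ∀ z z', (∀ i, z i ≡ z' i [ZMOD D i]) → H z = H z') {T : Type*} [Fintype T]
    (f : T → Fin N → ℤ) (inj : ∀ s t, (∀ i, f s i ≡ f t i [ZMOD D i]) → s = t)
    (surj : ∀ z : Fin N → ℤ, ∃ t, ∀ i, f t i ≡ z i [ZMOD D i]) :
    ∑ t, H (f t) = ∑ k : ∀ i, Fin (D i), H (toInt k) := by
  have hz : ∀ z : Fin N → ℤ, ∀ i, (z i % (D i : ℤ)).toNat < D i := fun z i => by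
    have h1 := Int.emod_lt_of_pos (z i) (show (0 : ℤ) < D i by exact_mod_cast hD i)
    have h2 := Int.emod_nonneg (z i) (show (D i : ℤ) ≠ 0 by exact_mod_cast (hD i).ne')
    omega
  let r : (Fin N → ℤ) → ∀ i, Fin (D i) := fun z i => ⟨(z i % (D i : ℤ)).toNat, hz z i⟩
  have hr : ∀ z i, toInt (r z) i ≡ z i [ZMOD D i] := by
    intro z i
    have h2 := Int.emod_nonneg (z i) (show (D i : ℤ) ≠ 0 by exact_mod_cast (hD i).ne')
    have : toInt (r z) i = z i % (D i : ℤ) := by simp [toInt, r, h2]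
    rw [this]; exact Int.mod_modEq _ _
  have hk : ∀ k : ∀ i, Fin (D i), r (toInt k) = k := by
    intro k; funext i; ext
    have : ((k i : ℕ) : ℤ) % (D i : ℤ) = (k i : ℕ) :=
      Int.emod_eq_of_lt (by positivity) (by exact_mod_cast (k i).2)
    simp [r, toInt, this]
  refine Fintype.sum_bijective (fun t => r (f t)) ⟨fun s t hst => ?_, fun k => ?_⟩ _ _ fun t => ?_
  · refine inj s t fun i => ((hr (f s) i).symm.trans ?_).trans (hr (f t) i)
    simp only at hst
    rw [hst]
  · obtain ⟨t, ht⟩ := surj (toInt k)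
    refine ⟨t, ?_⟩
    rw [← hk k]
    funext i
    ext
    simp only [r]
    rw [ht i]
  · exact hH _ _ fun i => (hr _ i).symm

theorem toInt_inj {D : Fin N → ℕ} (k k' : ∀ i, Fin (D i))
    (h : ∀ i, toInt k i ≡ toInt k' i [ZMOD D i]) : k = k' := by
  funext i; ext
  have h1 := h i
  simp only [toInt] at h1
  exact Nat.ModEq.eq_of_lt_of_lt ((Int.natCast_modEq_iff).mp h1) (k i).2 (k' i).2

theorem exists_toInt {D : Fin N → ℕ} (hD : ∀ i, 0 < D i) (z : Fin N → ℤ) :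
    ∃ k : ∀ i, Fin (D i), ∀ i, toInt k i ≡ z i [ZMOD D i] := by
  have hz : ∀ i, (z i % (D i : ℤ)).toNat < D i := fun i => by
    have h1 := Int.emod_lt_of_pos (z i) (show (0 : ℤ) < D i by exact_mod_cast hD i)
    have h2 := Int.emod_nonneg (z i) (show (D i : ℤ) ≠ 0 by exact_mod_cast (hD i).ne')
    omega
  refine ⟨fun i => ⟨(z i % (D i : ℤ)).toNat, hz i⟩, fun i => ?_⟩
  have h2 := Int.emod_nonneg (z i) (show (D i : ℤ) ≠ 0 by exact_mod_cast (hD i).ne')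
  have : toInt (fun i => (⟨(z i % (D i : ℤ)).toNat, hz i⟩ : Fin (D i))) i = z i % (D i : ℤ) := by
    simp [toInt, h2]
  rw [this]; exact Int.mod_modEq _ _

theorem sum_residues_add {D : Fin N → ℕ} (hD : ∀ i, 0 < D i) {H : (Fin N → ℤ) → ℂ}
    (hH : ∀ z z', (∀ i, z i ≡ z' i [ZMOD D i]) → H z = H z') (s : Fin N → ℤ) :
    ∑ k : ∀ i, Fin (D i), H (toInt k + s) = ∑ k : ∀ i, Fin (D i), H (toInt k) := by
  refine sum_residues_of_bijective hD hH (fun k => toInt k + s) (fun k k' h => ?_) fun z => ?_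
  · exact toInt_inj k k' fun i => Int.ModEq.add_right_cancel' _ (h i)
  · obtain ⟨k, hk⟩ := exists_toInt hD (z - s)
    refine ⟨k, fun i => ?_⟩
    have := (hk i).add_right (s i)
    simpa using this

end ResidueSums

end VVMF
end

noncomputable section
namespace VVMF

/-! ### Vector-valued theta functions -/

open Complex Filter Topology

/-- The identity for `m > 0`, complex conjugation otherwise. -/
def sc (m : ℤ) : ℂ →+* ℂ := if 0 < m then RingHom.id ℂ else starRingEnd ℂ

theorem sc_pos {m : ℤ} (h : 0 < m) (z : ℂ) : sc m z = z := by simp [sc, h]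

theorem sc_neg {m : ℤ} (h : m < 0) (z : ℂ) : sc m z = (starRingEnd ℂ) z := by
  simp [sc, not_lt.mpr h.le]

theorem continuous_sc (m : ℤ) : Continuous (sc m) := by
  unfold sc
  split_ifs
  · exact continuous_id
  · exact Complex.continuous_conj

@[simp] theorem sc_ofReal (m : ℤ) (x : ℝ) : sc m x = x := by
  unfold sc; split_ifs <;> simp

@[simp] theorem norm_sc (m : ℤ) (z : ℂ) : ‖sc m z‖ = ‖z‖ := by
  unfold sc; split_ifs <;> simp

theorem sc_ee {m : ℤ} (hm : m ≠ 0) (x : ℝ) : sc m (ee x) = ee ((m.sign : ℝ) * x : ℝ) := by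
  rcases lt_or_gt_of_ne hm with h | h
  · rw [sc_neg h, conj_ee, Int.sign_eq_neg_one_of_neg h]; simp
  · rw [sc_pos h, Int.sign_eq_one_of_pos h]; simp

theorem sc_ee_natAbs {m : ℤ} (hm : m ≠ 0) (x : ℝ) :
    sc m (ee ((m.natAbs : ℝ) * x : ℝ)) = ee ((m : ℝ) * x : ℝ) := by
  rw [sc_ee hm]
  congr 2
  have h := congrArg (Int.cast : ℤ → ℝ) (Int.sign_mul_natAbs m)
  rw [Int.cast_mul, Int.cast_natCast] at h
  rw [← mul_assoc, h]

/-- Fixes the branch. The number √(2m) e(1/8)/τ^(1/2) has the right square, and its real part is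
positive because τ^(1/2) lies in the open first quadrant; so it is the principal root. -/
theorem sqrt_transform {m : ℕ} (hm : 0 < m) {τ : ℂ} (hτ : 0 < τ.im) :
    1 / (2 * m * (I / τ)) ^ (1 / 2 : ℂ) =
      τ ^ (1 / 2 : ℂ) * ee (-(1 / 8 : ℝ)) * ((1 / Real.sqrt (2 * m) : ℝ) : ℂ) := by
  have hτ0 : τ ≠ 0 := by rintro rfl; simp at hτ
  set s : ℂ := τ ^ (1 / 2 : ℂ) with hs
  have hs2 : s ^ 2 = τ := by rw [hs, ← Complex.cpow_nat_mul]; simp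
  have hs0 : s ≠ 0 := by intro h; rw [h] at hs2; simp at hs2; exact hτ0 hs2.symm
  have harg : 0 < τ.arg := by
    rcases (Complex.arg_nonneg_iff.mpr hτ.le).eq_or_lt with h | h
    · have := (Complex.arg_eq_zero_iff.mp h.symm).2; rw [this] at hτ; exact absurd hτ (lt_irrefl _)
    · exact h
  have harg' : τ.arg ≤ Real.pi := Complex.arg_le_pi τ
  have hne : τ.arg ≠ Real.pi := by
    intro h; have := (Complex.arg_eq_pi_iff.mp h).2; rw [this] at hτ; exact lt_irrefl _ hτ
  have hlt : τ.arg < Real.pi := lt_of_le_of_ne harg' hne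
  have hexp : s = cexp (((Real.log ‖τ‖ / 2 : ℝ) : ℂ) + ((τ.arg / 2 : ℝ) : ℂ) * I) := by
    rw [hs, Complex.cpow_def_of_ne_zero hτ0, Complex.log]
    congr 1; push_cast; ring
  have hsre : 0 < s.re := by
    rw [hexp, Complex.exp_add, ← Complex.ofReal_exp, Complex.re_ofReal_mul, Complex.exp_ofReal_mul_I_re]
    exact mul_pos (Real.exp_pos _) (Real.cos_pos_of_mem_Ioo ⟨by linarith, by linarith⟩)
  have hsim : 0 < s.im := by
    rw [hexp, Complex.exp_add, ← Complex.ofReal_exp, Complex.im_ofReal_mul, Complex.exp_ofReal_mul_I_im]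
    exact mul_pos (Real.exp_pos _) (Real.sin_pos_of_pos_of_lt_pi (by linarith) (by linarith))
  set z : ℂ := ((Real.sqrt (2 * m) : ℝ) : ℂ) * (ee ((1 / 8 : ℝ)) / s) with hz
  have he8 : ee ((1 / 8 : ℝ)) = (((Real.sqrt 2 / 2 : ℝ) : ℂ)) * (1 + I) := by
    rw [ee]
    have : (2 * Real.pi * I * ((1 / 8 : ℝ) : ℂ)) = ((Real.pi / 4 : ℝ) : ℂ) * I := by push_cast; ring
    rw [this, Complex.exp_mul_I, ← Complex.ofReal_cos, ← Complex.ofReal_sin, Real.cos_pi_div_four,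
      Real.sin_pi_div_four]; ring
  have he82 : ee ((1 / 8 : ℝ)) ^ 2 = I := by
    rw [he8, mul_pow, ← Complex.ofReal_pow, div_pow, Real.sq_sqrt (by norm_num)]
    have : (1 + I) ^ 2 = 2 * I := by linear_combination Complex.I_sq
    rw [this]; push_cast; ring
  have hsqrt : 0 < Real.sqrt (2 * m) := Real.sqrt_pos.mpr (by positivity)
  have hzre : 0 < z.re := by
    rw [hz, Complex.re_ofReal_mul]
    refine mul_pos hsqrt ?_
    have : ee ((1 / 8 : ℝ)) / s = ((Real.sqrt 2 / 2 / Complex.normSq s : ℝ) : ℂ) *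
        ((1 + I) * (starRingEnd ℂ) s) := by
      rw [he8, div_eq_mul_inv, Complex.inv_def]; push_cast; ring
    rw [this, Complex.re_ofReal_mul]
    have h2 : ((1 + I) * (starRingEnd ℂ) s).re = s.re + s.im := by simp
    rw [h2]
    have := Complex.normSq_pos.mpr hs0
    positivity
  have hz2 : z ^ 2 = 2 * m * (I / τ) := by
    rw [hz, mul_pow, div_pow, he82, hs2, ← Complex.ofReal_pow, Real.sq_sqrt (by positivity)]
    push_cast; ring
  have hroot : (2 * m * (I / τ)) ^ (1 / 2 : ℂ) = z := by
    rw [← hz2, one_div]; exact Complex.sq_cpow_two_inv hzre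
  have h8 : ee (-(1 / 8 : ℝ)) = (ee ((1 / 8 : ℝ)))⁻¹ := ee_neg _
  rw [hroot, hz, h8]
  have := ee_ne_zero ((1 / 8 : ℝ))
  have hsq : ((Real.sqrt (2 * m) : ℝ) : ℂ) ≠ 0 := by exact_mod_cast hsqrt.ne'
  push_cast at *
  field_simp

namespace EvenLattice.Diag

variable {V : Type*} [AddCommGroup V] [Module ℚ V] {Λ : EvenLattice V} (D : Λ.Diag)

local notation "n" => Module.finrank ℚ V

open Classical in
/-- The number of `k` with `D.pt k ∈ L`, that is the index of `⊕ ℤ b_i` in `L`. -/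
def idx : ℂ := ∑ k : ∀ i, Fin (D.d i), if D.pt (toInt k) ∈ Λ.L then 1 else 0

open Classical in
-- Put M = ⊕ ℤb_i. Translating by a representative of x splits off the phase of that representative
-- and leaves the sum of the character (·, pt z) over L/M. This sum is [L : M] if pt z lies in L'
-- and zero otherwise. It is what collapses Poisson summation over M'/M to a sum over A.
theorem sum_cls_ee [FiniteDimensional ℚ V] (x : Λ.Disc) (z : Fin n → ℤ) :
    ∑ k : ∀ i, Fin (D.d i), (if Λ.Cls (D.pt (toInt k)) x then
      ee (-(QuadraticMap.polar Λ.q (D.pt (toInt k)) (D.pt z) : ℚ)) else 0) =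
    D.idx * ∑ y : Λ.Disc, if Λ.Cls (D.pt z) y then e (-Λ.bbar x y) else 0 := by
  obtain ⟨v, hv⟩ := exists_cls x
  have hM : ∀ i, D.d i = D.d i * 1 := fun i => (mul_one _).symm
  have hint : ∀ (z' : Fin n → ℤ) (l : V), ∀ w, QuadraticMap.polar Λ.q (D.pt z' + l) w =
      QuadraticMap.polar Λ.q (D.pt z') w + QuadraticMap.polar Λ.q l w :=
    fun z' l w => QuadraticMap.polar_add_left _ _ _ _
  have hb : ∀ (l : V) (s : V), ee (-(QuadraticMap.polar Λ.q (l + s) (D.pt z) : ℚ)) =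
      ee (-(QuadraticMap.polar Λ.q l (D.pt z) : ℚ)) *
      ee (-(QuadraticMap.polar Λ.q s (D.pt z) : ℚ)) := by
    intro l s
    rw [QuadraticMap.polar_add_left, ← ee_add]; congr 1; push_cast; ring
  -- the part of the sum over the coset of `L`
  have hL : ∀ s : V, ∑ k : ∀ i, Fin (D.d i), (if D.pt (toInt k) ∈ Λ.L then
      ee (-(QuadraticMap.polar Λ.q (D.pt (toInt k) + s) (D.pt z) : ℚ)) else 0) =
      ee (-(QuadraticMap.polar Λ.q s (D.pt z) : ℚ)) *
      ∑ k : ∀ i, Fin (D.d i), (if D.pt (toInt k) ∈ Λ.L then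
      ee (-(QuadraticMap.polar Λ.q (D.pt (toInt k)) (D.pt z) : ℚ)) else 0) := by
    intro s
    rw [Finset.mul_sum]
    refine Finset.sum_congr rfl fun k _ => ?_
    split_ifs
    · rw [hb, mul_comm]
    · simp
  -- periodicity with respect to `⊕ ℤ b_i`
  have hzb : ∀ (t : Fin n → ℤ), (∀ i, t i ≡ 0 [ZMOD D.d i]) →
      ee (-(QuadraticMap.polar Λ.q (D.pt t) (D.pt z) : ℚ)) = 1 := by
    intro t ht
    refine ee_eq_one_of_int ?_
    choose c hc using fun i => (Int.modEq_zero_iff_dvd.mp (ht i))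
    refine ⟨-∑ i, c i * (D.m i).sign * z i, ?_⟩
    rw [D.polar_eq]
    push_cast
    rw [neg_inj]
    refine Finset.sum_congr rfl fun i _ => ?_
    rw [repr_pt, repr_pt, hc]
    have hd : (D.d i : ℂ) ≠ 0 := by exact_mod_cast (D.d_pos i).ne'
    have h1 : (2 * D.m i : ℂ) = (D.m i).sign * D.d i := by
      have : ((D.m i).sign : ℤ) * D.d i = 2 * D.m i := by
        rw [d]; push_cast
        have := Int.sign_mul_abs (D.m i)
        linear_combination 2 * this
      exact_mod_cast this.symm
    push_cast
    rw [h1]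
    field_simp
  have shift : ∀ (P : V → Prop) (hP : ∀ v, ∀ l ∈ Λ.L, P (v + l) ↔ P v) (s : V), s ∈ Λ.dual →
      ∑ k : ∀ i, Fin (D.d i), (if P (D.pt (toInt k) + s) then
      ee (-(QuadraticMap.polar Λ.q (D.pt (toInt k) + s) (D.pt z) : ℚ)) else 0) =
      ∑ k : ∀ i, Fin (D.d i), (if P (D.pt (toInt k)) then
      ee (-(QuadraticMap.polar Λ.q (D.pt (toInt k)) (D.pt z) : ℚ)) else 0) := by
    intro P hP s hs
    obtain ⟨t, rfl⟩ := D.exists_pt hs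
    have := sum_residues_add D.d_pos (H := fun z' => if P (D.pt z') then
      ee (-(QuadraticMap.polar Λ.q (D.pt z') (D.pt z) : ℚ)) else 0) (fun a a' h => by
        obtain ⟨l, hl, h'⟩ := D.exists_pt_eq_add 1 (z := a) (z' := a')
          (fun i => by rw [mul_one]; exact h i)
        rw [Nat.cast_one, one_smul] at h'
        have e1 : P (D.pt a) ↔ P (D.pt a') := by rw [h']; exact hP _ _ hl
        have e2 : ee (-(QuadraticMap.polar Λ.q (D.pt a) (D.pt z) : ℚ)) =
            ee (-(QuadraticMap.polar Λ.q (D.pt a') (D.pt z) : ℚ)) := by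
          have : D.pt a = D.pt a' + D.pt (a - a') := by rw [← pt_add]; simp
          rw [this, hb, hzb (a - a') fun i => by
            have := (h i).sub_right (a' i); simpa using this, mul_one]
        simp only [e1, e2]) t
    simpa only [pt_add] using this
  have h1 := shift (fun w => Λ.Cls w x) (fun v l hl => cls_add_mem_iff hl) v hv.mem
  have hc : ∀ w, Λ.Cls (w + v) x ↔ w ∈ Λ.L := fun w => by
    have := cls_add_iff (v := w) (x := 0) hv
    rw [zero_add] at this
    rw [this, cls_zero_iff]
  simp only [hc] at h1
  rw [← h1, hL v]
  by_cases hz : D.pt z ∈ Λ.dual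
  · have hy : Λ.Cls (D.pt z) (Submodule.Quotient.mk ⟨_, hz⟩) := ⟨hz, rfl⟩
    rw [Finset.sum_eq_single (Submodule.Quotient.mk ⟨_, hz⟩ : Λ.Disc)]
    · rw [if_pos hy, hv.e_neg_bbar hy, mul_comm]
      congr 1
      refine Finset.sum_congr rfl fun k _ => ?_
      split_ifs with hk
      · obtain ⟨c, hc⟩ := polar_mem_int hz hk
        rw [QuadraticMap.polar_comm, hc]
        refine ee_eq_one_of_int ⟨-c, by push_cast; ring⟩
      · rfl
    · intro y _ hy'
      rw [if_neg]
      intro h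
      exact hy' (h.unique hy)
    · simp
  · have : ∀ y : Λ.Disc, ¬ Λ.Cls (D.pt z) y := fun y h => hz h.mem
    simp only [this, if_false, Finset.sum_const_zero, mul_zero]
    rw [mem_dual_iff] at hz
    push Not at hz
    obtain ⟨l, hl, hl'⟩ := hz
    -- Translation by l, whose pairing with `pt z` is not integral, multiplies the sum by a number
    -- different from 1 and leaves it unchanged, so the sum is zero.
    have h2 := shift (fun w => w ∈ Λ.L) (fun v l hl => Λ.L.add_mem_iff_left hl) l (L_le_dual hl)
    simp only [Λ.L.add_mem_iff_left hl] at h2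
    rw [hL l] at h2
    refine mul_eq_zero_of_right _ ?_
    by_contra h3
    have h4 := mul_right_cancel₀ h3 (h2.trans (one_mul _).symm)
    rw [ee, Complex.exp_eq_one_iff] at h4
    obtain ⟨c, hc⟩ := h4
    refine hl' (-c) ?_
    have h5 : (2 * Real.pi * I : ℂ) ≠ 0 := Complex.two_pi_I_ne_zero
    have h6 : (-(QuadraticMap.polar Λ.q l (D.pt z) : ℚ) : ℂ) = c := by
      apply mul_left_cancel₀ h5; rw [hc]; ring
    rw [QuadraticMap.polar_comm]
    have h7 : ((QuadraticMap.polar Λ.q l (D.pt z) : ℚ) : ℂ) = ((-c : ℤ) : ℚ) := by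
      push_cast; rw [← h6]; ring
    exact_mod_cast h7

open Classical in
theorem sum_cls [FiniteDimensional ℚ V] (x : Λ.Disc) :
    ∑ k : ∀ i, Fin (D.d i), (if Λ.Cls (D.pt (toInt k)) x then (1 : ℂ) else 0) = D.idx := by
  have h := D.sum_cls_ee x 0
  have h0 : D.pt 0 = 0 := by
    refine D.b.ext_elem fun i => ?_
    rw [repr_pt]; simp
  have h00 : Λ.Cls (0 : V) 0 := cls_zero_iff.mpr (zero_mem _)
  rw [h0, Finset.sum_eq_single (0 : Λ.Disc)] at h
  · rw [if_pos h00] at h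
    obtain ⟨v, hv⟩ := exists_cls x
    rw [hv.e_neg_bbar h00] at h
    simpa using h
  · intro y _ hy
    rw [if_neg]
    intro h; exact hy (h.unique h00)
  · simp

open Classical in
-- The index formula |M'/M| = [L : M]² |L'/L| for M = ⊕ ℤb_i. A double sum of characters over M'/M
-- is evaluated twice: in one order through `sum_cls_ee`, in the other by orthogonality, which
-- leaves only k = 0.
theorem prod_d_eq [FiniteDimensional ℚ V] :
    ((∏ i, D.d i : ℕ) : ℂ) = D.idx ^ 2 * Fintype.card Λ.Disc := by
  have h1 : ∑ z : ∀ i, Fin (D.d i), ∑ k : ∀ i, Fin (D.d i), (if Λ.Cls (D.pt (toInt k)) 0 then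
      ee (-(QuadraticMap.polar Λ.q (D.pt (toInt k)) (D.pt (toInt z)) : ℚ)) else 0) =
      D.idx ^ 2 * Fintype.card Λ.Disc := by
    simp_rw [sum_cls_ee]
    rw [← Finset.mul_sum, Finset.sum_comm]
    have : ∀ y : Λ.Disc, e (-Λ.bbar 0 y) = 1 := fun y => by
      obtain ⟨v, hv⟩ := exists_cls y
      rw [Cls.e_neg_bbar (cls_zero_iff.mpr (zero_mem _)) hv]; simp
    simp_rw [this, sum_cls]
    simp; ring
  rw [← h1, Finset.sum_comm]
  have hpt0 : D.pt 0 = 0 := by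
    refine D.b.ext_elem fun i => ?_
    rw [repr_pt]; simp
  let z0 : ∀ i, Fin (D.d i) := fun i => ⟨0, D.d_pos i⟩
  have hz0 : toInt z0 = 0 := by funext i; simp [toInt, z0]
  rw [Finset.sum_eq_single z0]
  · have h00 : Λ.Cls (0 : V) 0 := cls_zero_iff.mpr (zero_mem _)
    rw [hz0, hpt0]
    simp [h00]
  · intro k _ hk
    split_ifs with hcl
    · have hprod : ∀ z : ∀ i, Fin (D.d i),
          ee (-(QuadraticMap.polar Λ.q (D.pt (toInt k)) (D.pt (toInt z)) : ℚ)) =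
          ∏ i, ee (-(((D.m i).sign * ((k i : ℕ) * (z i : ℕ)) / D.d i))) := by
        intro z
        rw [← ee_sum, D.polar_eq]
        congr 1
        push_cast
        rw [← Finset.sum_neg_distrib]
        refine Finset.sum_congr rfl fun i _ => ?_
        rw [repr_pt, repr_pt]
        have hd : (D.d i : ℂ) ≠ 0 := by exact_mod_cast (D.d_pos i).ne'
        have h1 : (2 * D.m i : ℂ) = (D.m i).sign * D.d i := by
          have : ((D.m i).sign : ℤ) * D.d i = 2 * D.m i := by
            rw [d]; push_cast
            have := Int.sign_mul_abs (D.m i)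
            linear_combination 2 * this
          exact_mod_cast this.symm
        push_cast [toInt]
        rw [h1]
        field_simp
      simp_rw [hprod]
      have h2 := (Finset.prod_univ_sum (fun i : Fin n => (Finset.univ : Finset (Fin (D.d i))))
        (fun i z => ee (-(((D.m i).sign * ((k i : ℕ) * (z : ℕ)) / D.d i))))).symm
      rw [Fintype.piFinset_univ] at h2
      rw [h2]
      obtain ⟨i, hi⟩ : ∃ i, k i ≠ z0 i := by
        by_contra hcon; push Not at hcon; exact hk (funext hcon)
      refine Finset.prod_eq_zero (Finset.mem_univ i) ?_
      have hki : 0 < (k i : ℕ) := by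
        rcases Nat.eq_zero_or_pos (k i : ℕ) with h | h
        · exact absurd (Fin.ext h) hi
        · exact h
      have hd : (D.d i : ℂ) ≠ 0 := by exact_mod_cast (D.d_pos i).ne'
      set ζ : ℂ := ee (-((D.m i).sign * (k i : ℕ) / D.d i)) with hζ
      have hpow : ∀ z : ℕ, ee (-(((D.m i).sign * ((k i : ℕ) * z) / D.d i))) = ζ ^ z := by
        intro z
        rw [hζ, ee, ee, ← Complex.exp_nat_mul]; congr 1; ring
      have hgeom : ∑ z : Fin (D.d i), ee (-(((D.m i).sign * ((k i : ℕ) * ((z : ℕ) : ℂ)) / D.d i))) =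
          ∑ z ∈ Finset.range (D.d i), ζ ^ z := by
        rw [Finset.sum_range]
        exact Finset.sum_congr rfl fun z _ => hpow z
      rw [hgeom]
      have hζ1 : ζ ≠ 1 := by
        intro h
        rw [hζ, ee, Complex.exp_eq_one_iff] at h
        obtain ⟨c, hc⟩ := h
        have h5 : (2 * Real.pi * I : ℂ) ≠ 0 := Complex.two_pi_I_ne_zero
        have h6 : (-((D.m i).sign * (k i : ℕ) / D.d i) : ℂ) = c := by
          apply mul_left_cancel₀ h5; rw [hc]; ring
        have h7 : (-((D.m i).sign * (k i : ℕ)) : ℤ) = c * D.d i := by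
          rw [← neg_div, div_eq_iff hd] at h6
          exact_mod_cast h6
        have h8 : (D.d i : ℤ) ∣ (k i : ℕ) := by
          rcases lt_or_gt_of_ne (D.m_ne i) with h | h
          · rw [Int.sign_eq_neg_one_of_neg h] at h7
            exact ⟨c, by linarith⟩
          · rw [Int.sign_eq_one_of_pos h] at h7
            exact ⟨-c, by linarith⟩
        exact absurd (Nat.le_of_dvd hki (by exact_mod_cast h8)) (not_le.mpr (k i).2)
      rw [geom_sum_eq hζ1]
      have : ζ ^ D.d i = 1 := by
        rw [← hpow]
        refine ee_eq_one_of_int ⟨-((D.m i).sign * (k i : ℕ)), ?_⟩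
        push_cast; field_simp
      rw [this]; simp
    · simp
  · simp

theorem idx_eq_natCast : ∃ c : ℕ, D.idx = c := by
  classical
  exact ⟨∑ k : ∀ i, Fin (D.d i), if D.pt (toInt k) ∈ Λ.L then 1 else 0, by
    rw [idx]; push_cast; rfl⟩

theorem sum_sign [FiniteDimensional ℚ V] : ∑ i, (D.m i).sign = Λ.sig := by
  have heq : QuadraticMap.Equivalent Λ.q
      (QuadraticMap.weightedSumSquares ℚ (fun i => (D.m i : ℚ))) := by
    refine ⟨⟨D.b.equivFun, fun v => ?_⟩⟩
    rw [QuadraticMap.weightedSumSquares_apply, D.q_eq]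
    refine Finset.sum_congr rfl fun i _ => ?_
    simp [sq]
  rw [EvenLattice.sig, QuadraticForm.sigPos_of_equiv_weightedSumSquares heq,
    QuadraticForm.sigNeg_of_equiv_weightedSumSquares heq,
    Set.ncard_eq_toFinset_card', Set.ncard_eq_toFinset_card']
  simp only [Finset.card_eq_sum_ones, Set.toFinset_ofPred, Finset.sum_filter]
  push_cast
  rw [← Finset.sum_sub_distrib]
  refine Finset.sum_congr rfl fun i _ => ?_
  rcases lt_or_gt_of_ne (D.m_ne i) with h | h
  · rw [Int.sign_eq_neg_one_of_neg h, if_neg (by exact_mod_cast not_lt.mpr h.le), if_pos (by exact_mod_cast h)]; simp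
  · rw [Int.sign_eq_one_of_pos h, if_pos (by exact_mod_cast h), if_neg (by exact_mod_cast not_lt.mpr h.le)]; simp

/-- The archimedean automorphy factor `z ↦ z^{b⁺} (conj z)^{b⁻}`. -/
def jf (z : ℂ) : ℂ := ∏ i, sc (D.m i) z

theorem jf_mul (z w : ℂ) : D.jf (z * w) = D.jf z * D.jf w := by
  simp [jf, Finset.prod_mul_distrib]

@[simp] theorem jf_one : D.jf 1 = 1 := by simp [jf]

theorem jf_ofReal (x : ℝ) : D.jf x = (x : ℂ) ^ n := by simp [jf]

theorem norm_jf (z : ℂ) : ‖D.jf z‖ = ‖z‖ ^ n := by simp [jf]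

theorem jf_ne_zero {z : ℂ} (h : z ≠ 0) : D.jf z ≠ 0 := by
  rw [← norm_ne_zero_iff, norm_jf]; exact pow_ne_zero _ (norm_ne_zero_iff.mpr h)

theorem jf_inv (z : ℂ) : D.jf z⁻¹ = (D.jf z)⁻¹ := by simp [jf, Finset.prod_inv_distrib]

/-- The theta function of a coset of `⊕ ℤ b_i`. -/
def theta0 (z : Fin n → ℤ) (u w : Fin n → ℝ) (τ : ℂ) : ℂ :=
  ∏ i, sc (D.m i) (th (D.m i).natAbs ((z i : ℝ) / D.d i) (u i) (w i) τ)

open Classical in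
/-- The vector-valued theta function of the lattice `L` with characteristics `u`, `w`. -/
def Theta (u w : Fin n → ℝ) (τ : ℂ) : GrpAlg Λ := fun y =>
  ∑ k : ∀ i, Fin (D.d i), if Λ.Cls (D.pt (toInt k)) y then D.theta0 (toInt k) u w τ else 0

theorem theta0_T (z : Fin n → ℤ) (u w : Fin n → ℝ) (τ : ℂ) :
    D.theta0 z u (w - u) (τ + 1) = ee (Λ.q (D.pt z) : ℚ) * D.theta0 z u w τ := by
  have h : ((Λ.q (D.pt z) : ℚ) : ℂ) = ∑ i, ((((D.m i : ℤ) : ℝ) * ((z i : ℝ) / D.d i) ^ 2 : ℝ) : ℂ) := by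
    rw [D.q_eq]; push_cast
    exact Finset.sum_congr rfl fun i _ => by rw [repr_pt]; push_cast; rfl
  rw [h, ee_sum, theta0, theta0, ← Finset.prod_mul_distrib]
  refine Finset.prod_congr rfl fun i _ => ?_
  have hd : (D.d i : ℝ) ≠ 0 := by exact_mod_cast (D.d_pos i).ne'
  rw [← sc_ee_natAbs (D.m_ne i), ← map_mul]
  congr 1
  rw [Pi.sub_apply, th_T _ (z i) _ _ _ (by
    have : (2 * (D.m i).natAbs : ℝ) = D.d i := by rw [d]; push_cast; rfl
    rw [this]; field_simp)]
  push_cast; rfl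

theorem Theta_T (u w : Fin n → ℝ) (τ : ℂ) :
    D.Theta u (w - u) (τ + 1) = weilT Λ (D.Theta u w τ) := by
  funext y
  change _ = e (Λ.qbar y) * D.Theta u w τ y
  rw [Theta, Theta, Finset.mul_sum]
  refine Finset.sum_congr rfl fun k _ => ?_
  split_ifs with h
  · rw [theta0_T, h.e_qbar]
  · simp

variable [FiniteDimensional ℚ V]

theorem theta0_S (z : Fin n → ℤ) (u w : Fin n → ℝ) {τ : ℂ} (hτ : 0 < τ.im) :
    D.theta0 z (-w) u (-1 / τ) =
      D.jf (τ ^ (1 / 2 : ℂ)) * Complex.exp (-2 * Real.pi * Complex.I * (Λ.sig : ℂ) / 8) /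
        (Real.sqrt (∏ i, D.d i : ℕ) : ℂ) *
      ∑ k : ∀ i, Fin (D.d i), ee (-(QuadraticMap.polar Λ.q (D.pt z) (D.pt (toInt k)) : ℚ)) *
        D.theta0 (toInt k) u w τ := by
  have hi : ∀ i, sc (D.m i) (th (D.m i).natAbs ((z i : ℝ) / D.d i) ((-w) i) (u i) (-1 / τ)) =
      (sc (D.m i) (τ ^ (1 / 2 : ℂ)) * ee ((((-(1 / 8) : ℝ) * (D.m i).sign : ℝ)) : ℂ) *
        ((1 / Real.sqrt (D.d i) : ℝ) : ℂ)) *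
      ∑ k : Fin (D.d i), ee (-((((2 * D.m i * ((z i : ℝ) / D.d i * ((k : ℕ) / D.d i))) : ℝ)) : ℂ)) *
        sc (D.m i) (th (D.m i).natAbs (((k : ℕ) : ℝ) / D.d i) (u i) (w i) τ) := by
    intro i
    have h := th_S (D.natAbs_pos i) (z i) (u i) (w i) hτ
    rw [sqrt_transform (D.natAbs_pos i) hτ] at h
    have hd : (D.d i : ℝ) ≠ 0 := by exact_mod_cast (D.d_pos i).ne'
    have h' := congrArg (sc (D.m i)) h
    rw [map_mul, map_mul, map_mul, map_sum] at h'
    refine h'.trans ?_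
    congr 1
    · congr 1
      · congr 1
        have := sc_ee (D.m_ne i) (-(1 / 8))
        push_cast at this ⊢
        rw [this]; congr 1; ring
      · rw [sc_ofReal, d]; push_cast; rfl
    · refine Finset.sum_congr rfl fun k _ => ?_
      rw [map_mul]
      congr 1
      have := sc_ee (D.m_ne i) (-((z i : ℝ) * (k : ℕ) / D.d i))
      have e1 : (-(z i * (k : ℕ) / (2 * (D.m i).natAbs : ℕ)) : ℂ) =
          ((-((z i : ℝ) * (k : ℕ) / D.d i) : ℝ) : ℂ) := by rw [d]; push_cast; rfl
      rw [e1, this]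
      congr 1
      have h1 : (2 * D.m i : ℝ) = (D.m i).sign * D.d i := by
        have : ((D.m i).sign : ℤ) * D.d i = 2 * D.m i := by
          rw [d]; push_cast
          have := Int.sign_mul_abs (D.m i)
          linear_combination 2 * this
        exact_mod_cast this.symm
      rw [← Complex.ofReal_neg]
      congr 1
      rw [h1]; field_simp
  rw [theta0, Finset.prod_congr rfl fun i _ => hi i, Finset.prod_mul_distrib,
    Finset.prod_mul_distrib, Finset.prod_mul_distrib]
  congr 1
  · rw [mul_div_assoc, mul_assoc]
    congr 1
    rw [← ee_sum, div_eq_mul_inv]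
    congr 1
    · rw [ee]
      congr 1
      rw [← D.sum_sign]
      push_cast
      rw [← Finset.mul_sum]; ring
    · rw [← Complex.ofReal_prod, ← Complex.ofReal_inv]
      congr 1
      rw [Nat.cast_prod, Real.sqrt_prod _ (fun i _ => by positivity), ← Finset.prod_inv_distrib]
      simp
  · have h2 := Finset.prod_univ_sum (fun i : Fin n => (Finset.univ : Finset (Fin (D.d i))))
        (fun i k => ee (-((((2 * D.m i * ((z i : ℝ) / D.d i * ((k : ℕ) / D.d i))) : ℝ)) : ℂ)) *
        sc (D.m i) (th (D.m i).natAbs (((k : ℕ) : ℝ) / D.d i) (u i) (w i) τ))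
    rw [Fintype.piFinset_univ] at h2
    rw [h2]
    refine Finset.sum_congr rfl fun k _ => ?_
    rw [Finset.prod_mul_distrib]
    congr 1
    rw [← ee_sum, D.polar_eq]
    congr 1
    push_cast
    rw [← Finset.sum_neg_distrib]
    refine Finset.sum_congr rfl fun i _ => ?_
    rw [repr_pt, repr_pt]; push_cast [toInt]; ring

/-- Poisson summation gives a sum over M'/M, which `sum_cls_ee` collapses to A at the cost of the
factor [L : M]. That factor cancels because √|M'/M| = [L : M] √|A| by `prod_d_eq`. -/
theorem Theta_S (u w : Fin n → ℝ) {τ : ℂ} (hτ : 0 < τ.im) :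
    D.Theta (-w) u (-1 / τ) = D.jf (τ ^ (1 / 2 : ℂ)) • weilS Λ (D.Theta u w τ) := by
  classical
  funext x
  change _ = D.jf (τ ^ (1 / 2 : ℂ)) * (Complex.exp (-2 * Real.pi * Complex.I * (Λ.sig : ℂ) / 8) /
      (Real.sqrt (Fintype.card Λ.Disc) : ℂ) * ∑ y : Λ.Disc, e (-Λ.bbar x y) * D.Theta u w τ y)
  set c : ℂ := D.jf (τ ^ (1 / 2 : ℂ)) * Complex.exp (-2 * Real.pi * Complex.I * (Λ.sig : ℂ) / 8) /
        (Real.sqrt (∏ i, D.d i : ℕ) : ℂ) with hc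
  have h1 : D.Theta (-w) u (-1 / τ) x = c * ∑ k : ∀ i, Fin (D.d i), D.theta0 (toInt k) u w τ *
      ∑ k' : ∀ i, Fin (D.d i), (if Λ.Cls (D.pt (toInt k')) x then
      ee (-(QuadraticMap.polar Λ.q (D.pt (toInt k')) (D.pt (toInt k)) : ℚ)) else 0) := by
    rw [Theta]
    simp_rw [Finset.mul_sum]
    rw [Finset.sum_comm]
    refine Finset.sum_congr rfl fun k' _ => ?_
    split_ifs with h
    · rw [D.theta0_S _ _ _ hτ, ← hc, Finset.mul_sum]
      refine Finset.sum_congr rfl fun k _ => by ring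
    · simp
  have h2 : ∑ k : ∀ i, Fin (D.d i), D.theta0 (toInt k) u w τ *
      ∑ k' : ∀ i, Fin (D.d i), (if Λ.Cls (D.pt (toInt k')) x then
      ee (-(QuadraticMap.polar Λ.q (D.pt (toInt k')) (D.pt (toInt k)) : ℚ)) else 0) =
      D.idx * ∑ y : Λ.Disc, e (-Λ.bbar x y) * D.Theta u w τ y := by
    simp_rw [sum_cls_ee, Theta, Finset.mul_sum]
    rw [Finset.sum_comm]
    refine Finset.sum_congr rfl fun y _ => Finset.sum_congr rfl fun k _ => ?_
    split_ifs
    · ring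
    · simp
  have hsq : (Real.sqrt (∏ i, D.d i : ℕ) : ℂ) = D.idx * (Real.sqrt (Fintype.card Λ.Disc) : ℂ) := by
    obtain ⟨N, hN⟩ := D.idx_eq_natCast
    have := D.prod_d_eq
    rw [hN] at this ⊢
    have h3 : ((∏ i, D.d i : ℕ) : ℝ) = (N : ℝ) ^ 2 * (Fintype.card Λ.Disc : ℝ) := by
      exact_mod_cast this
    rw [h3, Real.sqrt_mul (by positivity), Real.sqrt_sq (by positivity)]
    push_cast; rfl
  have hidx : D.idx ≠ 0 := by
    intro h0
    have := D.prod_d_eq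
    rw [h0] at this
    have h4 : (∏ i, D.d i : ℕ) = 0 := by
      have h5 : ((∏ i, D.d i : ℕ) : ℂ) = 0 := by rw [this]; simp
      exact_mod_cast h5
    exact absurd h4 (Finset.prod_pos fun i _ => D.d_pos i).ne'
  rw [h1, h2, hc, hsq]
  have hcard : (Real.sqrt (Fintype.card Λ.Disc) : ℂ) ≠ 0 := by
    have : 0 < Fintype.card Λ.Disc := Fintype.card_pos
    exact_mod_cast (Real.sqrt_pos.mpr (by exact_mod_cast this)).ne'
  field_simp

end EvenLattice.Diag

end VVMF
end

noncomputable section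
namespace VVMF

/-! ### The Weil representation on `Mp₂(ℤ)` -/

open Complex Filter Topology

namespace EvenLattice

variable {V : Type*} [AddCommGroup V] [Module ℚ V] {Λ : EvenLattice V}

theorem bbar_add_left (x x' y : Λ.Disc) : Λ.bbar (x + x') y = Λ.bbar x y + Λ.bbar x' y := by
  obtain ⟨v, hv⟩ := exists_cls x
  obtain ⟨v', hv'⟩ := exists_cls x'
  obtain ⟨w, hw⟩ := exists_cls y
  rw [(hv.add hv').bbar hw, hv.bbar hw, hv'.bbar hw, QuadraticMap.polar_add_left]
  push_cast; rfl

theorem bbar_comm (x y : Λ.Disc) : Λ.bbar x y = Λ.bbar y x := by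
  rw [bbar, bbar, add_comm x y]; abel

theorem bbar_add_right (x y y' : Λ.Disc) : Λ.bbar x (y + y') = Λ.bbar x y + Λ.bbar x y' := by
  rw [bbar_comm, bbar_add_left, bbar_comm y, bbar_comm y']

@[simp] theorem qbar_zero : Λ.qbar 0 = 0 := by
  rw [(cls_zero_iff.mpr (zero_mem _) : Λ.Cls (0 : V) 0).qbar]; simp

@[simp] theorem bbar_zero_left (y : Λ.Disc) : Λ.bbar 0 y = 0 := by simp [bbar]

@[simp] theorem bbar_zero_right (y : Λ.Disc) : Λ.bbar y 0 = 0 := by simp [bbar]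

theorem bbar_neg_left (x y : Λ.Disc) : Λ.bbar (-x) y = -Λ.bbar x y := by
  rw [eq_neg_iff_add_eq_zero, ← bbar_add_left]; simp

theorem bbar_sub_left (x x' y : Λ.Disc) : Λ.bbar (x - x') y = Λ.bbar x y - Λ.bbar x' y := by
  rw [sub_eq_add_neg, bbar_add_left, bbar_neg_left, sub_eq_add_neg]

theorem bbar_nsmul_left (k : ℕ) (x y : Λ.Disc) : Λ.bbar (k • x) y = k • Λ.bbar x y := by
  induction k with
  | zero => simp
  | succ k ih => rw [succ_nsmul, bbar_add_left, ih, succ_nsmul]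

theorem bbar_nsmul_right (k : ℕ) (x y : Λ.Disc) : Λ.bbar x (k • y) = k • Λ.bbar x y := by
  rw [bbar_comm, bbar_nsmul_left, bbar_comm]

theorem qbar_nsmul (k : ℕ) (x : Λ.Disc) : Λ.qbar (k • x) = (k ^ 2) • Λ.qbar x := by
  obtain ⟨v, hv⟩ := exists_cls x
  have h : Λ.q (k • v) = (k : ℚ) ^ 2 * Λ.q v := by
    rw [← Nat.cast_smul_eq_nsmul ℚ, QuadraticMap.map_smul]; simp [sq]
  rw [(hv.nsmul k).qbar, hv.qbar, h]
  push_cast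
  rw [show ((k : ℝ) ^ 2 * ((Λ.q v : ℚ) : ℝ)) = (k ^ 2) • ((Λ.q v : ℚ) : ℝ) by simp]
  rfl

variable [FiniteDimensional ℚ V]

/-- A `ℤ`-basis of `L`, as a basis of the quadratic space. -/
theorem exists_basis (Λ : EvenLattice V) : ∃ b : Module.Basis (Fin (Module.finrank ℚ V)) ℚ V,
    Λ.L = Submodule.span ℤ (Set.range b) := by
  have := Λ.isLattice
  have hfree : Module.Free ℤ Λ.L := inferInstance
  let b := Module.Free.chooseBasis ℤ Λ.L
  let b' : Module.Basis _ ℚ V := b.extendOfIsLattice ℚ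
  have hL : Λ.L = Submodule.span ℤ (Set.range b') := by
    have h1 : Set.range b' = Λ.L.subtype '' Set.range b := by
      ext x
      simp [b', Set.mem_range]
    rw [h1, ← Submodule.map_span, b.span_eq, Submodule.map_top, Submodule.range_subtype]
  have hcard := Module.finrank_eq_card_basis b'
  refine ⟨b'.reindex (Fintype.equivFinOfCardEq hcard.symm), ?_⟩
  refine hL.trans ?_; congr 1; simp

theorem mem_L_of_dual {v : V} (h : ∀ w ∈ Λ.dual, ∃ c : ℤ, QuadraticMap.polar Λ.q v w = c) :
    v ∈ Λ.L := by
  obtain ⟨b, hb⟩ := Λ.exists_basis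
  have h2 := LinearMap.BilinForm.dualSubmodule_dualSubmodule_of_basis (R := ℤ)
    (B := QuadraticMap.polarBilin Λ.q) Λ.nondegenerate
    ⟨fun x y => by simp [QuadraticMap.polar_comm]⟩ b
  rw [← hb] at h2
  rw [← h2]
  intro w hw
  obtain ⟨c, hc⟩ := h w hw
  exact Submodule.mem_one.mpr ⟨c, by simpa using hc.symm⟩

theorem eq_zero_of_bbar {x : Λ.Disc} (h : ∀ y, Λ.bbar x y = 0) : x = 0 := by
  obtain ⟨v, hv⟩ := exists_cls x
  have : v ∈ Λ.L := mem_L_of_dual fun w hw => by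
    have h1 := h (Submodule.Quotient.mk ⟨w, hw⟩)
    rw [hv.bbar ⟨hw, rfl⟩, AddCircle.coe_eq_zero_iff] at h1
    obtain ⟨c, hc⟩ := h1
    refine ⟨c, ?_⟩
    have : ((c : ℚ) : ℝ) = ((QuadraticMap.polar Λ.q v w : ℚ) : ℝ) := by rw [← hc]; simp
    exact_mod_cast this.symm
  exact hv.unique (cls_zero_iff.mpr this)

theorem e_eq_one_iff (x : UnitAddCircle) : e x = 1 ↔ x = 0 := by
  rw [e, ← Circle.coe_one, Circle.ext_iff.symm, ← AddCircle.toCircle_zero (T := 1)]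
  exact (AddCircle.injective_toCircle one_ne_zero).eq_iff

open Classical in
theorem sum_e_bbar (x : Λ.Disc) :
    ∑ y, e (Λ.bbar x y) = if x = 0 then (Fintype.card Λ.Disc : ℂ) else 0 := by
  split_ifs with h
  · subst h; simp
  · obtain ⟨y, hy⟩ : ∃ y, Λ.bbar x y ≠ 0 := by
      by_contra hcon; push Not at hcon; exact h (eq_zero_of_bbar hcon)
    have h1 : e (Λ.bbar x y) * ∑ z, e (Λ.bbar x z) = ∑ z, e (Λ.bbar x z) := by
      rw [Finset.mul_sum, ← Equiv.sum_comp (Equiv.addLeft y) fun z => e (Λ.bbar x z)]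
      refine Finset.sum_congr rfl fun z _ => ?_
      rw [Equiv.coe_addLeft, bbar_add_right, e_add]
    by_contra hne
    exact hy ((e_eq_one_iff _).mp (mul_right_cancel₀ hne (h1.trans (one_mul _).symm)))

open Classical in
/-- The scalar `e(-sig/8) / √|L'/L|`. -/
def weilConst (Λ : EvenLattice V) : ℂ :=
  Complex.exp (-2 * Real.pi * Complex.I * (Λ.sig : ℂ) / 8) / (Real.sqrt (Fintype.card Λ.Disc) : ℂ)

theorem card_ne_zero : (Fintype.card Λ.Disc : ℂ) ≠ 0 := by
  exact_mod_cast Fintype.card_ne_zero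

theorem norm_weilConst_sq : ‖Λ.weilConst‖ ^ 2 = (Fintype.card Λ.Disc : ℝ)⁻¹ := by
  have h : (-2 * Real.pi * Complex.I * (Λ.sig : ℂ) / 8) =
      ((-2 * Real.pi * Λ.sig / 8 : ℝ) : ℂ) * I := by push_cast; ring
  rw [weilConst, norm_div, h, Complex.norm_exp_ofReal_mul_I, Complex.norm_real, Real.norm_eq_abs,
    abs_of_nonneg (Real.sqrt_nonneg _), div_pow, Real.sq_sqrt (by positivity)]
  simp

theorem weilConst_ne_zero : Λ.weilConst ≠ 0 := by
  intro h
  have := norm_weilConst_sq (Λ := Λ)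
  have h2 : (Fintype.card Λ.Disc : ℝ) ≠ 0 := by exact_mod_cast Fintype.card_ne_zero
  rw [h, norm_zero, zero_pow two_ne_zero] at this
  exact inv_ne_zero h2 this.symm

end EvenLattice

open EvenLattice

variable {V : Type*} [AddCommGroup V] [Module ℚ V] [FiniteDimensional ℚ V] {Λ : EvenLattice V}

theorem weilS_apply (v : GrpAlg Λ) (x : Λ.Disc) :
    weilS Λ v x = Λ.weilConst * ∑ y : Λ.Disc, e (-Λ.bbar x y) * v y := rfl

theorem weilT_apply (v : GrpAlg Λ) (x : Λ.Disc) : weilT Λ v x = e (Λ.qbar x) * v x := rfl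

variable (Λ) in
/-- `ρ(T)` as an automorphism. -/
def weilTEquiv : GrpAlg Λ ≃ₗ[ℂ] GrpAlg Λ :=
  LinearEquiv.ofLinearMap (weilT Λ)
    { toFun := fun v x => e (-Λ.qbar x) * v x
      map_add' := fun v w => by funext x; simp [mul_add]
      map_smul' := fun c v => by funext x; simp [mul_left_comm] }
    (by
      ext1 v
      funext x
      simp [weilT_apply, ← mul_assoc, ← e_add])
    (by
      ext1 v
      funext x
      simp [weilT_apply, ← mul_assoc, ← e_add])

theorem fourier_inversion (v : GrpAlg Λ) (x : Λ.Disc) :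
    ∑ y : Λ.Disc, e (Λ.bbar x y) * ∑ z : Λ.Disc, e (-Λ.bbar y z) * v z =
      Fintype.card Λ.Disc * v x := by
  classical
  simp_rw [Finset.mul_sum]
  rw [Finset.sum_comm]
  have : ∀ z : Λ.Disc, ∑ y : Λ.Disc, e (Λ.bbar x y) * (e (-Λ.bbar y z) * v z) =
      (if x = z then (Fintype.card Λ.Disc : ℂ) else 0) * v z := by
    intro z
    have h := sum_e_bbar (x - z)
    rw [sub_eq_zero] at h
    rw [← h, Finset.sum_mul]
    refine Finset.sum_congr rfl fun y _ => ?_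
    rw [← mul_assoc, ← e_add, bbar_sub_left, bbar_comm y z, sub_eq_add_neg]
  simp_rw [this]
  simp

theorem fourier_inversion' (v : GrpAlg Λ) (x : Λ.Disc) :
    ∑ y : Λ.Disc, e (-Λ.bbar x y) * ∑ z : Λ.Disc, e (Λ.bbar y z) * v z =
      Fintype.card Λ.Disc * v x := by
  have h := fourier_inversion (fun z => v (-z)) (-x)
  rw [neg_neg] at h
  rw [← h]
  refine Finset.sum_congr rfl fun y _ => ?_
  rw [bbar_neg_left]
  congr 1
  rw [← Equiv.sum_comp (Equiv.neg Λ.Disc)]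
  refine Finset.sum_congr rfl fun z _ => ?_
  rw [Equiv.neg_apply, bbar_comm y (-z), bbar_neg_left, bbar_comm z y]

variable (Λ) in
/-- `ρ(S)` as an automorphism. -/
def weilSEquiv : GrpAlg Λ ≃ₗ[ℂ] GrpAlg Λ :=
  LinearEquiv.ofLinearMap (weilS Λ)
    { toFun := fun v x => (Λ.weilConst * Fintype.card Λ.Disc)⁻¹ * ∑ y, e (Λ.bbar x y) * v y
      map_add' := fun v w => by funext x; simp [mul_add, Finset.sum_add_distrib]
      map_smul' := fun c v => by
        funext x
        simp only [Pi.smul_apply, smul_eq_mul, RingHom.id_apply, Finset.mul_sum]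
        exact Finset.sum_congr rfl fun y _ => by ring }
    (by
      refine LinearMap.ext fun v => ?_
      funext x
      have h1 := weilConst_ne_zero (Λ := Λ)
      have h2 := card_ne_zero (Λ := Λ)
      simp only [LinearMap.comp_apply, LinearMap.coe_mk, AddHom.coe_mk, weilS_apply,
        LinearMap.id_apply]
      simp_rw [mul_left_comm (e _), ← Finset.mul_sum]
      rw [fourier_inversion']
      field_simp)
    (by
      refine LinearMap.ext fun v => ?_
      funext x
      have h1 := weilConst_ne_zero (Λ := Λ)
      have h2 := card_ne_zero (Λ := Λ)
      simp only [LinearMap.comp_apply, LinearMap.coe_mk, AddHom.coe_mk, weilS_apply,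
        LinearMap.id_apply]
      simp_rw [mul_left_comm (e _), ← Finset.mul_sum]
      rw [fourier_inversion]
      field_simp)

variable (Λ) in
/-- The generator `(T, ρ(T))`. -/
def genT : Ext Λ := (Mp.T, weilTEquiv Λ)

variable (Λ) in
/-- The generator `(S, ρ(S))`. -/
def genS : Ext Λ := (Mp.S, weilSEquiv Λ)

theorem genT_mem : genT Λ ∈ weilGroup Λ := Subgroup.subset_closure (Or.inl ⟨rfl, rfl⟩)

theorem genS_mem : genS Λ ∈ weilGroup Λ := Subgroup.subset_closure (Or.inr ⟨rfl, rfl⟩)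

/-- The squared Hermitian norm on the group algebra. -/
def normSq (v : GrpAlg Λ) : ℝ := ∑ x, ‖v x‖ ^ 2

theorem normSq_weilT (v : GrpAlg Λ) : normSq (weilT Λ v) = normSq v := by
  simp [normSq, weilT_apply, norm_e]

/-- Plancherel on A. Unitarity of the Weil representation serves twice: for the absolute value of
the Gauss sums of L/pL and for the Hecke bound. -/
theorem normSq_weilS (v : GrpAlg Λ) : normSq (weilS Λ v) = normSq v := by
  classical
  have key : ∑ x : Λ.Disc, (∑ y : Λ.Disc, e (-Λ.bbar x y) * v y) *
      (starRingEnd ℂ) (∑ z : Λ.Disc, e (-Λ.bbar x z) * v z) =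
      Fintype.card Λ.Disc * ∑ x : Λ.Disc, v x * (starRingEnd ℂ) (v x) := by
    have h1 : ∀ x : Λ.Disc, (∑ y : Λ.Disc, e (-Λ.bbar x y) * v y) *
        (starRingEnd ℂ) (∑ z : Λ.Disc, e (-Λ.bbar x z) * v z) =
        ∑ z : Λ.Disc, (starRingEnd ℂ) (v z) * (e (Λ.bbar z x) * ∑ y : Λ.Disc, e (-Λ.bbar x y) * v y) := by
      intro x
      rw [map_sum, mul_comm, Finset.sum_mul]
      refine Finset.sum_congr rfl fun z _ => ?_
      rw [map_mul, conj_e, neg_neg, bbar_comm x z]; ring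
    simp_rw [h1]
    rw [Finset.sum_comm]
    simp_rw [← Finset.mul_sum, fourier_inversion]
    rw [Finset.mul_sum]
    exact Finset.sum_congr rfl fun z _ => by ring
  have h2 : ∀ z : ℂ, z * (starRingEnd ℂ) z = ((‖z‖ ^ 2 : ℝ) : ℂ) := fun z => by
    rw [Complex.mul_conj, Complex.normSq_eq_norm_sq]
  simp_rw [h2] at key
  have key' : ∑ x : Λ.Disc, ‖∑ y : Λ.Disc, e (-Λ.bbar x y) * v y‖ ^ 2 =
      Fintype.card Λ.Disc * ∑ x : Λ.Disc, ‖v x‖ ^ 2 := by exact_mod_cast key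
  rw [normSq, normSq]
  simp_rw [weilS_apply, norm_mul, mul_pow, norm_weilConst_sq]
  rw [← Finset.mul_sum, key', ← mul_assoc, inv_mul_cancel₀, one_mul]
  exact_mod_cast Fintype.card_ne_zero

open Matrix.SpecialLinearGroup in
theorem mapGL_apply (γ : SL(2, ℤ)) (i j : Fin 2) : (mapGL ℝ γ) i j = (γ i j : ℝ) := by simp

open Matrix.SpecialLinearGroup in
theorem T_M : Mp.T.M = mapGL ℝ ModularGroup.T := by
  ext i j
  rw [mapGL_apply]
  fin_cases i <;> fin_cases j <;> simp [Mp.T, ModularGroup.T, Matrix.GeneralLinearGroup.mkOfDetNeZero]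

open Matrix.SpecialLinearGroup in
theorem S_M : Mp.S.M = mapGL ℝ ModularGroup.S := by
  ext i j
  rw [mapGL_apply]
  fin_cases i <;> fin_cases j <;> simp [Mp.S, ModularGroup.S, Matrix.GeneralLinearGroup.mkOfDetNeZero]

theorem det_mul_sub (γ : SL(2, ℤ)) : γ 0 0 * γ 1 1 - γ 0 1 * γ 1 0 = 1 := by
  rw [← Matrix.det_fin_two]; exact γ.det_coe

open Matrix.SpecialLinearGroup in
theorem coe_mapGL_smul (γ : SL(2, ℤ)) (τ : ℍ) : ((mapGL ℝ γ • τ : ℍ) : ℂ) =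
    ((γ 0 0 : ℂ) * τ + γ 0 1) / ((γ 1 0 : ℂ) * τ + γ 1 1) := by
  have hdet : 0 < (mapGL ℝ γ).det.val := by simp
  rw [UpperHalfPlane.coe_smul_of_det_pos hdet, UpperHalfPlane.num, UpperHalfPlane.denom]
  simp

open Matrix.SpecialLinearGroup in
theorem denom_mapGL (γ : SL(2, ℤ)) (τ : ℍ) : UpperHalfPlane.denom (mapGL ℝ γ) τ =
    (γ 1 0 : ℂ) * τ + γ 1 1 := by
  rw [UpperHalfPlane.denom]; simp

open Matrix.SpecialLinearGroup in
theorem exists_lift (γ : SL(2, ℤ)) : ∃ x ∈ weilGroup Λ, x.1.M = mapGL ℝ γ := by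
  have h : γ ∈ Subgroup.closure {ModularGroup.S, ModularGroup.T} := by
    rw [SpecialLinearGroup.SL2Z_generators]; trivial
  induction h using Subgroup.closure_induction with
  | mem x hx =>
    rcases hx with rfl | rfl
    · exact ⟨genS Λ, genS_mem, S_M⟩
    · exact ⟨genT Λ, genT_mem, T_M⟩
  | one => exact ⟨1, one_mem _, by simp⟩
  | mul x y _ _ hx hy =>
    obtain ⟨a, ha, ha'⟩ := hx
    obtain ⟨b, hb, hb'⟩ := hy
    exact ⟨a * b, mul_mem ha hb, by rw [Prod.fst_mul, Mp.mul_M, ha', hb', map_mul]⟩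
  | inv x _ hx =>
    obtain ⟨a, ha, ha'⟩ := hx
    exact ⟨a⁻¹, inv_mem ha, by rw [Prod.fst_inv, Mp.inv_M, ha', map_inv]⟩

section Action

variable {k : ℕ}

/-- The action of `SL₂(ℤ)` on theta characteristics, first component. -/
def uAct (γ : SL(2, ℤ)) (u w : Fin k → ℝ) : Fin k → ℝ := fun i => -(γ 1 0) * w i + γ 1 1 * u i

/-- The action of `SL₂(ℤ)` on theta characteristics, second component. -/
def wAct (γ : SL(2, ℤ)) (u w : Fin k → ℝ) : Fin k → ℝ := fun i => γ 0 0 * w i - γ 0 1 * u i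

theorem uAct_mul (γ γ' : SL(2, ℤ)) (u w : Fin k → ℝ) :
    uAct (γ * γ') u w = uAct γ (uAct γ' u w) (wAct γ' u w) := by
  funext i
  simp only [uAct, wAct, Matrix.SpecialLinearGroup.coe_mul, Matrix.mul_apply, Fin.sum_univ_two]
  push_cast; ring

theorem wAct_mul (γ γ' : SL(2, ℤ)) (u w : Fin k → ℝ) :
    wAct (γ * γ') u w = wAct γ (uAct γ' u w) (wAct γ' u w) := by
  funext i
  simp only [uAct, wAct, Matrix.SpecialLinearGroup.coe_mul, Matrix.mul_apply, Fin.sum_univ_two]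
  push_cast; ring

theorem uAct_one (u w : Fin k → ℝ) : uAct 1 u w = u := by funext i; simp [uAct]

theorem wAct_one (u w : Fin k → ℝ) : wAct 1 u w = w := by funext i; simp [wAct]

end Action

open Matrix.SpecialLinearGroup in
/-- The transformation law of the theta function under `Mp₂(ℤ)`. -/
theorem exists_theta_transform (D : Λ.Diag) {x : Ext Λ} (hx : x ∈ weilGroup Λ) :
    ∃ γ : SL(2, ℤ), x.1.M = mapGL ℝ γ ∧ (∀ v, normSq (x.2 v) = normSq v) ∧ ∀ (τ : ℍ) u w,
      D.Theta (uAct γ u w) (wAct γ u w) ((x.1.M • τ : ℍ) : ℂ) =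
        D.jf (x.1.φ τ) • x.2 (D.Theta u w τ) := by
  induction hx using Subgroup.closure_induction with
  | mem x hx =>
    rcases hx with ⟨h1, h2⟩ | ⟨h1, h2⟩
    · refine ⟨ModularGroup.T, by rw [h1, T_M], fun v => ?_, fun τ u w => ?_⟩
      · rw [← normSq_weilT v, ← h2]; rfl
      · have e1 : (x.2 (D.Theta u w τ)) = weilT Λ (D.Theta u w τ) := by rw [← h2]; rfl
        rw [e1, ← D.Theta_T, h1, T_M, coe_mapGL_smul]
        have e2 : uAct ModularGroup.T u w = u := by funext i; simp [uAct, ModularGroup.T]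
        have e3 : wAct ModularGroup.T u w = w - u := by funext i; simp [wAct, ModularGroup.T]
        rw [e2, e3]
        simp [ModularGroup.T, Mp.T]
    · refine ⟨ModularGroup.S, by rw [h1, S_M], fun v => ?_, fun τ u w => ?_⟩
      · rw [← normSq_weilS v, ← h2]; rfl
      · have e1 : (x.2 (D.Theta u w τ)) = weilS Λ (D.Theta u w τ) := by rw [← h2]; rfl
        have e4 : x.1.φ τ = (τ : ℂ) ^ (1 / 2 : ℂ) := by rw [h1]; rfl
        rw [e1, e4, ← D.Theta_S _ _ τ.im_pos, h1, S_M, coe_mapGL_smul]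
        have e2 : uAct ModularGroup.S u w = -w := by funext i; simp [uAct, ModularGroup.S]
        have e3 : wAct ModularGroup.S u w = u := by funext i; simp [wAct, ModularGroup.S]
        rw [e2, e3]
        simp [ModularGroup.S]
  | one =>
    refine ⟨1, by simp, fun v => rfl, fun τ u w => ?_⟩
    rw [uAct_one, wAct_one]
    simp
  | mul x y _ _ hx hy =>
    obtain ⟨γ, h1, h2, h3⟩ := hx
    obtain ⟨γ', h1', h2', h3'⟩ := hy
    refine ⟨γ * γ', by simp [h1, h1'], fun v => ?_, fun τ u w => ?_⟩
    · exact (h2 _).trans (h2' v)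
    · rw [uAct_mul, wAct_mul, Prod.fst_mul, Mp.mul_M, Mp.mul_φ, mul_smul, h3, h3', D.jf_mul,
        map_smul, smul_smul]
      rfl
  | inv x _ hx =>
    obtain ⟨γ, h1, h2, h3⟩ := hx
    refine ⟨γ⁻¹, by simp [h1], fun v => ?_, fun τ u w => ?_⟩
    · have := h2 (x⁻¹.2 v)
      rw [← this]
      congr 1
      exact x.2.apply_symm_apply v
    · have := h3 (x.1.M⁻¹ • τ) (uAct γ⁻¹ u w) (wAct γ⁻¹ u w)
      rw [← uAct_mul, ← wAct_mul, mul_inv_cancel, uAct_one, wAct_one, smul_inv_smul] at this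
      rw [Prod.fst_inv, Mp.inv_M, Mp.inv_φ, D.jf_inv, this, map_smul, smul_smul,
        inv_mul_cancel₀ (D.jf_ne_zero (x.1.φ_ne_zero _)), one_smul]
      exact (x.2.symm_apply_apply _).symm

open Matrix.SpecialLinearGroup in
theorem exists_eq_mapGL {x : Ext Λ} (hx : x ∈ weilGroup Λ) : ∃ γ : SL(2, ℤ), x.1.M = mapGL ℝ γ := by
  obtain ⟨D⟩ := Λ.nonempty_diag
  obtain ⟨γ, h, _⟩ := exists_theta_transform D hx
  exact ⟨γ, h⟩

theorem normSq_of_mem {x : Ext Λ} (hx : x ∈ weilGroup Λ) (v : GrpAlg Λ) :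
    normSq (x.2 v) = normSq v := by
  obtain ⟨D⟩ := Λ.nonempty_diag
  obtain ⟨γ, _, h, _⟩ := exists_theta_transform D hx
  exact h v

open Matrix.SpecialLinearGroup in
theorem theta_transform (D : Λ.Diag) {x : Ext Λ} (hx : x ∈ weilGroup Λ) {γ : SL(2, ℤ)}
    (hγ : x.1.M = mapGL ℝ γ) (τ : ℍ) (u w) :
    D.Theta (uAct γ u w) (wAct γ u w) ((x.1.M • τ : ℍ) : ℂ) =
      D.jf (x.1.φ τ) • x.2 (D.Theta u w τ) := by
  obtain ⟨γ', h, _, h'⟩ := exists_theta_transform D hx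
  have : γ' = γ := (mapGL_inj (S := ℝ) _ _).mp (h.symm.trans hγ)
  rw [← this]
  exact h' τ u w

end VVMF
end

noncomputable section
namespace VVMF

/-! ### Theta functions as sums over the quadratic space -/

open Complex Filter Topology

theorem summable_tsum_prod_pi {N : ℕ} {f : Fin N → ℤ → ℂ} (hf : ∀ i, Summable fun a => ‖f i a‖) :
    (Summable fun z : Fin N → ℤ => ‖∏ i, f i (z i)‖) ∧
      ∑' z : Fin N → ℤ, ∏ i, f i (z i) = ∏ i, ∑' a, f i a := by
  induction N with
  | zero => exact ⟨Summable.of_finite, by simp⟩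
  | succ N ih =>
    obtain ⟨h1, h2⟩ := ih fun i => hf i.succ
    let E : ℤ × (Fin N → ℤ) ≃ (Fin (N + 1) → ℤ) := Fin.consEquiv fun _ => ℤ
    have hE : ∀ x : ℤ × (Fin N → ℤ), ∏ i, f i (E x i) = f 0 x.1 * ∏ i : Fin N, f i.succ (x.2 i) := by
      intro x
      rw [Fin.prod_univ_succ]
      simp [E, Fin.consEquiv]
    constructor
    · rw [← E.summable_iff]
      refine ((hf 0).mul_of_nonneg h1 (fun _ => norm_nonneg _) fun _ => norm_nonneg _).congr
        fun x => ?_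
      simp only [Function.comp, hE, norm_mul]
    · rw [← E.tsum_eq, Fin.prod_univ_succ, ← h2, tsum_mul_tsum_of_summable_norm (hf 0) h1]
      exact tsum_congr hE

namespace EvenLattice.Diag

variable {V : Type*} [AddCommGroup V] [Module ℚ V] {Λ : EvenLattice V} (D : Λ.Diag)

local notation "n" => Module.finrank ℚ V

/-- The real coordinates of a vector. -/
def co (v : V) : Fin n → ℝ := fun i => (D.b.repr v i : ℝ)

theorem co_add (v w : V) : D.co (v + w) = D.co v + D.co w := by funext i; simp [co]

theorem co_neg (v : V) : D.co (-v) = -D.co v := by funext i; simp [co]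

@[simp] theorem co_zero : D.co 0 = 0 := by funext i; simp [co]

theorem co_nsmul (c : ℕ) (v : V) : D.co (c • v) = (c : ℝ) • D.co v := by funext i; simp [co]

theorem co_zsmul (c : ℤ) (v : V) : D.co (c • v) = (c : ℝ) • D.co v := by funext i; simp [co]

/-- The bilinear form on real coordinate vectors. -/
def bil (u w : Fin n → ℝ) : ℝ := ∑ i, 2 * (D.m i : ℝ) * (u i * w i)

theorem bil_co (v w : V) : D.bil (D.co v) (D.co w) = (QuadraticMap.polar Λ.q v w : ℚ) := by
  rw [D.polar_eq, bil]; push_cast; rfl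

/-- The term of the theta series at the vector `v`. -/
def tm (u w : Fin n → ℝ) (τ : ℂ) (v : V) : ℂ :=
  ∏ i, sc (D.m i) (thTerm (D.m i).natAbs (D.co v i) (u i) (w i) τ 0)

theorem tm_add_right (u w w' : Fin n → ℝ) (τ : ℂ) (v : V) :
    D.tm u (w + w') τ v = ee (D.bil (D.co v + (1 / 2 : ℝ) • u) w' : ℝ) * D.tm u w τ v := by
  rw [bil, Complex.ofReal_sum, ee_sum, tm, tm, ← Finset.prod_mul_distrib]
  refine Finset.prod_congr rfl fun i _ => ?_
  have e1 : (2 * (D.m i : ℝ) * ((D.co v + (1 / 2 : ℝ) • u) i * w' i)) =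
      (D.m i : ℝ) * (2 * (D.co v i + u i / 2) * w' i) := by
    simp only [Pi.add_apply, Pi.smul_apply, smul_eq_mul]; ring
  rw [e1, ← sc_ee_natAbs (D.m_ne i), ← map_mul]
  congr 1
  rw [thTerm, thTerm, ← ee_add]
  congr 1
  simp only [Pi.add_apply]
  push_cast; ring

theorem tm_add_left (u w : Fin n → ℝ) (τ : ℂ) (s v : V) :
    D.tm (u + D.co s) w τ v = ee (-(D.bil (D.co s) w / 2) : ℝ) * D.tm u w τ (v + s) := by
  have e0 : -(D.bil (D.co s) w / 2) = ∑ i, (D.m i : ℝ) * -(D.co s i * w i) := by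
    rw [bil, Finset.sum_div, ← Finset.sum_neg_distrib]
    exact Finset.sum_congr rfl fun i _ => by ring
  rw [e0, Complex.ofReal_sum, ee_sum, tm, tm, ← Finset.prod_mul_distrib]
  refine Finset.prod_congr rfl fun i _ => ?_
  rw [← sc_ee_natAbs (D.m_ne i), ← map_mul]
  congr 1
  rw [thTerm, thTerm, ← ee_add, co_add]
  congr 1
  simp only [Pi.add_apply]
  push_cast; ring

theorem tm_smul {P : ℝ} (hP : P ≠ 0) (u w : Fin n → ℝ) (τ : ℂ) {v v' : V}
    (h : D.co v' = P • D.co v) :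
    D.tm (P⁻¹ • u) (P • w) (P ^ 2 * τ) v = D.tm u w τ v' := by
  rw [tm, tm]
  refine Finset.prod_congr rfl fun i _ => ?_
  have hi := congrFun h i
  simp only [Pi.smul_apply, smul_eq_mul] at hi
  rw [thTerm, thTerm, hi]
  congr 2
  have : (P : ℂ) ≠ 0 := by exact_mod_cast hP
  simp only [Pi.smul_apply, smul_eq_mul]
  push_cast
  field_simp
  ring

theorem tm_translate (u w : Fin n → ℝ) (τ : ℂ) (r : ℚ) (v : V) :
    D.tm u (w - (r : ℝ) • u) (τ + r) v = ee ((r * Λ.q v : ℚ) : ℝ) * D.tm u w τ v := by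
  have e0 : ((r * Λ.q v : ℚ) : ℝ) = ∑ i, (D.m i : ℝ) * (r * D.co v i ^ 2) := by
    rw [D.q_eq]
    push_cast
    rw [Finset.mul_sum]
    exact Finset.sum_congr rfl fun i _ => by rw [co]; ring
  rw [e0, Complex.ofReal_sum, ee_sum, tm, tm, ← Finset.prod_mul_distrib]
  refine Finset.prod_congr rfl fun i _ => ?_
  rw [← sc_ee_natAbs (D.m_ne i), ← map_mul]
  congr 1
  rw [thTerm, thTerm, ← ee_add]
  congr 1
  simp only [Pi.sub_apply, Pi.smul_apply, smul_eq_mul]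
  push_cast; ring

/-- Coordinates in the dual of `⊕ ℤ b_i`, split into residue and quotient. -/
def ptDiv (x : (∀ i, Fin (D.d i)) × (Fin n → ℤ)) : V :=
  D.pt fun i => ((x.1 i : ℕ) : ℤ) + D.d i * x.2 i

theorem ptDiv_injective : Function.Injective D.ptDiv := by
  rintro ⟨k, l⟩ ⟨k', l'⟩ h
  have h1 : ∀ i, ((k i : ℕ) : ℤ) + D.d i * l i = ((k' i : ℕ) : ℤ) + D.d i * l' i := by
    intro i
    have h2 := congrArg (fun v => D.b.repr v i) h
    simp only [ptDiv, repr_pt] at h2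
    have hd : (D.d i : ℚ) ≠ 0 := by exact_mod_cast (D.d_pos i).ne'
    rw [div_left_inj' hd] at h2
    exact_mod_cast h2
  have h3 : k = k' := toInt_inj k k' fun i => by
    have h4 := congrArg (· % (D.d i : ℤ)) (h1 i)
    simpa [Int.add_mul_emod_self_left, toInt, Int.ModEq] using h4
  refine Prod.ext h3 (funext fun i => ?_)
  have h5 := h1 i
  rw [h3] at h5
  have hd : (D.d i : ℤ) ≠ 0 := by exact_mod_cast (D.d_pos i).ne'
  exact mul_left_cancel₀ hd (add_left_cancel h5)

theorem mem_range_ptDiv {v : V} (hv : v ∈ Λ.dual) : v ∈ Set.range D.ptDiv := by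
  obtain ⟨z, rfl⟩ := D.exists_pt hv
  obtain ⟨k, hk⟩ := exists_toInt D.d_pos z
  choose c hc using fun i => (hk i).dvd
  refine ⟨(k, c), ?_⟩
  rw [ptDiv]
  congr 1
  funext i
  have := hc i
  simp only [toInt] at this ⊢
  omega

theorem ptDiv_cls (x : (∀ i, Fin (D.d i)) × (Fin n → ℤ)) (y : Λ.Disc) :
    Λ.Cls (D.ptDiv x) y ↔ Λ.Cls (D.pt (toInt x.1)) y := by
  obtain ⟨l, hl, h⟩ := D.exists_pt_eq_add 1
    (z := fun i => ((x.1 i : ℕ) : ℤ) + D.d i * x.2 i) (z' := toInt x.1) (fun i => by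
      rw [mul_one]; simp [Int.ModEq, toInt])
  rw [ptDiv, h, Nat.cast_one, one_smul]
  exact cls_add_mem_iff hl

theorem tm_ptDiv (u w : Fin n → ℝ) (τ : ℂ) (x : (∀ i, Fin (D.d i)) × (Fin n → ℤ)) :
    D.tm u w τ (D.ptDiv x) =
      ∏ i, sc (D.m i) (thTerm (D.m i).natAbs ((toInt x.1 i : ℝ) / D.d i) (u i) (w i) τ (x.2 i)) := by
  rw [tm]
  refine Finset.prod_congr rfl fun i _ => ?_
  have hd : (D.d i : ℝ) ≠ 0 := by exact_mod_cast (D.d_pos i).ne'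
  have h : D.co (D.ptDiv x) i = x.2 i + (toInt x.1 i : ℝ) / D.d i := by
    rw [co, ptDiv, repr_pt]; push_cast [toInt]; field_simp; ring
  rw [h, thTerm, thTerm]
  push_cast
  congr 2; ring

theorem summable_norm_thTerm_sc (u w : Fin n → ℝ) {τ : ℂ} (hτ : 0 < τ.im) (z : Fin n → ℤ)
    (i : Fin n) : Summable fun a => ‖sc (D.m i)
      (thTerm (D.m i).natAbs ((z i : ℝ) / D.d i) (u i) (w i) τ a)‖ := by
  simp_rw [norm_sc]
  exact (summable_thTerm (D.natAbs_pos i) _ _ _ hτ).norm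

theorem tsum_sc (m : ℤ) (g : ℤ → ℂ) : ∑' a, sc m (g a) = sc m (∑' a, g a) := by
  unfold sc
  split_ifs
  · rfl
  · exact (Complex.conj_tsum (fun a => g a)).symm

open Classical in
theorem summable_tm (u w : Fin n → ℝ) {τ : ℂ} (hτ : 0 < τ.im) {G : V → ℂ} {C : ℝ}
    (hG : ∀ v, ‖G v‖ ≤ C) (hG' : ∀ v, v ∉ Λ.dual → G v = 0) :
    Summable fun v => G v * D.tm u w τ v := by
  have hs : Function.support (fun v => G v * D.tm u w τ v) ⊆ Set.range D.ptDiv := by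
    intro v hv
    by_contra hcon
    refine hv ?_
    simp only
    rw [hG' v fun h => hcon (D.mem_range_ptDiv h), zero_mul]
  rw [← D.ptDiv_injective.summable_iff fun v hv => by_contra fun h => hv (hs h)]
  refine Summable.of_norm_bounded (g := fun x => C * ‖D.tm u w τ (D.ptDiv x)‖) ?_ fun x => ?_
  · refine Summable.mul_left _ ?_
    rw [summable_prod_of_nonneg fun x => norm_nonneg _]
    refine ⟨fun k => ?_, Summable.of_finite⟩
    refine (summable_tsum_prod_pi (D.summable_norm_thTerm_sc u w hτ (toInt k))).1.congr fun l => ?_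
    rw [D.tm_ptDiv]
  · rw [Function.comp, norm_mul]
    exact mul_le_mul_of_nonneg_right (hG _) (norm_nonneg _)

open Classical in
-- Indexing by all of V, with the class condition as a weight, turns scaling v ↦ Pv and translation
-- by lattice vectors into reindexings by bijections of V.
theorem Theta_eq_tsum (u w : Fin n → ℝ) {τ : ℂ} (hτ : 0 < τ.im) (y : Λ.Disc) :
    D.Theta u w τ y = ∑' v, (if Λ.Cls v y then 1 else 0) * D.tm u w τ v := by
  have hG : ∀ v, v ∉ Λ.dual → (if Λ.Cls v y then 1 else 0 : ℂ) = 0 :=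
    fun v hv => if_neg fun h => hv h.mem
  have hs := D.summable_tm u w hτ (G := fun v => if Λ.Cls v y then 1 else 0) (C := 1)
    (fun v => by split_ifs <;> simp) hG
  have hsup : Function.support (fun v => (if Λ.Cls v y then 1 else 0) * D.tm u w τ v) ⊆
      Set.range D.ptDiv := by
    intro v hv
    by_contra hcon
    refine hv ?_
    simp only
    rw [hG v fun h => hcon (D.mem_range_ptDiv h), zero_mul]
  have hs' := D.ptDiv_injective.summable_iff (fun v hv => by_contra fun h => hv (hsup h)) |>.mpr hs
  rw [← D.ptDiv_injective.tsum_eq hsup]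
  refine Eq.trans ?_ (Summable.tsum_prod hs').symm
  rw [tsum_fintype, Theta]
  refine Finset.sum_congr rfl fun k _ => ?_
  simp only [Function.comp, D.ptDiv_cls, tsum_mul_left, D.tm_ptDiv]
  split_ifs
  · rw [one_mul, (summable_tsum_prod_pi (D.summable_norm_thTerm_sc u w hτ (toInt k))).2, theta0]
    refine Finset.prod_congr rfl fun i _ => ?_
    rw [tsum_sc]; rfl
  · simp

open Classical in
-- With characteristic u = -x the exponential decay is governed by v - x, so only the vector v = x
-- survives at i∞; it contributes to its own class alone.
theorem tendsto_Theta (x : V) (hx : x ∈ Λ.dual) (w : Fin n → ℝ) (σ : ℝ) (y : Λ.Disc) :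
    Tendsto (fun T : ℝ => D.Theta (-D.co x) w (σ + I * T) y) atTop
      (𝓝 (if Λ.Cls x y then ee (D.bil (D.co x) w / 2 : ℝ) else 0)) := by
  obtain ⟨z, rfl⟩ := D.exists_pt hx
  have h1 : Tendsto (fun T : ℝ => D.Theta (-D.co (D.pt z)) w (σ + I * T) y) atTop
      (𝓝 (∑ k : ∀ i, Fin (D.d i), if Λ.Cls (D.pt (toInt k)) y then ∏ i, sc (D.m i)
        (∑' a : ℤ, if (a + (toInt k i : ℝ) / D.d i + (-D.co (D.pt z)) i : ℝ) = 0 then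
          ee (-((D.m i).natAbs * ((-D.co (D.pt z)) i : ℝ) * w i)) else 0) else 0)) := by
    refine tendsto_finsetSum _ fun k _ => ?_
    split_ifs
    · exact tendsto_finsetProd _ fun i _ => ((continuous_sc _).tendsto _).comp
        (tendsto_th_im_atTop (D.natAbs_pos i) _ _ _ _)
    · exact tendsto_const_nhds
  convert h1 using 2
  have key : ∀ (k : ∀ i, Fin (D.d i)) i (a : ℤ),
      (a + (toInt k i : ℝ) / D.d i + (-D.co (D.pt z)) i : ℝ) = 0 ↔ z i = toInt k i + D.d i * a := by
    intro k i a
    have hd : (D.d i : ℝ) ≠ 0 := by exact_mod_cast (D.d_pos i).ne'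
    rw [Pi.neg_apply, co, repr_pt]
    push_cast
    field_simp
    constructor
    · intro h
      have : ((z i : ℤ) : ℝ) = ((toInt k i + D.d i * a : ℤ) : ℝ) := by push_cast; linarith
      exact_mod_cast this
    · intro h
      rw [h]; push_cast; ring
  simp only [key]
  obtain ⟨k₀, hk₀⟩ := exists_toInt D.d_pos z
  choose c hc using fun i => (hk₀ i).dvd
  have hz : ∀ i, z i = toInt k₀ i + D.d i * c i := fun i => by have := hc i; omega
  rw [Finset.sum_eq_single k₀]
  · have hcl : Λ.Cls (D.pt (toInt k₀)) y ↔ Λ.Cls (D.pt z) y := by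
      rw [← D.ptDiv_cls (k₀, c), ptDiv]
      have : (fun i => (((k₀ i : ℕ) : ℤ) + D.d i * c i)) = z := funext fun i => (hz i).symm
      simp only [this]
    rw [hcl]
    split_ifs
    · rw [bil, Finset.sum_div, Complex.ofReal_sum, ee_sum]
      refine Finset.prod_congr rfl fun i _ => ?_
      have hd : (D.d i : ℤ) ≠ 0 := by exact_mod_cast (D.d_pos i).ne'
      rw [tsum_eq_single (c i), if_pos (hz i)]
      · have e1 : (2 * (D.m i : ℝ) * (D.co (D.pt z) i * w i) / 2) =
            (D.m i : ℝ) * (D.co (D.pt z) i * w i) := by ring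
        rw [e1, ← sc_ee_natAbs (D.m_ne i)]
        congr 2
        simp only [Pi.neg_apply]
        push_cast; ring
      · intro a ha
        rw [if_neg]
        intro h
        rw [hz i] at h
        exact ha (mul_left_cancel₀ hd (add_left_cancel h)).symm
    · rfl
  · intro k _ hk
    split_ifs
    · obtain ⟨i, hi⟩ : ∃ i, ¬ toInt k i ≡ z i [ZMOD D.d i] := by
        by_contra hcon
        push Not at hcon
        exact hk (toInt_inj _ _ fun i => (hcon i).trans (hk₀ i).symm)
      refine Finset.prod_eq_zero (Finset.mem_univ i) ?_
      have : ∀ a : ℤ, ¬ z i = toInt k i + D.d i * a := by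
        intro a h
        apply hi
        rw [h]; simp [Int.ModEq]
      simp [this]
    · rfl
  · simp

/-- The theta values with characteristic -v tend to the basis vector of the class of v. Linear maps
on a finite-dimensional space are continuous, so agreement on theta values passes to the basis. -/
theorem linearMap_ext_Theta [FiniteDimensional ℚ V] {W : Type*} [AddCommGroup W] [Module ℂ W]
    [TopologicalSpace W] [IsTopologicalAddGroup W] [ContinuousSMul ℂ W] [T2Space W]
    {f g : GrpAlg Λ →ₗ[ℂ] W} (h : ∀ u w (τ : ℍ), f (D.Theta u w τ) = g (D.Theta u w τ)) :
    f = g := by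
  classical
  refine LinearMap.pi_ext' fun x => LinearMap.ext_ring ?_
  obtain ⟨v, hv⟩ := exists_cls x
  have hlim : Tendsto (fun T : ℝ => D.Theta (-D.co v) 0 ((0 : ℝ) + I * T)) atTop
      (𝓝 (Pi.single x 1)) := by
    rw [tendsto_pi_nhds]
    intro y
    convert D.tendsto_Theta v hv.mem 0 0 y using 2
    rw [Pi.single_apply]
    by_cases hy : y = x
    · subst hy
      rw [if_pos rfl, if_pos hv]
      simp [bil]
    · rw [if_neg hy, if_neg fun h => hy (h.unique hv)]
  have h1 := (f.continuous_of_finiteDimensional.tendsto _).comp hlim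
  have h2 := (g.continuous_of_finiteDimensional.tendsto _).comp hlim
  refine tendsto_nhds_unique h1 (h2.congr' ?_)
  filter_upwards [eventually_gt_atTop 0] with T hT
  exact (h _ _ ⟨(0 : ℝ) + I * T, by simpa using hT⟩).symm

end EvenLattice.Diag

end VVMF
end

noncomputable section
namespace VVMF

/-! ### Theta functions and multiplication by an integer -/

open Complex Filter Topology

/-- `exp(2πi r)` for rational `r`. -/
def eQ (r : ℚ) : ℂ := ee ((r : ℝ) : ℂ)

theorem eQ_add (r s : ℚ) : eQ (r + s) = eQ r * eQ s := by
  rw [eQ, eQ, eQ, ← ee_add]; push_cast; rfl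

@[simp] theorem eQ_zero : eQ 0 = 1 := by simp [eQ, ee_zero]

theorem eQ_eq_one {r : ℚ} (h : ∃ c : ℤ, r = c) : eQ r = 1 := by
  obtain ⟨c, rfl⟩ := h
  exact ee_eq_one_of_int ⟨c, by push_cast; rfl⟩

theorem eQ_congr {r s : ℚ} (h : ∃ c : ℤ, r = s + c) : eQ r = eQ s := by
  obtain ⟨c, rfl⟩ := h
  rw [eQ_add, eQ_eq_one ⟨c, rfl⟩, mul_one]

theorem norm_eQ (r : ℚ) : ‖eQ r‖ = 1 := norm_ee_real _

theorem eQ_eq_one_iff {r : ℚ} : eQ r = 1 ↔ ∃ c : ℤ, r = c := by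
  refine ⟨fun h => ?_, eQ_eq_one⟩
  rw [eQ, ee, Complex.exp_eq_one_iff] at h
  obtain ⟨c, hc⟩ := h
  refine ⟨c, ?_⟩
  have h5 : (2 * Real.pi * I : ℂ) ≠ 0 := Complex.two_pi_I_ne_zero
  have h6 : (((r : ℝ)) : ℂ) = c := by
    apply mul_left_cancel₀ h5; rw [hc]; ring
  exact_mod_cast h6

theorem eQ_nat_mul (k : ℕ) (r : ℚ) : eQ (k * r) = eQ r ^ k := by
  rw [eQ, eQ, ee, ee, ← Complex.exp_nat_mul]; congr 1; push_cast; ring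

theorem conj_eQ (r : ℚ) : (starRingEnd ℂ) (eQ r) = eQ (-r) := by
  rw [eQ, conj_ee, eQ]; simp

open Classical in
theorem sum_fin_eQ {P : ℕ} (hP : 0 < P) (a : ℤ) :
    ∑ k : Fin P, eQ ((k : ℕ) * (a / P : ℚ)) = if (P : ℤ) ∣ a then (P : ℂ) else 0 := by
  simp_rw [eQ_nat_mul]
  have hP0 : (P : ℚ) ≠ 0 := by exact_mod_cast hP.ne'
  have h : ∑ k : Fin P, eQ (a / P : ℚ) ^ (k : ℕ) = ∑ k ∈ Finset.range P, eQ (a / P : ℚ) ^ k :=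
    (Finset.sum_range _).symm
  rw [h]
  split_ifs with hd
  · obtain ⟨c, rfl⟩ := hd
    rw [eQ_eq_one ⟨c, by push_cast; field_simp⟩]; simp
  · rw [geom_sum_eq, ← eQ_nat_mul, eQ_eq_one ⟨a, by field_simp⟩]
    · simp
    · intro h1
      obtain ⟨c, hc⟩ := eQ_eq_one_iff.mp h1
      refine hd ⟨c, ?_⟩
      rw [div_eq_iff hP0] at hc
      have : a = c * P := by exact_mod_cast hc
      rw [this, mul_comm]

namespace EvenLattice

variable {V : Type*} [AddCommGroup V] [Module ℚ V] {Λ : EvenLattice V}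

local notation "n" => Module.finrank ℚ V

/-- The lattice vector with given residues as coordinates. -/
def resid (b : Module.Basis (Fin n) ℚ V) {P : ℕ} (s : Fin n → Fin P) : V :=
  ∑ i, ((s i : ℕ) : ℤ) • b i

/-- The Gauss sum `∑_{s ∈ L/PL} e(h q(s) / P)`. -/
def latticeGauss (Λ : EvenLattice V) (b : Module.Basis (Fin n) ℚ V) (P : ℕ) (h : ℤ) : ℂ :=
  ∑ s : Fin n → Fin P, eQ (h * Λ.q (resid b s) / P)

theorem basis_mem {b : Module.Basis (Fin n) ℚ V}
    (hb : Λ.L = Submodule.span ℤ (Set.range b)) (i : Fin n) : b i ∈ Λ.L := by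
  rw [hb]; exact Submodule.subset_span ⟨i, rfl⟩

theorem resid_mem {b : Module.Basis (Fin n) ℚ V}
    (hb : Λ.L = Submodule.span ℤ (Set.range b)) {P : ℕ} (s : Fin n → Fin P) : resid b s ∈ Λ.L :=
  Submodule.sum_mem _ fun i _ => Submodule.smul_mem _ _ (basis_mem hb i)

theorem mem_dual_iff_basis {b : Module.Basis (Fin n) ℚ V}
    (hb : Λ.L = Submodule.span ℤ (Set.range b)) {v : V} :
    v ∈ Λ.dual ↔ ∀ i, ∃ c : ℤ, QuadraticMap.polar Λ.q v (b i) = c := by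
  refine ⟨fun h i => polar_mem_int h (basis_mem hb i), fun h => mem_dual_iff.mpr fun w hw => ?_⟩
  rw [hb] at hw
  induction hw using Submodule.span_induction with
  | mem x hx => obtain ⟨i, rfl⟩ := hx; exact h i
  | zero => exact ⟨0, by simp⟩
  | add x y _ _ hx hy =>
    obtain ⟨c, hc⟩ := hx
    obtain ⟨c', hc'⟩ := hy
    exact ⟨c + c', by rw [QuadraticMap.polar_add_right, hc, hc']; push_cast; rfl⟩
  | smul a x _ hx =>
    obtain ⟨c, hc⟩ := hx
    refine ⟨a * c, ?_⟩
    rw [← Int.cast_smul_eq_zsmul ℚ, QuadraticMap.polar_smul_right, hc]; simp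

open Classical in
/-- Orthogonality of the characters of `L/PL`. -/
theorem sum_eQ_polar {b : Module.Basis (Fin n) ℚ V}
    (hb : Λ.L = Submodule.span ℤ (Set.range b)) {P : ℕ} (hP : 0 < P) {v : V} (hv : v ∈ Λ.dual) :
    ∑ s : Fin n → Fin P, eQ (QuadraticMap.polar Λ.q v (resid b s) / P) =
      if ∃ v' ∈ Λ.dual, v = P • v' then (P : ℂ) ^ n else 0 := by
  choose c hc using (mem_dual_iff_basis hb).mp hv
  have h1 : ∀ s : Fin n → Fin P, eQ (QuadraticMap.polar Λ.q v (resid b s) / P) =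
      ∏ i, eQ ((s i : ℕ) * (c i / P : ℚ)) := by
    intro s
    have h2 : QuadraticMap.polar Λ.q v (resid b s) / P = ∑ i, ((s i : ℕ) * (c i / P : ℚ)) := by
      have := map_sum (QuadraticMap.polarBilin Λ.q v) (fun i => ((s i : ℕ) : ℤ) • b i) Finset.univ
      rw [QuadraticMap.polarBilin_apply_apply] at this
      rw [resid, this, Finset.sum_div]
      refine Finset.sum_congr rfl fun i _ => ?_
      rw [map_zsmul, QuadraticMap.polarBilin_apply_apply, hc]
      simp; ring
    rw [h2, eQ, Rat.cast_sum, Complex.ofReal_sum, ee_sum]; rfl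
  simp_rw [h1]
  have h2 := (Finset.prod_univ_sum (fun _ : Fin n => (Finset.univ : Finset (Fin P)))
    (fun i k => eQ ((k : ℕ) * (c i / P : ℚ)))).symm
  rw [Fintype.piFinset_univ] at h2
  rw [h2]
  simp_rw [sum_fin_eQ hP]
  have hP0 : (P : ℚ) ≠ 0 := by exact_mod_cast hP.ne'
  by_cases hall : ∀ i, (P : ℤ) ∣ c i
  · rw [if_pos, Finset.prod_congr rfl fun i _ => if_pos (hall i)]
    · simp
    · refine ⟨(P : ℚ)⁻¹ • v, (mem_dual_iff_basis hb).mpr fun i => ?_, ?_⟩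
      · obtain ⟨k, hk⟩ := hall i
        refine ⟨k, ?_⟩
        rw [QuadraticMap.polar_smul_left, hc, hk]; push_cast; simp [hP0]
      · rw [← Nat.cast_smul_eq_nsmul ℚ, smul_smul, mul_inv_cancel₀ hP0, one_smul]
  · rw [if_neg]
    · push Not at hall
      obtain ⟨i, hi⟩ := hall
      exact Finset.prod_eq_zero (Finset.mem_univ i) (if_neg hi)
    · rintro ⟨v', hv', rfl⟩
      refine hall fun i => ?_
      obtain ⟨k, hk⟩ := (mem_dual_iff_basis hb).mp hv' i
      refine ⟨k, ?_⟩
      have h3 := hc i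
      rw [← Nat.cast_smul_eq_nsmul ℚ, QuadraticMap.polar_smul_left, hk] at h3
      have : (c i : ℚ) = ((P * k : ℤ) : ℚ) := by rw [← h3]; simp
      exact_mod_cast this

theorem exists_sum_smul {b : Module.Basis (Fin n) ℚ V}
    (hb : Λ.L = Submodule.span ℤ (Set.range b)) {l : V} (hl : l ∈ Λ.L) :
    ∃ z : Fin n → ℤ, l = ∑ i, z i • b i := by
  rw [hb] at hl
  obtain ⟨z, hz⟩ := (Submodule.mem_span_range_iff_exists_fun ℤ).mp hl
  exact ⟨z, hz.symm⟩

theorem sum_smul_congr {b : Module.Basis (Fin n) ℚ V}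
    (hb : Λ.L = Submodule.span ℤ (Set.range b)) {P : ℕ} {z z' : Fin n → ℤ} (h : ∀ i, z i ≡ z' i [ZMOD P]) :
    ∃ l ∈ Λ.L, ∑ i, z i • b i = ∑ i, z' i • b i + (P : ℤ) • l := by
  choose c hc using fun i => (h i).symm.dvd
  refine ⟨∑ i, c i • b i, Submodule.sum_mem _ fun i _ => Submodule.smul_mem _ _ (basis_mem hb i), ?_⟩
  rw [Finset.smul_sum, ← Finset.sum_add_distrib]
  refine Finset.sum_congr rfl fun i _ => ?_
  have : z i = z' i + P * c i := by have := hc i; omega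
  rw [this, add_smul, mul_smul]

/-- Sums over `L/PL` are translation invariant. -/
theorem sum_resid_add {b : Module.Basis (Fin n) ℚ V}
    (hb : Λ.L = Submodule.span ℤ (Set.range b)) {P : ℕ} (hP : 0 < P) {F : V → ℂ}
    (hF : ∀ v ∈ Λ.L, ∀ l ∈ Λ.L, F (v + (P : ℤ) • l) = F v) {l : V} (hl : l ∈ Λ.L) :
    ∑ s : Fin n → Fin P, F (resid b s + l) = ∑ s : Fin n → Fin P, F (resid b s) := by
  obtain ⟨z, rfl⟩ := exists_sum_smul hb hl
  have := sum_residues_add (D := fun _ : Fin n => P) (fun _ => hP)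
    (H := fun z => F (∑ i, z i • b i)) (fun z z' h => by
      obtain ⟨l, hl, h⟩ := sum_smul_congr hb h
      simp only [h]
      exact hF _ (Submodule.sum_mem _ fun i _ => Submodule.smul_mem _ _ (basis_mem hb i)) _ hl) z
  simpa only [Pi.add_apply, add_smul, Finset.sum_add_distrib, toInt, resid] using this

theorem q_add (v w : V) : Λ.q (v + w) = Λ.q v + Λ.q w + QuadraticMap.polar Λ.q v w := by
  rw [QuadraticMap.polar]; ring

theorem q_zsmul (k : ℤ) (v : V) : Λ.q (k • v) = k ^ 2 * Λ.q v := by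
  rw [← Int.cast_smul_eq_zsmul ℚ, QuadraticMap.map_smul]; simp [sq]

theorem polar_zsmul_left (k : ℤ) (v w : V) :
    QuadraticMap.polar Λ.q (k • v) w = k * QuadraticMap.polar Λ.q v w := by
  rw [← Int.cast_smul_eq_zsmul ℚ, QuadraticMap.polar_smul_left]; simp

theorem polar_zsmul_right (k : ℤ) (v w : V) :
    QuadraticMap.polar Λ.q v (k • w) = k * QuadraticMap.polar Λ.q v w := by
  rw [QuadraticMap.polar_comm, polar_zsmul_left, QuadraticMap.polar_comm]

namespace Diag

variable (D : Λ.Diag)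

theorem bil_add_left (u u' w : Fin n → ℝ) : D.bil (u + u') w = D.bil u w + D.bil u' w := by
  rw [bil, bil, bil, ← Finset.sum_add_distrib]
  exact Finset.sum_congr rfl fun i _ => by simp only [Pi.add_apply]; ring

theorem bil_smul_left (c : ℝ) (u w : Fin n → ℝ) : D.bil (c • u) w = c * D.bil u w := by
  rw [bil, bil, Finset.mul_sum]
  exact Finset.sum_congr rfl fun i _ => by simp only [Pi.smul_apply, smul_eq_mul]; ring

theorem bil_comm (u w : Fin n → ℝ) : D.bil u w = D.bil w u := by
  rw [bil, bil]; exact Finset.sum_congr rfl fun i _ => by ring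

theorem bil_add_right (u w w' : Fin n → ℝ) : D.bil u (w + w') = D.bil u w + D.bil u w' := by
  rw [bil_comm, bil_add_left, bil_comm, D.bil_comm w']

theorem bil_smul_right (c : ℝ) (u w : Fin n → ℝ) : D.bil u (c • w) = c * D.bil u w := by
  rw [bil_comm, bil_smul_left, bil_comm]

theorem bil_self (v : V) : D.bil (D.co v) (D.co v) = 2 * (Λ.q v : ℚ) := by
  rw [bil_co, QuadraticMap.polar_self]; simp

/-- The scaling automorphism `v ↦ P v` of `V`. -/
def scale (V : Type*) [AddCommGroup V] [Module ℚ V] {P : ℕ} (hP : 0 < P) : V ≃ V where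
  toFun v := P • v
  invFun v := (P : ℚ)⁻¹ • v
  left_inv v := by
    have hP0 : (P : ℚ) ≠ 0 := by exact_mod_cast hP.ne'
    simp only [← Nat.cast_smul_eq_nsmul ℚ]; rw [smul_smul, inv_mul_cancel₀ hP0, one_smul]
  right_inv v := by
    have hP0 : (P : ℚ) ≠ 0 := by exact_mod_cast hP.ne'
    simp only [← Nat.cast_smul_eq_nsmul ℚ]; rw [smul_smul, mul_inv_cancel₀ hP0, one_smul]

/-- The second condition says that v itself lies in L'; its class is then determined by P times it,
by injectivity of P on A. -/
theorem cls_iff_nsmul {P : ℕ} (hP : 0 < P) (hinj : Function.Injective fun y : Λ.Disc => P • y)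
    (v : V) (y : Λ.Disc) :
    Λ.Cls v y ↔ Λ.Cls (P • v) (P • y) ∧ ∃ v' ∈ Λ.dual, P • v = P • v' := by
  constructor
  · intro h; exact ⟨h.nsmul P, v, h.mem, rfl⟩
  · rintro ⟨h, v', hv', h'⟩
    have : v = v' := (scale V hP).injective h'
    subst this
    have h2 : Λ.Cls v (Submodule.Quotient.mk ⟨v, hv'⟩) := ⟨hv', rfl⟩
    have h3 := hinj ((h2.nsmul P).unique h)
    rwa [← h3]

open Classical in
theorem Theta_scale {P : ℕ} (hP : 0 < P) (hinj : Function.Injective fun y : Λ.Disc => P • y)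
    (u w : Fin n → ℝ) {τ : ℂ} (hτ : 0 < τ.im) (y : Λ.Disc) :
    D.Theta ((P : ℝ)⁻¹ • u) ((P : ℝ) • w) (P ^ 2 * τ) y =
      ∑' v, (if Λ.Cls v (P • y) ∧ ∃ v' ∈ Λ.dual, v = P • v' then 1 else 0) * D.tm u w τ v := by
  have hP0 : (P : ℝ) ≠ 0 := by exact_mod_cast hP.ne'
  have hτ' : 0 < ((P : ℂ) ^ 2 * τ).im := by
    have : ((P : ℂ) ^ 2 * τ) = ((P ^ 2 : ℝ) : ℂ) * τ := by push_cast; rfl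
    rw [this, Complex.im_ofReal_mul]; positivity
  rw [D.Theta_eq_tsum _ _ hτ']
  refine Eq.trans (tsum_congr fun v => ?_) ((scale V hP).tsum_eq fun v =>
    (if Λ.Cls v (P • y) ∧ ∃ v' ∈ Λ.dual, v = P • v' then 1 else 0) * D.tm u w τ v)
  have h1 := D.tm_smul hP0 u w τ (v := v) (v' := P • v) (D.co_nsmul P v)
  have h2 : ((P : ℝ) : ℂ) = (P : ℂ) := by simp
  rw [h2] at h1
  rw [h1]
  exact congrArg (· * _) (if_congr (cls_iff_nsmul hP hinj v y) rfl rfl)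

/-- Substituting Pv for v restricts the theta sum to PL'. This restriction is the average over the
characters of L/PL, and each character is absorbed by shifting the characteristic w by s/P. -/
theorem Theta_scale_eq_sum {P : ℕ} (hP : 0 < P)
    (hinj : Function.Injective fun y : Λ.Disc => P • y)
    {b : Module.Basis (Fin n) ℚ V} (hb : Λ.L = Submodule.span ℤ (Set.range b))
    (u w : Fin n → ℝ) {τ : ℂ} (hτ : 0 < τ.im) (y : Λ.Disc) :
    D.Theta ((P : ℝ)⁻¹ • u) ((P : ℝ) • w) (P ^ 2 * τ) y =
      ((P : ℂ) ^ n)⁻¹ * ∑ s : Fin n → Fin P,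
        ee ((-(D.bil u (D.co (resid b s)) / (2 * P)) : ℝ) : ℂ) *
        D.Theta u (w + (P : ℝ)⁻¹ • D.co (resid b s)) τ (P • y) := by
  classical
  have hP0 : (P : ℂ) ≠ 0 := by exact_mod_cast hP.ne'
  rw [D.Theta_scale hP hinj u w hτ]
  simp_rw [D.Theta_eq_tsum _ _ hτ, ← tsum_mul_left]
  have hsum : ∀ s : Fin n → Fin P, Summable fun v =>
      ee ((-(D.bil u (D.co (resid b s)) / (2 * P)) : ℝ) : ℂ) *
        ((if Λ.Cls v (P • y) then 1 else 0) *
          D.tm u (w + (P : ℝ)⁻¹ • D.co (resid b s)) τ v) := fun s =>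
    (D.summable_tm u _ hτ (G := fun v => if Λ.Cls v (P • y) then 1 else 0) (C := 1)
      (fun v => by split_ifs <;> simp) (fun v hv => if_neg fun h => hv h.mem)).mul_left _
  rw [← Summable.tsum_finsetSum fun s _ => hsum s, ← tsum_mul_left]
  refine tsum_congr fun v => ?_
  by_cases hv : Λ.Cls v (P • y)
  · have h1 := sum_eQ_polar hb hP hv.mem
    simp only [hv, true_and, if_true, one_mul]
    have h2 : ∀ s : Fin n → Fin P, ee ((-(D.bil u (D.co (resid b s)) / (2 * P)) : ℝ) : ℂ) *
        D.tm u (w + (P : ℝ)⁻¹ • D.co (resid b s)) τ v =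
        eQ (QuadraticMap.polar Λ.q v (resid b s) / P) * D.tm u w τ v := by
      intro s
      rw [D.tm_add_right, ← mul_assoc, ← ee_add, eQ]
      congr 2
      rw [bil_add_left, bil_smul_left, bil_smul_right, bil_smul_right, bil_co]
      push_cast
      field_simp
      ring
    simp_rw [h2]
    rw [← Finset.sum_mul, h1]
    split_ifs
    · field_simp
    · simp
  · simp [hv]

variable [FiniteDimensional ℚ V]

open Matrix.SpecialLinearGroup in
-- Applies the transformation law to each summand of `Theta_scale_eq_sum`. For c = Pj the
-- characteristic shifted by (0, s/P) is the image under γ of (u, w) shifted by (js, (d/P)s): the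
-- first entry uses c = Pj, the second ad - bc = 1.
theorem Theta_scale_transform {P : ℕ} (hP : 0 < P)
    (hinj : Function.Injective fun y : Λ.Disc => P • y)
    {b : Module.Basis (Fin n) ℚ V} (hb : Λ.L = Submodule.span ℤ (Set.range b))
    {x : Ext Λ} (hx : x ∈ weilGroup Λ) {γ : SL(2, ℤ)} (hγ : x.1.M = mapGL ℝ γ) {j : ℤ}
    (hj : γ 1 0 = P * j) (u w : Fin n → ℝ) (τ : ℍ) (y : Λ.Disc) :
    D.Theta ((P : ℝ)⁻¹ • uAct γ u w) ((P : ℝ) • wAct γ u w) (P ^ 2 * ((x.1.M • τ : ℍ) : ℂ)) y =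
      D.jf (x.1.φ τ) * x.2 (((P : ℂ) ^ n)⁻¹ • ∑ s : Fin n → Fin P,
        ee ((-(D.bil (uAct γ u w) (D.co (resid b s)) / (2 * P)) : ℝ) : ℂ) •
        D.Theta (u + D.co (j • resid b s)) (w + (γ 1 1 / P : ℝ) • D.co (resid b s)) τ) (P • y) := by
  have hP0 : (P : ℝ) ≠ 0 := by exact_mod_cast hP.ne'
  rw [D.Theta_scale_eq_sum hP hinj hb _ _ (x.1.M • τ).im_pos]
  have key : ∀ s : Fin n → Fin P, D.Theta (uAct γ u w)
      (wAct γ u w + (P : ℝ)⁻¹ • D.co (resid b s)) ((x.1.M • τ : ℍ) : ℂ) = D.jf (x.1.φ τ) •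
      x.2 (D.Theta (u + D.co (j • resid b s)) (w + (γ 1 1 / P : ℝ) • D.co (resid b s)) τ) := by
    intro s
    rw [← theta_transform D hx hγ]
    have hdet : ((γ 0 0 : ℝ) * γ 1 1 - γ 0 1 * γ 1 0) = 1 := by exact_mod_cast det_mul_sub γ
    have hj' : (γ 1 0 : ℝ) = P * j := by exact_mod_cast hj
    congr 1
    · funext i
      simp only [uAct, co_zsmul, Pi.add_apply, Pi.smul_apply, smul_eq_mul, hj']
      field_simp; ring
    · funext i
      simp only [wAct, co_zsmul, Pi.add_apply, Pi.smul_apply, smul_eq_mul]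
      rw [hj'] at hdet
      field_simp
      linear_combination (-D.co (resid b s) i) * hdet
  simp only [key, map_smul, map_sum, Pi.smul_apply, Finset.sum_apply, smul_eq_mul, Finset.mul_sum]
  exact Finset.sum_congr rfl fun s _ => by ring

open Classical in
/-- The sum appearing in `Theta_scale_transform` as a weighted theta series. -/
theorem sum_Theta_shift {P : ℕ} (hP : 0 < P)
    {b : Module.Basis (Fin n) ℚ V} (hb : Λ.L = Submodule.span ℤ (Set.range b))
    {γ : SL(2, ℤ)} {j : ℤ}
    (hj : γ 1 0 = P * j) (u w : Fin n → ℝ) {τ : ℂ} (hτ : 0 < τ.im) (y : Λ.Disc) :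
    (∑ s : Fin n → Fin P,
        ee ((-(D.bil (uAct γ u w) (D.co (resid b s)) / (2 * P)) : ℝ) : ℂ) •
        D.Theta (u + D.co (j • resid b s)) (w + (γ 1 1 / P : ℝ) • D.co (resid b s)) τ) y =
      ∑' v, (if Λ.Cls v y then ∑ s : Fin n → Fin P,
        eQ ((-(j * γ 1 1) * Λ.q (resid b s) + γ 1 1 * QuadraticMap.polar Λ.q v (resid b s)) / P)
        else 0) * D.tm u w τ v := by
  have hP0 : (P : ℝ) ≠ 0 := by exact_mod_cast hP.ne'
  have hj' : (γ 1 0 : ℝ) = P * j := by exact_mod_cast hj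
  have h1 : ∀ s : Fin n → Fin P, ee ((-(D.bil (uAct γ u w) (D.co (resid b s)) / (2 * P)) : ℝ) : ℂ) *
        D.Theta (u + D.co (j • resid b s)) (w + (γ 1 1 / P : ℝ) • D.co (resid b s)) τ y =
      ∑' v, ((if Λ.Cls v y then 1 else 0) * eQ ((-(j * γ 1 1) * Λ.q (resid b s) +
        γ 1 1 * QuadraticMap.polar Λ.q v (resid b s)) / P)) * D.tm u w τ v := by
    intro s
    rw [D.Theta_eq_tsum _ _ hτ, ← tsum_mul_left]
    have hl : j • resid b s ∈ Λ.L := Submodule.smul_mem _ _ (resid_mem hb s)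
    -- Since js lies in L, translation by it preserves classes; by `tm_add_left` it turns the
    -- characteristic u + js back into u, up to a phase.
    rw [← (Equiv.addRight (j • resid b s)).tsum_eq (fun v => ((if Λ.Cls v y then 1 else 0) *
      eQ ((-(j * γ 1 1) * Λ.q (resid b s) +
        γ 1 1 * QuadraticMap.polar Λ.q v (resid b s)) / P)) * D.tm u w τ v)]
    refine tsum_congr fun v => ?_
    simp only [Equiv.coe_addRight, cls_add_mem_iff hl]
    split_ifs
    · rw [one_mul, one_mul, tm_add_left, tm_add_right, ← mul_assoc, ← mul_assoc, ← ee_add,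
        ← ee_add, eQ]
      congr 2
      rw [← Complex.ofReal_add, ← Complex.ofReal_add]
      congr 1
      have hu : uAct γ u w = (-(P * j) : ℝ) • w + (γ 1 1 : ℝ) • u := by
        funext i; simp [uAct, hj']
      rw [hu]
      simp only [bil_add_left, bil_smul_left, bil_smul_right, bil_add_right, co_add, co_zsmul,
        bil_self, QuadraticMap.polar_add_left, polar_zsmul_left, QuadraticMap.polar_self, bil_co,
        nsmul_eq_mul]
      rw [D.bil_comm w]
      push_cast
      field_simp
      ring
    · simp
  rw [Finset.sum_apply]
  refine (Finset.sum_congr rfl fun s _ => h1 s).trans ?_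
  rw [← Summable.tsum_finsetSum]
  · refine tsum_congr fun v => ?_
    split_ifs
    · rw [Finset.sum_mul]
      exact Finset.sum_congr rfl fun s _ => by rw [one_mul]
    · rw [zero_mul]
      exact Finset.sum_eq_zero fun s _ => by rw [zero_mul, zero_mul]
  · intro s _
    refine D.summable_tm u w hτ (C := 1) (fun v => ?_) fun v hv => ?_
    · split_ifs <;> simp [norm_eQ]
    · rw [if_neg fun h => hv h.mem, zero_mul]

end Diag

end EvenLattice

end VVMF
end

noncomputable section
namespace VVMF

/-! ### Conjugation by `α` -/

open Complex Filter Topology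

theorem Mp.S_pow_four_M : (Mp.S ^ 4).M = 1 := by
  have h : (Mp.S ^ 4).M = Mp.S.M ^ 4 := by simp [pow_succ]
  rw [h]
  ext i j
  fin_cases i <;> fin_cases j <;>
    simp [Mp.S, pow_succ, Matrix.mul_apply, Fin.sum_univ_two, Matrix.GeneralLinearGroup.mkOfDetNeZero]

/-- Two continuous nowhere vanishing functions with the same square on the connected half-plane
differ by a global sign. -/
theorem Mp.φ_eq_or_neg {x y : Mp} (h : x.M = y.M) : x.φ = y.φ ∨ x.φ = -y.φ := by
  have hsq : Set.EqOn (x.φ ^ 2) (y.φ ^ 2) Set.univ := fun τ _ => by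
    rw [Pi.pow_apply, Pi.pow_apply, x.sq, y.sq, h]
  rcases isPreconnected_univ.eq_or_eq_neg_of_sq_eq x.cont.continuousOn y.cont.continuousOn hsq
    (fun {τ} _ => y.φ_ne_zero τ) with h | h
  · exact Or.inl (funext fun τ => h (Set.mem_univ τ))
  · exact Or.inr (funext fun τ => h (Set.mem_univ τ))

/-- S⁴ is the nontrivial element (1, -1) over the identity. The sign is read off at the fixed point
i of S, where √τ has fourth power i² = -1. This element serves to correct signs of lifts. -/
theorem Mp.S_pow_four_φ (τ : ℍ) : (Mp.S ^ 4).φ τ = -1 := by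
  have hS : Mp.S.M • UpperHalfPlane.I = UpperHalfPlane.I := by
    ext1
    rw [S_M, coe_mapGL_smul]
    simp [ModularGroup.S]
  have hI : (Mp.S ^ 4).φ UpperHalfPlane.I = -1 := by
    have h1 : (Mp.S ^ 4).φ UpperHalfPlane.I = (Mp.S.φ UpperHalfPlane.I) ^ 2 *
        (Mp.S.φ UpperHalfPlane.I) ^ 2 := by
      simp only [pow_succ, pow_zero, one_mul, Mp.mul_φ, hS]; ring
    rw [h1, Mp.S.sq, S_M, denom_mapGL]
    simp [ModularGroup.S]
  rcases Mp.φ_eq_or_neg (x := Mp.S ^ 4) (y := 1) Mp.S_pow_four_M with h | h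
  · rw [h] at hI
    norm_num at hI
  · rw [h]; simp

theorem Mp.eq_or_eq_S_mul {x y : Mp} (h : x.M = y.M) : x = y ∨ x = Mp.S ^ 4 * y := by
  rcases Mp.φ_eq_or_neg h with h' | h'
  · exact Or.inl (Mp.ext h h')
  · refine Or.inr (Mp.ext ?_ ?_)
    · rw [Mp.mul_M, Mp.S_pow_four_M, one_mul, h]
    · funext τ
      rw [Mp.mul_φ, Mp.S_pow_four_φ, h']; simp

variable {V : Type*} [AddCommGroup V] [Module ℚ V] [FiniteDimensional ℚ V] {Λ : EvenLattice V}

open EvenLattice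

local notation "n" => Module.finrank ℚ V

theorem genS_pow_four_mem : genS Λ ^ 4 ∈ weilGroup Λ := pow_mem genS_mem 4

open Matrix.SpecialLinearGroup in
/-- Every element of the metaplectic cover of `SL₂(ℤ)` lifts to the Weil representation. -/
theorem exists_lift_eq (x : Mp) (γ : SL(2, ℤ)) (h : x.M = mapGL ℝ γ) :
    ∃ y ∈ weilGroup Λ, y.1 = x := by
  obtain ⟨y, hy, hy'⟩ := exists_lift (Λ := Λ) γ
  rcases Mp.eq_or_eq_S_mul (h.trans hy'.symm) with h1 | h1
  · exact ⟨y, hy, h1.symm⟩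
  · exact ⟨genS Λ ^ 4 * y, mul_mem genS_pow_four_mem hy, h1.symm⟩

theorem Ext_snd_ext (D : Λ.Diag) {f g : GrpAlg Λ ≃ₗ[ℂ] GrpAlg Λ}
    (h : ∀ u w (τ : ℍ), f (D.Theta u w τ) = g (D.Theta u w τ)) : f = g :=
  LinearEquiv.toLinearMap_injective (D.linearMap_ext_Theta h)

/-- The level is an infimum in ℕ, and the infimum of the empty set is 0; a nonzero level is
therefore attained. -/
theorem level_smul_qbar (h : Λ.level ≠ 0) (x : Λ.Disc) : Λ.level • Λ.qbar x = 0 := by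
  have hne : {N : ℕ | 0 < N ∧ ∀ x : Λ.Disc, N • Λ.qbar x = 0}.Nonempty := by
    by_contra hcon
    rw [Set.not_nonempty_iff_eq_empty] at hcon
    rw [level, hcon, Nat.sInf_empty] at h
    exact h rfl
  exact (Nat.sInf_mem hne).2 x

/-- If px = py, every value (x - y, z) is killed by both p and the level, which are coprime.
Non-degeneracy of the discriminant form gives x = y. -/
theorem nsmul_injective_of_not_dvd_level {p : ℕ} (hp : p.Prime) (h : ¬ p ∣ Λ.level) :
    Function.Injective fun y : Λ.Disc => p • y := by
  have h0 : Λ.level ≠ 0 := fun h0 => h (h0 ▸ dvd_zero p)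
  intro x y hxy
  rw [← sub_eq_zero]
  refine eq_zero_of_bbar fun z => ?_
  have hp0 : p • (x - y) = 0 := by rw [smul_sub]; exact sub_eq_zero.mpr hxy
  have h1 : p • Λ.bbar (x - y) z = 0 := by rw [← bbar_nsmul_left, hp0, bbar_zero_left]
  have h2 : Λ.level • Λ.bbar (x - y) z = 0 := by
    rw [bbar, smul_sub, smul_sub, level_smul_qbar h0, level_smul_qbar h0, level_smul_qbar h0]; simp
  have hc : Nat.Coprime p Λ.level := (Nat.Prime.coprime_iff_not_dvd hp).mpr h
  have h3 := addOrderOf_dvd_of_nsmul_eq_zero h1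
  have h4 := addOrderOf_dvd_of_nsmul_eq_zero h2
  have h5 := Nat.eq_one_of_dvd_one (hc ▸ Nat.dvd_gcd h3 h4)
  exact AddMonoid.addOrderOf_eq_one_iff.mp h5

/-- The operator `v ↦ (y ↦ v (P y))` for `P` prime to `|L'/L|`. -/
def mulEquiv {P : ℕ} (hinj : Function.Injective fun y : Λ.Disc => P • y) :
    GrpAlg Λ ≃ₗ[ℂ] GrpAlg Λ :=
  LinearEquiv.funCongrLeft ℂ ℂ (Equiv.ofBijective _ (Finite.injective_iff_bijective.mp hinj))

theorem mulEquiv_apply {P : ℕ} (hinj : Function.Injective fun y : Λ.Disc => P • y) (v : GrpAlg Λ)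
    (y : Λ.Disc) : mulEquiv hinj v y = v (P • y) := rfl

theorem mulEquiv_symm_apply {P : ℕ} (hinj : Function.Injective fun y : Λ.Disc => P • y)
    (v : GrpAlg Λ) (y : Λ.Disc) : (mulEquiv hinj).symm v (P • y) = v y := by
  conv_rhs => rw [← (mulEquiv hinj).apply_symm_apply v]
  rfl

namespace EvenLattice.Diag

variable (D : Λ.Diag)

open Matrix.SpecialLinearGroup in
/-- Conjugation by `α` on `Γ₀(P²)`. -/
theorem Theta_conj {P : ℕ} (hP : 0 < P) (hinj : Function.Injective fun y : Λ.Disc => P • y)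
    {x : Ext Λ} (hx : x ∈ weilGroup Λ) {γ : SL(2, ℤ)} (hγ : x.1.M = mapGL ℝ γ) {j : ℤ}
    (hj : γ 1 0 = P * (P * j)) (u w : Fin n → ℝ) (τ : ℍ) :
    D.Theta ((P : ℝ)⁻¹ • uAct γ u w) ((P : ℝ) • wAct γ u w) (P ^ 2 * ((x.1.M • τ : ℍ) : ℂ)) =
      D.jf (x.1.φ τ) • mulEquiv hinj (x.2 ((mulEquiv hinj).symm
        (D.Theta ((P : ℝ)⁻¹ • u) ((P : ℝ) • w) (P ^ 2 * τ)))) := by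
  classical
  obtain ⟨b, hb⟩ := Λ.exists_basis
  funext y
  have hP0 : (P : ℂ) ≠ 0 := by exact_mod_cast hP.ne'
  have hPQ : (P : ℚ) ≠ 0 := by exact_mod_cast hP.ne'
  rw [D.Theta_scale_transform hP hinj hb hx hγ hj, Pi.smul_apply, smul_eq_mul, mulEquiv_apply]
  refine congrArg (fun W => D.jf (x.1.φ τ) * x.2 W (P • y)) ?_
  rw [LinearEquiv.eq_symm_apply]
  funext y'
  rw [mulEquiv_apply, Pi.smul_apply, D.sum_Theta_shift hP hb hj u w τ.im_pos,
    D.Theta_scale hP hinj u w τ.im_pos, smul_eq_mul, ← tsum_mul_left]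
  refine tsum_congr fun v => ?_
  by_cases hv : Λ.Cls v (P • y')
  · simp only [hv, if_true, true_and]
    -- The lower left entry is divisible by P², so the quadratic phase in s is integral. Only the
    -- character (dv, s)/P of L/PL remains.
    have h1 : ∀ s : Fin n → Fin P, eQ ((-(((P * j : ℤ) : ℚ) * γ 1 1) * Λ.q (resid b s) +
        γ 1 1 * QuadraticMap.polar Λ.q v (resid b s)) / P) =
        eQ (QuadraticMap.polar Λ.q (γ 1 1 • v) (resid b s) / P) := by
      intro s
      obtain ⟨c, hc⟩ := Λ.even _ (resid_mem hb s)
      refine eQ_congr ⟨-(j * γ 1 1 * c), ?_⟩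
      rw [polar_zsmul_left, hc]
      push_cast
      field_simp; ring
    rw [Finset.sum_congr rfl fun s _ => h1 s,
      sum_eQ_polar hb hP (Submodule.smul_mem _ _ hv.mem)]
    -- The entry d is invertible modulo P, with inverse a, so dv ∈ PL' is the same as v ∈ PL'.
    have hiff : (∃ v' ∈ Λ.dual, γ 1 1 • v = P • v') ↔ ∃ v' ∈ Λ.dual, v = P • v' := by
      constructor
      · rintro ⟨v', hv', h⟩
        refine ⟨γ 0 0 • v' - (γ 0 1 * (P * j)) • v, Submodule.sub_mem _
          (Submodule.smul_mem _ _ hv') (Submodule.smul_mem _ _ hv.mem), ?_⟩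
        rw [smul_sub, smul_comm, ← h, ← natCast_zsmul, smul_smul, smul_smul, ← sub_smul]
        have := det_mul_sub γ
        rw [hj] at this
        rw [show γ 0 0 * γ 1 1 - (P : ℤ) * (γ 0 1 * (P * j)) = 1 by linear_combination this, one_smul]
      · rintro ⟨v', hv', rfl⟩
        exact ⟨γ 1 1 • v', Submodule.smul_mem _ _ hv', smul_comm _ _ _⟩
    rw [if_congr hiff rfl rfl]
    split_ifs
    · field_simp
    · simp
  · simp [hv]

theorem eQ_mul_of_level {h : ℤ} (hlev : ∀ x : Λ.Disc, h • Λ.qbar x = 0) {v : V} (hv : v ∈ Λ.dual) :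
    ∃ c : ℤ, h * Λ.q v = c := by
  have h1 : Λ.Cls v (Submodule.Quotient.mk ⟨v, hv⟩) := ⟨hv, rfl⟩
  have h2 := hlev (Submodule.Quotient.mk ⟨v, hv⟩)
  rw [h1.qbar] at h2
  have h3 : (((h * (Λ.q v : ℚ) : ℝ)) : UnitAddCircle) = 0 := by
    rw [← h2, ← zsmul_eq_mul]; rfl
  rw [AddCircle.coe_eq_zero_iff] at h3
  obtain ⟨c, hc⟩ := h3
  refine ⟨c, ?_⟩
  have : ((c : ℚ) : ℝ) = ((h * Λ.q v : ℚ) : ℝ) := by push_cast; rw [← hc]; simp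
  exact_mod_cast this.symm

open Matrix.SpecialLinearGroup in
/-- The image of the theta function under the elements with lower left entry `P`. -/
theorem Theta_middle {P : ℕ} (hP : 0 < P) (hinj : Function.Injective fun y : Λ.Disc => P • y)
    {b : Module.Basis (Fin n) ℚ V} (hb : Λ.L = Submodule.span ℤ (Set.range b))
    {x : Ext Λ} (hx : x ∈ weilGroup Λ) {γ : SL(2, ℤ)} (hγ : x.1.M = mapGL ℝ γ)
    (hj : γ 1 0 = P) (hlev : ∀ x : Λ.Disc, γ 1 1 • Λ.qbar x = 0) (u w : Fin n → ℝ) (τ : ℍ) :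
    D.Theta ((P : ℝ)⁻¹ • uAct γ u w) ((P : ℝ) • wAct γ u w) (P ^ 2 * ((x.1.M • τ : ℍ) : ℂ)) =
      D.jf (x.1.φ τ) • mulEquiv hinj (x.2 ((((P : ℂ) ^ n)⁻¹ * latticeGauss Λ b P (-γ 1 1)) •
        D.Theta u (w - (γ 1 1 / P : ℝ) • u) (τ + (γ 1 1 / P : ℝ)))) := by
  classical
  funext y
  have hP0 : (P : ℂ) ≠ 0 := by exact_mod_cast hP.ne'
  have hPQ : (P : ℚ) ≠ 0 := by exact_mod_cast hP.ne'
  have hj1 : γ 1 0 = P * 1 := by rw [hj, mul_one]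
  rw [D.Theta_scale_transform hP hinj hb hx hγ hj1, Pi.smul_apply, smul_eq_mul, mulEquiv_apply]
  refine congrArg (fun W => D.jf (x.1.φ τ) * x.2 W (P • y)) ?_
  funext y'
  have hτ' : 0 < ((τ : ℂ) + ((γ 1 1 / P : ℝ) : ℂ)).im := by simpa using τ.im_pos
  rw [Pi.smul_apply, Pi.smul_apply, D.sum_Theta_shift hP hb hj1 u w τ.im_pos,
    D.Theta_eq_tsum _ _ hτ', smul_eq_mul, smul_eq_mul, mul_assoc]
  congr 1
  rw [← tsum_mul_left]
  refine tsum_congr fun v => ?_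
  have htr := D.tm_translate u w τ (γ 1 1 / P : ℚ) v
  push_cast at htr ⊢
  rw [htr]
  split_ifs with hv
  -- Multiplication by P is bijective on A, so v can be written as l + Pv'' with l in L and v'' in
  -- L'.
  · obtain ⟨v'', hv''⟩ := exists_cls ((Equiv.ofBijective _ (Finite.injective_iff_bijective.mp
      hinj)).symm y')
    have hcl := hv''.nsmul P
    have hcl' : (P • ((Equiv.ofBijective _ (Finite.injective_iff_bijective.mp hinj)).symm y')) = y' :=
      (Equiv.ofBijective _ (Finite.injective_iff_bijective.mp hinj)).apply_symm_apply y'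
    rw [hcl'] at hcl
    have hl : v - P • v'' ∈ Λ.L := by
      rw [← cls_zero_iff]; simpa using hv.sub hcl
    obtain ⟨l, rfl⟩ : ∃ l, v = l + P • v'' := ⟨v - P • v'', by simp⟩
    rw [add_sub_cancel_right] at hl
    -- Completing the square in s: up to integers the pairing with Pv'' drops out, and what remains
    -- is a Gauss sum translated by -l, times a phase in l.
    have h1 : ∀ s : Fin n → Fin P, eQ ((-(1 * (γ 1 1 : ℚ)) * Λ.q (resid b s) +
        γ 1 1 * QuadraticMap.polar Λ.q (l + P • v'') (resid b s)) / P) =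
        eQ (γ 1 1 * Λ.q l / P) * eQ (((-γ 1 1 : ℤ) : ℚ) * Λ.q (resid b s + -l) / P) := by
      intro s
      obtain ⟨c, hc⟩ := polar_mem_int hv''.mem (resid_mem hb s)
      rw [← eQ_add]
      refine eQ_congr ⟨γ 1 1 * c, ?_⟩
      rw [q_add, QuadraticMap.polar_add_left, ← natCast_zsmul, polar_zsmul_left, hc,
        QuadraticMap.polar_neg_right, QuadraticMap.map_neg, QuadraticMap.polar_comm _ l]
      push_cast
      field_simp; ring
    rw [Finset.sum_congr rfl fun s _ => h1 s, ← Finset.mul_sum,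
      sum_resid_add hb hP (F := fun v => eQ (((-γ 1 1 : ℤ) : ℚ) * Λ.q v / P)) (fun v hv l hl => by
        obtain ⟨c, hc⟩ := polar_mem_int (L_le_dual hv) hl
        obtain ⟨c', hc'⟩ := Λ.even _ hl
        refine eQ_congr ⟨-γ 1 1 * (P * c' + c), ?_⟩
        rw [q_add, q_zsmul, polar_zsmul_right, hc, hc']
        push_cast
        field_simp; ring) (neg_mem hl)]
    -- Here d·q(v'') ∈ ℤ enters: it allows q(l) to be replaced by q(v) in the phase, which then
    -- becomes the effect of the translation τ ↦ τ + d/P.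
    have h2 : eQ (γ 1 1 * Λ.q l / P) = ee ((γ 1 1 / P * (Λ.q (l + P • v'') : ℚ) : ℂ)) := by
      have h3 : ee ((γ 1 1 / P * (Λ.q (l + P • v'') : ℚ) : ℂ)) =
          eQ (γ 1 1 * Λ.q (l + P • v'') / P) := by
        rw [eQ]; congr 1; push_cast; ring
      rw [h3]
      obtain ⟨c, hc⟩ := polar_mem_int hv''.mem hl
      obtain ⟨c', hc'⟩ := eQ_mul_of_level hlev hv''.mem
      symm
      refine eQ_congr ⟨P * c' + γ 1 1 * c, ?_⟩
      rw [q_add, ← natCast_zsmul, q_zsmul, polar_zsmul_right, QuadraticMap.polar_comm _ l, hc]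
      push_cast
      field_simp
      rw [← hc']
      ring
    rw [h2, latticeGauss]
    ring
  · simp

end EvenLattice.Diag

end VVMF
end

noncomputable section
namespace VVMF

/-! ### The double coset of `α` -/

open Complex Filter Topology

open EvenLattice

variable {V : Type*} [AddCommGroup V] [Module ℚ V] [FiniteDimensional ℚ V] {Λ : EvenLattice V}

local notation "n" => Module.finrank ℚ V

theorem exists_SL2 {a b c d : ℤ} (h : a * d - b * c = 1) :
    ∃ γ : SL(2, ℤ), γ 0 0 = a ∧ γ 0 1 = b ∧ γ 1 0 = c ∧ γ 1 1 = d :=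
  ⟨⟨!![a, b; c, d], by rw [Matrix.det_fin_two_of]; exact h⟩, rfl, rfl, rfl, rfl⟩

section

variable {p : ℕ} [Fact p.Prime]

/-- The element `α` with its action on the group algebra. -/
def heckeElt (hinj : Function.Injective fun y : Λ.Disc => p • y) : Ext Λ := (Mp.α p, mulEquiv hinj)

theorem α_apply (i j : Fin 2) : (Mp.α p).M i j = !![(p : ℝ) ^ 2, 0; 0, 1] i j := by
  simp [Mp.α, Matrix.GeneralLinearGroup.mkOfDetNeZero]

theorem coe_α_smul (τ : ℍ) : (((Mp.α p).M • τ : ℍ) : ℂ) = (p : ℂ) ^ 2 * τ := by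
  rw [UpperHalfPlane.coe_smul_of_det_pos (Mp.α p).det_pos, UpperHalfPlane.num, UpperHalfPlane.denom]
  simp [α_apply]

open Matrix.SpecialLinearGroup in
/-- Conjugation by `α` maps the elements of level `Γ₀(p²)` to `weilGroup`. -/
theorem heckeElt_conj_mem (hinj : Function.Injective fun y : Λ.Disc => p • y)
    {x : Ext Λ} (hx : x ∈ weilGroup Λ) {γ : SL(2, ℤ)} (hγ : x.1.M = mapGL ℝ γ)
    (hj : (p : ℤ) ^ 2 ∣ γ 1 0) :
    heckeElt hinj * x * (heckeElt hinj)⁻¹ ∈ weilGroup Λ := by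
  obtain ⟨j, hj⟩ := hj
  have hp : 0 < p := (Fact.out : p.Prime).pos
  have hp0 : (p : ℝ) ≠ 0 := by exact_mod_cast hp.ne'
  have hj' : γ 1 0 = p * (p * j) := by rw [hj]; ring
  obtain ⟨D⟩ := Λ.nonempty_diag
  obtain ⟨γ', h00, h01, h10, h11⟩ := exists_SL2 (a := γ 0 0) (b := p ^ 2 * γ 0 1) (c := j)
    (d := γ 1 1) (by
      have := det_mul_sub γ
      rw [hj] at this
      linear_combination this)
  have hM : (heckeElt hinj * x * (heckeElt hinj)⁻¹).1.M = mapGL ℝ γ' := by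
    change (Mp.α p).M * x.1.M * (Mp.α p).M⁻¹ = _
    rw [mul_inv_eq_iff_eq_mul]
    ext a c
    have hj2 : (γ 1 0 : ℝ) = p ^ 2 * j := by rw [hj]; push_cast; rfl
    fin_cases a <;> fin_cases c <;>
      simp [Matrix.mul_apply, Fin.sum_univ_two, α_apply, hγ, h00, h01, h10, h11, hj2, mul_comm]
  -- Some element of `weilGroup` lies over the conjugated matrix with the same φ. It remains to show
  -- that the two operators agree, which is tested on theta values.
  obtain ⟨y, hy, hy1⟩ := exists_lift_eq (Λ := Λ) (heckeElt hinj * x * (heckeElt hinj)⁻¹).1 γ' hM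
  suffices h : heckeElt hinj * x * (heckeElt hinj)⁻¹ = y by rw [h]; exact hy
  refine Prod.ext hy1.symm (Ext_snd_ext D fun u w T => ?_)
  set τ : ℍ := (Mp.α p).M⁻¹ • T with hτ
  have hT : T = (Mp.α p).M • τ := by rw [hτ, smul_inv_smul]
  -- The characteristics are rescaled by p and 1/p in advance, so that the factors in `Theta_conj`
  -- cancel and the theta function at p²τ has characteristics u and w.
  have h1 := D.Theta_conj hp hinj hx hγ hj' ((p : ℝ) • u) ((p : ℝ)⁻¹ • w) τ
  have h2 := theta_transform D hy (hy1 ▸ hM) T u w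
  have e1 : (p : ℝ)⁻¹ • uAct γ ((p : ℝ) • u) ((p : ℝ)⁻¹ • w) = uAct γ' u w := by
    funext i
    have hj2 : (γ 1 0 : ℝ) = p ^ 2 * j := by rw [hj]; push_cast; rfl
    simp only [uAct, Pi.smul_apply, smul_eq_mul, hj2, h10, h11]
    field_simp
  have e2 : (p : ℝ) • wAct γ ((p : ℝ) • u) ((p : ℝ)⁻¹ • w) = wAct γ' u w := by
    funext i
    simp only [wAct, Pi.smul_apply, smul_eq_mul, h00, h01]
    push_cast
    field_simp
  have e3 : ((y.1.M • T : ℍ) : ℂ) = p ^ 2 * ((x.1.M • τ : ℍ) : ℂ) := by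
    rw [← coe_α_smul, hy1, hτ]
    simp only [Prod.fst_mul, Prod.fst_inv, Mp.mul_M, Mp.inv_M, mul_smul]
    rfl
  have e4 : y.1.φ T = x.1.φ τ := by
    rw [hy1, hτ]
    simp only [Prod.fst_mul, Prod.fst_inv, Mp.mul_φ, Mp.inv_φ, Mp.inv_M, heckeElt]
    simp [Mp.α]
  have e5 : (p : ℂ) ^ 2 * τ = T := by rw [hT, coe_α_smul]
  rw [e1, e2, ← e3, h2, e4, smul_smul, smul_smul, inv_mul_cancel₀ hp0, mul_inv_cancel₀ hp0, one_smul,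
    one_smul, e5] at h1
  exact (smul_right_injective _ (D.jf_ne_zero (x.1.φ_ne_zero τ)) h1).symm

open Matrix.SpecialLinearGroup in
-- The coset of αx depends only on the bottom row of x as a point of ℙ¹(ℤ/p²). The quantity c'd -
-- d'c is the lower left entry of γ'γ⁻¹, and conjugating by α divides it by p².
theorem heckeElt_mul_rel_iff (hinj : Function.Injective fun y : Λ.Disc => p • y)
    {x x' : Ext Λ} (hx : x ∈ weilGroup Λ) (hx' : x' ∈ weilGroup Λ) {γ γ' : SL(2, ℤ)}
    (hγ : x.1.M = mapGL ℝ γ) (hγ' : x'.1.M = mapGL ℝ γ') :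
    heckeElt hinj * x' * (heckeElt hinj * x)⁻¹ ∈ weilGroup Λ ↔
      (p : ℤ) ^ 2 ∣ γ' 1 0 * γ 1 1 - γ' 1 1 * γ 1 0 := by
  have e1 : heckeElt hinj * x' * (heckeElt hinj * x)⁻¹ =
      heckeElt hinj * (x' * x⁻¹) * (heckeElt hinj)⁻¹ := by group
  have e2 : (x' * x⁻¹).1.M = mapGL ℝ (γ' * γ⁻¹) := by
    simp [hγ, hγ']
  have e3 : (γ' * γ⁻¹) 1 0 = γ' 1 0 * γ 1 1 - γ' 1 1 * γ 1 0 := by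
    rw [Matrix.SpecialLinearGroup.coe_mul, Matrix.SpecialLinearGroup.coe_inv, Matrix.adjugate_fin_two,
      Matrix.mul_apply, Fin.sum_univ_two]
    simp; ring
  rw [e1]
  constructor
  · intro h
    obtain ⟨δ, hδ⟩ := exists_eq_mapGL h
    have h2 : (Mp.α p).M * mapGL ℝ (γ' * γ⁻¹) = mapGL ℝ δ * (Mp.α p).M := by
      rw [← hδ, ← e2]
      change _ = (Mp.α p).M * (x' * x⁻¹).1.M * (Mp.α p).M⁻¹ * (Mp.α p).M
      group
    have h3 := congrArg (fun g : GL (Fin 2) ℝ => g 1 0) h2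
    simp only [Matrix.GeneralLinearGroup.coe_mul, Matrix.mul_apply, Fin.sum_univ_two, α_apply,
      mapGL_apply] at h3
    rw [e3] at h3
    simp at h3
    refine ⟨δ 1 0, ?_⟩
    have : ((γ' 1 0 * γ 1 1 - γ' 1 1 * γ 1 0 : ℤ) : ℝ) = ((p ^ 2 * δ 1 0 : ℤ) : ℝ) := by
      push_cast; rw [h3]; ring
    exact_mod_cast this
  · intro h
    exact heckeElt_conj_mem hinj (mul_mem hx' (inv_mem hx)) e2 (by rw [e3]; exact h)

open Matrix.SpecialLinearGroup in
/-- Representatives of the double coset of `α`, from representatives of `ℙ¹(ℤ/p²)`. -/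
theorem range_coset_reps (hinj : Function.Injective fun y : Λ.Disc => p • y) {ι : Type*}
    {x : ι → Ext Λ} (hx : ∀ i, x i ∈ weilGroup Λ) {γ : ι → SL(2, ℤ)}
    (hγ : ∀ i, (x i).1.M = mapGL ℝ (γ i))
    (hd : ∀ i i', (p : ℤ) ^ 2 ∣ γ i' 1 0 * γ i 1 1 - γ i' 1 1 * γ i 1 0 → i = i')
    (hc : ∀ γ' : SL(2, ℤ), ∃ i, (p : ℤ) ^ 2 ∣ γ' 1 0 * γ i 1 1 - γ' 1 1 * γ i 1 0) :
    Function.Injective (fun i => Quotient.mk (QuotientGroup.rightRel (weilGroup Λ))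
      (heckeElt hinj * x i)) ∧
    Set.range (fun i => Quotient.mk (QuotientGroup.rightRel (weilGroup Λ)) (heckeElt hinj * x i)) =
      Quotient.mk (QuotientGroup.rightRel (weilGroup Λ)) '' heckeCoset Λ p := by
  constructor
  · intro i i' h
    have h1 := QuotientGroup.rightRel_apply.mp (Quotient.exact h)
    exact hd i i' ((heckeElt_mul_rel_iff hinj (hx i) (hx i') (hγ i) (hγ i')).mp h1)
  · ext c
    constructor
    · rintro ⟨i, rfl⟩
      refine ⟨_, ⟨heckeElt hinj, rfl, fun v y => rfl, ?_⟩, rfl⟩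
      exact DoubleCoset.mem_doubleCoset.mpr ⟨1, one_mem _, x i, hx i, by rw [one_mul]⟩
    · rintro ⟨y, ⟨a, ha1, ha2, hy⟩, rfl⟩
      obtain ⟨z, hz, z', hz', rfl⟩ := DoubleCoset.mem_doubleCoset.mp hy
      have ha : a = heckeElt hinj := Prod.ext ha1 (LinearEquiv.ext fun v => funext fun y => ha2 v y)
      obtain ⟨γ', hγ'⟩ := exists_eq_mapGL hz'
      obtain ⟨i, hi⟩ := hc γ'
      refine ⟨i, Quotient.sound (QuotientGroup.rightRel_apply.mpr ?_)⟩
      have h1 := (heckeElt_mul_rel_iff hinj (hx i) hz' (hγ i) hγ').mpr hi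
      have e1 : z * a * z' * (heckeElt hinj * x i)⁻¹ =
          z * (heckeElt hinj * z' * (heckeElt hinj * x i)⁻¹) := by rw [ha]; group
      rw [e1]
      exact mul_mem hz h1

end

theorem slash_mul (κ : ℤ) (f : ℍ → GrpAlg Λ) (x y : Ext Λ) :
    slash Λ κ f (x * y) = slash Λ κ (slash Λ κ f x) y := by
  funext τ
  have h1 : ((x * y).1.M.det.val : ℝ) = x.1.M.det.val * y.1.M.det.val := by simp
  have h2 : (x * y).2.symm (f ((x * y).1.M • τ)) = y.2.symm (x.2.symm (f (x.1.M • y.1.M • τ))) := by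
    rw [Prod.fst_mul, Mp.mul_M, mul_smul]; rfl
  simp only [slash]
  rw [h1, h2, Real.mul_rpow x.1.det_pos.le y.1.det_pos.le, Prod.fst_mul, Mp.mul_φ, mul_zpow]
  simp only [map_smul, smul_smul]
  congr 1
  push_cast; ring

theorem slash_eq_of_mul_inv_mem {κ : ℤ} {f : ℍ → GrpAlg Λ} (hf : IsCuspForm Λ κ f) {x y : Ext Λ}
    (h : y * x⁻¹ ∈ weilGroup Λ) : slash Λ κ f x = slash Λ κ f y := by
  have : y = (y * x⁻¹) * x := by group
  rw [this, slash_mul, hf.slash_eq _ h]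

theorem heckeOp_eq_sum {κ : ℤ} {f : ℍ → GrpAlg Λ} (hf : IsCuspForm Λ κ f) {p : ℕ} [Fact p.Prime]
    {ι : Type*} [Fintype ι] (r : ι → Ext Λ)
    (h1 : Function.Injective fun i => Quotient.mk (QuotientGroup.rightRel (weilGroup Λ)) (r i))
    (h2 : Set.range (fun i => Quotient.mk (QuotientGroup.rightRel (weilGroup Λ)) (r i)) =
      Quotient.mk (QuotientGroup.rightRel (weilGroup Λ)) '' heckeCoset Λ p) :
    heckeOp Λ κ p f = (((p : ℝ) ^ ((κ : ℝ) / 2 - 2) : ℝ) : ℂ) • ∑ i, slash Λ κ f (r i) := by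
  rw [heckeOp, ← h2, finsum_mem_range h1, finsum_eq_sum_of_fintype]
  congr 1
  refine Finset.sum_congr rfl fun i _ => ?_
  refine slash_eq_of_mul_inv_mem hf ?_
  exact QuotientGroup.rightRel_apply.mp (Quotient.mk_out (s := QuotientGroup.rightRel _) (r i))

end VVMF
end

noncomputable section
namespace VVMF

/-! ### The Hecke operator in terms of explicit representatives -/

open Complex Filter Topology

open EvenLattice

variable {V : Type*} [AddCommGroup V] [Module ℚ V] [FiniteDimensional ℚ V] {Λ : EvenLattice V}

local notation "n" => Module.finrank ℚ V

theorem sqrt_mul_cpow {a : ℝ} (ha : 0 < a) {z : ℂ} (hz : z ≠ 0) :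
    ((a : ℂ) * z) ^ (1 / 2 : ℂ) = (Real.sqrt a : ℂ) * z ^ (1 / 2 : ℂ) := by
  have ha' : (a : ℂ) ≠ 0 := by exact_mod_cast ha.ne'
  rw [Complex.cpow_def_of_ne_zero (mul_ne_zero ha' hz), Complex.cpow_def_of_ne_zero hz,
    Complex.log_ofReal_mul ha hz, add_mul, Complex.exp_add, Real.sqrt_eq_rpow, Real.rpow_def_of_pos ha]
  push_cast; rfl

theorem S_φ (τ : ℍ) : Mp.S.φ τ = (τ : ℂ) ^ (1 / 2 : ℂ) := rfl

theorem coe_S_smul (τ : ℍ) : ((Mp.S.M • τ : ℍ) : ℂ) = -1 / τ := by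
  rw [S_M, coe_mapGL_smul]; simp [ModularGroup.S]

open Matrix.SpecialLinearGroup in
theorem genT_zpow_M (k : ℤ) : (genT Λ ^ k).1.M = mapGL ℝ (ModularGroup.T ^ k) := by
  have h : ∀ x : Ext Λ, ∀ k : ℤ, (x ^ k).1.M = x.1.M ^ k := fun x k =>
    map_zpow (⟨⟨fun x : Ext Λ => x.1.M, rfl⟩, fun _ _ => rfl⟩ : Ext Λ →* GL (Fin 2) ℝ) x k
  rw [h, map_zpow, ← T_M]; rfl

theorem coe_genT_zpow_smul (k : ℤ) (τ : ℍ) : (((genT Λ ^ k).1.M • τ : ℍ) : ℂ) = τ + k := by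
  rw [genT_zpow_M, coe_mapGL_smul]
  simp [ModularGroup.coe_T_zpow]

theorem T_zpow_mul_S_apply (k : ℤ) : (ModularGroup.T ^ k * ModularGroup.S) 0 0 = k ∧
    (ModularGroup.T ^ k * ModularGroup.S) 0 1 = -1 ∧
    (ModularGroup.T ^ k * ModularGroup.S) 1 0 = 1 ∧
    (ModularGroup.T ^ k * ModularGroup.S) 1 1 = 0 := by
  rw [Matrix.SpecialLinearGroup.coe_mul, ModularGroup.coe_T_zpow]
  simp [ModularGroup.S, Matrix.mul_apply, Fin.sum_univ_two]

theorem genT_zpow_φ (k : ℤ) (τ : ℍ) : (genT Λ ^ k).1.φ τ = 1 := by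
  induction k using Int.induction_on generalizing τ with
  | zero => simp
  | succ k ih =>
    rw [zpow_add_one, Prod.fst_mul, Mp.mul_φ, ih]
    simp [genT, Mp.T]
  | pred k ih =>
    rw [zpow_sub_one, Prod.fst_mul, Mp.mul_φ, ih]
    simp [genT, Mp.T]

theorem genT_zpow_snd (k : ℤ) (v : GrpAlg Λ) (y : Λ.Disc) :
    (genT Λ ^ k).2 v y = e (k • Λ.qbar y) * v y := by
  have h1 : ∀ v : GrpAlg Λ, (genT Λ).2 v y = e (Λ.qbar y) * v y := fun v => rfl
  have h2 : ∀ v : GrpAlg Λ, (genT Λ)⁻¹.2 v y = e (-Λ.qbar y) * v y := fun v => rfl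
  induction k using Int.induction_on generalizing v with
  | zero => simp
  | succ k ih =>
    rw [zpow_add_one, Prod.snd_mul, LinearEquiv.mul_apply, ih, h1, ← mul_assoc, ← e_add, add_smul,
      one_smul]
  | pred k ih =>
    rw [zpow_sub_one, Prod.snd_mul, LinearEquiv.mul_apply, ih, h2, ← mul_assoc, ← e_add, sub_smul,
      one_smul, sub_eq_add_neg]

/-- The component functions of `f`, extended to the complex plane. -/
def comp (f : ℍ → GrpAlg Λ) (y : Λ.Disc) (z : ℂ) : ℂ := f (UpperHalfPlane.ofComplex z) y

theorem comp_eq (f : ℍ → GrpAlg Λ) (y : Λ.Disc) {τ : ℍ} {z : ℂ} (h : (τ : ℂ) = z) :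
    f τ y = comp f y z := by
  rw [comp, ← h, UpperHalfPlane.ofComplex_apply]

section

variable {p : ℕ} [Fact p.Prime]

theorem det_α : ((Mp.α p).M.det.val : ℝ) = (p : ℝ) ^ 2 := by
  simp [Mp.α, Matrix.GeneralLinearGroup.mkOfDetNeZero]

open Matrix.SpecialLinearGroup in
theorem det_of_mem {x : Ext Λ} (hx : x ∈ weilGroup Λ) : (x.1.M.det.val : ℝ) = 1 := by
  obtain ⟨γ, hγ⟩ := exists_eq_mapGL hx
  rw [hγ]; simp

theorem det_coset (hinj : Function.Injective fun y : Λ.Disc => p • y) {x x' : Ext Λ}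
    (hx : x ∈ weilGroup Λ) (hx' : x' ∈ weilGroup Λ) :
    ((x * heckeElt hinj * x').1.M.det.val : ℝ) = (p : ℝ) ^ 2 := by
  simp only [Prod.fst_mul, Mp.mul_M, map_mul, Units.val_mul, det_of_mem hx, det_of_mem hx']
  rw [one_mul, mul_one]
  exact det_α

theorem sq_rpow_div_four (κ : ℤ) : ((p : ℝ) ^ 2) ^ ((κ : ℝ) / 4) = (p : ℝ) ^ ((κ : ℝ) / 2) := by
  rw [← Real.rpow_natCast, ← Real.rpow_mul (by positivity)]
  congr 1; push_cast; ring

/-- The contribution of `α` itself. -/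
theorem slash_heckeElt (hinj : Function.Injective fun y : Λ.Disc => p • y) (κ : ℤ)
    (f : ℍ → GrpAlg Λ) (τ : ℍ) (y : Λ.Disc) :
    slash Λ κ f (heckeElt hinj) τ (p • y) =
      (((p : ℝ) ^ ((κ : ℝ) / 2) : ℝ) : ℂ) * comp f y (p ^ 2 * τ) := by
  have h1 : ((heckeElt hinj).1.M.det.val : ℝ) = (p : ℝ) ^ 2 := det_α
  have h2 : (heckeElt hinj).1.φ τ = 1 := rfl
  rw [slash, h1, h2, sq_rpow_div_four, one_zpow, one_smul, Pi.smul_apply, smul_eq_mul,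
    ← comp_eq f y (τ := (Mp.α p).M • τ) (coe_α_smul τ)]
  congr 1
  exact mulEquiv_symm_apply hinj _ y

/-- The relation ρ(α)ρ(S)ρ(α) = ρ(S) in a form that avoids inverses: the factor p moves from one
argument of the pairing to the other and is absorbed by reindexing. -/
theorem genS_conj_snd (hinj : Function.Injective fun y : Λ.Disc => p • y) (v : GrpAlg Λ) :
    (genS Λ).2 (mulEquiv hinj ((genS Λ).2 (mulEquiv hinj v))) = (genS Λ).2 ((genS Λ).2 v) := by
  congr 1
  funext y
  rw [mulEquiv_apply]
  change Λ.weilConst * _ = Λ.weilConst * _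
  congr 1
  rw [← Equiv.sum_comp (Equiv.ofBijective _ (Finite.injective_iff_bijective.mp hinj))
    (fun z => e (-Λ.bbar y z) * v z)]
  refine Finset.sum_congr rfl fun z _ => ?_
  rw [mulEquiv_apply, Equiv.ofBijective_apply, bbar_nsmul_left, bbar_nsmul_right]

/-- The contribution of the representatives `(1, j; 0, p²)`. -/
theorem slash_lower (hinj : Function.Injective fun y : Λ.Disc => p • y) (κ : ℤ)
    (f : ℍ → GrpAlg Λ) (j : ℤ) (τ : ℍ) (y : Λ.Disc) :
    slash Λ κ f ((genS Λ)⁻¹ * heckeElt hinj * (genS Λ * genT Λ ^ j)) τ y =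
      (((p : ℝ) ^ (-((κ : ℝ) / 2)) : ℝ) : ℂ) *
        (e (-(j • Λ.qbar y)) * comp f (p • y) ((τ + j) / p ^ 2)) := by
  have hp : 0 < (p : ℝ) := by exact_mod_cast (Fact.out : p.Prime).pos
  have hpc : (p : ℂ) ≠ 0 := by exact_mod_cast hp.ne'
  set δ := (genS Λ)⁻¹ * heckeElt hinj * (genS Λ * genT Λ ^ j) with hδ
  have hδ' : genS Λ * δ = heckeElt hinj * (genS Λ * genT Λ ^ j) := by rw [hδ]; group
  have hτj : (τ : ℂ) + j ≠ 0 := by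
    rw [← coe_genT_zpow_smul (Λ := Λ)]; exact UpperHalfPlane.ne_zero _
  have hM : ((δ.1.M • τ : ℍ) : ℂ) = (τ + j) / p ^ 2 := by
    have h1 : Mp.S.M • (δ.1.M • τ) = (Mp.α p).M • Mp.S.M • (genT Λ ^ j).1.M • τ := by
      have := congrArg (fun x : Ext Λ => x.1.M • τ) hδ'
      simp only [Prod.fst_mul, Mp.mul_M, mul_smul] at this
      exact this
    have h2 := congrArg (fun z : ℍ => (z : ℂ)) h1
    simp only [coe_α_smul, coe_S_smul, coe_genT_zpow_smul] at h2
    have h3 : ((δ.1.M • τ : ℍ) : ℂ) ≠ 0 := UpperHalfPlane.ne_zero _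
    field_simp at h2 ⊢
    linear_combination h2
  -- Scaling by the positive number p² stays within the principal branch, so (τ + j)^(1/2) is p
  -- times the root at (τ + j)/p².
  have hφ : δ.1.φ τ = p := by
    have h1 : Mp.S.φ (δ.1.M • τ) * δ.1.φ τ = Mp.S.φ ((genT Λ ^ j).1.M • τ) := by
      have := congrArg (fun x : Ext Λ => x.1.φ τ) hδ'
      simp only [Prod.fst_mul, Mp.mul_φ, genT_zpow_φ, mul_one] at this
      exact this.trans (one_mul _)
    rw [S_φ, S_φ, hM, coe_genT_zpow_smul] at h1
    have h2 : (τ + j : ℂ) = (((p : ℝ) ^ 2 : ℝ) : ℂ) * ((τ + j) / p ^ 2) := by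
      push_cast; field_simp
    have h3 : ((τ + j) / p ^ 2 : ℂ) ≠ 0 := div_ne_zero hτj (pow_ne_zero _ hpc)
    have h4 : ((τ + j) / p ^ 2 : ℂ) ^ (1 / 2 : ℂ) ≠ 0 := by
      rw [Ne, Complex.cpow_eq_zero_iff]; tauto
    have h5 := sqrt_mul_cpow (show 0 < (p : ℝ) ^ 2 by positivity) h3
    rw [← h2, Real.sqrt_sq hp.le] at h5
    rw [h5] at h1
    apply mul_left_cancel₀ h4
    rw [h1]; push_cast; ring
  have hdet : (δ.1.M.det.val : ℝ) = (p : ℝ) ^ 2 :=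
    det_coset hinj (inv_mem genS_mem) (mul_mem genS_mem (zpow_mem genT_mem _))
  have hU : ∀ v, δ.2.symm v y = e (-(j • Λ.qbar y)) * v (p • y) := by
    intro v
    have h1 : δ.2.symm v = (genT Λ ^ (-j)).2 (mulEquiv hinj v) := by
      rw [LinearEquiv.symm_apply_eq]
      change v = (genS Λ).2.symm (mulEquiv hinj ((genS Λ).2 ((genT Λ ^ j).2 _)))
      have h2 : (genT Λ ^ j).2 ((genT Λ ^ (-j)).2 (mulEquiv hinj v)) = mulEquiv hinj v := by
        have := congrArg (fun x : Ext Λ => x.2 (mulEquiv hinj v)) (mul_inv_cancel (genT Λ ^ j))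
        rw [← zpow_neg] at this
        exact this
      rw [h2, LinearEquiv.eq_symm_apply]
      exact ((genS Λ).2.injective (genS_conj_snd hinj v)).symm
    rw [h1, genT_zpow_snd, mulEquiv_apply, neg_smul]
  rw [slash, hdet, hφ, sq_rpow_div_four, Pi.smul_apply, Pi.smul_apply, smul_eq_mul, smul_eq_mul, hU,
    ← comp_eq f (p • y) hM, ← mul_assoc]
  congr 1
  rw [← Complex.ofReal_natCast p, ← Complex.ofReal_zpow, ← Complex.ofReal_mul]
  congr 1
  rw [← Real.rpow_intCast, ← Real.rpow_add hp]
  congr 1; push_cast; ring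

open Matrix.SpecialLinearGroup in
/-- Representatives with matrix `(p, h; 0, p)`. -/
theorem exists_middle (hinj : Function.Injective fun y : Λ.Disc => p • y)
    {b : Module.Basis (Fin n) ℚ V} (hb : Λ.L = Submodule.span ℤ (Set.range b))
    {h : ℤ} (hph : IsCoprime (p : ℤ) h) (hlev : ∀ x : Λ.Disc, h • Λ.qbar x = 0) :
    ∃ x ∈ weilGroup Λ, ∃ g ∈ weilGroup Λ, ∃ γ : SL(2, ℤ), x.1.M = mapGL ℝ γ ∧
      γ 1 0 = p ∧ γ 1 1 = h ∧
      (∀ τ : ℍ, (((g * heckeElt hinj * x).1.M • τ : ℍ) : ℂ) = τ + h / p) ∧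
      (∀ τ : ℍ, (g * heckeElt hinj * x).1.φ τ = (Real.sqrt p : ℂ)) ∧
      ∀ v, (g * heckeElt hinj * x).2.symm v =
        ((Real.sqrt p : ℂ) ^ n * (((p : ℂ) ^ n)⁻¹ * latticeGauss Λ b p (-h))) • v := by
  have hp : 0 < p := (Fact.out : p.Prime).pos
  have hpr : (p : ℝ) ≠ 0 := by exact_mod_cast hp.ne'
  have hpc : (p : ℂ) ≠ 0 := by exact_mod_cast hp.ne'
  obtain ⟨D⟩ := Λ.nonempty_diag
  obtain ⟨r, s, hrs⟩ := hph
  -- `s h - (-r) p = 1`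
  obtain ⟨γ, h00, h01, h10, h11⟩ := exists_SL2 (a := s) (b := -r) (c := p) (d := h)
    (by linear_combination hrs)
  -- With γ = (s, -r; p, h), the factorisation αγ = (ps, -1; 1, 0)(p, h; 0, p) holds because sh + rp
  -- = 1. Its left factor is the matrix of T^(ps) S.
  set g₀ : Ext Λ := genT Λ ^ ((p : ℤ) * s) * genS Λ with hg₀
  have hg₀m : g₀ ∈ weilGroup Λ := mul_mem (zpow_mem genT_mem _) genS_mem
  have hM : ∀ x ∈ weilGroup Λ, x.1.M = mapGL ℝ γ → ∀ τ : ℍ,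
      (((g₀⁻¹ * heckeElt hinj * x).1.M • τ : ℍ) : ℂ) = τ + h / p := by
    intro x _ hxγ τ
    have h1 : g₀.1.M • ((g₀⁻¹ * heckeElt hinj * x).1.M • τ) = (Mp.α p).M • x.1.M • τ := by
      rw [← mul_smul, ← Mp.mul_M, ← Prod.fst_mul, ← mul_smul]
      have : g₀ * (g₀⁻¹ * heckeElt hinj * x) = heckeElt hinj * x := by group
      rw [this]; rfl
    have h2 := congrArg (fun z : ℍ => (z : ℂ)) h1
    set T := (g₀⁻¹ * heckeElt hinj * x).1.M • τ
    have h3 : g₀.1.M • T = (genT Λ ^ ((p : ℤ) * s)).1.M • Mp.S.M • T := by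
      rw [hg₀, Prod.fst_mul, Mp.mul_M, mul_smul]; rfl
    rw [h3] at h2
    simp only [coe_genT_zpow_smul, coe_S_smul, coe_α_smul, hxγ, coe_mapGL_smul, h00, h01, h10,
      h11] at h2
    have hT : (T : ℂ) ≠ 0 := UpperHalfPlane.ne_zero _
    have hden : ((p : ℤ) : ℂ) * τ + h ≠ 0 := by
      have := UpperHalfPlane.denom_ne_zero (mapGL ℝ γ) τ
      rwa [denom_mapGL, h10, h11] at this
    have hrs' : ((r : ℂ) * p + s * h) = 1 := by exact_mod_cast hrs
    push_cast at h2 hden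
    have h4 : (p : ℂ) * T = p * τ + h := by
      field_simp at h2
      linear_combination h2 + (-(p : ℂ) * T) * hrs'
    field_simp
    linear_combination h4
  -- The function φ of the product has square p, so it is constantly √p or -√p. In the second case x
  -- is replaced by S⁴x.
  obtain ⟨x, hx, hxγ, hφ⟩ : ∃ x ∈ weilGroup Λ, x.1.M = mapGL ℝ γ ∧
      ∀ τ : ℍ, (g₀⁻¹ * heckeElt hinj * x).1.φ τ = (Real.sqrt p : ℂ) := by
    obtain ⟨x, hx, hxγ⟩ := exists_lift (Λ := Λ) γ
    let y : Mp := ⟨(g₀⁻¹ * heckeElt hinj * x).1.M, fun _ => (Real.sqrt p : ℂ),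
      (g₀⁻¹ * heckeElt hinj * x).1.det_pos, continuous_const, fun τ => by
        have e0 : g₀ * (g₀⁻¹ * heckeElt hinj * x) = heckeElt hinj * x := by group
        have h1 := congrArg (fun x : Ext Λ => x.1.φ τ) e0
        simp only [Prod.fst_mul g₀, Mp.mul_φ] at h1
        have h2 : (heckeElt hinj * x).1.φ τ = x.1.φ τ := one_mul _
        have h3 : ∀ T, g₀.1.φ T = Mp.S.φ T := fun T => by
          rw [hg₀, Prod.fst_mul, Mp.mul_φ, genT_zpow_φ, one_mul]; rfl
        rw [h2, h3] at h1
        have h4 := congrArg (· ^ 2) h1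
        simp only [mul_pow, Mp.sq] at h4
        rw [S_M, hxγ, denom_mapGL, denom_mapGL, hM x hx hxγ, h10, h11] at h4
        simp [ModularGroup.S] at h4
        rw [← Complex.ofReal_pow, Real.sq_sqrt (by positivity)]
        have hden : (p : ℂ) * τ + h ≠ 0 := by
          have := UpperHalfPlane.denom_ne_zero (mapGL ℝ γ) τ
          rw [denom_mapGL, h10, h11] at this
          exact_mod_cast this
        have h5 : ((τ : ℂ) + h / p) * p = p * τ + h := by field_simp
        rw [← h5] at h4 hden
        push_cast
        exact (mul_left_cancel₀ (left_ne_zero_of_mul hden) h4).symm⟩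
    rcases Mp.φ_eq_or_neg (x := (g₀⁻¹ * heckeElt hinj * x).1) (y := y) rfl with h1 | h1
    · exact ⟨x, hx, hxγ, fun τ => congrFun h1 τ⟩
    · have hM4 : (genS Λ ^ 4 * x).1.M = x.1.M := by
        change (Mp.S ^ 4).M * x.1.M = _
        rw [Mp.S_pow_four_M, one_mul]
      refine ⟨genS Λ ^ 4 * x, mul_mem genS_pow_four_mem hx, hM4.trans hxγ, fun τ => ?_⟩
      have h2 := congrFun h1 τ
      rw [Prod.fst_mul, Mp.mul_φ] at h2 ⊢
      rw [hM4]
      have h3 : (genS Λ ^ 4 * x).1.φ τ = -x.1.φ τ := by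
        change (Mp.S ^ 4).φ _ * _ = _
        rw [Mp.S_pow_four_φ]; ring
      rw [h3, mul_neg, h2]
      simp [y]
  refine ⟨x, hx, g₀⁻¹, inv_mem hg₀m, γ, hxγ, h10, h11, hM x hx hxγ, hφ, ?_⟩
  set δ := g₀⁻¹ * heckeElt hinj * x with hδ
  set c : ℂ := ((p : ℂ) ^ n)⁻¹ * latticeGauss Λ b p (-h) with hc
  suffices hlin : ((Real.sqrt p : ℂ) ^ n * c) • (δ.2 : GrpAlg Λ →ₗ[ℂ] GrpAlg Λ) = LinearMap.id by
    intro v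
    rw [LinearEquiv.symm_apply_eq, map_smul]
    exact (LinearMap.congr_fun hlin v).symm
  refine D.linearMap_ext_Theta fun u W T => ?_
  obtain ⟨τ, hτ⟩ : ∃ τ : ℍ, (τ : ℂ) + h / p = T := by
    refine ⟨⟨(T : ℂ) - h / p, ?_⟩, ?_⟩
    · have : ((h : ℂ) / p) = ((h / p : ℝ) : ℂ) := by push_cast; rfl
      rw [this]; simpa using T.im_pos
    · change (T : ℂ) - h / p + h / p = T
      ring
  -- The point τ = T - h/p and the characteristic W + (h/p)u are chosen so that the translation in
  -- `Theta_middle` leads to the theta function at T with characteristics u and W. The left-hand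
  -- side is rewritten through the transformation law of g₀; cancelling g₀ leaves the scalar.
  have hmid := D.Theta_middle hp hinj hb hx hxγ h10 (by rw [h11]; exact hlev) u
    (W + (h / p : ℝ) • u) τ
  have hMτ : δ.1.M • τ = T := by ext1; rw [hM x hx hxγ, hτ]
  have hg₀γ : g₀.1.M = mapGL ℝ (ModularGroup.T ^ ((p : ℤ) * s) * ModularGroup.S) := by
    rw [hg₀, Prod.fst_mul, Mp.mul_M, genT_zpow_M, map_mul, ← S_M]; rfl
  have htr := theta_transform D hg₀m hg₀γ T u W
  have e0 : g₀ * δ = heckeElt hinj * x := by rw [hδ]; group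
  have e1 : (p : ℂ) ^ 2 * ((x.1.M • τ : ℍ) : ℂ) = ((g₀.1.M • T : ℍ) : ℂ) := by
    rw [← coe_α_smul, ← hMτ]
    have := congrArg (fun x : Ext Λ => x.1.M • τ) e0
    simp only [Prod.fst_mul, Mp.mul_M, mul_smul] at this
    rw [this]; rfl
  have hrs' : ((r : ℝ) * p + s * h) = 1 := by exact_mod_cast hrs
  obtain ⟨t00, t01, t10, t11⟩ := T_zpow_mul_S_apply ((p : ℤ) * s)
  have e2 : (p : ℝ)⁻¹ • uAct γ u (W + (h / p : ℝ) • u) =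
      uAct (ModularGroup.T ^ ((p : ℤ) * s) * ModularGroup.S) u W := by
    funext i
    simp only [uAct, Pi.smul_apply, Pi.add_apply, smul_eq_mul, h10, h11, t10, t11]
    push_cast
    field_simp; ring
  have e3 : (p : ℝ) • wAct γ u (W + (h / p : ℝ) • u) =
      wAct (ModularGroup.T ^ ((p : ℤ) * s) * ModularGroup.S) u W := by
    funext i
    simp only [wAct, Pi.smul_apply, Pi.add_apply, smul_eq_mul, h00, h01, t00, t01]
    push_cast
    field_simp
    linear_combination (u i) * hrs'
  have e4 : (W + (h / p : ℝ) • u) - ((γ 1 1 : ℝ) / p) • u = W := by rw [h11]; simp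
  have e5 : (τ : ℂ) + ((γ 1 1 / p : ℝ) : ℂ) = T := by rw [h11, ← hτ]; push_cast; rfl
  have e6 : x.1.φ τ = g₀.1.φ T * (Real.sqrt p : ℂ) := by
    have h1 := congrArg (fun x : Ext Λ => x.1.φ τ) e0
    simp only [Prod.fst_mul g₀, Mp.mul_φ] at h1
    have h2 : (heckeElt hinj * x).1.φ τ = x.1.φ τ := one_mul _
    rw [hMτ, h2, hδ, hφ] at h1
    exact h1.symm
  rw [e1, e2, e3, htr, e4, e5, h11, ← hc, e6, D.jf_mul, D.jf_ofReal, mul_smul] at hmid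
  have h7 := smul_right_injective _ (D.jf_ne_zero (g₀.1.φ_ne_zero T)) hmid
  have h8 : δ.2 (D.Theta u W T) = g₀.2.symm (mulEquiv hinj (x.2 (D.Theta u W T))) := rfl
  rw [LinearMap.smul_apply, LinearMap.id_apply]
  change _ • δ.2 (D.Theta u W T) = _
  rw [h8]
  have h9 := congrArg g₀.2.symm h7
  rw [LinearEquiv.symm_apply_apply] at h9
  conv_rhs => rw [h9]
  simp only [map_smul, smul_smul]

end

end VVMF
end

noncomputable section
namespace VVMF

/-! ### The explicit Hecke operator -/

open Complex Filter Topology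

open EvenLattice

variable {V : Type*} [AddCommGroup V] [Module ℚ V] [FiniteDimensional ℚ V] {Λ : EvenLattice V}

local notation "n" => Module.finrank ℚ V

variable {p : ℕ} [Fact p.Prime]

/-- The contribution of the representatives `(p, h; 0, p)`. -/
theorem slash_middle (hinj : Function.Injective fun y : Λ.Disc => p • y) (κ : ℤ)
    (f : ℍ → GrpAlg Λ) {x g : Ext Λ} (hx : x ∈ weilGroup Λ) (hg : g ∈ weilGroup Λ) {h : ℤ} {c : ℂ}
    (hM : ∀ τ : ℍ, (((g * heckeElt hinj * x).1.M • τ : ℍ) : ℂ) = τ + h / p)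
    (hφ : ∀ τ : ℍ, (g * heckeElt hinj * x).1.φ τ = (Real.sqrt p : ℂ))
    (hU : ∀ v, (g * heckeElt hinj * x).2.symm v = c • v) (τ : ℍ) (y : Λ.Disc) :
    slash Λ κ f (g * heckeElt hinj * x) τ y = c * comp f y (τ + h / p) := by
  have hp : 0 < (p : ℝ) := by exact_mod_cast (Fact.out : p.Prime).pos
  rw [slash, det_coset hinj hg hx, hφ, sq_rpow_div_four, hU]
  simp only [Pi.smul_apply, smul_eq_mul]
  rw [← comp_eq f y (hM τ), ← mul_assoc, ← Complex.ofReal_zpow, ← Complex.ofReal_mul]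
  have : (p : ℝ) ^ ((κ : ℝ) / 2) * Real.sqrt p ^ (-κ) = 1 := by
    rw [Real.sqrt_eq_rpow, ← Real.rpow_intCast, ← Real.rpow_mul hp.le, ← Real.rpow_add hp]
    rw [show (κ : ℝ) / 2 + 1 / 2 * ((-κ : ℤ) : ℝ) = 0 by push_cast; ring, Real.rpow_zero]
  rw [this]; simp

theorem S_mul_T_zpow_apply (k : ℤ) : (ModularGroup.S * ModularGroup.T ^ k) 1 0 = 1 ∧
    (ModularGroup.S * ModularGroup.T ^ k) 1 1 = k := by
  rw [Matrix.SpecialLinearGroup.coe_mul, ModularGroup.coe_T_zpow]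
  simp [ModularGroup.S, Matrix.mul_apply, Fin.sum_univ_two]

theorem isCoprime_level_mul (hlev : ¬ p ∣ Λ.level) (h : Fin (p - 1)) :
    IsCoprime (p : ℤ) ((Λ.level : ℤ) * ((h : ℕ) + 1)) := by
  have hp := (Fact.out : p.Prime)
  refine IsCoprime.mul_right ?_ ?_
  · exact Nat.isCoprime_iff_coprime.mpr ((Nat.Prime.coprime_iff_not_dvd hp).mpr hlev)
  · have : Nat.Coprime p (h + 1) := (Nat.Prime.coprime_iff_not_dvd hp).mpr fun hd => by
      have := Nat.le_of_dvd (by omega) hd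
      have := h.2
      omega
    exact_mod_cast Nat.isCoprime_iff_coprime.mpr this

theorem level_mul_smul_qbar (hlev : ¬ p ∣ Λ.level) (k : ℤ) (x : Λ.Disc) :
    ((Λ.level : ℤ) * k) • Λ.qbar x = 0 := by
  rw [mul_comm, mul_smul, natCast_zsmul, level_smul_qbar fun h => hlev (h ▸ dvd_zero p), smul_zero]

theorem dvd_of_sq_dvd_mul {a : ℤ} (h : (p : ℤ) ^ 2 ∣ p * a) : (p : ℤ) ∣ a := by
  have hp : (p : ℤ) ≠ 0 := by exact_mod_cast (Fact.out : p.Prime).ne_zero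
  rw [sq] at h
  exact (mul_dvd_mul_iff_left hp).mp h

open Matrix.SpecialLinearGroup in
-- The bottom rows (0, 1), (1, j) and (p, level·h) with 1 ≤ h < p represent ℙ¹(ℤ/p²). The factor
-- `level`, a unit modulo p, makes the last entry annihilate the quadratic form on A, as
-- `exists_middle` requires. The component at p•y is taken because there the contribution of α is
-- simply the component of f at y.
theorem heckeOp_apply (hinj : Function.Injective fun y : Λ.Disc => p • y) (hlev : ¬ p ∣ Λ.level)
    {b : Module.Basis (Fin n) ℚ V} (hb : Λ.L = Submodule.span ℤ (Set.range b))
    {κ : ℤ} {f : ℍ → GrpAlg Λ} (hf : IsCuspForm Λ κ f) (τ : ℍ) (y : Λ.Disc) :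
    heckeOp Λ κ p f τ (p • y) = (((p : ℝ) ^ ((κ : ℝ) / 2 - 2) : ℝ) : ℂ) *
      ((((p : ℝ) ^ ((κ : ℝ) / 2) : ℝ) : ℂ) * comp f y (p ^ 2 * τ) +
       ((((p : ℝ) ^ (-((κ : ℝ) / 2)) : ℝ) : ℂ) * ∑ j : Fin (p ^ 2),
          e (-((j : ℕ) • Λ.qbar (p • y))) * comp f (p • p • y) ((τ + (j : ℕ)) / p ^ 2) +
        ∑ h : Fin (p - 1), ((Real.sqrt p : ℂ) ^ n * (((p : ℂ) ^ n)⁻¹ *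
          latticeGauss Λ b p (-((Λ.level : ℤ) * ((h : ℕ) + 1))))) *
          comp f (p • y) (τ + ((Λ.level : ℤ) * ((h : ℕ) + 1) : ℤ) / p))) := by
  have hp := (Fact.out : p.Prime)
  have hpi : Prime (p : ℤ) := Nat.prime_iff_prime_int.mp hp
  choose x hx g hg γ hγ h10 h11 hM hφ hU using fun h : Fin (p - 1) =>
    exists_middle hinj hb (isCoprime_level_mul hlev h) (level_mul_smul_qbar hlev _)
  let X : Option (Fin (p ^ 2) ⊕ Fin (p - 1)) → Ext Λ := fun i => match i with
    | none => 1
    | some (Sum.inl j) => genS Λ * genT Λ ^ ((j : ℕ) : ℤ)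
    | some (Sum.inr h) => x h
  let Γ : Option (Fin (p ^ 2) ⊕ Fin (p - 1)) → SL(2, ℤ) := fun i => match i with
    | none => 1
    | some (Sum.inl j) => ModularGroup.S * ModularGroup.T ^ ((j : ℕ) : ℤ)
    | some (Sum.inr h) => γ h
  have hX : ∀ i, X i ∈ weilGroup Λ := by
    rintro (_ | j | h)
    · exact one_mem _
    · exact mul_mem genS_mem (zpow_mem genT_mem _)
    · exact hx h
  have hXΓ : ∀ i, (X i).1.M = mapGL ℝ (Γ i) := by
    rintro (_ | j | h)
    · simp [X, Γ]
    · simp only [X, Γ, Prod.fst_mul, Mp.mul_M, genT_zpow_M, map_mul, ← S_M]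
      rfl
    · exact hγ h
  have r1 : (Γ none) 1 0 = 0 ∧ (Γ none) 1 1 = 1 := by simp [Γ]
  have r2 : ∀ j, (Γ (some (Sum.inl j))) 1 0 = 1 ∧ (Γ (some (Sum.inl j))) 1 1 = (j : ℕ) :=
    fun j => S_mul_T_zpow_apply _
  have r3 : ∀ h, (Γ (some (Sum.inr h))) 1 0 = p ∧
      (Γ (some (Sum.inr h))) 1 1 = (Λ.level : ℤ) * ((h : ℕ) + 1) := fun h => ⟨h10 h, h11 h⟩
  have hpn : ∀ a : ℤ, (p : ℤ) ^ 2 ∣ a → (p : ℤ) ∣ a := fun a h => (Dvd.intro_left _ rfl : (p : ℤ) ∣ p ^ (1 : ℕ) * p).trans (by rwa [← pow_succ])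
  have hp1 : ¬ (p : ℤ) ∣ 1 := hpi.not_dvd_one
  have hlevi : ¬ (p : ℤ) ∣ Λ.level := by exact_mod_cast hlev
  have hh : ∀ h : Fin (p - 1), ¬ (p : ℤ) ∣ (Λ.level : ℤ) * ((h : ℕ) + 1) := fun h hd =>
    hpi.not_isUnit ((isCoprime_level_mul hlev h).isUnit_of_dvd' dvd_rfl hd)
  obtain ⟨hinj', hrange⟩ := range_coset_reps hinj hX hXΓ (by
    rintro (_ | j | h) (_ | j' | h') hd
    · rfl
    · rw [r1.1, r1.2, (r2 j').1, (r2 j').2] at hd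
      exact absurd (hpn _ hd) (by simpa using hp1)
    · rw [r1.1, r1.2, (r3 h').1, (r3 h').2] at hd
      exact absurd (dvd_of_sq_dvd_mul (a := 1) (by simpa using hd)) hp1
    · rw [r1.1, r1.2, (r2 j).1, (r2 j).2] at hd
      exact absurd (hpn _ hd) (by simpa using hp1)
    · rw [(r2 j).1, (r2 j).2, (r2 j').1, (r2 j').2] at hd
      have h1 : ((j : ℕ) : ℤ) ≡ (j' : ℕ) [ZMOD ((p ^ 2 : ℕ) : ℤ)] :=
        Int.modEq_iff_dvd.mpr (by
          push_cast
          rw [show ((j' : ℕ) : ℤ) - (j : ℕ) = -(1 * (j : ℕ) - (j' : ℕ) * 1) by ring]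
          exact (dvd_neg).mpr hd)
      have : j = j' := Fin.ext (Nat.ModEq.eq_of_lt_of_lt (Int.natCast_modEq_iff.mp h1) j.2 j'.2)
      rw [this]
    · rw [(r2 j).1, (r2 j).2, (r3 h').1, (r3 h').2] at hd
      refine absurd ?_ (hh h')
      have := hpn _ hd
      rw [mul_one] at this
      exact (dvd_sub_right (Dvd.intro _ rfl)).mp this
    · rw [(r3 h).1, (r3 h).2, r1.1, r1.2] at hd
      exact absurd (dvd_of_sq_dvd_mul (a := -1) (by simpa using hd)) (by simpa using hp1)
    · rw [(r2 j').1, (r2 j').2, (r3 h).1, (r3 h).2] at hd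
      refine absurd ?_ (hh h)
      have := hpn _ hd
      rw [one_mul] at this
      exact (dvd_sub_left (Dvd.intro_left _ rfl)).mp this
    · rw [(r3 h').1, (r3 h').2, (r3 h).1, (r3 h).2] at hd
      have h1 : (p : ℤ) ∣ (Λ.level : ℤ) * ((h : ℕ) - (h' : ℕ)) := dvd_of_sq_dvd_mul (by
        convert hd using 1; ring)
      have h2 := (hpi.dvd_or_dvd h1).resolve_left hlevi
      have h3 : ((h' : ℕ) : ℤ) ≡ (h : ℕ) [ZMOD (p : ℤ)] := Int.modEq_iff_dvd.mpr h2
      have : h = h' := (Fin.ext (Nat.ModEq.eq_of_lt_of_lt (Int.natCast_modEq_iff.mp h3)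
        (by have := h'.2; omega) (by have := h.2; omega))).symm
      rw [this]) (by
    intro γ'
    have hdet := det_mul_sub γ'
    by_cases h1 : (p : ℤ) ∣ γ' 1 0
    · obtain ⟨c, hc⟩ := h1
      by_cases h2 : (p : ℤ) ∣ c
      · refine ⟨none, ?_⟩
        rw [r1.1, r1.2, hc]
        obtain ⟨c', rfl⟩ := h2
        exact ⟨c', by ring⟩
      -- For a bottom row (pc, d) with p ∤ c the index k must satisfy c·level·k ≡ d mod p. The
      -- solution is d times the inverse v of level·c; it is nonzero because determinant 1 excludes
      -- p ∣ d.
      · have hcop : IsCoprime (p : ℤ) ((Λ.level : ℤ) * c) :=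
          (hpi.coprime_iff_not_dvd.mpr hlevi).mul_right (hpi.coprime_iff_not_dvd.mpr h2)
        obtain ⟨u, v, huv⟩ := hcop
        have hpos : (0 : ℤ) < p := by exact_mod_cast hp.pos
        set k : ℤ := (v * γ' 1 1) % p with hk
        have hk0 := Int.emod_nonneg (v * γ' 1 1) hpos.ne'
        have hk1 := Int.emod_lt_of_pos (v * γ' 1 1) hpos
        have hkd : (p : ℤ) ∣ v * γ' 1 1 - k := Int.dvd_self_sub_emod
        have hkey : (p : ℤ) ∣ c * ((Λ.level : ℤ) * k) - γ' 1 1 := by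
          obtain ⟨w, hw⟩ := hkd
          refine ⟨-(c * Λ.level * w) - u * γ' 1 1, ?_⟩
          linear_combination (-(c * Λ.level)) * hw + (γ' 1 1) * huv
        have hkne : k ≠ 0 := by
          intro hk'
          rw [hk'] at hkey
          have h5 : (p : ℤ) ∣ γ' 1 1 := by simpa using hkey
          refine hp1 ?_
          rw [← hdet]
          exact dvd_sub (h5.mul_left _) ((Dvd.intro _ hc.symm).mul_left _)
        refine ⟨some (Sum.inr ⟨k.toNat - 1, by omega⟩), ?_⟩
        rw [(r3 _).1, (r3 _).2, hc]
        have h6 : ((((⟨k.toNat - 1, by omega⟩ : Fin (p - 1)) : ℕ) : ℤ) + 1) = k := by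
          simp only; omega
        rw [h6]
        obtain ⟨w, hw⟩ := hkey
        exact ⟨w, by linear_combination (p : ℤ) * hw⟩
    · have hcop : IsCoprime ((p : ℤ) ^ 2) (γ' 1 0) := (hpi.coprime_iff_not_dvd.mpr h1).pow_left
      obtain ⟨u, v, huv⟩ := hcop
      have hpos0 : (0 : ℤ) < p := by exact_mod_cast hp.pos
      have hpos : (0 : ℤ) < (p : ℤ) ^ 2 := by positivity
      set k : ℤ := (v * γ' 1 1) % (p : ℤ) ^ 2 with hk
      have hk0 := Int.emod_nonneg (v * γ' 1 1) hpos.ne'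
      have hk1 := Int.emod_lt_of_pos (v * γ' 1 1) hpos
      have hkd : (p : ℤ) ^ 2 ∣ v * γ' 1 1 - k := Int.dvd_self_sub_emod
      have hlt : k.toNat < p ^ 2 := by
        have : (k.toNat : ℤ) < ((p ^ 2 : ℕ) : ℤ) := by push_cast; omega
        exact_mod_cast this
      refine ⟨some (Sum.inl ⟨k.toNat, hlt⟩), ?_⟩
      rw [(r2 _).1, (r2 _).2]
      have h6 : (((⟨k.toNat, hlt⟩ : Fin (p ^ 2)) : ℕ) : ℤ) = k := by simp only; omega
      rw [h6]
      obtain ⟨w, hw⟩ := hkd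
      refine ⟨-(γ' 1 0 * w) - u * γ' 1 1, ?_⟩
      linear_combination (-(γ' 1 0)) * hw + (γ' 1 1) * huv)
  rw [heckeOp_eq_sum hf _ hinj' hrange, Pi.smul_apply, Pi.smul_apply, smul_eq_mul]
  congr 1
  rw [Fintype.sum_option, Fintype.sum_sum_type, Pi.add_apply, Pi.add_apply, Pi.add_apply,
    Pi.add_apply, Finset.sum_apply, Finset.sum_apply, Finset.sum_apply, Finset.sum_apply]
  congr 1
  · rw [← slash_heckeElt hinj κ f τ y]
    congr 3
    exact mul_one _
  · congr 1
    · rw [Finset.mul_sum]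
      refine Finset.sum_congr rfl fun j _ => ?_
      have h1 := slash_lower hinj κ f ((j : ℕ) : ℤ) τ (p • y)
      rw [natCast_zsmul, Int.cast_natCast] at h1
      rw [← h1]
      refine congrFun (congrFun (slash_eq_of_mul_inv_mem hf ?_) τ) (p • y)
      have : (genS Λ)⁻¹ * heckeElt hinj * (genS Λ * genT Λ ^ ((j : ℕ) : ℤ)) *
          (heckeElt hinj * X (some (Sum.inl j)))⁻¹ = (genS Λ)⁻¹ := by simp only [X]; group
      rw [this]
      exact inv_mem genS_mem
    · refine Finset.sum_congr rfl fun h _ => ?_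
      rw [← slash_middle hinj κ f (hx h) (hg h) (hM h) (hφ h) (hU h) τ (p • y)]
      refine congrFun (congrFun (slash_eq_of_mul_inv_mem hf ?_) τ) (p • y)
      have : g h * heckeElt hinj * x h * (heckeElt hinj * X (some (Sum.inr h)))⁻¹ = g h := by
        simp only [X]; group
      rw [this]
      exact hg h

end VVMF
end

noncomputable section
namespace VVMF

/-! ### Gauss sums of the lattice and of the discriminant form -/

open Complex Filter Topology

open EvenLattice

variable {V : Type*} [AddCommGroup V] [Module ℚ V] {Λ : EvenLattice V}

local notation "n" => Module.finrank ℚ V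

theorem latticeGauss_congr {b : Module.Basis (Fin n) ℚ V}
    (hb : Λ.L = Submodule.span ℤ (Set.range b)) {P : ℕ} (hP : 0 < P) {h h' : ℤ}
    (hh : h ≡ h' [ZMOD P]) : latticeGauss Λ b P h = latticeGauss Λ b P h' := by
  refine Finset.sum_congr rfl fun s _ => ?_
  obtain ⟨c, hc⟩ := Λ.even _ (resid_mem hb s)
  obtain ⟨k, hk⟩ := hh.symm.dvd
  have hP0 : (P : ℚ) ≠ 0 := by exact_mod_cast hP.ne'
  refine eQ_congr ⟨k * c, ?_⟩
  have : (h : ℚ) = h' + P * k := by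
    have h2 : h = h' + P * k := by omega
    rw [h2]; push_cast; rfl
  rw [hc, this]
  push_cast
  field_simp

theorem conj_latticeGauss (b : Module.Basis (Fin n) ℚ V) (P : ℕ) (h : ℤ) :
    (starRingEnd ℂ) (latticeGauss Λ b P h) = latticeGauss Λ b P (-h) := by
  rw [latticeGauss, latticeGauss, map_sum]
  refine Finset.sum_congr rfl fun s _ => ?_
  rw [conj_eQ]
  congr 1; push_cast; ring

theorem sqrt_re_im_pos {z : ℂ} (hz : 0 < z.im) :
    0 < (z ^ (1 / 2 : ℂ)).re ∧ 0 < (z ^ (1 / 2 : ℂ)).im := by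
  have hz0 : z ≠ 0 := by rintro rfl; simp at hz
  have harg : 0 < z.arg := by
    rcases (Complex.arg_nonneg_iff.mpr hz.le).eq_or_lt with h | h
    · have := (Complex.arg_eq_zero_iff.mp h.symm).2; rw [this] at hz; exact absurd hz (lt_irrefl _)
    · exact h
  have hne : z.arg ≠ Real.pi := by
    intro h; have := (Complex.arg_eq_pi_iff.mp h).2; rw [this] at hz; exact lt_irrefl _ hz
  have hlt : z.arg < Real.pi := lt_of_le_of_ne (Complex.arg_le_pi z) hne
  have hexp : z ^ (1 / 2 : ℂ) = cexp (((Real.log ‖z‖ / 2 : ℝ) : ℂ) + ((z.arg / 2 : ℝ) : ℂ) * I) := by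
    rw [Complex.cpow_def_of_ne_zero hz0, Complex.log]
    congr 1; push_cast; ring
  rw [hexp, Complex.exp_add, ← Complex.ofReal_exp, Complex.re_ofReal_mul, Complex.im_ofReal_mul,
    Complex.exp_ofReal_mul_I_re, Complex.exp_ofReal_mul_I_im]
  exact ⟨mul_pos (Real.exp_pos _) (Real.cos_pos_of_mem_Ioo ⟨by linarith, by linarith⟩),
    mul_pos (Real.exp_pos _) (Real.sin_pos_of_pos_of_lt_pi (by linarith) (by linarith))⟩

theorem sqrt_sq (z : ℂ) : (z ^ (1 / 2 : ℂ)) ^ 2 = z := by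
  rw [← Complex.cpow_nat_mul]; simp

/-- Both sides have the same square. All three principal roots lie in the open first quadrant, so
both sides have positive imaginary part, and the sign is +. -/
theorem sqrt_mul_sqrt {P : ℕ} (hP : 0 < P) {τ : ℂ} (hτ : 0 < τ.im) :
    (-1 / τ + P) ^ (1 / 2 : ℂ) * τ ^ (1 / 2 : ℂ) =
      (Real.sqrt P : ℂ) * (τ + ((-1 / P : ℝ) : ℂ)) ^ (1 / 2 : ℂ) := by
  have hτ0 : τ ≠ 0 := by rintro rfl; simp at hτ
  have hP0 : (P : ℂ) ≠ 0 := by exact_mod_cast hP.ne'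
  have h1 : 0 < (-1 / τ + P).im := by
    have : (-1 / τ).im = τ.im / Complex.normSq τ := by
      rw [neg_div, one_div, Complex.neg_im, Complex.inv_im]; ring
    rw [Complex.add_im, this, Complex.natCast_im, add_zero]
    exact div_pos hτ (Complex.normSq_pos.mpr hτ0)
  have h2 : 0 < (τ + ((-1 / P : ℝ) : ℂ)).im := by
    rw [Complex.add_im, Complex.ofReal_im, add_zero]; exact hτ
  obtain ⟨a1, a2⟩ := sqrt_re_im_pos h1
  obtain ⟨b1, b2⟩ := sqrt_re_im_pos hτ
  obtain ⟨c1, c2⟩ := sqrt_re_im_pos h2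
  have hsqrt : 0 < Real.sqrt P := Real.sqrt_pos.mpr (by exact_mod_cast hP)
  have hsq : ((-1 / τ + P) ^ (1 / 2 : ℂ) * τ ^ (1 / 2 : ℂ)) ^ 2 =
      ((Real.sqrt P : ℂ) * (τ + ((-1 / P : ℝ) : ℂ)) ^ (1 / 2 : ℂ)) ^ 2 := by
    rw [mul_pow, mul_pow, sqrt_sq, sqrt_sq, sqrt_sq, ← Complex.ofReal_pow, Real.sq_sqrt (by positivity)]
    push_cast
    field_simp; ring
  rcases sq_eq_sq_iff_eq_or_eq_neg.mp hsq with h | h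
  · exact h
  · exfalso
    have him := congrArg Complex.im h
    rw [Complex.mul_im, Complex.neg_im, Complex.im_ofReal_mul] at him
    have := mul_pos a1 b2
    have := mul_pos a2 b1
    have := mul_pos hsqrt c2
    linarith

variable [FiniteDimensional ℚ V]

theorem S_T_S_apply (k : ℤ) :
    (ModularGroup.S * ModularGroup.T ^ k * ModularGroup.S) 0 0 = -1 ∧
    (ModularGroup.S * ModularGroup.T ^ k * ModularGroup.S) 0 1 = 0 ∧
    (ModularGroup.S * ModularGroup.T ^ k * ModularGroup.S) 1 0 = k ∧
    (ModularGroup.S * ModularGroup.T ^ k * ModularGroup.S) 1 1 = -1 := by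
  rw [Matrix.SpecialLinearGroup.coe_mul, Matrix.SpecialLinearGroup.coe_mul, ModularGroup.coe_T_zpow]
  simp [ModularGroup.S, Matrix.mul_apply, Fin.sum_univ_two]

theorem genS_snd (v : GrpAlg Λ) (y : Λ.Disc) :
    (genS Λ).2 v y = Λ.weilConst * ∑ z : Λ.Disc, e (-Λ.bbar y z) * v z := rfl

/-- Reciprocity between the Gauss sums of `L/PL` and of the discriminant form. -/
theorem gauss_reciprocity {P : ℕ} (hP : 0 < P) (hinj : Function.Injective fun y : Λ.Disc => P • y)
    {b : Module.Basis (Fin n) ℚ V} (hb : Λ.L = Submodule.span ℤ (Set.range b)) :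
    (Real.sqrt P : ℂ) ^ n * (((P : ℂ) ^ n)⁻¹ * latticeGauss Λ b P 1) *
      (Λ.weilConst * gaussSum Λ P) = 1 := by
  classical
  obtain ⟨D⟩ := Λ.nonempty_diag
  have hP0 : (P : ℝ) ≠ 0 := by exact_mod_cast hP.ne'
  have hPc : (P : ℂ) ≠ 0 := by exact_mod_cast hP.ne'
  -- The matrices (-1, 0; P, -1) of x and (-P, -1; 1, 0) of g satisfy P²·xτ = g(τ - 1/P). The theta
  -- function at this point is computed both by `Theta_scale_transform` and by the transformation
  -- law of g. In the component at 0, with τ = iT and T → ∞, one side gives ρ(g), the other a Gauss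
  -- sum of L/PL times ρ(x), whose entry contains G_A(P).
  set x : Ext Λ := genS Λ * genT Λ ^ (P : ℤ) * genS Λ with hx
  set g : Ext Λ := genT Λ ^ (-(P : ℤ)) * genS Λ with hg
  have hxm : x ∈ weilGroup Λ := mul_mem (mul_mem genS_mem (zpow_mem genT_mem _)) genS_mem
  have hgm : g ∈ weilGroup Λ := mul_mem (zpow_mem genT_mem _) genS_mem
  obtain ⟨s00, s01, s10, s11⟩ := S_T_S_apply (P : ℤ)
  set γ := ModularGroup.S * ModularGroup.T ^ (P : ℤ) * ModularGroup.S
  have hxγ : x.1.M = Matrix.SpecialLinearGroup.mapGL ℝ γ := by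
    simp only [hx, γ, Prod.fst_mul, Mp.mul_M, genT_zpow_M, map_mul, ← S_M]; rfl
  have hgγ : g.1.M = Matrix.SpecialLinearGroup.mapGL ℝ
      (ModularGroup.T ^ (-(P : ℤ)) * ModularGroup.S) := by
    rw [hg, Prod.fst_mul, Mp.mul_M, genT_zpow_M, map_mul, ← S_M]; rfl
  have hu0 : ∀ γ : SL(2, ℤ), uAct γ (0 : Fin n → ℝ) 0 = 0 := fun γ => by funext i; simp [uAct]
  have hw0 : ∀ γ : SL(2, ℤ), wAct γ (0 : Fin n → ℝ) 0 = 0 := fun γ => by funext i; simp [wAct]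
  -- the identity on the imaginary axis
  have key : ∀ T : ℝ, 0 < T → g.2 (D.Theta 0 0 (((-1 / P : ℝ) : ℂ) + I * T)) 0 =
      (Real.sqrt P : ℂ) ^ n * x.2 (((P : ℂ) ^ n)⁻¹ • ∑ s : Fin n → Fin P,
        D.Theta (-D.co (-resid b s)) ((-1 / P : ℝ) • D.co (resid b s)) ((0 : ℝ) + I * T)) 0 := by
    intro T hT
    let τ : ℍ := ⟨I * T, by simpa using hT⟩
    let T' : ℍ := ⟨((-1 / P : ℝ) : ℂ) + I * T, by
      rw [Complex.add_im, Complex.ofReal_im]; simpa using hT⟩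
    have hτ : (τ : ℂ) = I * T := rfl
    have hT' : (T' : ℂ) = τ + ((-1 / P : ℝ) : ℂ) := add_comm _ _
    have h1 := D.Theta_scale_transform hP hinj hb hxm hxγ (j := 1) (by rw [s10, mul_one]) 0 0 τ 0
    have h2 := theta_transform D hgm hgγ T' 0 0
    rw [hu0, hw0] at h1 h2
    rw [smul_zero, smul_zero] at h1
    have e1 : (P : ℂ) ^ 2 * ((x.1.M • τ : ℍ) : ℂ) = ((g.1.M • T' : ℍ) : ℂ) := by
      rw [hxγ, coe_mapGL_smul, s00, s01, s10, s11, hg, Prod.fst_mul, Mp.mul_M, mul_smul,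
        coe_genT_zpow_smul]
      have : (((genS Λ).1.M • T' : ℍ) : ℂ) = -1 / T' := coe_S_smul T'
      rw [this]
      have hT0 : (T' : ℂ) ≠ 0 := UpperHalfPlane.ne_zero _
      have h3 : (P : ℂ) * T' = P * τ + -1 := by rw [hT']; push_cast; field_simp
      have h4 : (P : ℂ) * τ + -1 ≠ 0 := by rw [← h3]; exact mul_ne_zero hPc hT0
      have h5 : (T' : ℂ) = (P * τ + -1) / P := by rw [← h3]; field_simp
      rw [h5]
      push_cast
      field_simp
      ring
    have e2 : x.1.φ τ = (Real.sqrt P : ℂ) * g.1.φ T' := by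
      have hgφ : g.1.φ T' = (T' : ℂ) ^ (1 / 2 : ℂ) := by
        rw [hg, Prod.fst_mul, Mp.mul_φ, genT_zpow_φ, one_mul]; rfl
      have hxφ : x.1.φ τ = (-1 / τ + P : ℂ) ^ (1 / 2 : ℂ) * (τ : ℂ) ^ (1 / 2 : ℂ) := by
        rw [hx, Prod.fst_mul, Mp.mul_φ, Prod.fst_mul, Mp.mul_φ, genT_zpow_φ, mul_one]
        have : (((genT Λ ^ (P : ℤ)).1.M • (genS Λ).1.M • τ : ℍ) : ℂ) = -1 / τ + P := by
          rw [coe_genT_zpow_smul]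
          have : (((genS Λ).1.M • τ : ℍ) : ℂ) = -1 / τ := coe_S_smul τ
          rw [this]; push_cast; rfl
        rw [← this]; rfl
      rw [hgφ, hxφ, hT']
      exact sqrt_mul_sqrt hP τ.im_pos
    have e3 : ∑ s : Fin n → Fin P, ee ((-(D.bil 0 (D.co (resid b s)) / (2 * P)) : ℝ) : ℂ) •
        D.Theta (0 + D.co ((1 : ℤ) • resid b s)) (0 + (γ 1 1 / P : ℝ) • D.co (resid b s)) τ =
        ∑ s : Fin n → Fin P,
        D.Theta (-D.co (-resid b s)) ((-1 / P : ℝ) • D.co (resid b s)) ((0 : ℝ) + I * T) := by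
      refine Finset.sum_congr rfl fun s _ => ?_
      have hb0 : D.bil 0 (D.co (resid b s)) = 0 := by simp [Diag.bil]
      rw [hb0, Diag.co_neg, neg_neg, zero_add, zero_add, one_smul, s11]
      simp [ee_zero, hτ]
    rw [e1, h2, e2, e3, smul_zero, D.jf_mul, D.jf_ofReal, Pi.smul_apply, smul_eq_mul, mul_comm (_ ^ _),
      mul_assoc] at h1
    exact mul_left_cancel₀ (D.jf_ne_zero (g.1.φ_ne_zero T')) h1
  have hcl : ∀ v ∈ Λ.L, ∀ (w : Fin n → ℝ) (σ : ℝ),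
      Tendsto (fun T : ℝ => D.Theta (-D.co v) w (σ + I * T)) atTop
      (𝓝 (ee (D.bil (D.co v) w / 2 : ℝ) • (Pi.single 0 1 : GrpAlg Λ))) := by
    intro v hv w σ
    rw [tendsto_pi_nhds]
    intro y
    convert D.tendsto_Theta v (L_le_dual hv) w σ y using 2
    rw [Pi.smul_apply, Pi.single_apply, smul_eq_mul]
    by_cases hy : y = 0
    · subst hy
      rw [if_pos rfl, if_pos (cls_zero_iff.mpr hv), mul_one]
    · rw [if_neg hy, if_neg fun h => hy (h.unique (cls_zero_iff.mpr hv)), mul_zero]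
  let A : GrpAlg Λ →ₗ[ℂ] ℂ := LinearMap.proj 0 ∘ₗ (g.2 : GrpAlg Λ →ₗ[ℂ] GrpAlg Λ)
  let B : GrpAlg Λ →ₗ[ℂ] ℂ := LinearMap.proj 0 ∘ₗ (x.2 : GrpAlg Λ →ₗ[ℂ] GrpAlg Λ)
  have l1 : Tendsto (fun T : ℝ => g.2 (D.Theta 0 0 (((-1 / P : ℝ) : ℂ) + I * T)) 0) atTop
      (𝓝 (A (Pi.single 0 1))) := by
    have h := (A.continuous_of_finiteDimensional.tendsto _).comp (hcl 0 (zero_mem _) 0 (-1 / P))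
    have h0 : D.bil (D.co 0) 0 = 0 := by rw [Diag.co_zero]; simp [Diag.bil]
    rw [h0] at h
    simp only [zero_div, Complex.ofReal_zero, ee_zero, one_smul, Diag.co_zero, neg_zero] at h
    exact h
  have l2 : Tendsto (fun T : ℝ => (Real.sqrt P : ℂ) ^ n * x.2 (((P : ℂ) ^ n)⁻¹ •
      ∑ s : Fin n → Fin P, D.Theta (-D.co (-resid b s)) ((-1 / P : ℝ) • D.co (resid b s))
        ((0 : ℝ) + I * T)) 0) atTop
      (𝓝 ((Real.sqrt P : ℂ) ^ n * B (((P : ℂ) ^ n)⁻¹ • ∑ s : Fin n → Fin P,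
        ee (D.bil (D.co (-resid b s)) ((-1 / P : ℝ) • D.co (resid b s)) / 2 : ℝ) •
          (Pi.single 0 1 : GrpAlg Λ)))) := by
    refine Tendsto.const_mul _ ((B.continuous_of_finiteDimensional.tendsto _).comp ?_)
    exact Tendsto.const_smul (tendsto_finsetSum _ fun s _ =>
      hcl _ (neg_mem (resid_mem hb s)) _ 0) _
  have hlim := tendsto_nhds_unique l1 (l2.congr' (by
    filter_upwards [eventually_gt_atTop 0] with T hT
    exact (key T hT).symm))
  have hA : A (Pi.single 0 1) = Λ.weilConst := by
    change g.2 (Pi.single 0 1) 0 = _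
    rw [hg, Prod.snd_mul, LinearEquiv.mul_apply, genT_zpow_snd, genS_snd]
    simp [Pi.single_apply]
  have hB : B (Pi.single 0 1) = Λ.weilConst * (Λ.weilConst * gaussSum Λ P) := by
    change x.2 (Pi.single 0 1) 0 = _
    rw [hx, Prod.snd_mul, LinearEquiv.mul_apply, Prod.snd_mul, LinearEquiv.mul_apply, genS_snd]
    congr 1
    rw [gaussSum, Finset.mul_sum]
    refine Finset.sum_congr rfl fun z _ => ?_
    rw [genT_zpow_snd, genS_snd]
    simp [Pi.single_apply, mul_comm]
  have hs : ∀ s : Fin n → Fin P,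
      ee (D.bil (D.co (-resid b s)) ((-1 / P : ℝ) • D.co (resid b s)) / 2 : ℝ) =
        eQ ((1 : ℤ) * Λ.q (resid b s) / P) := by
    intro s
    rw [eQ]
    congr 2
    have : D.co (-resid b s) = (-1 : ℝ) • D.co (resid b s) := by rw [Diag.co_neg]; simp
    rw [this, Diag.bil_smul_left, Diag.bil_smul_right, Diag.bil_self]
    push_cast
    field_simp
  simp only [hs, ← Finset.sum_smul, map_smul, hA, hB, smul_eq_mul] at hlim
  have hw := weilConst_ne_zero (Λ := Λ)
  apply mul_left_cancel₀ hw
  rw [mul_one]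
  conv_rhs => rw [hlim]
  rw [latticeGauss]
  ring

theorem normSq_mulEquiv {P : ℕ} (hinj : Function.Injective fun y : Λ.Disc => P • y)
    (v : GrpAlg Λ) : normSq (mulEquiv hinj v) = normSq v :=
  Equiv.sum_comp (Equiv.ofBijective _ (Finite.injective_iff_bijective.mp hinj))
    fun y => ‖v y‖ ^ 2

/-- By `exists_middle` the normalised Gauss sum is the scalar by which the inverse of a product of
isometries acts, so it has absolute value 1. Residues h of arbitrary shape are first moved into the
multiples of the level. -/
theorem norm_latticeGauss {p : ℕ} [Fact p.Prime] (hlev : ¬ p ∣ Λ.level)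
    {b : Module.Basis (Fin n) ℚ V} (hb : Λ.L = Submodule.span ℤ (Set.range b)) {h : ℤ}
    (hph : ¬ (p : ℤ) ∣ h) :
    ‖(Real.sqrt p : ℂ) ^ n * (((p : ℂ) ^ n)⁻¹ * latticeGauss Λ b p h)‖ = 1 := by
  classical
  have hp := (Fact.out : p.Prime)
  have hpi : Prime (p : ℤ) := Nat.prime_iff_prime_int.mp hp
  have hinj := nsmul_injective_of_not_dvd_level hp hlev
  have hlevi : ¬ (p : ℤ) ∣ Λ.level := by exact_mod_cast hlev
  obtain ⟨u, v, huv⟩ := hpi.coprime_iff_not_dvd.mpr hlevi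
  -- `h ≡ level * (v * h)`
  have hmod : h ≡ -((Λ.level : ℤ) * (-(v * h))) [ZMOD p] :=
    Int.modEq_iff_dvd.mpr ⟨-(u * h), by linear_combination h * huv⟩
  have hv : ¬ (p : ℤ) ∣ v := fun hd => hpi.not_dvd_one (by
    rw [← huv]; exact dvd_add (Dvd.intro_left _ rfl) (hd.mul_right _))
  have hcop : IsCoprime (p : ℤ) ((Λ.level : ℤ) * (-(v * h))) :=
    (hpi.coprime_iff_not_dvd.mpr hlevi).mul_right
      ((hpi.coprime_iff_not_dvd.mpr hv).mul_right (hpi.coprime_iff_not_dvd.mpr hph)).neg_right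
  obtain ⟨x, hx, g, hg, γ, _, _, _, _, _, hU⟩ :=
    exists_middle hinj hb hcop (level_mul_smul_qbar hlev _)
  rw [latticeGauss_congr hb hp.pos hmod]
  set c := (Real.sqrt p : ℂ) ^ n * (((p : ℂ) ^ n)⁻¹ *
    latticeGauss Λ b p (-((Λ.level : ℤ) * (-(v * h))))) with hc
  have hnorm : ∀ w, normSq ((g * heckeElt hinj * x).2 w) = normSq w := fun w => by
    change normSq (g.2 (mulEquiv hinj (x.2 w))) = _
    rw [normSq_of_mem hg, normSq_mulEquiv, normSq_of_mem hx]
  have h1 := hnorm ((g * heckeElt hinj * x).2.symm (Pi.single 0 1))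
  rw [LinearEquiv.apply_symm_apply, hU] at h1
  have h2 : normSq (c • (Pi.single 0 1 : GrpAlg Λ)) = ‖c‖ ^ 2 * normSq (Pi.single 0 1 : GrpAlg Λ) := by
    simp only [normSq, Pi.smul_apply, smul_eq_mul, norm_mul, mul_pow, Finset.mul_sum]
  have h3 : normSq (Pi.single 0 1 : GrpAlg Λ) = 1 := by
    rw [normSq, Finset.sum_eq_single 0]
    · simp
    · intro y _ hy; simp [hy]
    · simp
  rw [h2, h3, mul_one] at h1
  exact (pow_eq_one_iff_of_nonneg (norm_nonneg c) two_ne_zero).mp h1.symm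

end VVMF
end

noncomputable section
namespace VVMF

/-! ### Quadratic Gauss sums over finite prime fields -/

open Complex Filter Topology

open EvenLattice

/-- An orthogonal basis exists because 2 is invertible; the change of basis multiplies the
determinant by a square, which is all that the quadratic character needs. -/
theorem exists_diagonalisation {K : Type*} [Field K] (h2 : (2 : K) ≠ 0) {m : ℕ}
    (A : Matrix (Fin m) (Fin m) K) (hA : A.IsSymm) :
    ∃ (w : Fin m → K) (r : K) (e : (Fin m → K) ≃ (Fin m → K)), r ≠ 0 ∧ ∏ i, w i = r ^ 2 * A.det ∧
      ∀ c, e c ⬝ᵥ A.mulVec (e c) = ∑ i, w i * c i ^ 2 := by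
  classical
  have : Invertible (2 : K) := invertibleOfNonzero h2
  let B : LinearMap.BilinForm K (Fin m → K) := Matrix.toBilin' A
  have hB : LinearMap.IsSymm B := ⟨fun x y => by
    simp only [B, Matrix.toBilin'_apply', RingHom.id_apply]
    rw [Matrix.dotProduct_mulVec, ← Matrix.mulVec_transpose, hA.eq, dotProduct_comm]⟩
  obtain ⟨v', hv'⟩ := LinearMap.BilinForm.exists_orthogonal_basis hB
  let v : Module.Basis (Fin m) K (Fin m → K) := v'.reindex (finCongr (by simp))
  have hv : ∀ i j, i ≠ j → B (v i) (v j) = 0 := fun i j hij => by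
    simp only [v, Module.Basis.reindex_apply]
    exact hv' (fun h => hij ((finCongr _).symm.injective h))
  refine ⟨fun i => B (v i) (v i), ((Pi.basisFun K (Fin m)).toMatrix v).det, v.equivFun.symm.toEquiv,
    ?_, ?_, fun c => ?_⟩
  · have := Module.Basis.invertibleToMatrix (Pi.basisFun K (Fin m)) v
    exact (Matrix.isUnit_det_of_invertible _).ne_zero
  · have h := congrArg Matrix.det
      (LinearMap.BilinForm.toMatrix_mul_basis_toMatrix (Pi.basisFun K (Fin m)) v B)
    have hd : LinearMap.BilinForm.toMatrix v B = Matrix.diagonal fun i => B (v i) (v i) := by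
      ext i j
      rw [LinearMap.BilinForm.toMatrix_apply, Matrix.diagonal_apply]
      split_ifs with hij
      · rw [hij]
      · exact hv i j hij
    rw [hd, Matrix.det_diagonal, Matrix.det_mul, Matrix.det_mul, Matrix.det_transpose,
      LinearMap.BilinForm.toMatrix_basisFun, LinearMap.BilinForm.toMatrix'_toBilin'] at h
    rw [← h]; ring
  · have h : ∀ x, x ⬝ᵥ A.mulVec x = B x x := fun x => (Matrix.toBilin'_apply' A x x).symm
    rw [h]
    change B (v.equivFun.symm c) (v.equivFun.symm c) = _
    rw [v.equivFun_symm_apply, map_sum]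
    refine Finset.sum_congr rfl fun i _ => ?_
    rw [map_sum, LinearMap.sum_apply, Finset.sum_eq_single i]
    · simp; ring
    · intro j _ hj; simp [hv j i hj]
    · simp

theorem addChar_sum {A R ι : Type*} [AddCommMonoid A] [CommMonoid R] (ψ : AddChar A R)
    (s : Finset ι) (f : ι → A) : ψ (∑ i ∈ s, f i) = ∏ i ∈ s, ψ (f i) := by
  classical
  induction s using Finset.induction_on with
  | empty => simp
  | insert a s ha ih => rw [Finset.sum_insert ha, Finset.prod_insert ha, AddChar.map_add_eq_mul, ih]

section OneDim

variable {p : ℕ} [Fact p.Prime]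

/-- The complex valued quadratic character of `ℤ/p`. -/
def legChar (p : ℕ) [Fact p.Prime] : MulChar (ZMod p) ℂ :=
  (quadraticChar (ZMod p)).ringHomComp (Int.castRingHom ℂ)

theorem legChar_apply (a : ZMod p) : legChar p a = ((quadraticChar (ZMod p) a : ℤ) : ℂ) := rfl

theorem legChar_intCast (a : ℤ) : legChar p (a : ZMod p) = ((legendreSym p a : ℤ) : ℂ) := rfl

theorem legChar_sq {a : ZMod p} (ha : a ≠ 0) : legChar p a ^ 2 = 1 := by
  rw [legChar_apply]; exact_mod_cast quadraticChar_sq_one ha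

/-- The quadratic Gauss sum modulo `p`. -/
def quadGauss (p : ℕ) [Fact p.Prime] : ℂ := _root_.gaussSum (legChar p) ZMod.stdAddChar

theorem sum_legChar_mul_stdAddChar (hp2 : p ≠ 2) (a : ZMod p) :
    ∑ h, legChar p h * ZMod.stdAddChar (a * h) = legChar p a * quadGauss p := by
  have hch : ringChar (ZMod p) ≠ 2 := by rwa [ZMod.ringChar_zmod_n]
  by_cases ha : a = 0
  · subst ha
    simp only [zero_mul, AddChar.map_zero_eq_one, mul_one, MulChar.map_zero, legChar_apply]
    exact_mod_cast quadraticChar_sum_zero hch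
  · have h := gaussSum_mulShift (legChar p) ZMod.stdAddChar (Units.mk0 a ha)
    rw [Units.val_mk0] at h
    rw [quadGauss, ← h, ← mul_assoc, ← sq, legChar_sq ha, one_mul]
    rfl

theorem quadGauss_sq (hp2 : p ≠ 2) : quadGauss p ^ 2 = legChar p (-1) * p := by
  have hch : ringChar (ZMod p) ≠ 2 := by rwa [ZMod.ringChar_zmod_n]
  have h1 : legChar p ≠ 1 := by
    intro h
    obtain ⟨a, ha⟩ := quadraticChar_exists_neg_one' hch
    have h2 := congrArg (fun χ : MulChar (ZMod p) ℂ => χ a) h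
    simp only [legChar_apply, ha, MulChar.one_apply_coe] at h2
    norm_num at h2
  have h2 : (legChar p).IsQuadratic := (quadraticChar_isQuadratic (ZMod p)).comp _
  rw [quadGauss, gaussSum_sq h1 h2 (ZMod.isPrimitive_stdAddChar p), ZMod.card]

theorem norm_quadGauss_sq (hp2 : p ≠ 2) : ‖quadGauss p‖ ^ 2 = p := by
  rw [← norm_pow, quadGauss_sq hp2, norm_mul]
  have h := congrArg norm (legChar_sq (p := p) (a := -1) (by simp))
  rw [norm_pow, norm_one] at h
  rw [(pow_eq_one_iff_of_nonneg (norm_nonneg _) two_ne_zero).mp h]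
  simp

/-- Each h has 1 + χ(h) square roots, χ being the quadratic character. The part with coefficient 1
sums to zero, leaving a Gauss sum. -/
theorem sum_sq_stdAddChar (hp2 : p ≠ 2) {a : ZMod p} (ha : a ≠ 0) :
    ∑ y, (ZMod.stdAddChar (a * y ^ 2) : ℂ) = legChar p a * quadGauss p := by
  classical
  have hch : ringChar (ZMod p) ≠ 2 := by rwa [ZMod.ringChar_zmod_n]
  have h1 : ∑ y, (ZMod.stdAddChar (a * y ^ 2) : ℂ) =
      ∑ h : ZMod p, (legChar p h + 1) * ZMod.stdAddChar (a * h) := by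
    rw [← Finset.sum_fiberwise (s := Finset.univ) (g := fun y : ZMod p => y ^ 2)]
    refine Finset.sum_congr rfl fun h _ => ?_
    have h2 := quadraticChar_card_sqrts hch h
    rw [Finset.sum_congr rfl (g := fun _ => (ZMod.stdAddChar (a * h) : ℂ)) fun y hy => by
      rw [(Finset.mem_filter.mp hy).2], Finset.sum_const, nsmul_eq_mul, legChar_apply]
    congr 1
    have h3 : ({x | x ^ 2 = h} : Set (ZMod p)).toFinset = Finset.univ.filter fun y => y ^ 2 = h := by
      ext; simp
    rw [h3] at h2
    exact_mod_cast h2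
  have h4 : ∑ h : ZMod p, (ZMod.stdAddChar (a * h) : ℂ) = 0 := by
    exact AddChar.sum_eq_zero_of_ne_one (ψ := AddChar.mulShift ZMod.stdAddChar a)
      (ZMod.isPrimitive_stdAddChar p ha)
  simp_rw [h1, add_mul, one_mul]
  rw [Finset.sum_add_distrib, h4, add_zero, sum_legChar_mul_stdAddChar hp2]

end OneDim

/-! ### Evaluation of the Gauss sums of the lattice -/

variable {V : Type*} [AddCommGroup V] [Module ℚ V] {Λ : EvenLattice V}

local notation "n" => Module.finrank ℚ V

theorem exists_gram {b : Module.Basis (Fin n) ℚ V} (hb : Λ.L = Submodule.span ℤ (Set.range b)) :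
    ∃ G : Matrix (Fin n) (Fin n) ℤ, ∀ i j, (G i j : ℚ) = QuadraticMap.polar Λ.q (b i) (b j) := by
  choose G hG using fun i j => polar_mem_int (L_le_dual (basis_mem hb i)) (basis_mem hb j)
  exact ⟨fun i j => G i j, fun i j => (hG i j).symm⟩

/-- The determinant of the Gram matrix agrees with the order of the discriminant group, up to the
sign determined by the signature and a rational square. -/
theorem exists_det_gram [FiniteDimensional ℚ V] {b : Module.Basis (Fin n) ℚ V}
    {G : Matrix (Fin n) (Fin n) ℤ}
    (hG : ∀ i j, (G i j : ℚ) = QuadraticMap.polar Λ.q (b i) (b j)) :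
    ∃ (r : ℚ) (ε : ℤ), (ε : ℂ) = I ^ ((n : ℤ) - Λ.sig) ∧
      (G.det : ℚ) = r ^ 2 * (ε * Fintype.card Λ.Disc) := by
  classical
  obtain ⟨D⟩ := Λ.nonempty_diag
  obtain ⟨c, hc⟩ := D.idx_eq_natCast
  have h := congrArg Matrix.det
    (LinearMap.BilinForm.toMatrix_mul_basis_toMatrix D.b b (QuadraticMap.polarBilin Λ.q))
  have h1 : LinearMap.BilinForm.toMatrix b (QuadraticMap.polarBilin Λ.q) =
      G.map (Int.castRingHom ℚ) := by
    ext i j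
    rw [LinearMap.BilinForm.toMatrix_apply, Matrix.map_apply, eq_intCast, hG]; rfl
  have h2 : LinearMap.BilinForm.toMatrix D.b (QuadraticMap.polarBilin Λ.q) =
      Matrix.diagonal fun i => (2 * D.m i : ℚ) := by
    ext i j
    rw [LinearMap.BilinForm.toMatrix_apply, Matrix.diagonal_apply, QuadraticMap.polarBilin_apply_apply,
      D.polar_eq]
    simp only [Module.Basis.repr_self, Finsupp.single_apply]
    rw [Finset.sum_eq_single i]
    · by_cases hij : i = j
      · simp [hij]
      · simp [hij, Ne.symm hij]
    · intro k _ hk; simp [Ne.symm hk]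
    · simp
  rw [h1, h2, Matrix.det_mul, Matrix.det_mul, Matrix.det_transpose, Matrix.det_diagonal,
    ← RingHom.mapMatrix_apply, ← RingHom.map_det, eq_intCast] at h
  refine ⟨(D.b.toMatrix b).det * c, ∏ i, (D.m i).sign, ?_, ?_⟩
  · have hs : ∀ i, (((D.m i).sign : ℤ) : ℂ) = I ^ (1 - (D.m i).sign) := fun i => by
      rcases lt_or_gt_of_ne (D.m_ne i) with hm | hm
      · rw [Int.sign_eq_neg_one_of_neg hm]
        norm_num
      · rw [Int.sign_eq_one_of_pos hm]; simp
    rw [Int.cast_prod, Finset.prod_congr rfl fun i _ => hs i]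
    have hp : ∀ s : Finset (Fin n), ∏ i ∈ s, I ^ (1 - (D.m i).sign) =
        I ^ (∑ i ∈ s, (1 - (D.m i).sign)) := fun s => by
      induction s using Finset.induction_on with
      | empty => simp
      | insert a s ha ih => rw [Finset.prod_insert ha, Finset.sum_insert ha, ih, zpow_add₀ I_ne_zero]
    rw [hp, Finset.sum_sub_distrib, D.sum_sign]
    simp
  · have hd : ((∏ i, D.d i : ℕ) : ℚ) = c ^ 2 * Fintype.card Λ.Disc := by
      have := D.prod_d_eq
      rw [hc] at this
      exact_mod_cast this
    have hm : ∏ i, (2 * D.m i : ℚ) = (∏ i, (D.m i).sign : ℤ) * (∏ i, D.d i : ℕ) := by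
      push_cast
      rw [← Finset.prod_mul_distrib]
      refine Finset.prod_congr rfl fun i _ => ?_
      have h3 : (D.m i).sign * ((D.m i).natAbs : ℤ) = D.m i := Int.sign_mul_natAbs _
      have h4 : (2 * D.m i : ℤ) = (D.m i).sign * (D.d i : ℤ) := by
        rw [Diag.d]; rw [Nat.cast_mul, Nat.cast_ofNat]; linear_combination -2 * h3
      exact_mod_cast h4
    rw [← h, hm, hd]; ring

theorem not_dvd_card [FiniteDimensional ℚ V] {p : ℕ} [Fact p.Prime]
    (hinj : Function.Injective fun y : Λ.Disc => p • y) : ¬ p ∣ Fintype.card Λ.Disc := by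
  intro h
  obtain ⟨x, hx⟩ := exists_prime_addOrderOf_dvd_card p h
  have h1 : p • x = 0 := by rw [← hx]; exact addOrderOf_nsmul_eq_zero x
  have h2 : x = 0 := hinj (by simpa using h1)
  rw [h2, addOrderOf_zero] at hx
  exact (Fact.out : p.Prime).one_lt.ne hx

theorem two_mul_q_resid {b : Module.Basis (Fin n) ℚ V} {G : Matrix (Fin n) (Fin n) ℤ}
    (hG : ∀ i j, (G i j : ℚ) = QuadraticMap.polar Λ.q (b i) (b j)) {P : ℕ} (s : Fin n → Fin P) :
    2 * Λ.q (resid b s) = ((∑ i, ∑ j, (s i : ℕ) * (G i j * (s j : ℕ)) : ℤ) : ℚ) := by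
  have h : 2 * Λ.q (resid b s) = QuadraticMap.polarBilin Λ.q (resid b s) (resid b s) := by
    rw [QuadraticMap.polarBilin_apply_apply, QuadraticMap.polar_self, two_smul, two_mul]
  rw [h, resid, map_sum]
  push_cast
  simp_rw [map_sum, LinearMap.sum_apply]
  rw [Finset.sum_comm]
  refine Finset.sum_congr rfl fun i _ => Finset.sum_congr rfl fun j _ => ?_
  rw [hG]
  simp only [← Int.cast_smul_eq_zsmul ℚ, map_smul, LinearMap.smul_apply, smul_eq_mul,
    QuadraticMap.polarBilin_apply_apply, Int.cast_natCast]
  rw [QuadraticMap.polar_comm]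
  ring

/-- The factor 1/2 appears because the Gram matrix represents 2q. -/
theorem latticeGauss_eq_sum_zmod {b : Module.Basis (Fin n) ℚ V}
    (hb : Λ.L = Submodule.span ℤ (Set.range b)) {G : Matrix (Fin n) (Fin n) ℤ}
    (hG : ∀ i j, (G i j : ℚ) = QuadraticMap.polar Λ.q (b i) (b j)) {p : ℕ} [Fact p.Prime]
    (hp2 : p ≠ 2) (h : ℤ) :
    latticeGauss Λ b p h = ∑ s : Fin n → ZMod p,
      ZMod.stdAddChar ((2 : ZMod p)⁻¹ * (h : ZMod p) * (s ⬝ᵥ (G.map (Int.castRingHom (ZMod p))).mulVec s)) := by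
  have hp := (Fact.out : p.Prime)
  have h2 : (2 : ZMod p) ≠ 0 := fun h0 => hp2 ((Nat.prime_dvd_prime_iff_eq hp Nat.prime_two).mp
    ((ZMod.natCast_eq_zero_iff 2 p).mp (by exact_mod_cast h0)))
  have hbij : Function.Bijective fun (s : Fin n → Fin p) (i : Fin n) => ((s i : ℕ) : ZMod p) := by
    rw [Fintype.bijective_iff_injective_and_card]
    refine ⟨fun s t hst => funext fun i => Fin.ext ?_, by simp⟩
    have := (ZMod.natCast_eq_natCast_iff' _ _ _).mp (congrFun hst i)
    rwa [Nat.mod_eq_of_lt (s i).2, Nat.mod_eq_of_lt (t i).2] at this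
  rw [← hbij.sum_comp, latticeGauss]
  refine Finset.sum_congr rfl fun s _ => ?_
  obtain ⟨z, hz⟩ := Λ.even _ (resid_mem hb s)
  have h3 := two_mul_q_resid hG s
  rw [hz] at h3
  have h4 : 2 * z = ∑ i, ∑ j, ((s i : ℕ) : ℤ) * (G i j * ((s j : ℕ) : ℤ)) := by exact_mod_cast h3
  have h5 : ((2 : ZMod p)⁻¹ * (h : ZMod p) * ((fun i => ((s i : ℕ) : ZMod p)) ⬝ᵥ
      (G.map (Int.castRingHom (ZMod p))).mulVec fun i => ((s i : ℕ) : ZMod p)) : ZMod p) =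
      ((h * z : ℤ) : ZMod p) := by
    have h6 : ((fun i => ((s i : ℕ) : ZMod p)) ⬝ᵥ
      (G.map (Int.castRingHom (ZMod p))).mulVec fun i => ((s i : ℕ) : ZMod p)) =
        ((2 * z : ℤ) : ZMod p) := by
      rw [h4]
      simp [dotProduct, Matrix.mulVec, Finset.mul_sum]
    rw [h6]
    push_cast
    field_simp
  rw [h5, ZMod.stdAddChar_coe, eQ, ee, hz]
  congr 1
  push_cast
  ring

/-- Diagonalising the Gram matrix modulo p turns the sum into a product of one-dimensional Gauss
sums, and the quadratic characters of the diagonal entries combine to that of the determinant. That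
the form is non-degenerate modulo p is deduced from `norm_latticeGauss`. -/
theorem latticeGauss_eq [FiniteDimensional ℚ V] {b : Module.Basis (Fin n) ℚ V}
    (hb : Λ.L = Submodule.span ℤ (Set.range b)) {G : Matrix (Fin n) (Fin n) ℤ}
    (hG : ∀ i j, (G i j : ℚ) = QuadraticMap.polar Λ.q (b i) (b j)) {p : ℕ} [Fact p.Prime]
    (hp2 : p ≠ 2) (hlev : ¬ p ∣ Λ.level) :
    ((G.det : ℤ) : ZMod p) ≠ 0 ∧ ∀ h : ℤ, ¬ (p : ℤ) ∣ h → latticeGauss Λ b p h =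
      (legChar p 2 * legChar p h) ^ n * legChar p (G.det : ℤ) * quadGauss p ^ n := by
  classical
  have hp := (Fact.out : p.Prime)
  have h2 : (2 : ZMod p) ≠ 0 := fun h0 => hp2 ((Nat.prime_dvd_prime_iff_eq hp Nat.prime_two).mp
    ((ZMod.natCast_eq_zero_iff 2 p).mp (by exact_mod_cast h0)))
  have hsym : (G.map (Int.castRingHom (ZMod p))).IsSymm := by
    ext i j
    rw [Matrix.transpose_apply, Matrix.map_apply, Matrix.map_apply]
    congr 1
    have : (G j i : ℚ) = G i j := by rw [hG, hG, QuadraticMap.polar_comm]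
    exact_mod_cast this
  obtain ⟨w, r, e, hr, hw, hd⟩ := exists_diagonalisation h2 _ hsym
  have hdet : (G.map (Int.castRingHom (ZMod p))).det = ((G.det : ℤ) : ZMod p) := by
    rw [← RingHom.mapMatrix_apply, ← RingHom.map_det, eq_intCast]
  rw [hdet] at hw
  have hprod : ∀ h : ℤ, latticeGauss Λ b p h =
      ∏ i, ∑ y : ZMod p, (ZMod.stdAddChar (2⁻¹ * (h : ZMod p) * w i * y ^ 2) : ℂ) := fun h => by
    rw [latticeGauss_eq_sum_zmod hb hG hp2, ← e.sum_comp, Finset.prod_univ_sum,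
      Fintype.piFinset_univ]
    refine Finset.sum_congr rfl fun c _ => ?_
    rw [hd, Finset.mul_sum, addChar_sum]
    refine Finset.prod_congr rfl fun i _ => ?_
    rw [← mul_assoc]
  have hh : ∀ h : ℤ, ¬ (p : ℤ) ∣ h → (2 : ZMod p)⁻¹ * (h : ZMod p) ≠ 0 := fun h hph =>
    mul_ne_zero (inv_ne_zero h2) fun h0 => hph ((ZMod.intCast_zmod_eq_zero_iff_dvd h p).mp h0)
  have hp1 : (1 : ℝ) < p := by exact_mod_cast hp.one_lt
  have hsq1 : 1 < Real.sqrt p := by rw [Real.lt_sqrt zero_le_one]; simpa using hp1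
  have hnq : ∀ a : ZMod p, a ≠ 0 →
      ‖∑ y : ZMod p, (ZMod.stdAddChar (a * y ^ 2) : ℂ)‖ = Real.sqrt p := fun a ha => by
    rw [sum_sq_stdAddChar hp2 ha, norm_mul]
    have h3 := congrArg norm (legChar_sq ha)
    rw [norm_pow, norm_one] at h3
    rw [(pow_eq_one_iff_of_nonneg (norm_nonneg _) two_ne_zero).mp h3, one_mul,
      ← Real.sqrt_sq (norm_nonneg _), norm_quadGauss_sq hp2]
  -- A zero diagonal entry would contribute p instead of √p, making the Gauss sum strictly larger in
  -- absolute value than p^(n/2).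
  have hw0 : ∀ i, w i ≠ 0 := by
    by_contra! hcon
    obtain ⟨i, hi⟩ := hcon
    have h1 : ¬ (p : ℤ) ∣ 1 := (Nat.prime_iff_prime_int.mp hp).not_dvd_one
    have hn := norm_latticeGauss hlev hb h1
    rw [norm_mul, norm_mul, hprod, norm_prod, norm_pow, norm_inv, norm_pow, Complex.norm_real,
      Real.norm_of_nonneg (Real.sqrt_nonneg _), Complex.norm_natCast] at hn
    have hlt : ∏ _i : Fin n, Real.sqrt p < ∏ i, ‖∑ y : ZMod p,
        (ZMod.stdAddChar (2⁻¹ * ((1 : ℤ) : ZMod p) * w i * y ^ 2) : ℂ)‖ := by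
      have hz : ∀ i, w i = 0 → ‖∑ y : ZMod p,
        (ZMod.stdAddChar (2⁻¹ * ((1 : ℤ) : ZMod p) * w i * y ^ 2) : ℂ)‖ = p := fun i hi => by
        simp [hi]
      have hlt' : Real.sqrt p < p := by
        rw [Real.sqrt_lt' (by linarith)]; nlinarith
      refine Finset.prod_lt_prod (fun i _ => by linarith) (fun j _ => ?_)
        ⟨i, Finset.mem_univ _, by rw [hz i hi]; exact hlt'⟩
      by_cases hj : w j = 0
      · rw [hz j hj]; exact hlt'.le
      · rw [hnq _ (mul_ne_zero (hh 1 h1) hj)]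
    rw [Finset.prod_const, Finset.card_univ, Fintype.card_fin] at hlt
    have hs0 : 0 < Real.sqrt p ^ n := pow_pos (by linarith) _
    have hpn : (p : ℝ) ^ n = Real.sqrt p ^ n * Real.sqrt p ^ n := by
      rw [← mul_pow, Real.mul_self_sqrt (by linarith)]
    rw [hpn] at hn
    generalize ∏ i, ‖∑ y : ZMod p,
        (ZMod.stdAddChar (2⁻¹ * ((1 : ℤ) : ZMod p) * w i * y ^ 2) : ℂ)‖ = X at hn hlt
    have : X = Real.sqrt p ^ n := by
      field_simp at hn
      exact hn
    exact hlt.ne this.symm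
  have hdet0 : ((G.det : ℤ) : ZMod p) ≠ 0 := fun h0 => by
    rw [h0, mul_zero] at hw
    exact Finset.prod_ne_zero_iff.mpr (fun i _ => hw0 i) hw
  refine ⟨hdet0, fun h hph => ?_⟩
  have hinv : legChar p (2⁻¹ : ZMod p) = legChar p 2 := by
    have h3 : legChar p (2⁻¹ : ZMod p) * legChar p 2 = 1 := by
      rw [← map_mul, inv_mul_cancel₀ h2, map_one]
    have h4 := legChar_sq h2
    linear_combination legChar p 2 * h3 - legChar p (2⁻¹ : ZMod p) * h4
  have hwi : ∏ i, legChar p (w i) = legChar p (G.det : ℤ) := by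
    rw [← map_prod, hw, map_mul, map_pow, legChar_sq hr, one_mul]
  rw [hprod, Finset.prod_congr rfl fun i _ => sum_sq_stdAddChar hp2 (mul_ne_zero (hh h hph) (hw0 i)),
    Finset.prod_mul_distrib]
  simp only [map_mul, Finset.prod_mul_distrib, Finset.prod_const, Finset.card_univ,
    Fintype.card_fin, hwi, hinv]
  ring

end VVMF
end

/-! ### Sums over the representatives (p, h; 0, p) in terms of the discriminant form -/

noncomputable section
namespace VVMF

open Complex Filter Topology

open EvenLattice

variable {V : Type*} [AddCommGroup V] [Module ℚ V] {Λ : EvenLattice V}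

local notation "n" => Module.finrank ℚ V

/-- Since A and B are prime to p, both the numerator and the denominator of r are prime to p, and
the quadratic character does not see r². -/
theorem legChar_eq_of_eq_sq_mul {p : ℕ} [Fact p.Prime] {A B : ℤ} {r : ℚ}
    (h : (A : ℚ) = r ^ 2 * B) (hA : (A : ZMod p) ≠ 0) (hB : (B : ZMod p) ≠ 0) :
    legChar p A = legChar p B := by
  have hp := (Fact.out : p.Prime)
  have hpi : Prime (p : ℤ) := Nat.prime_iff_prime_int.mp hp
  have h1 : A * (r.den : ℤ) ^ 2 = r.num ^ 2 * B := by
    have h2 : (r.den : ℚ) ≠ 0 := by exact_mod_cast r.den_nz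
    have h3 : r * r.den = r.num := Rat.mul_den_eq_num r
    have : (A * (r.den : ℤ) ^ 2 : ℚ) = r.num ^ 2 * B := by
      rw [← h3, h]; push_cast; ring
    exact_mod_cast this
  have h2 : ((r.den : ℤ) : ZMod p) ≠ 0 := by
    intro h0
    have hd : (p : ℤ) ∣ r.den := (ZMod.intCast_zmod_eq_zero_iff_dvd _ p).mp h0
    have h3 : (p : ℤ) ∣ r.num ^ 2 * B := by
      rw [← h1]; exact Dvd.dvd.mul_left (dvd_pow hd two_ne_zero) _
    have h4 : (p : ℤ) ∣ r.num := (hpi.dvd_or_dvd h3).elim hpi.dvd_of_dvd_pow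
      fun h => (hB ((ZMod.intCast_zmod_eq_zero_iff_dvd _ p).mpr h)).elim
    have h5 : p ∣ Nat.gcd r.num.natAbs r.den :=
      Nat.dvd_gcd (Int.natCast_dvd.mp h4) (by exact_mod_cast hd)
    rw [r.reduced] at h5
    exact hp.one_lt.ne' (Nat.dvd_one.mp h5)
  have h3 : (A : ZMod p) * ((r.den : ℤ) : ZMod p) ^ 2 = (r.num : ZMod p) ^ 2 * B := by
    exact_mod_cast congrArg (Int.cast : ℤ → ZMod p) h1
  have h4 : (r.num : ZMod p) ≠ 0 := by
    intro h0
    rw [h0, zero_pow two_ne_zero, zero_mul] at h3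
    exact mul_ne_zero hA (pow_ne_zero 2 h2) h3
  have h5 := congrArg (legChar p) h3
  rwa [map_mul, map_mul, map_pow, map_pow, legChar_sq h2, legChar_sq h4, mul_one, one_mul] at h5

theorem legChar_neg_one {p : ℕ} [Fact p.Prime] (hp2 : p ≠ 2) :
    legChar p (-1) = ((ZMod.χ₄ p : ℤ) : ℂ) := by
  have hch : ringChar (ZMod p) ≠ 2 := by rwa [ZMod.ringChar_zmod_n]
  rw [legChar_apply, quadraticChar_neg_one hch, ZMod.card]

theorem legChar_two {p : ℕ} [Fact p.Prime] (hp2 : p ≠ 2) :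
    legChar p 2 = ((ZMod.χ₈ p : ℤ) : ℂ) := by
  have hch : ringChar (ZMod p) ≠ 2 := by rwa [ZMod.ringChar_zmod_n]
  rw [legChar_apply, quadraticChar_two hch, ZMod.card]

theorem kronecker_two (a : ℤ) : kronecker a 2 = ZMod.χ₈ (a : ZMod 8) := by
  have h : (2 : ℕ).factorization 2 = 1 := Nat.prime_two.factorization_self
  rw [kronecker, h]
  simp

/-- The order |A| is split into its 2-part, where the symbol is a power of (2/p), and its odd part,
where quadratic reciprocity applies. The reciprocity sign and the sign ε of the Gram determinant are
accounted for by the power of ε_p. -/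
theorem chi_eq [FiniteDimensional ℚ V] {p : ℕ} [Fact p.Prime] (hp2 : p ≠ 2)
    (hcard : ¬ p ∣ Fintype.card Λ.Disc) (hn : Odd n) {ε : ℤ}
    (hε : (ε : ℂ) = I ^ ((n : ℤ) - Λ.sig)) :
    chi Λ p = legChar p 2 * legChar p ((ε * Fintype.card Λ.Disc : ℤ) : ZMod p) *
      legChar p (-1) ^ ((n + 1) / 2) := by
  have hp := (Fact.out : p.Prime)
  have hpo : Odd p := hp.odd_of_ne_two hp2
  have hC0 : Fintype.card Λ.Disc ≠ 0 := fun h => hcard (h ▸ dvd_zero p)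
  obtain ⟨v, m, hmv, hm⟩ : ∃ v m : ℕ, Fintype.card Λ.Disc = 2 ^ v * m ∧ Odd m ∧
      (Fintype.card Λ.Disc).factorization 2 = v ∧
      Fintype.card Λ.Disc / 2 ^ v = m :=
    ⟨_, _, (Nat.ordProj_mul_ordCompl_eq_self _ 2).symm,
      Nat.not_even_iff_odd.mp fun h => Nat.not_dvd_ordCompl Nat.prime_two hC0 h.two_dvd, rfl, rfl⟩
  obtain ⟨hmo, hv, hd⟩ := hm
  have h8 : ZMod.χ₈ (((-1 : ℤ)) : ZMod 8) = 1 := by decide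
  have hk1 : kronecker (-1) (Fintype.card Λ.Disc) = ZMod.χ₄ m := by
    rw [kronecker, hv, hd, h8, one_pow, one_mul, jacobiSym.at_neg_one hmo]
  have hk2 : (kronecker p (Fintype.card Λ.Disc) : ℂ) = legChar p 2 ^ v * (jacobiSym p m : ℂ) := by
    rw [kronecker, hv, hd, legChar_two hp2]; push_cast; rfl
  have hk3 : (kronecker p 2 : ℂ) = legChar p 2 := by
    rw [kronecker_two, legChar_two hp2]; push_cast; rfl
  have h2 : legChar p 2 ^ 2 = 1 := legChar_sq fun h0 =>
    hp2 ((Nat.prime_dvd_prime_iff_eq hp Nat.prime_two).mp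
      ((ZMod.natCast_eq_zero_iff 2 p).mp (by exact_mod_cast h0)))
  have hE2 : ε = 1 ∨ ε = -1 := by
    have h1 : (ε : ℂ) ^ 4 = 1 := by
      rw [hε, ← zpow_natCast, ← zpow_mul, mul_comm, zpow_mul, zpow_natCast]
      norm_num [I_pow_four]
    have h2 : ε ^ 4 = 1 := by exact_mod_cast h1
    exact (pow_eq_one_iff_cases.mp h2).elim (by omega) (fun h => h.elim Or.inl fun h => Or.inr h.1)
  have hEE : (ε : ℂ) * ε = 1 := by rcases hE2 with h | h <;> simp [h]
  -- For even signature n - sig would be odd and ε² = -1, impossible for ε = ±1.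
  have hsig : Odd Λ.sig := by
    by_contra hs
    have hs' : Even Λ.sig := Int.not_odd_iff_even.mp hs
    have ho : Odd ((n : ℤ) - Λ.sig) := Odd.sub_even (by exact_mod_cast hn) hs'
    have h3 : (ε : ℂ) ^ 2 = -1 := by
      rw [hε, ← zpow_natCast, ← zpow_mul, mul_comm, zpow_mul, zpow_natCast, I_sq, ho.neg_one_zpow]
    rw [sq, hEE] at h3
    norm_num at h3
  have h2s : legChar p 2 ^ Λ.sig = legChar p 2 := by
    obtain ⟨k, hk⟩ := hsig
    have h20 : legChar p 2 ≠ 0 := fun h => by rw [h] at h2; norm_num at h2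
    rw [hk, zpow_add₀ h20, zpow_mul, zpow_ofNat, h2]; simp
  have hIs : I ^ Λ.sig = I ^ n * ε := by
    rw [← inv_eq_of_mul_eq_one_left hEE, hε, ← zpow_neg, ← zpow_natCast, ← zpow_add₀ I_ne_zero]
    congr 1; ring
  have hcc : legChar p ((ε * Fintype.card Λ.Disc : ℤ) : ZMod p) =
      legChar p (ε : ZMod p) * (legChar p 2 ^ v * (jacobiSym m p : ℂ)) := by
    rw [hmv]; push_cast
    rw [map_mul, map_mul, map_pow]
    congr 2
    have := legChar_intCast (p := p) m
    rw [jacobiSym.legendreSym.to_jacobiSym] at this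
    exact_mod_cast this
  rw [chi, hk1, hk2, hk3, h2s, hcc]
  obtain ⟨k, hk⟩ := hn
  have hk' : (n + 1) / 2 = k + 1 := by omega
  rw [hk']
  rcases (show p % 4 = 1 ∨ p % 4 = 3 by obtain ⟨c, hc⟩ := hpo; omega) with h4 | h4
  · have hm1 : legChar p (-1) = 1 := by rw [legChar_neg_one hp2, ZMod.χ₄_nat_one_mod_four h4]; simp
    have he : legChar p (ε : ZMod p) = 1 := by rcases hE2 with h | h <;> simp [h, hm1]
    rw [epsilon, if_pos h4, one_zpow, hm1, he, one_pow,
      jacobiSym.quadratic_reciprocity_one_mod_four h4 hmo]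
    ring
  · have hm1 : legChar p (-1) = -1 := by
      rw [legChar_neg_one hp2, ZMod.χ₄_nat_three_mod_four h4]; simp
    have he : legChar p (ε : ZMod p) = ε := by rcases hE2 with h | h <;> simp [h, hm1]
    have hIk : I ^ n * I = (-1) ^ (k + 1) := by
      rw [hk, ← pow_succ, ← I_sq, ← pow_mul]; congr 1
    rw [epsilon, if_neg (by omega), zpow_add₀ I_ne_zero, hIs, hm1, he, ← hIk]
    rcases (show m % 4 = 1 ∨ m % 4 = 3 by obtain ⟨c, hc⟩ := hmo; omega) with h5 | h5
    · rw [ZMod.χ₄_nat_one_mod_four h5, jacobiSym.quadratic_reciprocity_one_mod_four h5 hpo, zpow_one]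
      ring
    · rw [ZMod.χ₄_nat_three_mod_four h5, jacobiSym.quadratic_reciprocity_three_mod_four h5 h4,
        zpow_neg_one, inv_I]
      push_cast
      ring

variable [FiniteDimensional ℚ V] {p : ℕ} [Fact p.Prime]

theorem gaussSum_ne_zero (hlev : ¬ p ∣ Λ.level) : gaussSum Λ p ≠ 0 := by
  obtain ⟨b, hb⟩ := exists_basis Λ
  have h := gauss_reciprocity (Fact.out : p.Prime).pos
    (nsmul_injective_of_not_dvd_level Fact.out hlev) hb
  intro h0
  simp [h0] at h

/-- The normalised Gauss sum of the lattice modulo `p` in terms of the discriminant form. -/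
theorem normalised_latticeGauss_one (hlev : ¬ p ∣ Λ.level)
    {b : Module.Basis (Fin n) ℚ V} (hb : Λ.L = Submodule.span ℤ (Set.range b)) :
    (Real.sqrt p : ℂ) ^ n * (((p : ℂ) ^ n)⁻¹ * latticeGauss Λ b p 1) =
      gaussSum Λ 1 / gaussSum Λ p := by
  have h := gauss_reciprocity (Fact.out : p.Prime).pos
    (nsmul_injective_of_not_dvd_level Fact.out hlev) hb
  have h1 := gauss_reciprocity (Λ := Λ) (P := 1) one_pos (fun a b h => by simpa using h) hb
  have hl : latticeGauss Λ b 1 1 = 1 := by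
    rw [latticeGauss, Fintype.sum_unique]
    obtain ⟨z, hz⟩ := Λ.even _ (resid_mem hb (default : Fin n → Fin 1))
    exact eQ_eq_one ⟨z, by rw [hz]; simp⟩
  rw [hl] at h1
  simp only [Nat.cast_one, Real.sqrt_one, Complex.ofReal_one, one_pow, inv_one, mul_one,
    one_mul] at h1
  rw [eq_div_iff (gaussSum_ne_zero hlev)]
  set X := (Real.sqrt p : ℂ) ^ n * (((p : ℂ) ^ n)⁻¹ * latticeGauss Λ b p 1)
  linear_combination (gaussSum Λ 1) * h - X * gaussSum Λ p * h1

/-- For odd p the argument h enters only through (h/p)^n, which is 1 for even n; for p = 2 there is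
only one unit residue. -/
theorem latticeGauss_even (hn : Even n) (hlev : ¬ p ∣ Λ.level)
    {b : Module.Basis (Fin n) ℚ V} (hb : Λ.L = Submodule.span ℤ (Set.range b)) {h : ℤ} (hh : ¬ (p : ℤ) ∣ h) :
    latticeGauss Λ b p h = latticeGauss Λ b p 1 := by
  have hp := (Fact.out : p.Prime)
  by_cases hp2 : p = 2
  · subst hp2
    exact latticeGauss_congr hb two_pos (by rw [Int.modEq_iff_dvd]; push_cast at hh ⊢; omega)
  · obtain ⟨G, hG⟩ := exists_gram hb
    obtain ⟨-, hF⟩ := latticeGauss_eq hb hG hp2 hlev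
    have h1 : ¬ (p : ℤ) ∣ 1 := (Nat.prime_iff_prime_int.mp hp).not_dvd_one
    obtain ⟨k, hk⟩ := hn
    have h2 : (2 : ZMod p) ≠ 0 := fun h0 => hp2 ((Nat.prime_dvd_prime_iff_eq hp Nat.prime_two).mp
      ((ZMod.natCast_eq_zero_iff 2 p).mp (by exact_mod_cast h0)))
    have hpw : ∀ h : ℤ, ¬ (p : ℤ) ∣ h → (legChar p 2 * legChar p h) ^ n = 1 := fun h hh => by
      rw [hk, ← two_mul, pow_mul, mul_pow, legChar_sq h2, legChar_sq (fun h0 => hh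
        ((ZMod.intCast_zmod_eq_zero_iff_dvd h p).mp h0)), one_mul, one_pow]
    rw [hF h hh, hF 1 h1, hpw h hh, hpw 1 h1]

/-- The ratio is a normalised Gauss sum. It is real because replacing h by -h does not change the
sum in even rank, and it has absolute value 1. -/
theorem gaussSum_ratio_sq (hn : Even n) (hlev : ¬ p ∣ Λ.level) :
    (gaussSum Λ 1 / gaussSum Λ p) ^ 2 = 1 := by
  obtain ⟨b, hb⟩ := exists_basis Λ
  have h1 : ¬ (p : ℤ) ∣ 1 := (Nat.prime_iff_prime_int.mp (Fact.out : p.Prime)).not_dvd_one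
  have hnorm := norm_latticeGauss hlev hb h1
  rw [normalised_latticeGauss_one hlev hb] at hnorm
  have hconj : (starRingEnd ℂ) (gaussSum Λ 1 / gaussSum Λ p) = gaussSum Λ 1 / gaussSum Λ p := by
    rw [← normalised_latticeGauss_one hlev hb, map_mul, map_mul, conj_latticeGauss,
      latticeGauss_even hn hlev hb (by rwa [dvd_neg])]
    simp
  rw [sq]
  nth_rewrite 2 [← hconj]
  rw [Complex.mul_conj, Complex.normSq_eq_norm_sq, hnorm]
  simp

/-- For p = 2 the Gauss sum is a sum of signs, hence an integer. Its absolute value is 2^(n/2), so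
2^n is a perfect square. -/
theorem even_finrank_of_two (h2 : p = 2) (hlev : ¬ p ∣ Λ.level) : Even n := by
  subst h2
  obtain ⟨b, hb⟩ := exists_basis Λ
  have hnorm := norm_latticeGauss (p := 2) hlev hb (h := 1) (by norm_num)
  obtain ⟨z, hz⟩ : ∃ z : ℤ, latticeGauss Λ b 2 1 = z := by
    choose z hz using fun s : Fin n → Fin 2 => Λ.even _ (resid_mem hb s)
    refine ⟨∑ s, (-1) ^ (z s).natAbs, ?_⟩
    rw [latticeGauss, Int.cast_sum]
    refine Finset.sum_congr rfl fun s _ => ?_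
    rw [hz, Int.cast_pow, Int.cast_neg, Int.cast_one, Int.cast_one]
    have hm : eQ (1 / 2) = -1 := by
      rw [eQ, ee, ← Complex.exp_pi_mul_I]; congr 1; push_cast; ring
    have : eQ ((1 : ℚ) * z s / (2 : ℕ)) = eQ ((z s).natAbs * (1 / 2 : ℚ)) := by
      rcases Int.natAbs_eq (z s) with h | h
      · congr 1
        rw [h]; simp; ring
      · refine eQ_congr ⟨z s, ?_⟩
        have : (z s : ℚ) = -((z s).natAbs : ℚ) := by exact_mod_cast congrArg (Int.cast : ℤ → ℚ) h
        rw [this]; push_cast; ring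
    rw [this, eQ_nat_mul, hm]
  rw [hz, norm_mul, norm_mul, norm_pow, norm_inv, norm_pow, Complex.norm_real,
      Real.norm_of_nonneg (Real.sqrt_nonneg _), Complex.norm_natCast, Complex.norm_intCast] at hnorm
  have h1 : (z.natAbs : ℝ) ^ 2 = 2 ^ n := by
    have hs : (Real.sqrt (2 : ℕ) ^ n) ^ 2 = 2 ^ n := by
      rw [← pow_mul, mul_comm, pow_mul, Real.sq_sqrt (by norm_num)]; norm_num
    have h3 := congrArg (· ^ 2) hnorm
    simp only [mul_pow, one_pow, hs, inv_pow] at h3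
    rw [Nat.cast_ofNat] at h3
    rw [Nat.cast_natAbs, Int.cast_abs]
    have h4 : (2 : ℝ) ^ n ≠ 0 := by positivity
    field_simp at h3
    exact h3
  have h2 : z.natAbs ^ 2 = 2 ^ n := by exact_mod_cast h1
  have h3 := congrArg (fun k => k.factorization 2) h2
  simp only [Nat.factorization_pow, Finsupp.smul_apply, Nat.prime_two.factorization_self,
    smul_eq_mul, mul_one] at h3
  exact ⟨_, by rw [← h3, two_mul]⟩

/-- In even rank the Gauss sum is the same for all h, and the remaining sum of characters over the
nonzero residues is p - 1 or -1. -/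
theorem middle_sum_even (hn : Even n) (hlev : ¬ p ∣ Λ.level)
    {b : Module.Basis (Fin n) ℚ V} (hb : Λ.L = Submodule.span ℤ (Set.range b)) (k : ℤ) :
    ∑ h : Fin (p - 1), ((Real.sqrt p : ℂ) ^ n * (((p : ℂ) ^ n)⁻¹ *
      latticeGauss Λ b p (-((Λ.level : ℤ) * ((h : ℕ) + 1))))) * eQ (k * (((h : ℕ) + 1 : ℕ) : ℚ) / p) =
      gaussSum Λ 1 / gaussSum Λ p * ((if (p : ℤ) ∣ k then (p : ℂ) else 0) - 1) := by
  have hp := (Fact.out : p.Prime)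
  have hpi : Prime (p : ℤ) := Nat.prime_iff_prime_int.mp hp
  have h1 : ∀ h : Fin (p - 1), latticeGauss Λ b p (-((Λ.level : ℤ) * ((h : ℕ) + 1))) =
      latticeGauss Λ b p 1 := fun h => by
    refine latticeGauss_even hn hlev hb ?_
    rw [dvd_neg]
    intro hd
    rcases hpi.dvd_or_dvd hd with hd | hd
    · exact hlev (by exact_mod_cast hd)
    · have h2 : p ∣ (h : ℕ) + 1 := by exact_mod_cast hd
      have := Nat.le_of_dvd (Nat.succ_pos _) h2
      have := h.2
      omega
  simp_rw [h1, normalised_latticeGauss_one hlev hb, ← Finset.mul_sum]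
  congr 1
  rw [← sum_fin_eQ hp.pos k, Fin.sum_univ_eq_sum_range (fun h => eQ (k * ((h + 1 : ℕ) : ℚ) / p)),
    Fin.sum_univ_eq_sum_range (fun h => eQ ((h : ℕ) * (k / p : ℚ)))]
  obtain ⟨q, hq⟩ : ∃ q, p = q + 1 := ⟨p - 1, by have := hp.pos; omega⟩
  have hq' : p - 1 = q := by omega
  rw [hq', show Finset.range p = Finset.range (q + 1) by rw [hq], Finset.sum_range_succ']
  simp only [Nat.cast_zero, zero_mul, eQ_zero, add_sub_cancel_right]
  refine Finset.sum_congr rfl fun h _ => ?_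
  congr 1; ring

theorem sum_fin_eq_sum_zmod (F : ZMod p → ℂ) :
    ∑ h : Fin (p - 1), F (((h : ℕ) + 1 : ℕ)) = ∑ a, F a - F 0 := by
  have hp := (Fact.out : p.Prime)
  have hbij : Function.Bijective fun (s : Fin p) => ((s : ℕ) : ZMod p) := by
    rw [Fintype.bijective_iff_injective_and_card]
    refine ⟨fun s t hst => Fin.ext ?_, by simp⟩
    have := (ZMod.natCast_eq_natCast_iff' _ _ _).mp hst
    rwa [Nat.mod_eq_of_lt s.2, Nat.mod_eq_of_lt t.2] at this
  rw [← hbij.sum_comp, Fin.sum_univ_eq_sum_range (fun h => F ((h + 1 : ℕ) : ZMod p)),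
    Fin.sum_univ_eq_sum_range (fun h => F ((h : ℕ) : ZMod p))]
  obtain ⟨q, hq⟩ : ∃ q, p = q + 1 := ⟨p - 1, by have := hp.pos; omega⟩
  have hq' : p - 1 = q := by omega
  rw [hq', show Finset.range p = Finset.range (q + 1) by rw [hq], Finset.sum_range_succ']
  simp

/-- In odd rank the Gauss sum depends on h through (h/p), so the sum over h is itself a quadratic
Gauss sum in k. The exponent n + 1 of the Gauss sum modulo p is even, and its square (-1/p)p gives
the factor (-1/p)^((n+1)/2) found in `chi_eq`. -/
theorem middle_sum_odd (hn : Odd n) (hlev : ¬ p ∣ Λ.level)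
    {b : Module.Basis (Fin n) ℚ V} (hb : Λ.L = Submodule.span ℤ (Set.range b)) (k : ℤ) :
    ∑ h : Fin (p - 1), ((Real.sqrt p : ℂ) ^ n * (((p : ℂ) ^ n)⁻¹ *
      latticeGauss Λ b p (-((Λ.level : ℤ) * ((h : ℕ) + 1))))) * eQ (k * (((h : ℕ) + 1 : ℕ) : ℚ) / p) =
      chi Λ p * (legendreSym p (-(Λ.level * k)) : ℂ) * Real.sqrt p := by
  have hp := (Fact.out : p.Prime)
  have hpi : Prime (p : ℤ) := Nat.prime_iff_prime_int.mp hp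
  have hp2 : p ≠ 2 := fun h => Nat.not_even_iff_odd.mpr hn (even_finrank_of_two h hlev)
  have h2 : (2 : ZMod p) ≠ 0 := fun h0 => hp2 ((Nat.prime_dvd_prime_iff_eq hp Nat.prime_two).mp
      ((ZMod.natCast_eq_zero_iff 2 p).mp (by exact_mod_cast h0)))
  obtain ⟨G, hG⟩ := exists_gram hb
  obtain ⟨hdet0, hF⟩ := latticeGauss_eq hb hG hp2 hlev
  obtain ⟨r, ε, hε, hdet⟩ := exists_det_gram hG
  have hcard := not_dvd_card (nsmul_injective_of_not_dvd_level hp hlev)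
  have hε0 : ((ε * Fintype.card Λ.Disc : ℤ) : ZMod p) ≠ 0 := by
    intro h0
    rcases hpi.dvd_or_dvd ((ZMod.intCast_zmod_eq_zero_iff_dvd _ p).mp h0) with hd | hd
    · have h3 : IsUnit ε := by
        have h1 : (ε : ℂ) ^ 4 = 1 := by
          rw [hε, ← zpow_natCast, ← zpow_mul, mul_comm, zpow_mul, zpow_natCast]
          norm_num [I_pow_four]
        exact (isUnit_pow_iff four_ne_zero).mp (by rw [show ε ^ 4 = 1 by exact_mod_cast h1]; exact isUnit_one)
      exact hpi.not_isUnit (isUnit_of_dvd_unit hd h3)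
    · exact hcard (by exact_mod_cast hd)
  have hchi := chi_eq hp2 hcard hn hε
  rw [← legChar_eq_of_eq_sq_mul (p := p) (by rw [Int.cast_mul, Int.cast_natCast]; exact hdet) hdet0 hε0] at hchi
  obtain ⟨m, hm⟩ := hn
  let C : ℂ := (Real.sqrt p : ℂ) ^ n * (((p : ℂ) ^ n)⁻¹ *
    (legChar p 2 * legChar p (-(Λ.level : ℤ) : ℤ) * legChar p (G.det : ℤ) * quadGauss p ^ n))
  have hpw : ∀ h : ℤ, (legChar p 2 * legChar p h) ^ n = legChar p 2 * legChar p h := fun h => by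
    by_cases h0 : (h : ZMod p) = 0
    · rw [h0, MulChar.map_zero, mul_zero, zero_pow (by omega)]
    · rw [hm, pow_succ, pow_mul, mul_pow, legChar_sq h2, legChar_sq h0, one_mul, one_pow, one_mul]
  have h1 : ∀ h : Fin (p - 1), ((Real.sqrt p : ℂ) ^ n * (((p : ℂ) ^ n)⁻¹ *
      latticeGauss Λ b p (-((Λ.level : ℤ) * ((h : ℕ) + 1))))) * eQ (k * (((h : ℕ) + 1 : ℕ) : ℚ) / p) =
      C * (fun a : ZMod p => legChar p a * ZMod.stdAddChar ((k : ZMod p) * a)) (((h : ℕ) + 1 : ℕ)) :=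
      fun h => by
    have hnd : ¬ (p : ℤ) ∣ -((Λ.level : ℤ) * ((h : ℕ) + 1)) := by
      rw [dvd_neg]
      intro hd
      rcases hpi.dvd_or_dvd hd with hd | hd
      · exact hlev (by exact_mod_cast hd)
      · have h2 : p ∣ (h : ℕ) + 1 := by exact_mod_cast hd
        have := Nat.le_of_dvd (Nat.succ_pos _) h2
        have := h.2
        omega
    have hs : eQ (k * (((h : ℕ) + 1 : ℕ) : ℚ) / p) =
        ZMod.stdAddChar ((k : ZMod p) * (((h : ℕ) + 1 : ℕ) : ZMod p)) := by
      have : (k : ZMod p) * (((h : ℕ) + 1 : ℕ) : ZMod p) = ((k * ((h : ℕ) + 1 : ℕ) : ℤ) : ZMod p) := by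
        push_cast; rfl
      rw [this, ZMod.stdAddChar_coe, eQ, ee]
      congr 1; push_cast; ring
    have hl : legChar p (-((Λ.level : ℤ) * ((h : ℕ) + 1)) : ℤ) =
        legChar p (-(Λ.level : ℤ) : ℤ) * legChar p (((h : ℕ) + 1 : ℕ) : ZMod p) := by
      rw [← map_mul]; congr 1; push_cast; ring
    rw [hF _ hnd, hpw, hs, hl]
    simp only [C]
    ring
  rw [Finset.sum_congr rfl fun h _ => h1 h, ← Finset.mul_sum, sum_fin_eq_sum_zmod
      (fun a : ZMod p => legChar p a * ZMod.stdAddChar ((k : ZMod p) * a)),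
    sum_legChar_mul_stdAddChar hp2]
  simp only [MulChar.map_zero, zero_mul, sub_zero]
  have hlk : ((legendreSym p (-(Λ.level * k)) : ℤ) : ℂ) =
      legChar p (-(Λ.level : ℤ) : ℤ) * legChar p (k : ZMod p) := by
    rw [← legChar_intCast, ← map_mul]; congr 1; push_cast; ring
  have hm2 : (n + 1) / 2 = m + 1 := by omega
  have hg : quadGauss p ^ n * quadGauss p = legChar p (-1) ^ (m + 1) * (p : ℂ) ^ (m + 1) := by
    rw [← mul_pow, ← quadGauss_sq hp2, ← pow_mul, ← pow_succ, hm]; congr 1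
  have hsq : (Real.sqrt p : ℂ) ^ n * (((p : ℂ) ^ n)⁻¹ * (p : ℂ) ^ (m + 1)) = Real.sqrt p := by
    have hs : (Real.sqrt p : ℂ) ^ 2 = p := by
      rw [← Complex.ofReal_pow, Real.sq_sqrt (Nat.cast_nonneg _)]; simp
    have hp0 : (p : ℂ) ≠ 0 := by exact_mod_cast hp.ne_zero
    rw [hm, pow_succ, pow_mul, hs]
    field_simp
    ring
  rw [hlk, hchi, hm2]
  simp only [C]
  linear_combination (legChar p 2 * legChar p (-(Λ.level : ℤ) : ℤ) * legChar p (G.det : ℤ) *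
    legChar p (k : ZMod p)) * ((Real.sqrt p : ℂ) ^ n * ((p : ℂ) ^ n)⁻¹) * hg +
    (legChar p 2 * legChar p (-(Λ.level : ℤ) : ℤ) * legChar p (G.det : ℤ) *
    legChar p (k : ZMod p)) * legChar p (-1) ^ (m + 1) * hsq

end VVMF
end

noncomputable section
namespace VVMF

/-! ### Fourier coefficients -/

open Complex Filter Topology

open EvenLattice

section Periodic

variable {F : ℂ → ℂ}

theorem continuous_horizontal (hd : ∀ z : ℂ, 0 < z.im → DifferentiableAt ℂ F z) {c T : ℝ}
    (hT : 0 < T) (a : ℝ) : Continuous fun u : ℝ => F (c * u + a + T * I) := by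
  rw [continuous_iff_continuousAt]
  intro u
  have h : 0 < ((c : ℂ) * u + a + T * I).im := by simpa [← Complex.ofReal_mul] using hT
  exact ContinuousAt.comp (f := fun u : ℝ => (c : ℂ) * u + a + T * I) (hd _ h).continuousAt
    (by fun_prop)

/-- The mean value of a periodic holomorphic function over a horizontal segment does not depend on
the height. -/
theorem integral_height (hd : ∀ z : ℂ, 0 < z.im → DifferentiableAt ℂ F z)
    (hper : ∀ z : ℂ, 0 < z.im → F (z + 1) = F z) {T T' : ℝ} (hT : 0 < T) (hT' : 0 < T') :
    ∫ u in (0 : ℝ)..1, F (u + T * I) = ∫ u in (0 : ℝ)..1, F (u + T' * I) := by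
  have h := Complex.integral_boundary_rect_eq_zero_of_differentiableOn F (T * I) (1 + T' * I)
    (fun z hz => by
      refine (hd z ?_).differentiableWithinAt
      have hz2 := hz.2
      simp only [Set.mem_preimage, Complex.mul_im, Complex.add_im] at hz2
      simp at hz2
      have := (Set.mem_uIcc.mp hz2)
      rcases this with h | h
      · linarith [h.1]
      · linarith [h.1])
  have hv : ∫ y : ℝ in T..T', F (1 + y * I) = ∫ y : ℝ in T..T', F (0 + y * I) := by
    refine intervalIntegral.integral_congr fun y hy => ?_
    have hy0 : 0 < y := by
      rcases Set.mem_uIcc.mp hy with h | h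
      · linarith [h.1]
      · linarith [h.1]
    change F (1 + y * I) = F (0 + y * I)
    rw [zero_add, add_comm, hper _ (by simpa using hy0)]
  simp at h
  simp only [zero_add] at hv
  rw [hv] at h
  linear_combination h

theorem integral_shift (hper : ∀ z : ℂ, 0 < z.im → F (z + 1) = F z) {T : ℝ} (hT : 0 < T) (a : ℝ) :
    ∫ u in (0 : ℝ)..1, F (u + a + T * I) = ∫ u in (0 : ℝ)..1, F (u + T * I) := by
  have hp : Function.Periodic (fun u : ℝ => F (u + T * I)) 1 := fun u => by
    change F ((u + 1 : ℝ) + T * I) = F (u + T * I)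
    rw [← hper (u + T * I) (by simpa using hT)]
    congr 1; push_cast; ring
  have h1 := intervalIntegral.integral_comp_add_right (a := 0) (b := 1)
    (fun u : ℝ => F (u + T * I)) a
  have h2 := hp.intervalIntegral_add_eq a 0
  rw [zero_add, add_comm a 1] at h2
  rw [zero_add, h2] at h1
  rw [← h1]
  refine intervalIntegral.integral_congr fun u _ => ?_
  push_cast; rfl

theorem integral_scale (hd : ∀ z : ℂ, 0 < z.im → DifferentiableAt ℂ F z)
    (hper : ∀ z : ℂ, 0 < z.im → F (z + 1) = F z) {T : ℝ} (hT : 0 < T) {P : ℕ}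
    (hP : 0 < P) :
    ∫ u in (0 : ℝ)..1, F (P * u + T * I) = ∫ u in (0 : ℝ)..1, F (u + T * I) := by
  have hp : Function.Periodic (fun u : ℝ => F (u + T * I)) 1 := fun u => by
    change F ((u + 1 : ℝ) + T * I) = F (u + T * I)
    rw [← hper (u + T * I) (by simpa using hT)]
    congr 1; push_cast; ring
  have hP0 : (P : ℝ) ≠ 0 := by exact_mod_cast hP.ne'
  have h1 := intervalIntegral.integral_comp_mul_left (a := 0) (b := 1)
    (fun u : ℝ => F (u + T * I)) hP0
  have h2 := hp.intervalIntegral_add_zsmul_eq P 0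
  simp only [zero_add, zsmul_eq_mul, mul_one, Int.cast_natCast] at h2
  have hc : Continuous fun u : ℝ => F (u + T * I) := by
    simpa using continuous_horizontal hd (c := 1) hT 0
  replace h2 := h2 fun _ _ => hc.intervalIntegrable _ _
  rw [mul_zero, mul_one, h2] at h1
  have h3 : ∫ u in (0 : ℝ)..1, F (P * u + T * I) = ∫ u in (0 : ℝ)..1, F ((P * u : ℝ) + T * I) := by
    refine intervalIntegral.integral_congr fun u _ => ?_
    push_cast; rfl
  have hPc : (P : ℂ) ≠ 0 := by exact_mod_cast hP.ne'
  rw [h3, h1]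
  simp [hPc]

theorem sum_integral_div (hd : ∀ z : ℂ, 0 < z.im → DifferentiableAt ℂ F z) {T : ℝ} (hT : 0 < T)
    {P : ℕ} (hP : 0 < P) :
    ∑ j : Fin P, ∫ u in (0 : ℝ)..1, F ((u + T * I + (j : ℕ)) / P) =
      P * ∫ u in (0 : ℝ)..1, F (u + (T / P : ℝ) * I) := by
  have hP0 : (P : ℝ) ≠ 0 := by exact_mod_cast hP.ne'
  have hPc : (P : ℂ) ≠ 0 := by exact_mod_cast hP.ne'
  let g : ℝ → ℂ := fun u => F (((P : ℝ)⁻¹ : ℝ) * u + (0 : ℝ) + (T / P : ℝ) * I)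
  have hg : Continuous g := continuous_horizontal hd (div_pos hT (by exact_mod_cast hP)) 0
  have h1 : ∀ j : ℕ, ∫ u in (0 : ℝ)..1, F ((u + T * I + (j : ℕ)) / P) =
      ∫ u in (j : ℝ)..((j + 1 : ℕ) : ℝ), g u := fun j => by
    have := intervalIntegral.integral_comp_add_right (a := 0) (b := 1) g (j : ℝ)
    rw [zero_add, add_comm (1 : ℝ)] at this
    rw [Nat.cast_succ, ← this]
    refine intervalIntegral.integral_congr fun u _ => ?_
    change F _ = F _
    congr 1
    push_cast
    field_simp
    ring
  rw [Fin.sum_univ_eq_sum_range (fun j => ∫ u in (0 : ℝ)..1, F ((u + T * I + (j : ℕ)) / P)),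
    Finset.sum_congr rfl fun j _ => h1 j,
    intervalIntegral.sum_integral_adjacent_intervals (a := fun j : ℕ => (j : ℝ))
      fun k _ => hg.intervalIntegrable _ _]
  have h2 := intervalIntegral.integral_comp_mul_left (a := 0) (b := P)
    (fun u : ℝ => F (u + (T / P : ℝ) * I)) (inv_ne_zero hP0)
  rw [mul_zero, inv_mul_cancel₀ hP0, inv_inv] at h2
  rw [Nat.cast_zero]
  refine Eq.trans (intervalIntegral.integral_congr fun u _ => ?_) (h2.trans (by simp))
  change F _ = F _
  congr 1
  push_cast
  ring

/-- The mean over a period is invariant under the translation by a, which also multiplies it by ζ ≠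
1. -/
theorem integral_eq_zero_of_shift (hper : ∀ z : ℂ, 0 < z.im → F (z + 1) = F z) {T : ℝ}
    (hT : 0 < T) {a : ℝ} {ζ : ℂ} (hζ : ζ ≠ 1)
    (h : ∀ z : ℂ, 0 < z.im → F (z + a) = ζ * F z) :
    ∫ u in (0 : ℝ)..1, F (u + T * I) = 0 := by
  have h1 := integral_shift hper hT a
  have h2 : ∫ u in (0 : ℝ)..1, F (u + a + T * I) = ζ * ∫ u in (0 : ℝ)..1, F (u + T * I) := by
    rw [← intervalIntegral.integral_const_mul]
    refine intervalIntegral.integral_congr fun u _ => ?_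
    change F (u + a + T * I) = ζ * F (u + T * I)
    rw [← h _ (by simpa using hT)]
    congr 1; ring
  rw [h2] at h1
  have h3 : (ζ - 1) * ∫ u in (0 : ℝ)..1, F (u + T * I) = 0 := by linear_combination h1
  exact (mul_eq_zero.mp h3).resolve_left (sub_ne_zero.mpr hζ)

theorem integral_linear (a b c : ℂ) {gA gB gC : ℝ → ℂ} (hA : Continuous gA) (hB : Continuous gB)
    (hC : Continuous gC) :
    ∫ u in (0 : ℝ)..1, a * (b * gA u + (c * gB u + gC u)) =
      a * (b * (∫ u in (0 : ℝ)..1, gA u) +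
        (c * (∫ u in (0 : ℝ)..1, gB u) + ∫ u in (0 : ℝ)..1, gC u)) := by
  have hBC : Continuous fun u => c * gB u + gC u := (hB.const_mul c).add hC
  have hA' : Continuous fun u => b * gA u := hA.const_mul b
  have hB' : Continuous fun u => c * gB u := hB.const_mul c
  rw [intervalIntegral.integral_const_mul, intervalIntegral.integral_add
    (hA'.intervalIntegrable _ _) (hBC.intervalIntegrable _ _), intervalIntegral.integral_add
    (hB'.intervalIntegrable _ _) (hC.intervalIntegrable _ _), intervalIntegral.integral_const_mul,
    intervalIntegral.integral_const_mul]

end Periodic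

variable {V : Type*} [AddCommGroup V] [Module ℚ V] [FiniteDimensional ℚ V] {Λ : EvenLattice V}

theorem comp_add_one {κ : ℤ} {f : ℍ → GrpAlg Λ} (hf : IsCuspForm Λ κ f) (y : Λ.Disc) {z : ℂ}
    (hz : 0 < z.im) : comp f y (z + 1) = e (Λ.qbar y) * comp f y z := by
  let τ : ℍ := ⟨z, hz⟩
  have h1 : (((genT Λ).1.M • τ : ℍ) : ℂ) = z + 1 := by
    have := coe_genT_zpow_smul (Λ := Λ) 1 τ
    rw [zpow_one] at this
    rw [this]; simp [τ]
  have h2 := (genT Λ).2.apply_symm_apply (f ((genT Λ).1.M • τ))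
  have h3 : (genT Λ).2.symm (f ((genT Λ).1.M • τ)) = f τ := by
    have h4 := congrFun (hf.slash_eq (genT Λ) genT_mem) τ
    rw [slash, det_of_mem genT_mem] at h4
    have h5 : (genT Λ).1.φ τ = 1 := rfl
    rw [h5] at h4
    simpa using h4
  rw [h3] at h2
  rw [← comp_eq f y h1, ← h2, ← comp_eq f y (τ := τ) rfl]
  rfl

theorem differentiableAt_comp {κ : ℤ} {f : ℍ → GrpAlg Λ} (hf : IsCuspForm Λ κ f) (y : Λ.Disc)
    {z : ℂ} (hz : 0 < z.im) : DifferentiableAt ℂ (comp f y) z := by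
  have h := UpperHalfPlane.mdifferentiable_iff.mp (hf.holo y)
  exact (h z hz).differentiableAt ((isOpen_lt continuous_const Complex.continuous_im).mem_nhds hz)

/-- The `y`-component of `f`, multiplied by `e(-mτ)`. -/
def twist (f : ℍ → GrpAlg Λ) (y : Λ.Disc) (m : ℚ) (z : ℂ) : ℂ := comp f y z * ee (-(m * z))

theorem twist_differentiableAt {κ : ℤ} {f : ℍ → GrpAlg Λ} (hf : IsCuspForm Λ κ f) (y : Λ.Disc)
    (m : ℚ) (z : ℂ) (hz : 0 < z.im) : DifferentiableAt ℂ (twist f y m) z := by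
  refine (differentiableAt_comp hf y hz).mul ?_
  unfold ee
  fun_prop

theorem twist_add_one {κ : ℤ} {f : ℍ → GrpAlg Λ} (hf : IsCuspForm Λ κ f) {y : Λ.Disc} {m : ℚ}
    (z : ℂ) (hz : 0 < z.im) :
    twist f y m (z + 1) = e (Λ.qbar y - ((m : ℝ) : UnitAddCircle)) * twist f y m z := by
  have h : e (-((m : ℝ) : UnitAddCircle)) = ee (-m) := by
    rw [← AddCircle.coe_neg, e_coe]; simp
  rw [twist, twist, comp_add_one hf y hz, sub_eq_add_neg, e_add, h, mul_add, mul_one, neg_add, ee_add]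
  ring

theorem twist_add_nat {κ : ℤ} {f : ℍ → GrpAlg Λ} (hf : IsCuspForm Λ κ f) {y : Λ.Disc} {m : ℚ}
    (k : ℕ) (z : ℂ) (hz : 0 < z.im) :
    twist f y m (z + k) = e (k • (Λ.qbar y - ((m : ℝ) : UnitAddCircle))) * twist f y m z := by
  induction k with
  | zero => simp [e_zero]
  | succ k ih =>
    rw [Nat.cast_succ, ← add_assoc, twist_add_one hf _ (by simpa using hz), ih, ← mul_assoc, ← e_add,
      succ_nsmul']

theorem twist_periodic {κ : ℤ} {f : ℍ → GrpAlg Λ} (hf : IsCuspForm Λ κ f) {y : Λ.Disc} {m : ℚ}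
    (hm : ((m : ℝ) : UnitAddCircle) = Λ.qbar y) (z : ℂ) (hz : 0 < z.im) :
    twist f y m (z + 1) = twist f y m z := by
  rw [twist_add_one hf z hz, hm, sub_self, e_zero, one_mul]

theorem fourierCoeff_eq (f : ℍ → GrpAlg Λ) (y : Λ.Disc) (m : ℚ) :
    fourierCoeff Λ f y m = ∫ u in (0 : ℝ)..1, twist f y m (u + (1 : ℝ) * I) := by
  refine intervalIntegral.integral_congr fun u _ => ?_
  have h : ((u +ᵥ UpperHalfPlane.I : ℍ) : ℂ) = u + (1 : ℝ) * I := by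
    rw [UpperHalfPlane.coe_vadd]; simp
  change f (u +ᵥ UpperHalfPlane.I) y * _ = twist f y m (u + (1 : ℝ) * I)
  rw [comp_eq f y h, twist, ee]
  congr 2
  push_cast
  ring

theorem fourierCoeff_eq_height {κ : ℤ} {f : ℍ → GrpAlg Λ} (hf : IsCuspForm Λ κ f) {y : Λ.Disc}
    {m : ℚ} (hm : ((m : ℝ) : UnitAddCircle) = Λ.qbar y) {T : ℝ} (hT : 0 < T) :
    fourierCoeff Λ f y m = ∫ u in (0 : ℝ)..1, twist f y m (u + T * I) := by
  rw [fourierCoeff_eq]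
  exact integral_height (twist_differentiableAt hf y m) (twist_periodic hf hm) one_pos hT

local notation "n" => Module.finrank ℚ V

theorem coe_eq_iff_ee {m : ℚ} {x : UnitAddCircle} : ((m : ℝ) : UnitAddCircle) = x ↔
    e (x - ((m : ℝ) : UnitAddCircle)) = 1 := by
  constructor
  · rintro rfl; simp [e_zero]
  · intro h
    have h1 : AddCircle.toCircle (x - ((m : ℝ) : UnitAddCircle)) = 1 := Circle.ext h
    have h2 : x - ((m : ℝ) : UnitAddCircle) = 0 :=
      AddCircle.injective_toCircle one_ne_zero (by rw [h1, AddCircle.toCircle_zero])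
    exact (sub_eq_zero.mp h2).symm

/-! ### The Hecke operator on Fourier coefficients -/

section Hecke

variable {p : ℕ} [Fact p.Prime]

/-- Distributing e(-mz) over the three families turns each summand into a twist with its own
frequency: m/p² for α, p²m for (1, j; 0, p²), where it also absorbs the phases e(-j q), and m for
(p, h; 0, p), where a character of h is left over. -/
theorem heckeOp_twist (hinj : Function.Injective fun y : Λ.Disc => p • y) (hlev : ¬ p ∣ Λ.level)
    {b : Module.Basis (Fin n) ℚ V} (hb : Λ.L = Submodule.span ℤ (Set.range b))
    {κ : ℤ} {f : ℍ → GrpAlg Λ} (hf : IsCuspForm Λ κ f) {ev : ℂ} (hev : heckeOp Λ κ p f = ev • f)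
    {y : Λ.Disc} {m : ℚ} (hm : ((m : ℝ) : UnitAddCircle) = Λ.qbar (p • y)) {k : ℤ}
    (hk : (Λ.level : ℚ) * m = k) (z : ℂ) (hz : 0 < z.im) :
    ev * twist f (p • y) m z = (((p : ℝ) ^ ((κ : ℝ) / 2 - 2) : ℝ) : ℂ) *
      ((((p : ℝ) ^ ((κ : ℝ) / 2) : ℝ) : ℂ) * twist f y (m / p ^ 2) (p ^ 2 * z) +
       ((((p : ℝ) ^ (-((κ : ℝ) / 2)) : ℝ) : ℂ) * ∑ j : Fin (p ^ 2),
          twist f (p • p • y) (p ^ 2 * m) ((z + (j : ℕ)) / (p ^ 2 : ℕ)) +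
        ∑ h : Fin (p - 1), ((Real.sqrt p : ℂ) ^ n * (((p : ℂ) ^ n)⁻¹ *
          latticeGauss Λ b p (-((Λ.level : ℤ) * ((h : ℕ) + 1))))) *
          eQ (k * (((h : ℕ) + 1 : ℕ) : ℚ) / p) *
          twist f (p • y) m (z + (((Λ.level : ℝ) * ((h : ℕ) + 1) / p : ℝ) : ℂ)))) := by
  have hp0 : (p : ℂ) ≠ 0 := by exact_mod_cast (Fact.out : p.Prime).ne_zero
  let τ : ℍ := ⟨z, hz⟩
  have h := heckeOp_apply hinj hlev hb hf τ y
  have hz' : (τ : ℂ) = z := rfl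
  rw [hev, Pi.smul_apply, Pi.smul_apply, smul_eq_mul, comp_eq f _ hz', hz'] at h
  rw [twist, ← mul_assoc, h, mul_assoc, add_mul, add_mul]
  congr 2
  · rw [mul_assoc, twist]
    congr 3
    push_cast
    field_simp
  · congr 1
    · rw [mul_assoc, Finset.sum_mul]
      congr 1
      refine Finset.sum_congr rfl fun j _ => ?_
      have h1 : e (-((j : ℕ) • Λ.qbar (p • y))) = ee (-(m * (j : ℕ))) := by
        rw [← hm, ← AddCircle.coe_nsmul, ← AddCircle.coe_neg, e_coe]
        congr 1
        push_cast
        rw [nsmul_eq_mul]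
        ring
      rw [h1, twist]
      have h2 : ee (-(((p ^ 2 * m : ℚ) : ℂ) * ((z + (j : ℕ)) / ((p ^ 2 : ℕ) : ℂ)))) =
          ee (-(m * (j : ℕ))) * ee (-(m * z)) := by
        rw [← ee_add]
        congr 1
        push_cast
        field_simp
        ring
      rw [h2]
      push_cast
      ring
    · rw [Finset.sum_mul]
      refine Finset.sum_congr rfl fun j _ => ?_
      have h1 : z + (((Λ.level : ℝ) * ((j : ℕ) + 1) / p : ℝ) : ℂ) =
          z + (((Λ.level : ℤ) * ((j : ℕ) + 1) : ℤ) : ℂ) / p := by push_cast; ring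
      have h2 : ee (-(m * z)) = eQ (k * (((j : ℕ) + 1 : ℕ) : ℚ) / p) *
          ee (-(m * (z + (((Λ.level : ℤ) * ((j : ℕ) + 1) : ℤ) : ℂ) / p))) := by
        rw [eQ, ← hk, ← ee_add]
        congr 1
        push_cast
        field_simp
        ring
      rw [h1, twist, h2]
      ring

/-- The action of the Hecke operator on Fourier coefficients. -/
theorem hecke_fourierCoeff (hlev : ¬ p ∣ Λ.level)
    {b : Module.Basis (Fin n) ℚ V} (hb : Λ.L = Submodule.span ℤ (Set.range b))
    {κ : ℤ} {f : ℍ → GrpAlg Λ} (hf : IsCuspForm Λ κ f) {ev : ℂ} (hev : heckeOp Λ κ p f = ev • f)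
    {y : Λ.Disc} {m : ℚ} (hm : ((m : ℝ) : UnitAddCircle) = Λ.qbar (p • y)) {k : ℤ}
    (hk : (Λ.level : ℚ) * m = k) :
    ∃ B : ℂ, ((((m / p ^ 2 : ℚ) : ℝ) : UnitAddCircle) = Λ.qbar y →
        B = fourierCoeff Λ f y (m / p ^ 2)) ∧
      ((((m / p ^ 2 : ℚ) : ℝ) : UnitAddCircle) ≠ Λ.qbar y → B = 0) ∧
      ev * fourierCoeff Λ f (p • y) m = (((p : ℝ) ^ ((κ : ℝ) / 2 - 2) : ℝ) : ℂ) *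
      ((((p : ℝ) ^ ((κ : ℝ) / 2) : ℝ) : ℂ) * B +
       ((((p : ℝ) ^ (-((κ : ℝ) / 2)) : ℝ) : ℂ) * (p ^ 2 *
          fourierCoeff Λ f (p • p • y) (p ^ 2 * m)) +
        (∑ h : Fin (p - 1), ((Real.sqrt p : ℂ) ^ n * (((p : ℂ) ^ n)⁻¹ *
          latticeGauss Λ b p (-((Λ.level : ℤ) * ((h : ℕ) + 1))))) *
          eQ (k * (((h : ℕ) + 1 : ℕ) : ℚ) / p)) * fourierCoeff Λ f (p • y) m)) := by
  have hp := (Fact.out : p.Prime)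
  have hp0 : (p : ℂ) ≠ 0 := by exact_mod_cast hp.ne_zero
  have hpR : (0 : ℝ) < (p : ℝ) ^ 2 := by have := hp.pos; positivity
  have hinj := nsmul_injective_of_not_dvd_level (Λ := Λ) hp hlev
  -- B is the mean of the contribution of α. It is a Fourier coefficient only when m/p² belongs to
  -- q(y) + ℤ.
  refine ⟨∫ u in (0 : ℝ)..1, twist f y (m / p ^ 2) (p ^ 2 * (u + (1 : ℝ) * I)), fun h => ?_,
    fun h => ?_, ?_⟩
  · rw [fourierCoeff_eq_height hf h hpR, ← integral_scale (twist_differentiableAt hf _ _)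
      (twist_periodic hf h) hpR (P := p ^ 2) (by have := hp.pos; positivity)]
    refine intervalIntegral.integral_congr fun u _ => ?_
    congr 1; push_cast; ring
  -- Otherwise z ↦ z + 1/p² multiplies the integrand by a phase different from 1, although p² such
  -- steps give the full period; hence the mean is zero.
  · have hζ : e (Λ.qbar y - (((m / p ^ 2 : ℚ) : ℝ) : UnitAddCircle)) ≠ 1 :=
      fun h1 => h (coe_eq_iff_ee.mpr h1)
    have hp2 : e ((p ^ 2) • (Λ.qbar y - (((m / p ^ 2 : ℚ) : ℝ) : UnitAddCircle))) = 1 := by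
      rw [smul_sub, ← qbar_nsmul, ← hm, ← AddCircle.coe_nsmul]
      have : (p ^ 2) • ((m / p ^ 2 : ℚ) : ℝ) = (m : ℝ) := by
        have hpr : (p : ℝ) ≠ 0 := by exact_mod_cast hp.ne_zero
        rw [nsmul_eq_mul]; push_cast; field_simp
      rw [this, sub_self, e_zero]
    have him : ∀ z : ℂ, 0 < z.im → 0 < ((p : ℂ) ^ 2 * z).im := fun z hz => by
      have : ((p : ℂ) ^ 2 * z).im = (p : ℝ) ^ 2 * z.im := by
        rw [show (p : ℂ) ^ 2 = (((p : ℝ) ^ 2 : ℝ) : ℂ) by push_cast; rfl, Complex.im_ofReal_mul]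
      rw [this]; positivity
    refine integral_eq_zero_of_shift (F := fun z => twist f y (m / p ^ 2) (p ^ 2 * z)) (fun z hz => ?_)
      one_pos (a := 1 / p ^ 2) hζ (fun z hz => ?_)
    · rw [mul_add, mul_one]
      have := twist_add_nat hf (y := y) (m := m / p ^ 2) (p ^ 2) _ (him z hz)
      rw [hp2, one_mul] at this
      rw [← this]; push_cast; rfl
    · rw [← twist_add_one hf _ (him z hz)]
      congr 1; push_cast; field_simp
  · have hcont : ∀ (w : Λ.Disc) (l : ℚ) (c a T : ℝ), 0 < T →
        Continuous fun u : ℝ => twist f w l (c * u + a + T * I) := fun w l c a T hT =>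
      continuous_horizontal (twist_differentiableAt hf w l) hT a
    have hA : Continuous fun u : ℝ => twist f y (m / p ^ 2) (p ^ 2 * (u + (1 : ℝ) * I)) := by
      convert hcont y (m / p ^ 2) (p ^ 2) 0 (p ^ 2) hpR using 3
      push_cast; ring
    have hB : ∀ j : Fin (p ^ 2), Continuous fun u : ℝ =>
        twist f (p • p • y) (p ^ 2 * m) ((u + (1 : ℝ) * I + (j : ℕ)) / (p ^ 2 : ℕ)) := fun j => by
      convert hcont (p • p • y) (p ^ 2 * m) (1 / p ^ 2) ((j : ℕ) / p ^ 2) (1 / p ^ 2)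
        (by positivity) using 3
      push_cast; field_simp; ring
    have hC : ∀ h : Fin (p - 1), Continuous fun u : ℝ =>
        twist f (p • y) m (u + (1 : ℝ) * I + (((Λ.level : ℝ) * ((h : ℕ) + 1) / p : ℝ) : ℂ)) :=
        fun h => by
      convert hcont (p • y) m 1 ((Λ.level : ℝ) * ((h : ℕ) + 1) / p) 1 one_pos using 3
      push_cast; ring
    have hC' : ∀ h : Fin (p - 1), ∫ u in (0 : ℝ)..1,
        twist f (p • y) m (u + (1 : ℝ) * I + (((Λ.level : ℝ) * ((h : ℕ) + 1) / p : ℝ) : ℂ)) =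
        fourierCoeff Λ f (p • y) m := fun h => by
      rw [fourierCoeff_eq, ← integral_shift (twist_periodic hf hm) one_pos
        ((Λ.level : ℝ) * ((h : ℕ) + 1) / p)]
      refine intervalIntegral.integral_congr fun u _ => ?_
      congr 1; ring
    have hm2 : (((p ^ 2 * m : ℚ) : ℝ) : UnitAddCircle) = Λ.qbar (p • p • y) := by
      rw [qbar_nsmul, ← hm, ← AddCircle.coe_nsmul, nsmul_eq_mul]; push_cast; rfl
    have hB' := sum_integral_div (twist_differentiableAt hf (p • p • y) (p ^ 2 * m)) one_pos
      (P := p ^ 2) (by have := hp.pos; positivity)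
    rw [← fourierCoeff_eq_height hf hm2
      (div_pos one_pos (by have := hp.pos; positivity))] at hB'
    have hB'' : Continuous fun u : ℝ => ∑ j : Fin (p ^ 2),
        twist f (p • p • y) (p ^ 2 * m) ((u + (1 : ℝ) * I + (j : ℕ)) / (p ^ 2 : ℕ)) :=
      continuous_finsetSum _ fun j _ => hB j
    have hC'' : Continuous fun u : ℝ => ∑ h : Fin (p - 1), ((Real.sqrt p : ℂ) ^ n * (((p : ℂ) ^ n)⁻¹ *
          latticeGauss Λ b p (-((Λ.level : ℤ) * ((h : ℕ) + 1))))) *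
          eQ (k * (((h : ℕ) + 1 : ℕ) : ℚ) / p) *
          twist f (p • y) m (u + (1 : ℝ) * I + (((Λ.level : ℝ) * ((h : ℕ) + 1) / p : ℝ) : ℂ)) :=
      continuous_finsetSum _ fun j _ => (hC j).const_mul _
    rw [fourierCoeff_eq f (p • y), ← intervalIntegral.integral_const_mul,
      intervalIntegral.integral_congr fun u _ => heckeOp_twist hinj hlev hb hf hev hm hk
        (u + (1 : ℝ) * I) (by simp), integral_linear _ _ _ hA hB'' hC'',
      intervalIntegral.integral_finsetSum fun j _ => (hB j).intervalIntegrable _ _, hB',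
      intervalIntegral.integral_finsetSum fun j _ => ((hC j).const_mul _).intervalIntegrable _ _]
    simp_rw [intervalIntegral.integral_const_mul, hC', ← Finset.sum_mul, fourierCoeff_eq f (p • y)]
    push_cast
    rfl

end Hecke

end VVMF
end

noncomputable section
namespace VVMF

/-! ### The Hecke bound for the Fourier coefficients -/

open Complex Filter Topology Asymptotics

open EvenLattice

variable {V : Type*} [AddCommGroup V] [Module ℚ V] [FiniteDimensional ℚ V] {Λ : EvenLattice V}

theorem continuous_apply_of_isCuspForm {κ : ℤ} {f : ℍ → GrpAlg Λ} (hf : IsCuspForm Λ κ f)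
    (x : Λ.Disc) : Continuous fun τ => f τ x := (hf.holo x).continuous

/-- The operator ρ(γ) is unitary, so only the factor |φ|^(2κ) remains, and the transformation of
Im(τ)^k cancels it. -/
theorem normSq_invariant {κ : ℤ} {f : ℍ → GrpAlg Λ} (hf : IsCuspForm Λ κ f) (γ : SL(2, ℤ)) (τ : ℍ) :
    normSq (f (γ • τ)) * (γ • τ).im ^ ((κ : ℝ) / 2) = normSq (f τ) * τ.im ^ ((κ : ℝ) / 2) := by
  obtain ⟨x, hx, hγ⟩ := exists_lift (Λ := Λ) γ
  have h := congrFun (hf.slash_eq x hx) τ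
  rw [slash, det_of_mem hx, Real.one_rpow, Complex.ofReal_one, one_smul] at h
  have hM : x.1.M • τ = γ • τ := by rw [hγ]; rfl
  rw [hM] at h
  have hφ := x.1.φ_ne_zero τ
  have h1 : normSq (f τ) = ‖x.1.φ τ ^ (-κ)‖ ^ 2 * normSq (f (γ • τ)) := by
    rw [← h]
    have h2 : normSq (x.2.symm (f (γ • τ))) = normSq (f (γ • τ)) := by
      rw [← normSq_of_mem hx, LinearEquiv.apply_symm_apply]
    rw [← h2]
    simp only [normSq, Pi.smul_apply, smul_eq_mul, norm_mul, mul_pow, Finset.mul_sum]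
  have hsq : ‖x.1.φ τ‖ ^ 2 = ‖UpperHalfPlane.denom x.1.M τ‖ := by rw [← x.1.sq, norm_pow]
  have him : (γ • τ).im = τ.im / ‖x.1.φ τ‖ ^ 4 := by
    have : ‖x.1.φ τ‖ ^ 4 = (‖x.1.φ τ‖ ^ 2) ^ 2 := by ring
    rw [this, hsq, ← Complex.normSq_eq_norm_sq, ← hM, UpperHalfPlane.im_smul_eq_div_normSq,
      det_of_mem hx]
    simp
  have hφ0 : 0 < ‖x.1.φ τ‖ := norm_pos_iff.mpr hφ
  rw [h1, him, Real.div_rpow τ.im_pos.le (by positivity), norm_zpow]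
  have h3 : (‖x.1.φ τ‖ ^ 4) ^ ((κ : ℝ) / 2) = ‖x.1.φ τ‖ ^ (2 * κ) := by
    rw [← Real.rpow_natCast, ← Real.rpow_mul hφ0.le, ← Real.rpow_intCast]
    congr 1; push_cast; ring
  have h4 : (‖x.1.φ τ‖ ^ (-κ)) ^ 2 = (‖x.1.φ τ‖ ^ (2 * κ))⁻¹ := by
    rw [← zpow_natCast, ← zpow_mul, ← zpow_neg]; congr 1; push_cast; ring
  rw [h3, h4]
  field_simp

/-- Translation by the level removes the phases e(q(x)), so each component is periodic; vanishing at
i∞ then means exponential decay, which beats any power of Im τ. -/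
theorem isBigO_cusp {κ : ℤ} {f : ℍ → GrpAlg Λ} (hf : IsCuspForm Λ κ f) (hlev : Λ.level ≠ 0) :
    (fun τ => normSq (f τ) * τ.im ^ ((κ : ℝ) / 2)) =O[UpperHalfPlane.atImInfty]
      fun τ => τ.im ^ (0 : ℝ) := by
  have hL : (0 : ℝ) < Λ.level := by exact_mod_cast Nat.pos_of_ne_zero hlev
  have h1 : ∀ x : Λ.Disc, (fun τ => ‖f τ x‖ ^ 2 * τ.im ^ ((κ : ℝ) / 2))
      =O[UpperHalfPlane.atImInfty] fun τ => τ.im ^ (0 : ℝ) := fun x => by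
    have hper : Function.Periodic ((fun τ => f τ x) ∘ UpperHalfPlane.ofComplex) (Λ.level : ℝ) := by
      intro z
      by_cases hz : 0 < z.im
      · have h := twist_add_nat hf (y := x) (m := 0) Λ.level z hz
        simp only [twist, Rat.cast_zero, zero_mul, neg_zero, ee_zero, mul_one,
          AddCircle.coe_zero, sub_zero, level_smul_qbar hlev, e_zero, one_mul] at h
        simpa [comp] using h
      · have hz' : ¬ 0 < (z + (Λ.level : ℝ)).im := by simpa using hz
        simp only [Function.comp_apply]
        rw [UpperHalfPlane.ofComplex_apply_of_im_nonpos (not_lt.mp hz),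
          UpperHalfPlane.ofComplex_apply_of_im_nonpos (not_lt.mp hz')]
    have h2 := UpperHalfPlane.IsZeroAtImInfty.exp_decay_atImInfty (hf.zero_at_infty x) hL hper
      (hf.holo x) (hf.zero_at_infty x).boundedAtFilter
    have h3 := (h2.norm_left.pow 2).mul (isBigO_refl (fun τ : ℍ => τ.im ^ ((κ : ℝ) / 2))
      UpperHalfPlane.atImInfty)
    refine h3.trans ?_
    simp only [Real.rpow_zero]
    have h4 := (tendsto_rpow_mul_exp_neg_mul_atTop_nhds_zero ((κ : ℝ) / 2) (4 * Real.pi / Λ.level)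
      (by positivity)).comp (tendsto_comap : Tendsto UpperHalfPlane.im UpperHalfPlane.atImInfty atTop)
    refine (h4.congr fun τ => ?_).isBigO_one ℝ
    simp only [Function.comp_apply]
    rw [mul_comm, ← Real.exp_nat_mul]
    congr 2
    push_cast; ring
  have h2 : (fun τ => normSq (f τ) * τ.im ^ ((κ : ℝ) / 2)) =
      fun τ => ∑ x, ‖f τ x‖ ^ 2 * τ.im ^ ((κ : ℝ) / 2) := by
    funext τ; rw [normSq, Finset.sum_mul]
  rw [h2]
  exact IsBigO.fun_sum fun x _ => h1 x

/-- The invariant function ‖f‖² Im(τ)^k is bounded near the cusp, hence on a fundamental domain and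
everywhere. -/
theorem exists_norm_bound {κ : ℤ} {f : ℍ → GrpAlg Λ} (hf : IsCuspForm Λ κ f) (hlev : Λ.level ≠ 0) :
    ∃ C : ℝ, ∀ τ x, ‖f τ x‖ ≤ C * τ.im ^ (-((κ : ℝ) / 4)) := by
  have hcont : Continuous fun τ => normSq (f τ) * τ.im ^ ((κ : ℝ) / 2) := by
    refine Continuous.mul ?_ ?_
    · simp only [normSq]
      exact continuous_finsetSum _ fun x _ => (continuous_apply_of_isCuspForm hf x).norm.pow 2
    · exact UpperHalfPlane.continuous_im.rpow_const fun τ => Or.inl τ.im_ne_zero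
  obtain ⟨C, hC⟩ := ModularGroup.exists_bound_of_invariant_of_isBigO hcont le_rfl
    (isBigO_cusp hf hlev) fun γ τ => normSq_invariant hf γ τ
  refine ⟨Real.sqrt C, fun τ x => ?_⟩
  have h := hC τ
  rw [Real.rpow_zero, mul_one] at h
  have hle : ‖f τ x‖ ^ 2 ≤ normSq (f τ) :=
    Finset.single_le_sum (f := fun x => ‖f τ x‖ ^ 2) (fun _ _ => sq_nonneg _) (Finset.mem_univ x)
  have hy := τ.im_pos
  have h1 : ‖f τ x‖ ^ 2 ≤ C * τ.im ^ (-((κ : ℝ) / 2)) := by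
    have h2 : normSq (f τ) * τ.im ^ ((κ : ℝ) / 2) ≤ C := (le_abs_self _).trans h
    rw [Real.rpow_neg hy.le, ← div_eq_mul_inv, le_div_iff₀ (by positivity)]
    exact (mul_le_mul_of_nonneg_right hle (by positivity)).trans h2
  have h3 : τ.im ^ (-((κ : ℝ) / 4)) = Real.sqrt (τ.im ^ (-((κ : ℝ) / 2))) := by
    rw [Real.sqrt_eq_rpow, ← Real.rpow_mul hy.le]; congr 1; ring
  have hC0 : 0 ≤ C := (norm_nonneg _).trans h
  rw [h3, ← Real.sqrt_mul hC0]
  exact Real.le_sqrt_of_sq_le h1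

/-- The Hecke bound. -/
theorem exists_fourierCoeff_bound {κ : ℤ} {f : ℍ → GrpAlg Λ} (hf : IsCuspForm Λ κ f)
    (hlev : Λ.level ≠ 0) : ∃ C : ℝ, ∀ (x : Λ.Disc) (m : ℚ), 0 < m →
      ((m : ℝ) : UnitAddCircle) = Λ.qbar x → ‖fourierCoeff Λ f x m‖ ≤ C * (m : ℝ) ^ ((κ : ℝ) / 4) := by
  obtain ⟨C, hC⟩ := exists_norm_bound hf hlev
  refine ⟨C * Real.exp (2 * Real.pi), fun x m hm hmx => ?_⟩
  have hm' : (0 : ℝ) < m := by exact_mod_cast hm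
  -- At height 1/m the exponential factor has the constant absolute value e^(2π), and the bound for
  -- f gives m^(k/2).
  have hT : (0 : ℝ) < 1 / m := by positivity
  rw [fourierCoeff_eq_height hf hmx hT]
  have h := intervalIntegral.norm_integral_le_of_norm_le_const (a := 0) (b := 1)
    (f := fun u : ℝ => twist f x m (u + (1 / m : ℝ) * I))
    (C := C * Real.exp (2 * Real.pi) * (m : ℝ) ^ ((κ : ℝ) / 4)) fun u _ => ?_
  · simpa using h
  · let τ : ℍ := ⟨u + (1 / m : ℝ) * I, by
      simpa [← Complex.ofReal_inv, -Complex.ofReal_inv] using hT⟩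
    have him : τ.im = 1 / m := by
      change ((u : ℂ) + (1 / m : ℝ) * I).im = _
      simp
    have h1 := hC τ x
    have h2 : (1 / (m : ℝ)) ^ (-((κ : ℝ) / 4)) = (m : ℝ) ^ ((κ : ℝ) / 4) := by
      rw [one_div, Real.inv_rpow hm'.le, Real.rpow_neg hm'.le, inv_inv]
    rw [him, h2] at h1
    have h3 : ‖ee (-(m * (u + (1 / m : ℝ) * I)))‖ = Real.exp (2 * Real.pi) := by
      rw [norm_ee]
      congr 1
      simp
      field_simp
    rw [twist, norm_mul, h3, ← comp_eq f x (τ := τ) rfl]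
    calc _ ≤ C * (m : ℝ) ^ ((κ : ℝ) / 4) * Real.exp (2 * Real.pi) :=
          mul_le_mul_of_nonneg_right h1 (Real.exp_pos _).le
      _ = _ := by ring

end VVMF
end

noncomputable section
namespace VVMF

/-! ### The recursion along the powers of `p` -/

open Complex Filter Topology

open EvenLattice

/-- The sequence with generating function `(1 + ν y) / (1 - β y + y ^ 2)`. -/
def eulerSeq (β ν : ℂ) : ℕ → ℂ
  | 0 => 1
  | 1 => β + ν
  | j + 2 => β * eulerSeq β ν (j + 1) - eulerSeq β ν j

theorem den_mul_tsum_eulerSeq {β ν y : ℂ} (h : Summable fun j => eulerSeq β ν j * y ^ j) :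
    (1 - β * y + y ^ 2) * ∑' j, eulerSeq β ν j * y ^ j = 1 + ν * y := by
  have h1 : Summable fun j => eulerSeq β ν (j + 1) * y ^ (j + 1) := (summable_nat_add_iff 1).mpr h
  have e0 := h.tsum_eq_zero_add
  have e1 := h1.tsum_eq_zero_add
  have e2 : ∑' j, eulerSeq β ν (j + 1 + 1) * y ^ (j + 1 + 1) =
      β * y * (∑' j, eulerSeq β ν (j + 1) * y ^ (j + 1)) - y ^ 2 * ∑' j, eulerSeq β ν j * y ^ j := by
    rw [← tsum_mul_left, ← tsum_mul_left, ← (h1.mul_left (β * y)).tsum_sub (h.mul_left (y ^ 2))]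
    refine tsum_congr fun j => ?_
    rw [eulerSeq]; ring
  rw [e2] at e1
  simp only [eulerSeq, pow_zero, mul_one, zero_add, pow_one] at e0 e1
  linear_combination e0 + e1 - β * y * e0

/-- If |y| ≥ 1, summability forces c_j → 0. The form X² - βXY + Y² is constant on consecutive terms
of the sequence, so its value 1 + βν + ν² must be zero. Then c_j (-ν)^j = 1 for all j, and |ν| ≤ 1
gives |c_j| ≥ 1, a contradiction. -/
theorem norm_lt_one_of_summable {β ν y : ℂ} (hν : ‖ν‖ ≤ 1)
    (h : Summable fun j => eulerSeq β ν j * y ^ j) : ‖y‖ < 1 := by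
  by_contra! hy
  have ht : Tendsto (eulerSeq β ν) atTop (𝓝 0) := by
    refine squeeze_zero_norm (fun j => ?_) (tendsto_zero_iff_norm_tendsto_zero.mp h.tendsto_atTop_zero)
    rw [norm_mul, norm_pow]
    exact le_mul_of_one_le_right (norm_nonneg _) (one_le_pow₀ hy)
  have hinv : ∀ j, eulerSeq β ν (j + 1) ^ 2 - β * eulerSeq β ν (j + 1) * eulerSeq β ν j +
      eulerSeq β ν j ^ 2 = 1 + β * ν + ν ^ 2 := fun j => by
    induction j with
    | zero => simp only [eulerSeq]; ring
    | succ j ih => rw [← ih, eulerSeq]; ring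
  have ht1 : Tendsto (fun j => eulerSeq β ν (j + 1)) atTop (𝓝 0) :=
    ht.comp (tendsto_add_atTop_nat 1)
  have hlim := ((ht1.pow 2).sub ((ht1.const_mul β).mul ht)).add (ht.pow 2)
  have hz : 1 + β * ν + ν ^ 2 = 0 := by
    refine tendsto_nhds_unique ((tendsto_const_nhds (f := (atTop : Filter ℕ))).congr fun j => (hinv j).symm) ?_
    simpa using hlim
  -- When 1 + βν + ν² = 0 the factor 1 + νy divides 1 - βy + y², and the generating function
  -- degenerates to a geometric series of ratio -y/ν.
  have hpow : ∀ j, eulerSeq β ν j * (-ν) ^ j = 1 ∧ eulerSeq β ν (j + 1) * (-ν) ^ (j + 1) = 1 :=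
      fun j => by
    induction j with
    | zero => exact ⟨by simp [eulerSeq], by simp only [eulerSeq]; linear_combination -hz⟩
    | succ j ih =>
      refine ⟨ih.2, ?_⟩
      rw [eulerSeq]
      linear_combination β * (-ν) * ih.2 - ν ^ 2 * ih.1 - hz
  have hge : ∀ j, 1 ≤ ‖eulerSeq β ν j‖ := fun j => by
    have h1 := congrArg norm (hpow j).1
    rw [norm_mul, norm_pow, norm_neg, norm_one] at h1
    have h2 : ‖ν‖ ^ j ≤ 1 := pow_le_one₀ (norm_nonneg _) hν
    nlinarith [norm_nonneg (eulerSeq β ν j)]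
  have hn := ht.norm
  rw [norm_zero] at hn
  exact absurd (ge_of_tendsto' hn hge) (by norm_num)

/-- Here |νy| < 1, so the numerator is nonzero. The denominator times the sum is the numerator, so
it is nonzero too. -/
theorem tsum_eulerSeq {β ν y : ℂ} (hν : ‖ν‖ ≤ 1) (h : Summable fun j => eulerSeq β ν j * y ^ j) :
    1 - β * y + y ^ 2 ≠ 0 ∧ 1 + ν * y ≠ 0 ∧
      ∑' j, eulerSeq β ν j * y ^ j = (1 + ν * y) / (1 - β * y + y ^ 2) := by
  have hy := norm_lt_one_of_summable hν h
  have hnum : 1 + ν * y ≠ 0 := fun h0 => by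
    have h1 : ν * y = -1 := by linear_combination h0
    have h2 := congrArg norm h1
    rw [norm_mul, norm_neg, norm_one] at h2
    nlinarith [norm_nonneg ν, norm_nonneg y]
  have hS := den_mul_tsum_eulerSeq h
  have hden : 1 - β * y + y ^ 2 ≠ 0 := fun h0 => by
    rw [h0, zero_mul] at hS
    exact hnum hS.symm
  exact ⟨hden, hnum, by rw [← hS]; field_simp⟩

variable {V : Type*} [AddCommGroup V] [Module ℚ V] [FiniteDimensional ℚ V] {Λ : EvenLattice V}

local notation "n" => Module.finrank ℚ V

section

variable {p : ℕ} [Fact p.Prime]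

theorem norm_chi_le (hn : Odd n) (hlev : ¬ p ∣ Λ.level) : ‖chi Λ p‖ ≤ 1 := by
  have hp2 : p ≠ 2 := fun h => Nat.not_even_iff_odd.mpr hn (even_finrank_of_two h hlev)
  obtain ⟨b, hb⟩ := exists_basis Λ
  obtain ⟨G, hG⟩ := exists_gram hb
  obtain ⟨r, ε, hε, -⟩ := exists_det_gram hG
  have hle : ∀ a : ZMod p, ‖legChar p a‖ ≤ 1 := fun a => by
    by_cases ha : a = 0
    · rw [ha, MulChar.map_zero, norm_zero]; exact zero_le_one
    · have h3 := congrArg norm (legChar_sq ha)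
      rw [norm_pow, norm_one] at h3
      exact ((pow_eq_one_iff_of_nonneg (norm_nonneg _) two_ne_zero).mp h3).le
  rw [chi_eq hp2 (not_dvd_card (nsmul_injective_of_not_dvd_level Fact.out hlev)) hn hε, norm_mul,
    norm_mul, norm_pow]
  exact mul_le_one₀ (mul_le_one₀ (hle _) (norm_nonneg _) (hle _)) (by positivity)
    (pow_le_one₀ (norm_nonneg _) (hle _))

variable (Λ) in
/-- The linear coefficient of the numerator of the Euler factor. -/
def eulerNu (p : ℕ) [Fact p.Prime] (t : ℚ) : ℂ :=
  if Even Λ.rk then deltaNotDvd p t * (gaussSum Λ 1 / gaussSum Λ p)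
  else -(chi Λ p * (legendreNeg p t : ℂ) * (((p : ℝ) ^ (-(1 / 2) : ℝ) : ℝ) : ℂ))

variable (Λ) in
/-- The negative of the linear coefficient of the denominator of the Euler factor. -/
def eulerBeta (κ : ℤ) (p : ℕ) (ev : ℂ) : ℂ :=
  if Even Λ.rk then ev / (((p : ℝ) ^ ((κ : ℝ) / 2 - 1) : ℝ) : ℂ) -
      (1 - (p : ℂ)⁻¹) * (gaussSum Λ 1 / gaussSum Λ p)
  else ev / (((p : ℝ) ^ ((κ : ℝ) / 2 - 1) : ℝ) : ℂ)

theorem eulerNum_eq (t : ℚ) (y : ℂ) : eulerNum Λ p t y = 1 + eulerNu Λ p t * y := by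
  unfold eulerNum eulerNu
  split_ifs <;> ring

theorem eulerDen_eq (κ : ℤ) (ev y : ℂ) : eulerDen Λ κ p ev y = 1 - eulerBeta Λ κ p ev * y + y ^ 2 := by
  unfold eulerDen eulerBeta
  split_ifs <;> ring

theorem norm_eulerNu_le (hlev : ¬ p ∣ Λ.level) (t : ℚ) : ‖eulerNu Λ p t‖ ≤ 1 := by
  have hp := (Fact.out : p.Prime)
  unfold eulerNu
  split_ifs with hn
  · have h1 := congrArg norm (gaussSum_ratio_sq (Λ := Λ) hn hlev)
    rw [norm_pow, norm_one] at h1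
    rw [norm_mul, (pow_eq_one_iff_of_nonneg (norm_nonneg _) two_ne_zero).mp h1, mul_one, deltaNotDvd]
    split_ifs <;> simp
  · rw [norm_neg, norm_mul, norm_mul, Complex.norm_real]
    have h1 := norm_chi_le (Λ := Λ) (Nat.not_even_iff_odd.mp hn) hlev
    have h2 : ‖((legendreNeg p t : ℤ) : ℂ)‖ ≤ 1 := by
      have h0 : legendreNeg p t = quadraticChar (ZMod p) ((-(t.num * t.den) : ℤ) : ZMod p) := rfl
      rw [Complex.norm_intCast, h0]
      rcases quadraticChar_isQuadratic (ZMod p) ((-(t.num * t.den) : ℤ) : ZMod p) with h | h | h <;>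
        rw [h] <;> norm_num
    have h3 : ‖(p : ℝ) ^ (-(1 / 2) : ℝ)‖ ≤ 1 := by
      rw [Real.norm_of_nonneg (by positivity)]
      exact Real.rpow_le_one_of_one_le_of_nonpos (by exact_mod_cast hp.one_le) (by norm_num)
    exact mul_le_one₀ (mul_le_one₀ h1 (norm_nonneg _) h2) (norm_nonneg _) h3

/-- The middle coefficient of the Hecke recursion. -/
theorem middle_sum_of_dvd (κ : ℤ) (hlev : ¬ p ∣ Λ.level) {b : Module.Basis (Fin n) ℚ V}
    (hb : Λ.L = Submodule.span ℤ (Set.range b)) (ev : ℂ) {k : ℤ} (hk : (p : ℤ) ∣ k) :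
    ev - (((p : ℝ) ^ ((κ : ℝ) / 2 - 1) : ℝ) : ℂ) / p *
      ∑ h : Fin (p - 1), ((Real.sqrt p : ℂ) ^ n * (((p : ℂ) ^ n)⁻¹ *
      latticeGauss Λ b p (-((Λ.level : ℤ) * ((h : ℕ) + 1))))) * eQ (k * (((h : ℕ) + 1 : ℕ) : ℚ) / p) =
      (((p : ℝ) ^ ((κ : ℝ) / 2 - 1) : ℝ) : ℂ) * eulerBeta Λ κ p ev := by
  have hp := (Fact.out : p.Prime)
  have hp0 : (p : ℂ) ≠ 0 := by exact_mod_cast hp.ne_zero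
  have hK : (((p : ℝ) ^ ((κ : ℝ) / 2 - 1) : ℝ) : ℂ) ≠ 0 := by
    have := hp.pos
    exact_mod_cast (by positivity : (0 : ℝ) < (p : ℝ) ^ ((κ : ℝ) / 2 - 1)).ne'
  unfold eulerBeta
  split_ifs with hn
  · rw [middle_sum_even hn hlev hb, if_pos hk]
    generalize (((p : ℝ) ^ ((κ : ℝ) / 2 - 1) : ℝ) : ℂ) = K at hK ⊢
    generalize gaussSum Λ 1 / gaussSum Λ p = u
    field_simp
  · have h0 : legendreSym p (-(Λ.level * k)) = 0 := by
      rw [legendreSym.eq_zero_iff, ZMod.intCast_zmod_eq_zero_iff_dvd, dvd_neg]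
      exact hk.mul_left _
    rw [middle_sum_odd (Nat.not_even_iff_odd.mp hn) hlev hb, h0]
    generalize (((p : ℝ) ^ ((κ : ℝ) / 2 - 1) : ℝ) : ℂ) = K at hK ⊢
    field_simp
    simp

/-- At the start of a chain p need not divide level·t, and the deviation from `middle_sum_of_dvd` is
exactly the linear coefficient ν of the numerator. The factors m² and level² are invisible to the
Legendre symbol, and p does not divide the denominator of t. -/
theorem middle_sum_base (κ : ℤ) (hlev : ¬ p ∣ Λ.level) {b : Module.Basis (Fin n) ℚ V}
    (hb : Λ.L = Submodule.span ℤ (Set.range b)) (ev : ℂ) {t : ℚ} {k₀ : ℤ}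
    (hk₀ : (Λ.level : ℚ) * t = k₀) {m : ℕ} (hm : ¬ p ∣ m) :
    ev - (((p : ℝ) ^ ((κ : ℝ) / 2 - 1) : ℝ) : ℂ) / p *
      ∑ h : Fin (p - 1), ((Real.sqrt p : ℂ) ^ n * (((p : ℂ) ^ n)⁻¹ *
      latticeGauss Λ b p (-((Λ.level : ℤ) * ((h : ℕ) + 1))))) *
        eQ ((((m : ℤ) ^ 2 * k₀ : ℤ) : ℚ) * (((h : ℕ) + 1 : ℕ) : ℚ) / p) =
      (((p : ℝ) ^ ((κ : ℝ) / 2 - 1) : ℝ) : ℂ) * (eulerBeta Λ κ p ev + eulerNu Λ p t) := by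
  have hp := (Fact.out : p.Prime)
  have hpi : Prime (p : ℤ) := Nat.prime_iff_prime_int.mp hp
  have hp0 : (p : ℂ) ≠ 0 := by exact_mod_cast hp.ne_zero
  have hK : (((p : ℝ) ^ ((κ : ℝ) / 2 - 1) : ℝ) : ℂ) ≠ 0 := by
    have := hp.pos
    exact_mod_cast (by positivity : (0 : ℝ) < (p : ℝ) ^ ((κ : ℝ) / 2 - 1)).ne'
  have hlevi : ¬ (p : ℤ) ∣ Λ.level := by exact_mod_cast hlev
  have hmi : ¬ (p : ℤ) ∣ m := by exact_mod_cast hm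
  have hkt : k₀ * t.den = Λ.level * t.num := by
    have h1 : t * t.den = t.num := Rat.mul_den_eq_num t
    have : (k₀ * t.den : ℚ) = Λ.level * t.num := by rw [← hk₀, ← h1]; ring
    exact_mod_cast this
  have hden : ¬ (p : ℤ) ∣ t.den := fun hd => by
    have h1 : (p : ℤ) ∣ t.num := by
      have h2 : (p : ℤ) ∣ Λ.level * t.num := by rw [← hkt]; exact hd.mul_left _
      exact (hpi.dvd_or_dvd h2).resolve_left hlevi
    have h5 : p ∣ Nat.gcd t.num.natAbs t.den :=
      Nat.dvd_gcd (Int.natCast_dvd.mp h1) (by exact_mod_cast hd)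
    rw [t.reduced] at h5
    exact hp.one_lt.ne' (Nat.dvd_one.mp h5)
  unfold eulerBeta eulerNu
  split_ifs with hn
  · have hiff : (p : ℤ) ∣ (m : ℤ) ^ 2 * k₀ ↔ (p : ℤ) ∣ t.num := by
      constructor
      · intro h
        have h1 : (p : ℤ) ∣ k₀ := (hpi.dvd_or_dvd h).resolve_left fun h => hmi (hpi.dvd_of_dvd_pow h)
        have h2 : (p : ℤ) ∣ Λ.level * t.num := by rw [← hkt]; exact h1.mul_right _
        exact (hpi.dvd_or_dvd h2).resolve_left hlevi
      · intro h
        have h2 : (p : ℤ) ∣ k₀ * t.den := by rw [hkt]; exact h.mul_left _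
        exact ((hpi.dvd_or_dvd h2).resolve_right hden).mul_left _
    rw [middle_sum_even hn hlev hb, deltaNotDvd]
    simp only [hiff]
    generalize (((p : ℝ) ^ ((κ : ℝ) / 2 - 1) : ℝ) : ℂ) = K at hK ⊢
    generalize gaussSum Λ 1 / gaussSum Λ p = u
    split_ifs
    · field_simp
      ring
    · field_simp
      ring
  · have hl : legendreSym p (-(Λ.level * ((m : ℤ) ^ 2 * k₀))) = legendreNeg p t := by
      have hsq : ∀ a : ℤ, ¬ (p : ℤ) ∣ a → legendreSym p a ^ 2 = 1 := fun a ha =>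
        legendreSym.sq_one p fun h0 => ha ((ZMod.intCast_zmod_eq_zero_iff_dvd _ p).mp h0)
      have h1 : legendreSym p (-(Λ.level * ((m : ℤ) ^ 2 * k₀))) * legendreSym p t.den ^ 2 =
          legendreSym p (-(t.num * t.den)) * (legendreSym p Λ.level ^ 2 * legendreSym p m ^ 2) := by
        simp only [sq, ← legendreSym.mul]
        congr 1
        linear_combination (-(Λ.level * (m : ℤ) ^ 2 * t.den)) * hkt
      rw [hsq _ hden, hsq _ hlevi, hsq _ hmi, mul_one, mul_one, mul_one] at h1
      exact h1
    rw [middle_sum_odd (Nat.not_even_iff_odd.mp hn) hlev hb, hl]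
    have hs : (((p : ℝ) ^ (-(1 / 2) : ℝ) : ℝ) : ℂ) = Real.sqrt p / p := by
      rw [← Complex.ofReal_natCast, ← Complex.ofReal_div]
      congr 1
      have hpr : (0 : ℝ) < p := by exact_mod_cast hp.pos
      rw [Real.sqrt_eq_rpow, ← Real.rpow_sub_one hpr.ne']
      norm_num
    rw [hs]
    generalize (((p : ℝ) ^ ((κ : ℝ) / 2 - 1) : ℝ) : ℂ) = K at hK ⊢
    field_simp
    ring

/-- The Fourier coefficients along the powers of `p`. -/
theorem fourierCoeff_pow {κ : ℤ} (hlev : ¬ p ∣ Λ.level) {f : ℍ → GrpAlg Λ} (hf : IsCuspForm Λ κ f)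
    {ev : ℂ} (hev : heckeOp Λ κ p f = ev • f) {x : Λ.Disc} {t : ℚ}
    (htx : ((t : ℝ) : UnitAddCircle) = Λ.qbar x)
    (hpt : ¬ ∃ z : ℤ, (Λ.level : ℚ) * t = (p : ℚ) ^ 2 * z) {m : ℕ} (hm : ¬ p ∣ m) (j : ℕ) :
    fourierCoeff Λ f ((p ^ j * m) • x) (((p ^ j * m : ℕ) : ℚ) ^ 2 * t) =
      (((p : ℝ) ^ ((κ : ℝ) / 2 - 1) : ℝ) : ℂ) ^ j * eulerSeq (eulerBeta Λ κ p ev) (eulerNu Λ p t) j *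
        fourierCoeff Λ f (m • x) ((m : ℚ) ^ 2 * t) := by
  have hp := (Fact.out : p.Prime)
  have hpi : Prime (p : ℤ) := Nat.prime_iff_prime_int.mp hp
  have hmi : ¬ (p : ℤ) ∣ m := by exact_mod_cast hm
  have hp0 : (p : ℂ) ≠ 0 := by exact_mod_cast hp.ne_zero
  have hpr : (0 : ℝ) < p := by exact_mod_cast hp.pos
  have hlev0 : Λ.level ≠ 0 := fun h => hlev (h ▸ dvd_zero p)
  obtain ⟨b, hb⟩ := exists_basis Λ
  have hinj := nsmul_injective_of_not_dvd_level (Λ := Λ) hp hlev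
  -- `level * r` is an integer for `r ∈ q(y) + ℤ`
  have hint : ∀ (y : Λ.Disc) (r : ℚ), ((r : ℝ) : UnitAddCircle) = Λ.qbar y →
      ∃ k : ℤ, (Λ.level : ℚ) * r = k := fun y r h => by
    have h1 : ((Λ.level • (r : ℝ) : ℝ) : UnitAddCircle) = 0 := by
      rw [AddCircle.coe_nsmul, h, level_smul_qbar hlev0]
    obtain ⟨k, hk⟩ := (AddCircle.coe_eq_zero_iff 1).mp h1
    refine ⟨k, ?_⟩
    rw [nsmul_eq_mul, zsmul_eq_mul, mul_one] at hk
    exact_mod_cast hk.symm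
  obtain ⟨k₀, hk₀⟩ := hint x t htx
  set K : ℂ := (((p : ℝ) ^ ((κ : ℝ) / 2 - 1) : ℝ) : ℂ) with hK
  have hc1 : (((p : ℝ) ^ ((κ : ℝ) / 2 - 2) : ℝ) : ℂ) = K / p := by
    rw [hK, ← Complex.ofReal_natCast, ← Complex.ofReal_div]
    congr 1
    rw [show (κ : ℝ) / 2 - 2 = (κ : ℝ) / 2 - 1 - 1 by ring, Real.rpow_sub_one hpr.ne']
  have hc2 : (((p : ℝ) ^ ((κ : ℝ) / 2) : ℝ) : ℂ) = K * p := by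
    rw [hK, ← Complex.ofReal_natCast, ← Complex.ofReal_mul]
    congr 1
    rw [← Real.rpow_add_one hpr.ne']; congr 1; ring
  have hc3 : (((p : ℝ) ^ (-((κ : ℝ) / 2)) : ℝ) : ℂ) = (K * p)⁻¹ := by
    rw [← hc2, ← Complex.ofReal_inv, Real.rpow_neg hpr.le]
  have hK0 : K ≠ 0 := by
    rw [hK]; exact_mod_cast (by positivity : (0 : ℝ) < (p : ℝ) ^ ((κ : ℝ) / 2 - 1)).ne'
  have hqm : ∀ j : ℕ, ((((((p ^ j * m : ℕ) : ℚ) ^ 2 * t : ℚ)) : ℝ) : UnitAddCircle) =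
      Λ.qbar ((p ^ j * m) • x) := fun j => by
    rw [qbar_nsmul, ← htx, ← AddCircle.coe_nsmul, nsmul_eq_mul]; push_cast; rfl
  induction j using Nat.strong_induction_on with
  | _ j ih =>
    rcases j with _ | _ | j
    · simp [eulerSeq]
    · -- the first step
      obtain ⟨y, hy⟩ := (Finite.injective_iff_surjective.mp hinj) (m • x)
      replace hy : p • y = m • x := hy
      have hmq : ((((m : ℚ) ^ 2 * t : ℚ) : ℝ) : UnitAddCircle) = Λ.qbar (p • y) := by
        rw [hy]; simpa using hqm 0
      have hk : (Λ.level : ℚ) * ((m : ℚ) ^ 2 * t) = (((m : ℤ) ^ 2 * k₀ : ℤ) : ℚ) := by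
        push_cast; rw [← hk₀]; ring
      obtain ⟨B, -, hB, h⟩ := hecke_fourierCoeff hlev hb hf hev hmq hk
      -- A nonzero B would require level·m²t/p² to be an integer; since p ∤ m, that would give p² ∣
      -- level·t.
      have hB0 : B = 0 := hB fun hq => by
        obtain ⟨z, hz⟩ := hint y _ hq
        have hpq : (p : ℚ) ≠ 0 := by exact_mod_cast hp.ne_zero
        have h1 : (m : ℤ) ^ 2 * k₀ = (p : ℤ) ^ 2 * z := by
          have : ((m : ℤ) ^ 2 * k₀ : ℚ) = (p : ℚ) ^ 2 * z := by
            rw [← hk₀, ← hz]; push_cast; field_simp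
          exact_mod_cast this
        have hcop : IsCoprime ((p : ℤ) ^ 2) ((m : ℤ) ^ 2) :=
          ((hpi.coprime_iff_not_dvd).mpr hmi).pow
        obtain ⟨w, hw⟩ := hcop.dvd_of_dvd_mul_left (Dvd.intro _ h1.symm)
        exact hpt ⟨w, by rw [hk₀, hw]; push_cast; rfl⟩
      have hmid := middle_sum_base κ hlev hb ev hk₀ hm
      rw [hB0, hc1, hc2, hc3, hy] at h
      rw [← hK] at hmid
      have e1 : (p ^ (0 + 1) * m) • x = p • m • x := by rw [← mul_smul]; simp
      have e2 : (((p ^ (0 + 1) * m : ℕ) : ℚ) ^ 2 * t) = (p : ℚ) ^ 2 * ((m : ℚ) ^ 2 * t) := by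
        push_cast; ring
      rw [e1, e2, zero_add, pow_one, eulerSeq, ← hmid, sub_mul, h]
      field_simp
      ring
    -- From here on the coefficient at m/p² is the term two steps back, and p divides level times
    -- the current index, so the middle sum contributes to β only.
    · have i1 := ih (j + 1) (by omega)
      have i0 := ih j (by omega)
      have hsm : p • ((p ^ j * m) • x) = (p ^ (j + 1) * m) • x := by
        rw [← mul_smul]; congr 1; ring
      have hk : (Λ.level : ℚ) * (((p ^ (j + 1) * m : ℕ) : ℚ) ^ 2 * t) =
          (((p : ℤ) * ((p : ℤ) ^ (2 * j + 1) * (m : ℤ) ^ 2 * k₀) : ℤ) : ℚ) := by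
        push_cast; rw [← hk₀]; ring
      obtain ⟨B, hB, -, h⟩ := hecke_fourierCoeff hlev hb hf hev
        (y := (p ^ j * m) • x) (by rw [hsm]; exact hqm (j + 1)) hk
      have hpq : (p : ℚ) ≠ 0 := by exact_mod_cast hp.ne_zero
      have e0 : (((p ^ (j + 1) * m : ℕ) : ℚ) ^ 2 * t) / p ^ 2 = ((p ^ j * m : ℕ) : ℚ) ^ 2 * t := by
        push_cast; field_simp; try ring
      rw [e0] at hB
      have hmid := middle_sum_of_dvd κ hlev hb ev
        (Dvd.intro ((p : ℤ) ^ (2 * j + 1) * (m : ℤ) ^ 2 * k₀) rfl)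
      rw [hB (hqm j), hc1, hc2, hc3, hsm] at h
      rw [← hK] at hmid
      have e1 : (p ^ (j + 1 + 1) * m) • x = p • (p ^ (j + 1) * m) • x := by
        rw [← mul_smul]; congr 1; ring
      have e2 : (((p ^ (j + 1 + 1) * m : ℕ) : ℚ) ^ 2 * t) =
          (p : ℚ) ^ 2 * (((p ^ (j + 1) * m : ℕ) : ℚ) ^ 2 * t) := by
        push_cast; ring
      rw [e1, e2, eulerSeq]
      generalize fourierCoeff Λ f (p • (p ^ (j + 1) * m) • x)
        ((p : ℚ) ^ 2 * (((p ^ (j + 1) * m : ℕ) : ℚ) ^ 2 * t)) = a2 at h ⊢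
      generalize ∑ h : Fin (p - 1), ((Real.sqrt p : ℂ) ^ n * (((p : ℂ) ^ n)⁻¹ *
        latticeGauss Λ b p (-((Λ.level : ℤ) * ((h : ℕ) + 1))))) *
        eQ ((((p : ℤ) * ((p : ℤ) ^ (2 * j + 1) * (m : ℤ) ^ 2 * k₀) : ℤ) : ℚ) *
          (((h : ℕ) + 1 : ℕ) : ℚ) / p) = W at h hmid
      rw [i1, i0] at h
      have h2 : a2 = (ev - K / p * W) * (K ^ (j + 1) *
          eulerSeq (eulerBeta Λ κ p ev) (eulerNu Λ p t) (j + 1) *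
            fourierCoeff Λ f (m • x) ((m : ℚ) ^ 2 * t)) - K ^ 2 * (K ^ j *
          eulerSeq (eulerBeta Λ κ p ev) (eulerNu Λ p t) j *
            fourierCoeff Λ f (m • x) ((m : ℚ) ^ 2 * t)) := by
        rw [sub_mul, h]
        field_simp
        ring
      rw [h2, hmid]
      ring

end

end VVMF
end

noncomputable section
namespace VVMF

/-! ### Factorisation of the Dirichlet series -/

open Complex Filter Topology

open EvenLattice

section Factorisation

variable {p : ℕ}

theorem pow_mul_injective (hp : p.Prime) :
    Function.Injective fun z : ℕ × {m : ℕ // ¬ p ∣ m} => p ^ z.1 * (z.2 : ℕ) := by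
  rintro ⟨i, m, hm⟩ ⟨j, l, hl⟩ h
  have h' : p ^ i * m = p ^ j * l := h
  have hi : ∀ (i m : ℕ), ¬ p ∣ m → (p ^ i * m).factorization p = i := fun i m hm => by
    have hm0 : m ≠ 0 := fun h => hm (h ▸ dvd_zero p)
    rw [Nat.factorization_mul (pow_ne_zero _ hp.ne_zero) hm0, Finsupp.add_apply,
      hp.factorization_pow, Finsupp.single_eq_same, Nat.factorization_eq_zero_of_not_dvd hm, add_zero]
  have hij : i = j := by rw [← hi i m hm, h', hi j l hl]
  subst hij
  have hml : m = l := Nat.eq_of_mul_eq_mul_left (pow_pos hp.pos i) h'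
  subst hml
  rfl

theorem exists_pow_mul (hp : p.Prime) {k : ℕ} (hk : k ≠ 0) :
    ∃ z : ℕ × {m : ℕ // ¬ p ∣ m}, p ^ z.1 * (z.2 : ℕ) = k :=
  ⟨⟨k.factorization p, k / p ^ k.factorization p, Nat.not_dvd_ordCompl hp hk⟩,
    Nat.ordProj_mul_ordCompl_eq_self k p⟩

variable {F : ℕ → ℂ} {g : ℕ → ℂ}

/-- Every positive integer is uniquely p^j m with p ∤ m, so F becomes a product function on pairs
(j, m). Since the sum over j converges, summability of F is decided by its values prime to p. -/
theorem tsum_factor (hp : p.Prime) (h0 : F 0 = 0)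
    (hF : ∀ j m, ¬ p ∣ m → F (p ^ j * m) = g j * F m) (hg : Summable g) :
    (Summable F ↔ Summable fun k => if p ∣ k then 0 else F k) ∧
      ∑' k, F k = (∑' k, if p ∣ k then 0 else F k) * ∑' j, g j := by
  have hinj := pow_mul_injective hp
  have hsupp : Function.support F ⊆
      Set.range fun z : ℕ × {m : ℕ // ¬ p ∣ m} => p ^ z.1 * (z.2 : ℕ) := fun k hk => by
    have hk0 : k ≠ 0 := fun h => hk (by rw [h, h0])
    exact exists_pow_mul hp hk0
  have hsupp' : Function.support (fun k => if p ∣ k then 0 else F k) ⊆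
      Set.range ((↑) : {m : ℕ // ¬ p ∣ m} → ℕ) := fun k hk => by
    by_cases hpk : p ∣ k
    · exact absurd (if_pos hpk) hk
    · exact ⟨⟨k, hpk⟩, rfl⟩
  have hcomp : (F ∘ fun z : ℕ × {m : ℕ // ¬ p ∣ m} => p ^ z.1 * (z.2 : ℕ)) =
      fun z => g z.1 * F z.2 := funext fun z => hF _ _ z.2.2
  have hcomp' : ((fun k => if p ∣ k then 0 else F k) ∘ ((↑) : {m : ℕ // ¬ p ∣ m} → ℕ)) =
      fun m : {m : ℕ // ¬ p ∣ m} => F (m : ℕ) :=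
    funext fun m : {m : ℕ // ¬ p ∣ m} => if_neg m.2
  have hs := hinj.summable_iff (f := F) fun k hk => by
    by_contra h; exact hk (hsupp h)
  have hs' := Subtype.val_injective.summable_iff (f := fun k => if p ∣ k then 0 else F k)
    fun k hk => by by_contra h; exact hk (hsupp' h)
  rw [hcomp] at hs
  rw [hcomp'] at hs'
  have hiff : Summable F ↔ Summable fun k => if p ∣ k then 0 else F k := by
    refine ⟨fun h => ?_, fun h => ?_⟩
    · refine h.norm.of_norm_bounded fun k => ?_
      split_ifs
      · simp
      · exact le_rfl
    · exact hs.mp (summable_mul_of_summable_norm (f := g)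
        (g := fun m : {m : ℕ // ¬ p ∣ m} => F (m : ℕ)) hg.norm (hs'.mpr h).norm)
  refine ⟨hiff, ?_⟩
  by_cases hsum : Summable F
  · have e1 := hinj.tsum_eq hsupp
    have e2 := Subtype.val_injective.tsum_eq hsupp'
    have e3 := tsum_mul_tsum_of_summable_norm hg.norm (hs'.mpr (hiff.mp hsum)).norm
    rw [← e1, ← e2, mul_comm]
    refine (Eq.trans ?_ e3.symm).trans ?_
    · exact tsum_congr fun z => congrFun hcomp z
    · congr 1
      exact tsum_congr fun z => (congrFun hcomp' z).symm
  -- Without summability both sums have the default value 0, and the identity still holds.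
  · rw [tsum_eq_zero_of_not_summable hsum, tsum_eq_zero_of_not_summable (fun h => hsum (hiff.mpr h)),
      zero_mul]

/-- Along the progression p^j m the function F is g times the nonzero constant F m. -/
theorem summable_of_factor (hp : p.Prime)
    (hF : ∀ j m, ¬ p ∣ m → F (p ^ j * m) = g j * F m) (hs : Summable F) {m : ℕ} (hm : ¬ p ∣ m)
    (hm0 : F m ≠ 0) : Summable g := by
  have h := hs.comp_injective (i := fun j : ℕ => p ^ j * m) fun i j hij => by
    have := pow_mul_injective hp (a₁ := (i, ⟨m, hm⟩)) (a₂ := (j, ⟨m, hm⟩)) hij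
    exact congrArg Prod.fst this
  have h1 : (F ∘ fun j : ℕ => p ^ j * m) = fun j => g j * F m := funext fun j => hF j m hm
  rw [h1] at h
  exact (summable_mul_right_iff hm0).mp h

end Factorisation

/-! ### The L-series and its factor at p -/

variable {V : Type*} [AddCommGroup V] [Module ℚ V] [FiniteDimensional ℚ V] {Λ : EvenLattice V}

section

variable {p : ℕ} [Fact p.Prime] {κ : ℤ} {f : ℍ → GrpAlg Λ} {ev : ℂ} {x : Λ.Disc} {t : ℚ} {N : ℕ}

theorem Lcoeff_pow_mul (hp : ¬ p ∣ Λ.level * N) (hf : IsCuspForm Λ κ f)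
    (hev : heckeOp Λ κ p f = ev • f) (htx : ((t : ℝ) : UnitAddCircle) = Λ.qbar x)
    (hpt : ¬ ∃ z : ℤ, (Λ.level : ℚ) * t = (p : ℚ) ^ 2 * z) (j : ℕ) {m : ℕ} (hm : ¬ p ∣ m) :
    Lcoeff Λ f x t N (p ^ j * m) = (((p : ℝ) ^ ((κ : ℝ) / 2 - 1) : ℝ) : ℂ) ^ j *
      eulerSeq (eulerBeta Λ κ p ev) (eulerNu Λ p t) j * Lcoeff Λ f x t N m := by
  have hN : ¬ p ∣ N := fun h => hp (h.mul_left _)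
  have hcop : (p ^ j).Coprime N := Nat.Coprime.pow_left _ ((Nat.Prime.coprime_iff_not_dvd Fact.out).mpr hN)
  have hg : (p ^ j * m).gcd N = m.gcd N := hcop.gcd_mul_left_cancel m
  simp only [Lcoeff, hg]
  split_ifs
  · exact fourierCoeff_pow (fun h => hp (h.mul_right _)) hf hev htx hpt hm j
  · simp

theorem Lcoeff_mul_prime (k : ℕ) :
    Lcoeff Λ f x t (N * p) k = if p ∣ k then 0 else Lcoeff Λ f x t N k := by
  have hp := (Fact.out : p.Prime)
  have h : k.gcd (N * p) = 1 ↔ k.gcd N = 1 ∧ ¬ p ∣ k := by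
    change Nat.Coprime _ _ ↔ Nat.Coprime _ _ ∧ _
    rw [Nat.coprime_mul_iff_right, Nat.coprime_comm (m := p), hp.coprime_iff_not_dvd]
  unfold Lcoeff
  by_cases h1 : p ∣ k
  · rw [if_pos h1, if_neg fun h2 => (h.mp h2).2 h1]
  · rw [if_neg h1]
    simp only [h, h1, not_false_eq_true, and_true]

theorem eulerVar_pow (κ : ℤ) (s : ℂ) (j : ℕ) :
    eulerVar κ p s ^ j * ((p ^ j : ℕ) : ℂ) ^ s = (((p : ℝ) ^ ((κ : ℝ) / 2 - 1) : ℝ) : ℂ) ^ j := by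
  have hp := (Fact.out : p.Prime)
  have hp0 : (p : ℂ) ≠ 0 := by exact_mod_cast hp.ne_zero
  have h1 : ((p ^ j : ℕ) : ℂ) ^ s = ((p : ℂ) ^ s) ^ j := by
    rw [Nat.cast_pow, ← Complex.natCast_cpow_natCast_mul, ← Complex.cpow_nat_mul, mul_comm]
  have h2 : (((p : ℝ) ^ ((κ : ℝ) / 2 - 1) : ℝ) : ℂ) = (p : ℂ) ^ ((κ : ℂ) / 2 - 1) := by
    rw [Complex.ofReal_cpow (Nat.cast_nonneg p)]; push_cast; rfl
  rw [h1, h2, ← mul_pow, eulerVar, ← Complex.cpow_add _ _ hp0]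
  congr 2; ring

/-- In the half plane of the region, the generating series at `p` converges. -/
theorem summable_eulerSeq_of_lt (hp : ¬ p ∣ Λ.level * N) (hf : IsCuspForm Λ κ f)
    (hev : heckeOp Λ κ p f = ev • f) (ht : 0 < t) (htx : ((t : ℝ) : UnitAddCircle) = Λ.qbar x)
    (hpt : ¬ ∃ z : ℤ, (Λ.level : ℚ) * t = (p : ℚ) ^ 2 * z) {m : ℕ} (hm : ¬ p ∣ m)
    (hm0 : Lcoeff Λ f x t N m ≠ 0) {s : ℂ} (hs : (κ : ℝ) / 2 < s.re) :
    Summable fun j => eulerSeq (eulerBeta Λ κ p ev) (eulerNu Λ p t) j * eulerVar κ p s ^ j := by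
  have hpp := (Fact.out : p.Prime)
  have hpr : (0 : ℝ) < p := by exact_mod_cast hpp.pos
  have hp1 : (1 : ℝ) < p := by exact_mod_cast hpp.one_lt
  have hlev : ¬ p ∣ Λ.level := fun h => hp (h.mul_right _)
  obtain ⟨C, hC⟩ := exists_fourierCoeff_bound hf (fun h => hlev (h ▸ dvd_zero p))
  have hc : fourierCoeff Λ f (m • x) ((m : ℚ) ^ 2 * t) ≠ 0 := by
    rw [Lcoeff] at hm0
    split_ifs at hm0 with h
    · exact hm0
    · exact absurd rfl hm0
  set c := fourierCoeff Λ f (m • x) ((m : ℚ) ^ 2 * t) with hcdef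
  set K : ℝ := (p : ℝ) ^ ((κ : ℝ) / 2 - 1) with hK
  have hK0 : 0 < K := by positivity
  have hmpos : 0 < m := Nat.pos_of_ne_zero fun h => hm (h ▸ dvd_zero p)
  have htr : (0 : ℝ) < t := by exact_mod_cast ht
  have hmr : (0 : ℝ) < m := by exact_mod_cast hmpos
  -- The Hecke bound at p^j m, combined with `fourierCoeff_pow` and the nonvanishing of c, bounds
  -- the growth of the sequence c_j itself.
  have hbound : ∀ j, K ^ j * ‖eulerSeq (eulerBeta Λ κ p ev) (eulerNu Λ p t) j‖ * ‖c‖ ≤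
      C * ((m : ℝ) ^ 2 * t) ^ ((κ : ℝ) / 4) * ((p : ℝ) ^ ((κ : ℝ) / 2)) ^ j := fun j => by
    have h1 := hC ((p ^ j * m) • x) (((p ^ j * m : ℕ) : ℚ) ^ 2 * t)
      (mul_pos (pow_pos (by exact_mod_cast Nat.mul_pos (pow_pos (Fact.out : p.Prime).pos j) hmpos) 2)
        ht) (by
      rw [qbar_nsmul, ← htx, ← AddCircle.coe_nsmul, nsmul_eq_mul]; push_cast; rfl)
    rw [fourierCoeff_pow hlev hf hev htx hpt hm, norm_mul, norm_mul, norm_pow, Complex.norm_real,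
      Real.norm_of_nonneg hK0.le] at h1
    refine h1.trans (le_of_eq ?_)
    rw [mul_assoc]
    congr 1
    have h2 : (((((p ^ j * m : ℕ) : ℚ) ^ 2 * t : ℚ)) : ℝ) = ((m : ℝ) ^ 2 * t) * (p : ℝ) ^ (2 * j) := by
      push_cast; ring
    rw [h2, Real.mul_rpow (by positivity) (by positivity)]
    congr 1
    rw [← Real.rpow_natCast, ← Real.rpow_natCast, ← Real.rpow_mul hpr.le, ← Real.rpow_mul hpr.le]
    congr 1; push_cast; ring
  have hy : ‖eulerVar κ p s‖ = K * (p : ℝ) ^ (-s.re) := by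
    rw [eulerVar, Complex.norm_natCast_cpow_of_pos hpp.pos, hK, ← Real.rpow_add hpr]
    congr 1
    simp
    ring
  have hr : (p : ℝ) ^ ((κ : ℝ) / 2) * (p : ℝ) ^ (-s.re) < 1 := by
    rw [← Real.rpow_add hpr]
    exact Real.rpow_lt_one_of_one_lt_of_neg hp1 (by linarith)
  have hgeo := (summable_geometric_of_lt_one (by positivity) hr).mul_left
    (C * ((m : ℝ) ^ 2 * t) ^ ((κ : ℝ) / 4) / ‖c‖)
  refine hgeo.of_norm_bounded fun j => ?_
  have hcn : 0 < ‖c‖ := norm_pos_iff.mpr hc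
  rw [norm_mul, norm_pow, hy, mul_pow, mul_pow, div_mul_eq_mul_div, le_div_iff₀ hcn]
  have h3 := mul_le_mul_of_nonneg_right (hbound j) (show 0 ≤ ((p : ℝ) ^ (-s.re)) ^ j by positivity)
  calc _ = K ^ j * ‖eulerSeq (eulerBeta Λ κ p ev) (eulerNu Λ p t) j‖ * ‖c‖ *
        ((p : ℝ) ^ (-s.re)) ^ j := by ring
    _ ≤ _ := h3
    _ = _ := by ring

/-- Places the half-plane Re s > k + 1 - 2σ inside Re s > k, where the Hecke bound gives convergence
along the powers of p. -/
theorem sigmaBound_le (Λ : EvenLattice V) (N : ℕ) : sigmaBound Λ N ≤ 1 / 2 := by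
  unfold sigmaBound
  split_ifs <;> norm_num

end

end VVMF

end

/-! ### The main theorem -/

open VVMF
theorem mainTheorem4 {V : Type*} [AddCommGroup V] [Module ℚ V] [FiniteDimensional ℚ V]
    (Λ : VVMF.EvenLattice V) (κ : ℤ) (N p : ℕ) [Fact p.Prime] (hp : ¬ p ∣ Λ.level * N)
    (f : UpperHalfPlane → VVMF.GrpAlg Λ) (hf : VVMF.IsCuspForm Λ κ f)
    (ev : ℂ) (hev : VVMF.heckeOp Λ κ p f = ev • f)
    (x : Λ.Disc) (t : ℚ) (ht : 0 < t) (htx : ((t : ℝ) : UnitAddCircle) = Λ.qbar x)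
    (hpt : ¬ ∃ z : ℤ, (Λ.level : ℚ) * t = (p : ℚ) ^ 2 * z) :
    (∀ s ∈ VVMF.Region Λ κ f x t N,
      (LSeriesSummable (VVMF.Lcoeff Λ f x t N) s ↔
        LSeriesSummable (VVMF.Lcoeff Λ f x t (N * p)) s) ∧
      LSeries (VVMF.Lcoeff Λ f x t N) s =
        LSeries (VVMF.Lcoeff Λ f x t (N * p)) s *
          (VVMF.eulerNum Λ p t (VVMF.eulerVar κ p s) /
            VVMF.eulerDen Λ κ p ev (VVMF.eulerVar κ p s))) ∧
    ((∃ s₀ : ℂ, LSeries (VVMF.Lcoeff Λ f x t N) s₀ ≠ 0) →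
      ∀ s ∈ VVMF.Region Λ κ f x t N,
        VVMF.eulerDen Λ κ p ev (VVMF.eulerVar κ p s) ≠ 0 ∧
        VVMF.eulerNum Λ p t (VVMF.eulerVar κ p s) /
          VVMF.eulerDen Λ κ p ev (VVMF.eulerVar κ p s) ≠ 0) := by
  have hpp := (Fact.out : p.Prime)
  have hlev : ¬ p ∣ Λ.level := fun h => hp (h.mul_right _)
  set β := eulerBeta Λ κ p ev with hβ
  set ν := eulerNu Λ p t with hν
  have hν1 : ‖ν‖ ≤ 1 := norm_eulerNu_le hlev t
  set c := Lcoeff Λ f x t N with hc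
  have hcp : ∀ k, Lcoeff Λ f x t (N * p) k = if p ∣ k then 0 else c k := Lcoeff_mul_prime
  have hpow : ∀ j m, ¬ p ∣ m → c (p ^ j * m) = (((p : ℝ) ^ ((κ : ℝ) / 2 - 1) : ℝ) : ℂ) ^ j *
      eulerSeq β ν j * c m := fun j m hm => Lcoeff_pow_mul hp hf hev htx hpt j hm
  have hterm0 : ∀ s, LSeries.term c s 0 = 0 := fun s => LSeries.term_zero ..
  have hterm : ∀ s j m, ¬ p ∣ m → LSeries.term c s (p ^ j * m) =
      (eulerSeq β ν j * eulerVar κ p s ^ j) * LSeries.term c s m := fun s j m hm => by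
    have hm0 : m ≠ 0 := fun h => hm (h ▸ dvd_zero p)
    have hpj : p ^ j ≠ 0 := pow_ne_zero _ hpp.ne_zero
    have hpjs : ((p ^ j : ℕ) : ℂ) ^ s ≠ 0 := by
      rw [Ne, Complex.cpow_eq_zero_iff, not_and_or]; left; exact_mod_cast hpj
    rw [LSeries.term_of_ne_zero (mul_ne_zero hpj hm0), LSeries.term_of_ne_zero hm0, hpow j m hm,
      Nat.cast_mul, Complex.natCast_mul_natCast_cpow, ← eulerVar_pow κ s j]
    field_simp
  have hterm' : ∀ s, LSeries.term (Lcoeff Λ f x t (N * p)) s =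
      fun k => if p ∣ k then 0 else LSeries.term c s k := fun s => funext fun k => by
    by_cases hk0 : k = 0
    · subst hk0; simp
    · rw [LSeries.term_of_ne_zero hk0, LSeries.term_of_ne_zero hk0, hcp]
      split_ifs <;> simp
  -- Either some coefficient with index prime to p is nonzero, which gives convergence of the series
  -- at p throughout the region, or all coefficients of positive index vanish.
  by_cases hne : ∃ m, ¬ p ∣ m ∧ c m ≠ 0
  · obtain ⟨m, hm, hcm⟩ := hne
    have hm0 : m ≠ 0 := fun h => hm (h ▸ dvd_zero p)
    have hsum : ∀ s ∈ Region Λ κ f x t N, Summable fun j => eulerSeq β ν j * eulerVar κ p s ^ j := by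
      rintro s (hs | hs)
      · exact summable_eulerSeq_of_lt hp hf hev ht htx hpt hm hcm
          (by have := sigmaBound_le Λ N; linarith)
      · refine summable_of_factor hpp (hterm s) hs hm ?_
        rw [LSeries.term_of_ne_zero hm0]
        refine div_ne_zero hcm ?_
        rw [Ne, Complex.cpow_eq_zero_iff, not_and_or]; left; exact_mod_cast hm0
    refine ⟨fun s hs => ?_, fun _ s hs => ?_⟩
    · obtain ⟨-, -, h3⟩ := tsum_eulerSeq hν1 (hsum s hs)
      obtain ⟨h4, h5⟩ := tsum_factor hpp (hterm0 s) (hterm s) (hsum s hs)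
      refine ⟨?_, ?_⟩
      · rw [LSeriesSummable, LSeriesSummable, hterm']; exact h4
      · rw [LSeries, LSeries, hterm', eulerNum_eq, eulerDen_eq, ← h3]; exact h5
    · obtain ⟨h1, h2, -⟩ := tsum_eulerSeq hν1 (hsum s hs)
      rw [eulerNum_eq, eulerDen_eq]
      exact ⟨h1, div_ne_zero h2 h1⟩
  -- Both L-series are identically zero, so the identity reads 0 = 0 whatever the value of the
  -- quotient, including the value 0 taken when its denominator vanishes.
  · push Not at hne
    have hz : ∀ k, k ≠ 0 → c k = 0 := fun k hk => by
      obtain ⟨⟨j, m, hm⟩, rfl⟩ := exists_pow_mul hpp hk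
      rw [hpow j m hm, hne m hm, mul_zero]
    have hz1 : ∀ s, LSeries.term c s = 0 := fun s => funext fun k => by
      by_cases hk : k = 0
      · subst hk; simp
      · rw [LSeries.term_of_ne_zero hk, hz k hk]; simp
    have hz2 : ∀ s, LSeries.term (Lcoeff Λ f x t (N * p)) s = 0 := fun s => by
      rw [hterm', hz1]; funext k; simp
    refine ⟨fun s _ => ⟨?_, ?_⟩, ?_⟩
    · rw [LSeriesSummable, LSeriesSummable, hz1, hz2]
    · rw [LSeries, LSeries, hz1, hz2]; simp
    · rintro ⟨s₀, h⟩
      exact absurd (by rw [LSeries, hz1]; simp) h
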